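/- **Setting.** Let $\mathcal T=\{T_0,\dots,T_{m-1}\}$, $m\ge 1$, be a collection of strings over integer letters, of total length $n$ (positions are counted from $0$). A *MEM* is a tuple $(x,y,a,b,\ell)$ with $T_x[a..a+\ell-1]=T_y[b..b+\ell-1]$ such that ($a=0$ or $b=0$ or $T_x[a-1]\ne T_y[b-1]$) and ($a+\ell=|T_x|$ or $b+\ell=|T_y|$ or $T_x[a+\ell]\neq T_y[b+\ell]$). *The grammar $\mathcal G$ (FFGram).* In each round every string $s$ is flanked to $\$s\$\#$. Symbols are compared by an arbitrary injective function on the symbols of the round (chosen anew in each round), with $\$$ smallest and $\#$ largest. A position is S-type (L-type) if its symbol is smaller (larger) than the next one, or equal to it with the next position S-type (L-type); a local minimum is an S-type position before the closing $\$\#$ whose predecessor is L-type. Every two consecutive local minima $j<j'$ give the phrase on the positions $j-1..j'+1$; the first phrase runs from the beginning to the position after the first local minimum, the last one from the position before the last local minimum to the end; a string without local minimum is one phrase. Each distinct phrase $F$ of the round gives a nonterminal $X$ with the rule $X\to F$, and the strings become the sequences of the nonterminals of their phrases. The rounds stop when no string has a local minimum; the start symbol $S$ then derives the concatenation of the resulting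 flanked strings. $G$ is the sum of the lengths of all right-hand sides. Let $\mathit{efexp}(X)$ be the expansion of $X$ that recursively skips the first and the last two symbols of each right-hand side, with inner occurrences of $\$,\#$ expanding to the empty string (the $\mathit{efexp}$ expansions of consecutive nodes of a level partition the text). In $X\to A_1\cdots A_z$ the symbol $A_j$ has the offset $\sum_{2\le k<j,\;k\le z-2}|\mathit{efexp}(A_k)|$. *Primary MEMs.* A parse tree node *encodes* an occurrence $T_x[a..a+\ell-1]$ if its full expansion (overlaps included) covers the occurrence and the two symbols next to it in $\$T_x\$\#$. The lowest node that encodes it (the rightmost one on that level) is its *locus*; if no node below the root encodes it, the locus is the root, in the part of $S$'s right-hand side belonging to $T_x$. The occurrence is primary if its locus is the root or the leftmost node with its label. A MEM is primary (a prMEM) if both of its occurrences are; it is encoded by the tuple $(X,Y,o_X,o_Y,\ell)$ of the labels of the two loci (the string identifier if the locus is the root) and the numbers $o_X,o_Y\in\mathbb Z$ of symbols that precede the occurrences within the $\mathit{efexp}$ expansions of the loci. The *simplified* grammar arises by recursively replacing each nonterminal that occurs exactly once in the right-hand sides by its right-hand side, adding up the offsets; in each tuple a replaced nonterminal is changed to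 the place that now encloses its right-hand side, and its offset is updated accordingly. The symbols are numbered consecutively, in any order of the terminals and any order of the nonterminals. **Theorem.** There is one random access machine program (unit-cost integer addition, subtraction, array access, tests) with the following property. For every $\mathcal T$, every grammar $\mathcal G$ of size $G$ built from $\mathcal T$ with FFGram, and every $\tau\in\mathbb N$: given the simplified version of $\mathcal G$ (right-hand sides with offsets) and the list $\mathcal L$ of the (updated) tuples of the prMEMs of length $>\tau$, the program reports the positions $(x,y,a,b,\ell)$ of all $occ$ MEMs of $\mathcal T$ of length $>\tau$, each exactly once, in $O(G+occ)$ time. The machine has $O\bigl((G+occ)\log(G+n)\bigr)$ bits of memory, including the input. In particular, if text positions fit into $O(\log G)$ bits, i.e. $n\le G^{k}$ for a constant $k$, it uses $O(\log G\,(G+occ))$ bits. The constant in the time bound is absolute; that in the last bound is an absolute constant times $k+1$. -/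

import Mathlib

/-! ## A unit-cost random access machine with bounded words -/

namespace RAM

/-- Commands over `v` integer variables and `a` integer arrays. -/
inductive Cmd (v a : ℕ) where
  | skip
  | const (x : Fin v) (z : ℤ)
  | add (x y z : Fin v)
  | sub (x y z : Fin v)
  | load (x : Fin v) (A : Fin a) (i : Fin v)
  | store (A : Fin a) (i x : Fin v)
  | print (x : Fin v)
  | seq (p q : Cmd v a)
  | ifPos (x : Fin v) (p q : Cmd v a)
  | whilePos (x : Fin v) (p : Cmd v a)

/-- Variables, arrays, and the (write-only) output stream. -/
structure State (v a : ℕ) where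
  var : Fin v → ℤ
  arr : Fin a → ℕ → ℤ
  out : List ℤ

/-- The integer `z` fits into a (signed) machine word of `W` bits. -/
def Fits (W : ℕ) (z : ℤ) : Prop := |z| < 2 ^ W

def State.set {v a : ℕ} (s : State v a) (x : Fin v) (z : ℤ) : State v a :=
  { s with var := Function.update s.var x z }

/-- `Exec W S p s t s'`: on a machine whose words have `W` bits and whose arrays have `S` cells
each, the command `p`, started in state `s`, halts in state `s'` after exactly `t` steps. Each
elementary command and each test costs one step. An overflowing operation or an access outside
an array has no execution. -/
inductive Exec (W S : ℕ) {v a : ℕ} : Cmd v a → State v a → ℕ → State v a → Prop where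
  | skip (s : State v a) : Exec W S .skip s 1 s
  | const (s : State v a) (x : Fin v) (z : ℤ) (hz : Fits W z) :
      Exec W S (.const x z) s 1 (s.set x z)
  | add (s : State v a) (x y z : Fin v) (h : Fits W (s.var y + s.var z)) :
      Exec W S (.add x y z) s 1 (s.set x (s.var y + s.var z))
  | sub (s : State v a) (x y z : Fin v) (h : Fits W (s.var y - s.var z)) :
      Exec W S (.sub x y z) s 1 (s.set x (s.var y - s.var z))
  | load (s : State v a) (x : Fin v) (A : Fin a) (i : Fin v) (n : ℕ)
      (hi : s.var i = (n : ℤ)) (hn : n < S) :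
      Exec W S (.load x A i) s 1 (s.set x (s.arr A n))
  | store (s : State v a) (A : Fin a) (i x : Fin v) (n : ℕ)
      (hi : s.var i = (n : ℤ)) (hn : n < S) :
      Exec W S (.store A i x) s 1
        { s with arr := Function.update s.arr A (Function.update (s.arr A) n (s.var x)) }
  | print (s : State v a) (x : Fin v) :
      Exec W S (.print x) s 1 { s with out := s.out ++ [s.var x] }
  | seq (p q : Cmd v a) (s s₁ s₂ : State v a) (t₁ t₂ : ℕ)
      (hp : Exec W S p s t₁ s₁) (hq : Exec W S q s₁ t₂ s₂) :
      Exec W S (.seq p q) s (t₁ + t₂) s₂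
  | ifTrue (x : Fin v) (p q : Cmd v a) (s s' : State v a) (t : ℕ)
      (hx : 0 < s.var x) (hp : Exec W S p s t s') : Exec W S (.ifPos x p q) s (t + 1) s'
  | ifFalse (x : Fin v) (p q : Cmd v a) (s s' : State v a) (t : ℕ)
      (hx : ¬ 0 < s.var x) (hq : Exec W S q s t s') : Exec W S (.ifPos x p q) s (t + 1) s'
  | whileDone (x : Fin v) (p : Cmd v a) (s : State v a) (hx : ¬ 0 < s.var x) :
      Exec W S (.whilePos x p) s 1 s
  | whileStep (x : Fin v) (p : Cmd v a) (s s₁ s₂ : State v a) (t₁ t₂ : ℕ)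
      (hx : 0 < s.var x) (hp : Exec W S p s t₁ s₁)
      (hw : Exec W S (.whilePos x p) s₁ t₂ s₂) :
      Exec W S (.whilePos x p) s (t₁ + t₂ + 1) s₂

/-- A program: a number of variables, a number of work arrays in addition to array `0`, which
holds the input, and the code. -/
structure Program where
  vars : ℕ
  workArrays : ℕ
  code : Cmd vars (workArrays + 1)

/-- The input stands at the beginning of array `0`; everything else is zero. -/
def Program.init (P : Program) (input : List ℤ) : State P.vars (P.workArrays + 1) where
  var := fun _ => 0
  arr := fun A n => if A = 0 then input.getD n 0 else 0
  out := []

/-- With words of `W` bits and arrays of `S` cells (array `0`, which has to hold the whole input,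
included), the program halts on `input` after `t` steps, having printed `output`. -/
def Program.Run (P : Program) (W S : ℕ) (input : List ℤ) (t : ℕ) (output : List ℤ) : Prop :=
  input.length ≤ S ∧ (∀ z ∈ input, Fits W z) ∧
    ∃ s', Exec W S P.code (P.init input) t s' ∧ s'.out = output

/-- The number of bits of all variables and arrays, with one sign bit per word. -/
def Program.bits (P : Program) (W S : ℕ) : ℕ :=
  (W + 1) * (P.vars + (P.workArrays + 1) * S)

end RAM

/-! ## Maximal exact matches -/

/-- The data of a match of `T_x[a .. a+len-1]` with `T_y[b .. b+len-1]` (everything is counted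
from `0`). -/
structure Match where
  x : ℕ
  y : ℕ
  a : ℕ
  b : ℕ
  len : ℕ

/-- `M` is a maximal exact match in the collection `T`. -/
def IsMEM (T : List (List ℕ)) (M : Match) : Prop :=
  ∃ s t : List ℕ, T[M.x]? = some s ∧ T[M.y]? = some t ∧
    M.a + M.len ≤ s.length ∧ M.b + M.len ≤ t.length ∧
    (s.drop M.a).take M.len = (t.drop M.b).take M.len ∧
    (M.a = 0 ∨ M.b = 0 ∨ s[M.a - 1]? ≠ t[M.b - 1]?) ∧
    (M.a + M.len = s.length ∨ M.b + M.len = t.length ∨ s[M.a + M.len]? ≠ t[M.b + M.len]?)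

/-! ## Symbols and the parsing `FFPar` -/

/-- Grammar symbols. A nonterminal is identified with the right-hand side of its only rule. -/
inductive GSym where
  | letter (c : ℕ)
  | dollar
  | hash
  | rule (rhs : List GSym)

mutual
def GSym.decEq : (A B : GSym) → Decidable (A = B)
  | .letter c, .letter d =>
      if h : c = d then isTrue (by rw [h]) else isFalse (by simpa using h)
  | .dollar, .dollar => isTrue rfl
  | .hash, .hash => isTrue rfl
  | .rule F, .rule Q =>
      match GSym.decEqList F Q with
      | isTrue h => isTrue (by rw [h])
      | isFalse h => isFalse (by simpa using h)
  | .letter _, .dollar => isFalse (by simp)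
  | .letter _, .hash => isFalse (by simp)
  | .letter _, .rule _ => isFalse (by simp)
  | .dollar, .letter _ => isFalse (by simp)
  | .dollar, .hash => isFalse (by simp)
  | .dollar, .rule _ => isFalse (by simp)
  | .hash, .letter _ => isFalse (by simp)
  | .hash, .dollar => isFalse (by simp)
  | .hash, .rule _ => isFalse (by simp)
  | .rule _, .letter _ => isFalse (by simp)
  | .rule _, .dollar => isFalse (by simp)
  | .rule _, .hash => isFalse (by simp)
def GSym.decEqList : (F Q : List GSym) → Decidable (F = Q)
  | [], [] => isTrue rfl
  | [], _ :: _ => isFalse (by simp)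
  | _ :: _, [] => isFalse (by simp)
  | A :: F, B :: Q =>
      match GSym.decEq A B, GSym.decEqList F Q with
      | isTrue h, isTrue k => isTrue (by rw [h, k])
      | isFalse h, _ => isFalse (by simp [h])
      | _, isFalse k => isFalse (by simp [k])
end

instance : DecidableEq GSym := GSym.decEq

/-- The string `$ s $ #`. -/
def flank (s : List GSym) : List GSym := .dollar :: (s ++ [.dollar, .hash])

/-- The value by which symbols are compared: `$` is the smallest, `#` the largest symbol, and `h`
gives the order of the others. -/
def key (h : GSym → ℕ) : GSym → ℕ∞
  | .dollar => 0
  | .hash => ⊤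
  | A => (h A : ℕ∞) + 1

/-- The first position of the string is S-type. -/
def IsSType (h : GSym → ℕ) : List GSym → Prop
  | A :: B :: r => key h A < key h B ∨ (A = B ∧ IsSType h (B :: r))
  | _ => False

/-- The first position of the string is L-type. -/
def IsLType (h : GSym → ℕ) : List GSym → Prop
  | A :: B :: r => key h B < key h A ∨ (A = B ∧ IsLType h (B :: r))
  | _ => False

open Classical in
/-- The positions (from `0`) of the local minima of a flanked string `s`: the LMS-type positions
before the closing `$ #`. -/
noncomputable def localMinima (h : GSym → ℕ) (s : List GSym) : List ℕ :=
  (List.range s.length).filter fun j =>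
    1 ≤ j ∧ j + 2 < s.length ∧ IsSType h (s.drop j) ∧ IsLType h (s.drop (j - 1))

/-- First and last positions of the phrases of a flanked string: one phrase `j - 1 .. j' + 1` for
any two consecutive local minima `j`, `j'`, one from the beginning to the position after the first
local minimum, and one from the position before the last local minimum to the end. A string
without local minima is a single phrase. -/
noncomputable def cuts (h : GSym → ℕ) (s : List GSym) : List (ℕ × ℕ) :=
  (0 :: (localMinima h s).map (· - 1)).zip ((localMinima h s).map (· + 1) ++ [s.length - 1])

/-- The phrases of a flanked string. -/
noncomputable def phrases (h : GSym → ℕ) (s : List GSym) : List (List GSym) :=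
  (cuts h s).map fun c => (s.drop c.1).take (c.2 + 1 - c.1)

/-! ## The grammar built by `FFGram` -/

/-- The string `t` after `i` rounds of parsing, where round `i + 1` uses the order `h i`. -/
noncomputable def parse (h : ℕ → GSym → ℕ) (t : List ℕ) : ℕ → List GSym
  | 0 => t.map .letter
  | i + 1 => (phrases (h i) (flank (parse h t i))).map .rule

/-- A run of `FFGram`: a nonempty collection, and for every round an injective function on the
alphabet of that round, such that the parsing stops after `rounds` rounds. -/
structure FFGram where
  T : List (List ℕ)
  T_ne : T ≠ []
  rounds : ℕ
  h : ℕ → GSym → ℕ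
  h_inj : ∀ i ≤ rounds, Set.InjOn (h i) {A | ∃ t ∈ T, A ∈ parse h t i}
  proceeds : ∀ i < rounds, ∃ t ∈ T, localMinima (h i) (flank (parse h t i)) ≠ []
  stops : ∀ t ∈ T, localMinima (h rounds) (flank (parse h t rounds)) = []

namespace FFGram

/-- The nonterminals other than the start symbol, each given by the right-hand side of its
rule. -/
noncomputable def nonterminals (𝒢 : FFGram) : Finset (List GSym) :=
  ((List.range 𝒢.rounds).flatMap fun i =>
    𝒢.T.flatMap fun t => phrases (𝒢.h i) (flank (parse 𝒢.h t i))).toFinset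

/-- The right-hand side of the rule of the start symbol, split into the parts that stem from the
single strings of the collection. -/
noncomputable def startParts (𝒢 : FFGram) : List (List GSym) :=
  𝒢.T.map fun t => flank (parse 𝒢.h t 𝒢.rounds)

/-- `G`: the sum of the lengths of all right-hand sides. -/
noncomputable def size (𝒢 : FFGram) : ℕ :=
  ∑ F ∈ 𝒢.nonterminals, F.length + (𝒢.startParts.map List.length).sum

/-- `n`: the number of symbols of the collection. -/
def textLength (𝒢 : FFGram) : ℕ := (𝒢.T.map List.length).sum

end FFGram

mutual
/-- The expansion that recursively skips the leftmost and the two rightmost edges. -/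
def GSym.efexp : GSym → List ℕ
  | .letter c => [c]
  | .dollar => []
  | .hash => []
  | .rule F => GSym.efexpTail F
/-- All but the first and the last two symbols are expanded. -/
def GSym.efexpTail : List GSym → List ℕ
  | [] => []
  | _ :: F => GSym.efexpInit F
/-- All but the last two symbols are expanded. -/
def GSym.efexpInit : List GSym → List ℕ
  | A :: B :: C :: F => GSym.efexp A ++ GSym.efexpInit (B :: C :: F)
  | _ => []
end

/-- The offsets of the symbols of a right-hand side `A_1 ⋯ A_x`: the `j`-th one is the length of
`efexp(A_2) ⋯ efexp(A_{j-1})`, where the symbols `A_{x-1}` and `A_x` are not counted. -/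
def offsets (F : List GSym) : List ℕ :=
  (List.range F.length).map fun j =>
    ((F.take (min j (F.length - 2))).drop 1 |>.map fun A => A.efexp.length).sum

/-! ## Primary MEMs -/

/-- For every symbol of `parse h t i` the first and the last position of `$ t $ #` (counted from
`0`) that the full expansion of that symbol, overlaps included, covers. -/
noncomputable def spans (h : ℕ → GSym → ℕ) (t : List ℕ) : ℕ → List (ℕ × ℕ)
  | 0 => (List.range t.length).map fun k => (k + 1, k + 1)
  | i + 1 =>
      let r := (0, 0) :: (spans h t i ++
        [(t.length + 1, t.length + 1), (t.length + 2, t.length + 2)])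
      (cuts (h i) (flank (parse h t i))).map fun c =>
        ((r.getD c.1 (0, 0)).1, (r.getD c.2 (0, 0)).2)

/-- Where an occurrence can lie: below a nonterminal (given by the right-hand side of its rule), or
directly below the start symbol, in the part of its right-hand side that belongs to the string with
the given identifier. -/
inductive Place where
  | nonterminal (F : List GSym)
  | text (x : ℕ)
deriving DecidableEq

namespace FFGram

/-- The `k`-th node of level `i` in the parse tree of `T_x` covers the substring
`T_x[a .. a+len-1]` together with its two neighbours in `$ T_x $ #`. -/
def Covers (𝒢 : FFGram) (x a len i k : ℕ) : Prop :=
  ∃ t r, 𝒢.T[x]? = some t ∧ (spans 𝒢.h t i)[k]? = some r ∧ r.1 ≤ a ∧ a + len + 1 ≤ r.2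

/-- The node `(i, k)` is the lowest node labelled with a nonterminal that covers the substring with
its two neighbours (the rightmost one, if overlapping nodes of the lowest level do so). -/
def IsLowest (𝒢 : FFGram) (x a len i k : ℕ) : Prop :=
  1 ≤ i ∧ i ≤ 𝒢.rounds ∧ 𝒢.Covers x a len i k ∧
    (∀ i' k', 1 ≤ i' → i' < i → ¬ 𝒢.Covers x a len i' k') ∧
    (∀ k', k < k' → ¬ 𝒢.Covers x a len i k')

/-- The label of the `k`-th node of level `i` in the parse tree of `T_x`. -/
noncomputable def label (𝒢 : FFGram) (x i k : ℕ) : Option GSym :=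
  (𝒢.T[x]?).bind fun t => (parse 𝒢.h t i)[k]?

/-- The node is the leftmost one with its label, i.e. an internal node of the grammar tree. -/
def IsLeftmost (𝒢 : FFGram) (x i k : ℕ) : Prop :=
  ∀ x' k', 𝒢.label x' i k' = 𝒢.label x i k → x < x' ∨ (x = x' ∧ k ≤ k')

/-- The position in `T_x` at which the `efexp` expansion of the `k`-th node of level `i` starts. -/
noncomputable def efStart (𝒢 : FFGram) (x i k : ℕ) : ℕ :=
  (((parse 𝒢.h (𝒢.T.getD x []) i).take k).map fun A => A.efexp.length).sum

/-- `T_x[a .. a+len-1]` is a primary occurrence: the lowest node that encodes it belongs to the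
grammar tree as an internal node. This node is labelled `X`, and `o` symbols precede the occurrence
within its `efexp` expansion (`o` is negative if the occurrence starts in the part overlapping the
previous node). If no other node encodes the occurrence, the start symbol does. -/
inductive PrimaryUnder (𝒢 : FFGram) (x a len : ℕ) : Place → ℤ → Prop where
  | node (i k : ℕ) (F : List GSym) (hlow : 𝒢.IsLowest x a len i k) (hleft : 𝒢.IsLeftmost x i k)
      (hF : 𝒢.label x i k = some (.rule F)) :
      PrimaryUnder 𝒢 x a len (.nonterminal F) ((a : ℤ) - (𝒢.efStart x i k : ℤ))
  | start (hx : x < 𝒢.T.length)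
      (h : ∀ i k, 1 ≤ i → i ≤ 𝒢.rounds → ¬ 𝒢.Covers x a len i k) :
      PrimaryUnder 𝒢 x a len (.text x) (a : ℤ)

end FFGram

/-- The tuples `(X, Y, o_X, o_Y, ℓ)` that encode primary MEMs. -/
structure PrTuple where
  X : Place
  Y : Place
  oX : ℤ
  oY : ℤ
  len : ℕ

/-- The tuple encodes a primary MEM of the collection. -/
def FFGram.IsPrMEM (𝒢 : FFGram) (p : PrTuple) : Prop :=
  ∃ M : Match, IsMEM 𝒢.T M ∧ M.len = p.len ∧
    𝒢.PrimaryUnder M.x M.a M.len p.X p.oX ∧ 𝒢.PrimaryUnder M.y M.b M.len p.Y p.oY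

/-! ## The simplified grammar -/

namespace FFGram

/-- The number of occurrences of the nonterminal in the right-hand sides of all rules. -/
noncomputable def occurrences (𝒢 : FFGram) (F : List GSym) : ℕ :=
  ∑ Q ∈ 𝒢.nonterminals, Q.count (.rule F) + (𝒢.startParts.map fun Q => Q.count (.rule F)).sum

/-- The right-hand side `F` and its offsets after all nonterminals with a single occurrence have
been replaced by their right-hand sides, recursively to depth `d`. -/
noncomputable def inline (𝒢 : FFGram) : ℕ → List GSym → List (GSym × ℕ)
  | 0, F => F.zip (offsets F)
  | d + 1, F => (F.zip (offsets F)).flatMap fun p =>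
      match p.1 with
      | .rule Q =>
          if 𝒢.occurrences Q = 1 then (inline 𝒢 d Q).map fun q => (q.1, p.2 + q.2) else [p]
      | _ => [p]

/-- The right-hand side that the simplification makes of `F`; the parse tree has height `rounds`
below the start symbol, so the replacement is complete. -/
noncomputable def simplified (𝒢 : FFGram) (F : List GSym) : List (GSym × ℕ) :=
  𝒢.inline 𝒢.rounds F

/-- The right-hand side of the rule (or the part of the start rule) belonging to a place. -/
def HasRhs (𝒢 : FFGram) (X : Place) (Q : List GSym) : Prop :=
  match X with
  | .nonterminal F => F ∈ 𝒢.nonterminals ∧ Q = F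
  | .text x => 𝒢.startParts[x]? = some Q

/-- `Relocates X o X' o'`: offset `o` in `X` becomes offset `o'` in `X'`, where `X'` is the place
that encloses the right-hand side of `X` in the simplified grammar. -/
inductive Relocates (𝒢 : FFGram) : Place → ℤ → Place → ℤ → Prop where
  | text (x : ℕ) (o : ℤ) : Relocates 𝒢 (.text x) o (.text x) o
  | keep (F : List GSym) (o : ℤ) (h : 𝒢.occurrences F ≠ 1) :
      Relocates 𝒢 (.nonterminal F) o (.nonterminal F) o
  | up (F : List GSym) (o : ℤ) (h : 𝒢.occurrences F = 1) (Y : Place) (Q : List GSym)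
      (hQ : 𝒢.HasRhs Y Q) (c : ℕ) (hc : (GSym.rule F, c) ∈ Q.zip (offsets Q))
      (X' : Place) (o' : ℤ) (hY : Relocates 𝒢 Y (o + c) X' o') :
      Relocates 𝒢 (.nonterminal F) o X' o'

/-- `L` is the list, updated to the simplified grammar, of the primary MEMs of length `> τ`, each
one once, in any order. -/
def IsPrMEMList (𝒢 : FFGram) (τ : ℕ) (L : List PrTuple) : Prop :=
  L.Nodup ∧ ∀ q, q ∈ L ↔ ∃ p, 𝒢.IsPrMEM p ∧ τ < p.len ∧ q.len = p.len ∧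
    𝒢.Relocates p.X p.oX q.X q.oX ∧ 𝒢.Relocates p.Y p.oY q.Y q.oY

/-- `letters` enumerates the terminals (without repetitions, in any order). -/
def EnumeratesLetters (𝒢 : FFGram) (letters : List ℕ) : Prop :=
  letters.Nodup ∧ ∀ c, c ∈ letters ↔ ∃ t ∈ 𝒢.T, c ∈ t

/-- `rules` enumerates the nonterminals, other than the start symbol, of the simplified grammar
(without repetitions, in any order). -/
def EnumeratesRules (𝒢 : FFGram) (rules : List (List GSym)) : Prop :=
  rules.Nodup ∧ ∀ F, F ∈ rules ↔ F ∈ 𝒢.nonterminals ∧ 𝒢.occurrences F ≠ 1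

end FFGram

/-! ## The input and the output as sequences of integers -/

/-- Symbols are numbered consecutively: `$`, `#`, the terminals, the nonterminals. -/
def GSym.code (letters : List ℕ) (rules : List (List GSym)) : GSym → ℤ
  | .dollar => 0
  | .hash => 1
  | .letter c => (2 + letters.idxOf c : ℕ)
  | .rule F => (2 + letters.length + rules.idxOf F : ℕ)

/-- A place is given by a flag that tells string identifiers from nonterminals, and a number. -/
def Place.code (letters : List ℕ) (rules : List (List GSym)) : Place → List ℤ
  | .nonterminal F => [0, (GSym.rule F).code letters rules]
  | .text x => [1, (x : ℤ)]

def PrTuple.code (letters : List ℕ) (rules : List (List GSym)) (q : PrTuple) : List ℤ :=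
  q.X.code letters rules ++ q.Y.code letters rules ++ [q.oX, q.oY, (q.len : ℤ)]

/-- The length of a right-hand side, and its symbols and offsets. -/
def codeRhs (letters : List ℕ) (rules : List (List GSym)) (E : List (GSym × ℕ)) : List ℤ :=
  (E.length : ℤ) :: E.flatMap fun p => [p.1.code letters rules, (p.2 : ℤ)]

/-- The input: the numbers of terminals, nonterminals, strings and tuples, then the simplified
rules in the order of their numbers, the simplified right-hand side of the start symbol string by
string, and the tuples. -/
noncomputable def FFGram.codeInput (𝒢 : FFGram) (letters : List ℕ) (rules : List (List GSym))
    (L : List PrTuple) : List ℤ :=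
  [(letters.length : ℤ), (rules.length : ℤ), (𝒢.T.length : ℤ), (L.length : ℤ)] ++
  rules.flatMap (fun F => codeRhs letters rules (𝒢.simplified F)) ++
  𝒢.startParts.flatMap (fun F => codeRhs letters rules (𝒢.simplified F)) ++
  L.flatMap (PrTuple.code letters rules)

def Match.code (M : Match) : List ℤ := [(M.x : ℤ), M.y, M.a, M.b, M.len]

/-!
# Reporting all maximal exact matches from the primary ones

**Matches and tuples.** A node of a parse tree is cut at the local minima of the level below it, and
its label determines everything under it: two nodes with the same label cover the same text, have the
same children, and these lie at the same distances from the starts of the `efexp` expansions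
(`children`, `alike`). Whether a node is the lowest and rightmost one that covers an occurrence and
its two neighbours can be read off its children, so a locus, together with the relative position, can
be moved to any other node with the same label (`IsLow.transfer`, `FFGram.Locus.transfer`). As loci
exist and are unique, each match stems from exactly one tuple, found by moving both of its occurrences
to the leftmost nodes with their labels (`exists_prMEM`, `IsPrMEMList.unique`). Conversely, if `X` and
`Y` are the labels in a tuple, any occurrence of the one paired with any occurrence of the other is a
match (`IsPrMEM.isMEM`). The matches are thus the disjoint union, over the tuples, of the products of
two sets of occurrences.

**Finding the occurrences.** The occurrences of a nonterminal are found by climbing from it to the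
right-hand sides that contain it, until the right-hand side is a part of that of the start symbol,
adding offsets on the way. Occurrences among the first symbol and the last two of a right-hand side
must not be followed: phrases overlap, and these symbols are accounted for in the neighbouring
phrases. Symbols with an empty expansion need not be followed. What remains are the symbols at which
the offset grows, and this criterion survives the simplification: a right-hand side with an expansion
of length `l` that is substituted contributes offsets that grow by `l` in total, and they grow between
two entries exactly where they did before (`HasRhs.mem_heavyEntries`). The program therefore takes as
edges the entries whose offset is smaller than the next one. Each node other than the root that has a
nonempty expansion has exactly one parent along these edges, also in the simplified grammar
(`at_iff_heavy`, `heavy_unique`), so the climbs from a place end in each of its occurrences exactly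
once (`mem_paths`).

**Time.** Climbing takes long if many nodes on the way have a single parent, which the
simplification does not exclude, as occurrences that are not followed count there. In linear time,
the program first assigns to every node the first node above it that does not have a single parent,
with the sum of the offsets (`Valid.contract`). Climbs over these nodes branch at every step before
the last, so that their total length is proportional to the number of their ends (`Valid.climb`).
Both sets of occurrences of a tuple are nonempty; hence the sum of their sizes is at most one more
than their product, and the total time is linear in the size of the input and the number `occ` of
matches (`Valid.run`). The number of tuples is at most `occ`, and the simplification does not increase
the size `G` of the grammar (`sum_simplified_le`).

**Space.** There are `O(G + occ)` cells. Offsets are bounded by the total length `n` of the strings,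
and `occ` by `(G + n) ^ 5` (`length_matches_le`), so words of `O(log (G + n))` bits suffice.

The program is verified with weakest preconditions that keep track of the elapsed time. The rule for
loops takes an invariant that bounds the time; amortized bounds are invariants with a potential.
-/

/-! ### Reasoning about programs -/

namespace RAM

variable {v a : ℕ}

/-- Replace cell `n` of array `A` by `z`. -/
def State.put (s : State v a) (A : Fin a) (n : ℕ) (z : ℤ) : State v a :=
  { s with arr := Function.update s.arr A (Function.update (s.arr A) n z) }

/-- Append `z` to the output. -/
def State.emit (s : State v a) (z : ℤ) : State v a :=
  { s with out := s.out ++ [z] }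

@[simp] theorem State.set_var (s : State v a) (x : Fin v) (z : ℤ) (y : Fin v) :
    (s.set x z).var y = if y = x then z else s.var y := by
  simp [State.set, Function.update_apply]
@[simp] theorem State.set_arr (s : State v a) (x : Fin v) (z : ℤ) : (s.set x z).arr = s.arr := rfl
@[simp] theorem State.set_out (s : State v a) (x : Fin v) (z : ℤ) : (s.set x z).out = s.out := rfl
@[simp] theorem State.put_var (s : State v a) (A : Fin a) (n : ℕ) (z : ℤ) :
    (s.put A n z).var = s.var := rfl
@[simp] theorem State.put_out (s : State v a) (A : Fin a) (n : ℕ) (z : ℤ) :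
    (s.put A n z).out = s.out := rfl
@[simp] theorem State.put_arr (s : State v a) (A : Fin a) (n : ℕ) (z : ℤ) (B : Fin a) :
    (s.put A n z).arr B = if B = A then Function.update (s.arr B) n z else s.arr B := by
  by_cases h : B = A
  · subst h; simp [State.put]
  · simp [State.put, h]
@[simp] theorem State.emit_var (s : State v a) (z : ℤ) : (s.emit z).var = s.var := rfl
@[simp] theorem State.emit_arr (s : State v a) (z : ℤ) : (s.emit z).arr = s.arr := rfl
@[simp] theorem State.emit_out (s : State v a) (z : ℤ) : (s.emit z).out = s.out ++ [z] := rfl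

/-- The command may assign the variable `x`. -/
def Cmd.writes : Cmd v a → Fin v → Bool
  | .const x _, y => x = y
  | .add x _ _, y => x = y
  | .sub x _ _, y => x = y
  | .load x _ _, y => x = y
  | .seq p q, y => p.writes y || q.writes y
  | .ifPos _ p q, y => p.writes y || q.writes y
  | .whilePos _ p, y => p.writes y
  | _, _ => false

/-- The command may store into the array `A`. -/
def Cmd.stores : Cmd v a → Fin a → Bool
  | .store A _ _, B => A = B
  | .seq p q, B => p.stores B || q.stores B
  | .ifPos _ p q, B => p.stores B || q.stores B
  | .whilePos _ p, B => p.stores B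
  | _, _ => false

/-- The command may print. -/
def Cmd.prints : Cmd v a → Bool
  | .print _ => true
  | .seq p q => p.prints || q.prints
  | .ifPos _ p q => p.prints || q.prints
  | .whilePos _ p => p.prints
  | _ => false

/-- The states `s` and `s'` differ only where the command `c` may write. -/
structure Frame (c : Cmd v a) (s s' : State v a) : Prop where
  var : ∀ x, c.writes x = false → s'.var x = s.var x
  arr : ∀ A, c.stores A = false → s'.arr A = s.arr A
  out : c.prints = false → s'.out = s.out

theorem Frame.refl (c : Cmd v a) (s : State v a) : Frame c s s := ⟨by simp, by simp, by simp⟩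

theorem Frame.trans {c : Cmd v a} {s s₁ s₂ : State v a} (h : Frame c s s₁) (k : Frame c s₁ s₂) :
    Frame c s s₂ :=
  ⟨fun x hx => (k.var x hx).trans (h.var x hx), fun x hx => (k.arr x hx).trans (h.arr x hx),
    fun hx => (k.out hx).trans (h.out hx)⟩

/-- What a command may write is read off its text, so that facts about all other variables and
arrays survive its execution without being part of its specification. -/
theorem Exec.frame {W S : ℕ} {c : Cmd v a} {s s' : State v a} {t : ℕ} (h : Exec W S c s t s') :
    Frame c s s' := by
  induction h with
  | skip => exact .refl _ _
  | const | add | sub | load =>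
    exact ⟨fun y hy => by simp [Cmd.writes] at hy; simp [Ne.symm hy], by simp, by simp⟩
  | store s A i x n hi hn =>
    refine ⟨by simp, fun B hB => ?_, by simp⟩
    simp only [Cmd.stores, decide_eq_false_iff_not] at hB
    exact Function.update_of_ne (Ne.symm hB) _ _
  | print => exact ⟨by simp, by simp, by simp [Cmd.prints]⟩
  | seq p q s s₁ s₂ t₁ t₂ _ _ hp hq =>
    refine ⟨fun x hx => ?_, fun x hx => ?_, fun hx => ?_⟩
    · simp only [Cmd.writes, Bool.or_eq_false_iff] at hx
      rw [hq.var x hx.2, hp.var x hx.1]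
    · simp only [Cmd.stores, Bool.or_eq_false_iff] at hx
      rw [hq.arr x hx.2, hp.arr x hx.1]
    · simp only [Cmd.prints, Bool.or_eq_false_iff] at hx
      rw [hq.out hx.2, hp.out hx.1]
  | ifTrue x p q s s' t hx _ hp =>
    refine ⟨fun x hx => ?_, fun x hx => ?_, fun hx => ?_⟩
    · simp only [Cmd.writes, Bool.or_eq_false_iff] at hx
      exact hp.var x hx.1
    · simp only [Cmd.stores, Bool.or_eq_false_iff] at hx
      exact hp.arr x hx.1
    · simp only [Cmd.prints, Bool.or_eq_false_iff] at hx
      exact hp.out hx.1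
  | ifFalse x p q s s' t hx _ hp =>
    refine ⟨fun x hx => ?_, fun x hx => ?_, fun hx => ?_⟩
    · simp only [Cmd.writes, Bool.or_eq_false_iff] at hx
      exact hp.var x hx.2
    · simp only [Cmd.stores, Bool.or_eq_false_iff] at hx
      exact hp.arr x hx.2
    · simp only [Cmd.prints, Bool.or_eq_false_iff] at hx
      exact hp.out hx.2
  | whileDone => exact .refl _ _
  | whileStep x p s s₁ s₂ t₁ t₂ hx _ _ hp hw =>
    exact Frame.trans ⟨fun x hx => hp.var x hx, fun x hx => hp.arr x hx, fun hx => hp.out hx⟩ hw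

/-- Started in `s` at time `t`, the command halts in a state and at a time that satisfy `Q`. -/
def wp (W S : ℕ) (c : Cmd v a) (s : State v a) (t : ℕ) (Q : State v a → ℕ → Prop) : Prop :=
  ∃ t' s', Exec W S c s t' s' ∧ Q s' (t + t')

variable {W S : ℕ} {s : State v a} {t : ℕ} {Q : State v a → ℕ → Prop}

theorem wp_conseq {c : Cmd v a} {R : State v a → ℕ → Prop} (h : wp W S c s t Q)
    (k : ∀ s' t', Frame c s s' → Q s' t' → R s' t') : wp W S c s t R := by
  obtain ⟨t', s', h, hQ⟩ := h
  exact ⟨t', s', h, k _ _ h.frame hQ⟩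

theorem wp_skip (h : Q s (t + 1)) : wp W S .skip s t Q := ⟨1, s, .skip s, h⟩

theorem wp_const {x : Fin v} {z : ℤ} (hz : Fits W z) (h : Q (s.set x z) (t + 1)) :
    wp W S (.const x z) s t Q := ⟨1, _, .const s x z hz, h⟩

theorem wp_add {x y z : Fin v} (hz : Fits W (s.var y + s.var z))
    (h : Q (s.set x (s.var y + s.var z)) (t + 1)) :
    wp W S (.add x y z) s t Q := ⟨1, _, .add s x y z hz, h⟩

theorem wp_sub {x y z : Fin v} (hz : Fits W (s.var y - s.var z))
    (h : Q (s.set x (s.var y - s.var z)) (t + 1)) :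
    wp W S (.sub x y z) s t Q := ⟨1, _, .sub s x y z hz, h⟩

theorem wp_load {x : Fin v} {A : Fin a} {i : Fin v} (n : ℕ) (hi : s.var i = n) (hn : n < S)
    (h : Q (s.set x (s.arr A n)) (t + 1)) : wp W S (.load x A i) s t Q :=
  ⟨1, _, .load s x A i n hi hn, h⟩

theorem wp_store {x : Fin v} {A : Fin a} {i : Fin v} (n : ℕ) (hi : s.var i = n) (hn : n < S)
    (h : Q (s.put A n (s.var x)) (t + 1)) : wp W S (.store A i x) s t Q :=
  ⟨1, _, .store s A i x n hi hn, h⟩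

theorem wp_print {x : Fin v} (h : Q (s.emit (s.var x)) (t + 1)) : wp W S (.print x) s t Q :=
  ⟨1, _, .print s x, h⟩

theorem wp_seq {p q : Cmd v a} (h : wp W S p s t fun s' t' => wp W S q s' t' Q) :
    wp W S (.seq p q) s t Q := by
  obtain ⟨t₁, s₁, h₁, t₂, s₂, h₂, hQ⟩ := h
  exact ⟨t₁ + t₂, s₂, .seq _ _ _ _ _ _ _ h₁ h₂, by rwa [← add_assoc]⟩

theorem wp_if {x : Fin v} {p q : Cmd v a} (hp : 0 < s.var x → wp W S p s (t + 1) Q)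
    (hq : ¬ 0 < s.var x → wp W S q s (t + 1) Q) : wp W S (.ifPos x p q) s t Q := by
  by_cases hx : 0 < s.var x
  · obtain ⟨t', s', h, hQ⟩ := hp hx
    exact ⟨t' + 1, s', .ifTrue _ _ _ _ _ _ hx h, by convert hQ using 1; omega⟩
  · obtain ⟨t', s', h, hQ⟩ := hq hx
    exact ⟨t' + 1, s', .ifFalse _ _ _ _ _ _ hx h, by convert hQ using 1; omega⟩

/-- The rule for loops. Every iteration takes time, so an invariant `I` that bounds the elapsed
time by `T` makes the loop end. -/
theorem wp_while {x : Fin v} {p : Cmd v a} (I : State v a → ℕ → Prop) (T : ℕ) (hI : I s t)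
    (hT : ∀ s' t', I s' t' → t' ≤ T)
    (hstep : ∀ s' t', I s' t' → Frame p s s' → 0 < s'.var x → wp W S p s' (t' + 1) I)
    (hdone : ∀ s' t', I s' t' → Frame p s s' → ¬ 0 < s'.var x → Q s' (t' + 1)) :
    wp W S (.whilePos x p) s t Q := by
  suffices H : ∀ n s' t', T - t' < n → I s' t' → Frame p s s' → wp W S (.whilePos x p) s' t' Q from
    H _ s t (Nat.lt_succ_self _) hI (.refl _ _)
  intro n
  induction n with
  | zero => intro s' t' h; omega
  | succ n ih =>
    intro s' t' hn hI' hF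
    by_cases hx : 0 < s'.var x
    · obtain ⟨t₁, s₁, h₁, hI₁⟩ := hstep s' t' hI' hF hx
      have := hT _ _ hI₁
      obtain ⟨t₂, s₂, h₂, hQ⟩ := ih s₁ _ (by omega) hI₁ (hF.trans h₁.frame)
      exact ⟨t₁ + t₂ + 1, s₂, .whileStep _ _ _ _ _ _ _ hx h₁ h₂, by convert hQ using 1; omega⟩
    · exact ⟨1, s', .whileDone _ _ _ hx, hdone _ _ hI' hF hx⟩

/-- A result of absolute value less than `K` does not overflow if words are long enough for `K`. -/
theorem fits_of {K z : ℤ} {W : ℕ} (hK : K ≤ 2 ^ W) (h₁ : -K < z) (h₂ : z < K) : Fits W z :=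
  abs_lt.2 ⟨by linarith, by linarith⟩

end RAM

namespace RAM

/-! ### Instances and the program -/

/-- The numbers in the input: `sig` letters, `r` rules, `m` strings, `nL` tuples; right-hand side `b`
(a rule if `b < r`, the part of the string `b - r` of the start rule otherwise) has length `len b`,
symbol codes `cd b j` and offsets `ofs b j`; tuple `i` relates the right-hand sides `X i` and `Y i`. -/
structure Inst where
  sig : ℕ
  r : ℕ
  m : ℕ
  nL : ℕ
  len : ℕ → ℕ
  cd : ℕ → ℕ → ℕ
  ofs : ℕ → ℕ → ℕ
  X : ℕ → ℕ
  Y : ℕ → ℕ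
  oX : ℕ → ℤ
  oY : ℕ → ℤ
  tl : ℕ → ℕ

namespace Inst

variable (I : Inst)

/-- The number of right-hand sides. -/
def nb : ℕ := I.r + I.m

/-- The address of right-hand side `b` in the input. -/
def st (b : ℕ) : ℕ := 4 + ∑ b' ∈ Finset.range b, (1 + 2 * I.len b')

theorem st_zero : I.st 0 = 4 := rfl
theorem st_succ (b : ℕ) : I.st (b + 1) = I.st b + 1 + 2 * I.len b := by
  simp [st, Finset.sum_range_succ]; omega
theorem st_mono {b b' : ℕ} (h : b ≤ b') : I.st b ≤ I.st b' :=
  Nat.add_le_add_left (Finset.sum_le_sum_of_subset (Finset.range_mono h)) _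
theorem le_st (b : ℕ) : 4 + b ≤ I.st b := by
  induction b with
  | zero => rfl
  | succ b ih => rw [st_succ]; omega

/-- Entry `j` of right-hand side `b` is a nonterminal whose `efexp` expansion is a nonempty part of
that of the right-hand side: the offset grows from this entry to the next one. -/
def isE (b j : ℕ) : Bool :=
  2 + I.sig ≤ I.cd b j ∧ j + 1 < I.len b ∧ I.ofs b j < I.ofs b (j + 1)

/-- The number of the rule that entry `j` of right-hand side `b` refers to. -/
def ch (b j : ℕ) : ℕ := I.cd b j - (2 + I.sig)

/-- The address of an entry. -/
def adr (p : ℕ × ℕ) : ℕ := I.st p.1 + 1 + 2 * p.2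

/-- The edges among the first `j` entries of right-hand side `b`. -/
def row (b j : ℕ) : List (ℕ × ℕ) := ((List.range j).filter (I.isE b)).map fun j => (b, j)

/-- The edges before entry `j` of right-hand side `b`. -/
def pre (b j : ℕ) : List (ℕ × ℕ) :=
  ((List.range b).flatMap fun b' => I.row b' (I.len b')) ++ I.row b j

/-- The edges that lead from rule `v` to the right-hand sides that contain it. -/
def E (v : ℕ) : List (ℕ × ℕ) :=
  ((I.pre I.nb 0).filter fun p => I.ch p.1 p.2 = v).reverse

theorem row_zero (b : ℕ) : I.row b 0 = [] := rfl
theorem row_succ (b j : ℕ) :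
    I.row b (j + 1) = I.row b j ++ if I.isE b j then [(b, j)] else [] := by
  by_cases h : I.isE b j <;> simp [row, List.range_succ, h]
theorem pre_succ (b j : ℕ) :
    I.pre b (j + 1) = I.pre b j ++ if I.isE b j then [(b, j)] else [] := by
  simp [pre, row_succ]
theorem pre_len (b : ℕ) : I.pre b (I.len b) = I.pre (b + 1) 0 := by
  simp [pre, row_zero, List.range_succ]

theorem mem_row {b j : ℕ} {p : ℕ × ℕ} : p ∈ I.row b j ↔ p.1 = b ∧ p.2 < j ∧ I.isE b p.2 := by
  obtain ⟨x, y⟩ := p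
  simp only [row, List.mem_map, List.mem_filter, List.mem_range, Prod.mk.injEq]
  constructor
  · rintro ⟨j', h, rfl, rfl⟩; exact ⟨rfl, h⟩
  · rintro ⟨rfl, h⟩; exact ⟨y, h, rfl, rfl⟩

theorem mem_pre {b j : ℕ} {p : ℕ × ℕ} :
    p ∈ I.pre b j ↔ I.isE p.1 p.2 ∧ (p.1 < b ∧ p.2 < I.len p.1 ∨ p.1 = b ∧ p.2 < j) := by
  simp only [pre, List.mem_append, List.mem_flatMap, List.mem_range, mem_row]
  constructor
  · rintro (⟨b', h, rfl, h'⟩ | ⟨rfl, h⟩)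
    · exact ⟨h'.2, .inl ⟨h, h'.1⟩⟩
    · exact ⟨h.2, .inr ⟨rfl, h.1⟩⟩
  · rintro ⟨h, h' | ⟨rfl, h'⟩⟩
    · exact .inl ⟨_, h'.1, rfl, h'.2, h⟩
    · exact .inr ⟨rfl, h', h⟩

theorem mem_E {v : ℕ} {p : ℕ × ℕ} :
    p ∈ I.E v ↔ p.1 < I.nb ∧ p.2 < I.len p.1 ∧ I.isE p.1 p.2 ∧ I.ch p.1 p.2 = v := by
  simp only [E, List.mem_reverse, List.mem_filter, mem_pre, decide_eq_true_eq]
  constructor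
  · rintro ⟨⟨h, h' | h'⟩, h''⟩
    · exact ⟨h'.1, h'.2, h, h''⟩
    · omega
  · rintro ⟨h, h', h'', k⟩; exact ⟨⟨h'', .inl ⟨h, h'⟩⟩, k⟩

theorem adr_lt_of_mem_pre {b j : ℕ} {p : ℕ × ℕ} (h : p ∈ I.pre b j) : I.adr p < I.adr (b, j) := by
  rw [mem_pre] at h
  obtain ⟨_, h | ⟨rfl, h⟩⟩ := h
  · have := I.st_mono (show p.1 + 1 ≤ b from h.1)
    rw [st_succ] at this
    simp only [adr]; omega
  · simp only [adr]; omega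

/-- Each entry takes two cells of the input, so that addresses bound the number of edges. -/
theorem length_pre_le (b j : ℕ) : (I.pre b j).length ≤ I.st b + j := by
  have H : ∀ b j, (I.pre b j).length ≤ (I.pre b 0).length + j := by
    intro b j
    induction j with
    | zero => simp
    | succ j ih =>
      rw [pre_succ, List.length_append]
      split_ifs <;> simp <;> omega
  have H0 : ∀ b, (I.pre b 0).length ≤ I.st b := by
    intro b
    induction b with
    | zero => simp [pre, row_zero]
    | succ b ih =>
      have := H b (I.len b)
      rw [← pre_len, st_succ]; omega
  have := H b j
  have := H0 b
  omega

theorem adr_lt {v : ℕ} {p : ℕ × ℕ} (h : p ∈ I.E v) : I.adr p + 1 < I.st I.nb := by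
  rw [mem_E] at h
  have := I.st_mono (show p.1 + 1 ≤ I.nb from h.1)
  rw [st_succ] at this
  simp only [adr]; omega

end Inst

/-- Following the pointers `nx` from `h` one meets the addresses of `l`; `0` ends the list. -/
def Chain (nx : ℕ → ℤ) : ℤ → List ℕ → Prop
  | h, [] => h = 0
  | h, e :: l => h = e ∧ 0 < e ∧ Chain nx (nx e) l

theorem Chain.update {nx : ℕ → ℤ} {n : ℕ} (z : ℤ) :
    ∀ {l : List ℕ} {h : ℤ}, Chain nx h l → n ∉ l → Chain (Function.update nx n z) h l
  | [], _, hc, _ => hc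
  | e :: l, h, hc, hn => by
    simp only [List.mem_cons, not_or] at hn
    refine ⟨hc.1, hc.2.1, ?_⟩
    rw [Function.update_of_ne (Ne.symm hn.1)]
    exact hc.2.2.update z hn.2

/-- The arrays `hd`, `nx`, `ow`, `ct` store the edges of the list `P` as linked lists, one for each
rule, with their owners and the lengths of the lists. -/
structure Linked (I : Inst) (hd nx ow ct : ℕ → ℤ) (P : List (ℕ × ℕ)) : Prop where
  chain : ∀ v, Chain nx (hd v) (((P.filter fun p => I.ch p.1 p.2 = v).reverse).map I.adr)
  own : ∀ p ∈ P, ow (I.adr p) = p.1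
  cnt : ∀ v, ct v = (P.filter fun p => I.ch p.1 p.2 = v).length

/-- Edges are found in the order of their addresses, so that the cell of the new edge is not in use
yet. -/
theorem Linked.push {I : Inst} {hd nx ow ct : ℕ → ℤ} {P : List (ℕ × ℕ)} (h : Linked I hd nx ow ct P)
    {p : ℕ × ℕ} (hp : ∀ q ∈ P, I.adr q < I.adr p) {v : ℕ} (hv : I.ch p.1 p.2 = v) :
    Linked I (Function.update hd v (I.adr p)) (Function.update nx (I.adr p) (hd v))
      (Function.update ow (I.adr p) p.1) (Function.update ct v (ct v + 1)) (P ++ [p]) := by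
  have hnot : ∀ w, I.adr p ∉ ((P.filter fun p => I.ch p.1 p.2 = w).reverse).map I.adr := by
    intro w hw
    simp only [List.mem_map, List.mem_reverse, List.mem_filter] at hw
    obtain ⟨q, ⟨hq, -⟩, hqe⟩ := hw
    have := hp q hq
    omega
  refine ⟨fun w => ?_, fun q hq => ?_, fun w => ?_⟩
  · by_cases hw : w = v
    · subst hw
      simp only [List.filter_append, List.filter_cons, hv, List.filter_nil, Function.update_self,
        decide_true, if_true, List.reverse_append, List.reverse_singleton, List.singleton_append,
        List.map_cons]
      exact ⟨rfl, by simp [Inst.adr], by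
        rw [Function.update_self]; exact (h.chain w).update _ (hnot w)⟩
    · rw [Function.update_of_ne hw]
      simp only [List.filter_append, List.filter_cons, hv, List.filter_nil, Ne.symm hw,
        decide_false, List.append_nil, Bool.false_eq_true, if_false]
      exact (h.chain w).update _ (hnot w)
  · simp only [List.mem_append, List.mem_singleton] at hq
    rcases hq with hq | rfl
    · rw [Function.update_of_ne (hp q hq).ne, h.own q hq]
    · simp
  · by_cases hw : w = v
    · subst hw; simp [hv, h.cnt]
    · simp [hv, Ne.symm hw, hw, h.cnt]

/-- The cells `0, 1, …` of the arrays `A` and `B` store the pairs of the list `l` from its last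
element to its first. -/
def Stored (A B : ℕ → ℤ) : List (ℕ × ℤ) → Prop
  | [] => True
  | p :: l => A l.length = p.1 ∧ B l.length = p.2 ∧ Stored A B l

theorem Stored.update {A B : ℕ → ℤ} {n : ℕ} (x y : ℤ) :
    ∀ {l : List (ℕ × ℤ)}, Stored A B l → l.length ≤ n →
      Stored (Function.update A n x) (Function.update B n y) l
  | [], _, _ => trivial
  | p :: l, h, hn => by
    simp only [List.length_cons] at hn
    have : l.length ≠ n := by omega
    refine ⟨?_, ?_, h.2.2.update x y (by omega)⟩
    · rw [Function.update_of_ne this, h.1]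
    · rw [Function.update_of_ne this, h.2.1]

theorem Stored.push {A B : ℕ → ℤ} {l : List (ℕ × ℤ)} (h : Stored A B l) (p : ℕ × ℤ) :
    Stored (Function.update A l.length p.1) (Function.update B l.length p.2) (p :: l) :=
  ⟨by simp, by simp, h.update _ _ le_rfl⟩

theorem Stored.get {A B : ℕ → ℤ} : ∀ {l : List (ℕ × ℤ)}, Stored A B l → ∀ i (hi : i < l.length),
    A i = (l.reverse[i]'(by simpa using hi)).1 ∧ B i = (l.reverse[i]'(by simpa using hi)).2
  | p :: l, h, i, hi => by
    simp only [List.length_cons] at hi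
    rcases Nat.lt_succ_iff_lt_or_eq.1 hi with hi | rfl
    · simpa [List.getElem_append_left, hi] using h.2.2.get i hi
    · simp [h.1, h.2.1]

/-! ### The program -/

/-
The arrays: `a_inp` holds the input. The edges that lead from rule `v` upwards form a linked list
with the head `a_hd v`, the length `a_ct v`, and the links `a_nx`; an edge is named by the address of
its entry in the input, and `a_ow` gives the right-hand side that this entry belongs to. The address
`0` ends a list. `a_rp v` and `a_ro v` are the representative of `v` and the offset in it, and
`a_dn v` is `1` once they are known. `a_sB` and `a_sO` are a stack of right-hand sides with offsets,
`a_tT` and `a_tO` the list of the strings and positions found so far.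

The variables: `v_zero`, `v_one`, `v_two`, `v_base` (the code of the first nonterminal), `v_r` and
`v_nb` keep constants; `v_nL` counts the tuples that are left; `v_pos` is the reading position in the
input; `v_sp` is the height of the stack and `v_rc` the length of the list of strings found, the first
`v_nX` of which stem from the first place of the tuple. The others are local to a command.
-/
local infixr:60 " ;; " => Cmd.seq

local notation "v_zero" => (0 : Fin 32)
local notation "v_one" => (1 : Fin 32)
local notation "v_base" => (2 : Fin 32)
local notation "v_r" => (3 : Fin 32)
local notation "v_nb" => (4 : Fin 32)
local notation "v_nL" => (5 : Fin 32)
local notation "v_pos" => (6 : Fin 32)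
local notation "v_b" => (7 : Fin 32)
local notation "v_rem" => (8 : Fin 32)
local notation "v_c" => (9 : Fin 32)
local notation "v_v" => (10 : Fin 32)
local notation "v_d" => (11 : Fin 32)
local notation "v_off" => (12 : Fin 32)
local notation "v_q" => (13 : Fin 32)
local notation "v_h" => (14 : Fin 32)
local notation "v_u" => (15 : Fin 32)
local notation "v_D" => (16 : Fin 32)
local notation "v_k" => (17 : Fin 32)
local notation "v_e" => (18 : Fin 32)
local notation "v_o" => (19 : Fin 32)
local notation "v_sp" => (20 : Fin 32)
local notation "v_rc" => (21 : Fin 32)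
local notation "v_nX" => (22 : Fin 32)
local notation "v_i" => (23 : Fin 32)
local notation "v_j" => (24 : Fin 32)
local notation "v_x" => (25 : Fin 32)
local notation "v_a" => (26 : Fin 32)
local notation "v_y" => (27 : Fin 32)
local notation "v_w" => (28 : Fin 32)
local notation "v_len" => (29 : Fin 32)
local notation "v_two" => (30 : Fin 32)
local notation "v_g" => (31 : Fin 32)
local notation "a_inp" => (0 : Fin 12)
local notation "a_hd" => (1 : Fin 12)
local notation "a_nx" => (2 : Fin 12)
local notation "a_ow" => (3 : Fin 12)
local notation "a_ct" => (4 : Fin 12)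
local notation "a_rp" => (5 : Fin 12)
local notation "a_ro" => (6 : Fin 12)
local notation "a_dn" => (7 : Fin 12)
local notation "a_sB" => (8 : Fin 12)
local notation "a_sO" => (9 : Fin 12)
local notation "a_tT" => (10 : Fin 12)
local notation "a_tO" => (11 : Fin 12)

/-- Read the header of the input. -/
def header : Cmd 32 12 :=
  .const v_one 1 ;; .const v_two 2 ;; .const v_h 3 ;; .const v_pos 4 ;;
  .load v_base a_inp v_zero ;; .add v_base v_base v_two ;; .load v_r a_inp v_one ;;
  .load v_nb a_inp v_two ;; .add v_nb v_nb v_r ;; .load v_nL a_inp v_h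

/-- Insert the edge at address `v_pos` into the list of rule `v_v`. -/
def insertEdge : Cmd 32 12 :=
  .load v_h a_hd v_v ;; .store a_nx v_pos v_h ;; .store a_hd v_v v_pos ;;
  .store a_ow v_pos v_b ;; .load v_h a_ct v_v ;; .add v_h v_h v_one ;; .store a_ct v_v v_h

/-- Insert the entry at address `v_pos` if it is an edge. -/
def tryEdge : Cmd 32 12 :=
  .load v_v a_inp v_pos ;; .sub v_v v_v v_base ;; .add v_d v_v v_one ;;
  .ifPos v_d
    (.sub v_d v_rem v_one ;;
      .ifPos v_d
        (.add v_q v_pos v_one ;; .load v_off a_inp v_q ;; .add v_q v_q v_two ;;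
          .load v_h a_inp v_q ;; .sub v_d v_h v_off ;; .ifPos v_d insertEdge .skip)
        .skip)
    .skip

/-- Go through the entries of one right-hand side. -/
def scanEntries : Cmd 32 12 :=
  .whilePos v_rem (tryEdge ;; .add v_pos v_pos v_two ;; .sub v_rem v_rem v_one)

/-- Collect the edges of all right-hand sides. -/
def scan : Cmd 32 12 :=
  .sub v_c v_nb v_b ;;
  .whilePos v_c (.load v_rem a_inp v_pos ;; .add v_pos v_pos v_one ;; scanEntries ;;
    .add v_b v_b v_one ;; .sub v_c v_nb v_b)

/-- Mark `v_b` as the representative of itself. -/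
def markRoot : Cmd 32 12 :=
  .store a_rp v_b v_b ;; .store a_ro v_b v_zero ;; .store a_dn v_b v_one

/-- Everything that does not have exactly one parent represents itself. -/
def markRoots : Cmd 32 12 :=
  .const v_b 0 ;; .sub v_c v_nb v_b ;;
  .whilePos v_c (.load v_h a_ct v_b ;; .sub v_h v_h v_one ;;
    .ifPos v_h markRoot (.sub v_h v_zero v_h ;; .ifPos v_h markRoot .skip) ;;
    .add v_b v_b v_one ;; .sub v_c v_nb v_b)

/-- Replace `v_u` by its only parent, and read the offset. -/
def step : Cmd 32 12 :=
  .load v_e a_hd v_u ;; .add v_q v_e v_one ;; .load v_off a_inp v_q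

/-- Climb from `v_b` to the next finished ancestor. -/
def climbUp : Cmd 32 12 :=
  .add v_u v_b v_zero ;; .const v_D 0 ;; .const v_k 0 ;; .load v_h a_dn v_u ;;
  .sub v_d v_one v_h ;;
  .whilePos v_d (step ;; .add v_D v_D v_off ;; .load v_u a_ow v_e ;; .add v_k v_k v_one ;;
    .load v_h a_dn v_u ;; .sub v_d v_one v_h)

/-- Climb once more, and write down the representatives. -/
def climbMark : Cmd 32 12 :=
  .load v_x a_rp v_u ;; .load v_h a_ro v_u ;; .add v_D v_D v_h ;; .add v_u v_b v_zero ;;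
  .whilePos v_k (.store a_rp v_u v_x ;; .store a_ro v_u v_D ;; .store a_dn v_u v_one ;;
    step ;; .sub v_D v_D v_off ;; .load v_u a_ow v_e ;; .sub v_k v_k v_one)

/-- Find the representatives: skip the nodes that have a single parent. -/
def contract : Cmd 32 12 :=
  markRoots ;; .const v_b 0 ;; .sub v_c v_nb v_b ;;
  .whilePos v_c (climbUp ;; climbMark ;; .add v_b v_b v_one ;; .sub v_c v_nb v_b)

/-- Push the representative of `v_u`, with the offset `v_o`, onto the stack. -/
def push : Cmd 32 12 :=
  .load v_h a_ro v_u ;; .add v_o v_o v_h ;; .load v_u a_rp v_u ;;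
  .store a_sB v_sp v_u ;; .store a_sO v_sp v_o ;; .add v_sp v_sp v_one

/-- Push the parents that are listed from `v_e` on. -/
def pushParents : Cmd 32 12 :=
  .whilePos v_e (.load v_u a_ow v_e ;; .add v_q v_e v_one ;; .load v_off a_inp v_q ;;
    .add v_o v_g v_off ;; push ;; .load v_e a_nx v_e)

/-- Find all places in the strings that lie below the entries of the stack. -/
def climb : Cmd 32 12 :=
  .whilePos v_sp (.sub v_sp v_sp v_one ;; .load v_u a_sB v_sp ;; .load v_g a_sO v_sp ;;
    .sub v_d v_u v_r ;; .add v_h v_d v_one ;;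
    .ifPos v_h
      (.store a_tT v_rc v_d ;; .store a_tO v_rc v_g ;; .add v_rc v_rc v_one)
      (.load v_e a_hd v_u ;; pushParents))

/-- Read a place at `v_pos` and its offset at `v_q`, and find its occurrences in the strings. -/
def expand : Cmd 32 12 :=
  .load v_h a_inp v_pos ;; .add v_pos v_pos v_one ;; .load v_u a_inp v_pos ;;
  .add v_pos v_pos v_one ;;
  .ifPos v_h (.add v_u v_u v_r) (.sub v_u v_u v_base) ;;
  .load v_o a_inp v_q ;; .const v_sp 0 ;; push ;; climb

/-- Print all pairs of an occurrence of the first place with one of the second place. -/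
def printPairs : Cmd 32 12 :=
  .const v_i 0 ;; .sub v_c v_nX v_i ;;
  .whilePos v_c (.load v_x a_tT v_i ;; .load v_a a_tO v_i ;; .add v_j v_nX v_zero ;;
    .sub v_d v_rc v_j ;;
    .whilePos v_d (.load v_y a_tT v_j ;; .load v_w a_tO v_j ;; .print v_x ;; .print v_y ;;
      .print v_a ;; .print v_w ;; .print v_len ;; .add v_j v_j v_one ;; .sub v_d v_rc v_j) ;;
    .add v_i v_i v_one ;; .sub v_c v_nX v_i)

/-- Report the matches of the tuple at `v_pos`. -/
def tuple : Cmd 32 12 :=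
  .const v_rc 0 ;; .add v_q v_pos v_two ;; .add v_q v_q v_two ;; expand ;;
  .add v_nX v_rc v_zero ;;
  .add v_q v_pos v_two ;; .add v_q v_q v_one ;; expand ;;
  .add v_pos v_pos v_two ;; .load v_len a_inp v_pos ;; .add v_pos v_pos v_one ;;
  printPairs

/-- Collect the edges, find the representatives, and report the matches of each tuple. -/
def mainCode : Cmd 32 12 :=
  header ;; scan ;; contract ;; .whilePos v_nL (tuple ;; .sub v_nL v_nL v_one)

/-- The program, with 32 variables and, apart from the input, 11 arrays. -/
def prog : Program := ⟨32, 11, mainCode⟩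


/-! ### Rules that name results -/

/-! Variants of the rules above for one command, at the end of a sequence (`last`) or followed by others
(`seq`). They take the value that the command computes as an argument, so that states remain small,
and the bound `K` on all values, which rules out overflow. -/

section Steps

variable {v a : ℕ} {W S : ℕ} {s : State v a} {t : ℕ} {Q : State v a → ℕ → Prop} {K : ℤ}
  {q : Cmd v a}

theorem const_seq (hK : K ≤ 2 ^ W) {x : Fin v} {z : ℤ} (hz : -K < z ∧ z < K)
    (h : wp W S q (s.set x z) (t + 1) Q) : wp W S (.seq (.const x z) q) s t Q :=
  wp_seq (wp_const (fits_of hK hz.1 hz.2) h)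

theorem add_last (hK : K ≤ 2 ^ W) {x y z : Fin v} (w : ℤ) (hw : s.var y + s.var z = w)
    (hz : -K < w ∧ w < K) (h : Q (s.set x w) (t + 1)) : wp W S (.add x y z) s t Q :=
  wp_add (hw ▸ fits_of hK hz.1 hz.2) (hw ▸ h)

theorem add_seq (hK : K ≤ 2 ^ W) {x y z : Fin v} (w : ℤ) (hw : s.var y + s.var z = w)
    (hz : -K < w ∧ w < K) (h : wp W S q (s.set x w) (t + 1) Q) :
    wp W S (.seq (.add x y z) q) s t Q :=
  wp_seq (add_last hK w hw hz h)

theorem sub_last (hK : K ≤ 2 ^ W) {x y z : Fin v} (w : ℤ) (hw : s.var y - s.var z = w)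
    (hz : -K < w ∧ w < K) (h : Q (s.set x w) (t + 1)) : wp W S (.sub x y z) s t Q :=
  wp_sub (hw ▸ fits_of hK hz.1 hz.2) (hw ▸ h)

theorem sub_seq (hK : K ≤ 2 ^ W) {x y z : Fin v} (w : ℤ) (hw : s.var y - s.var z = w)
    (hz : -K < w ∧ w < K) (h : wp W S q (s.set x w) (t + 1) Q) :
    wp W S (.seq (.sub x y z) q) s t Q :=
  wp_seq (sub_last hK w hw hz h)

theorem load_last {x : Fin v} {A : Fin a} {i : Fin v} (n : ℕ) (w : ℤ) (hi : s.var i = n)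
    (hn : n < S) (hw : s.arr A n = w) (h : Q (s.set x w) (t + 1)) :
    wp W S (.load x A i) s t Q :=
  wp_load n hi hn (hw ▸ h)

theorem load_seq {x : Fin v} {A : Fin a} {i : Fin v} (n : ℕ) (w : ℤ) (hi : s.var i = n)
    (hn : n < S) (hw : s.arr A n = w) (h : wp W S q (s.set x w) (t + 1) Q) :
    wp W S (.seq (.load x A i) q) s t Q :=
  wp_seq (load_last n w hi hn hw h)

theorem store_last {x : Fin v} {A : Fin a} {i : Fin v} (n : ℕ) (w : ℤ) (hi : s.var i = n)
    (hn : n < S) (hw : s.var x = w) (h : Q (s.put A n w) (t + 1)) :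
    wp W S (.store A i x) s t Q :=
  wp_store n hi hn (hw ▸ h)

theorem store_seq {x : Fin v} {A : Fin a} {i : Fin v} (n : ℕ) (w : ℤ) (hi : s.var i = n)
    (hn : n < S) (hw : s.var x = w) (h : wp W S q (s.put A n w) (t + 1) Q) :
    wp W S (.seq (.store A i x) q) s t Q :=
  wp_seq (store_last n w hi hn hw h)

theorem print_seq {x : Fin v} (w : ℤ) (hw : s.var x = w)
    (h : wp W S q (s.emit w) (t + 1) Q) : wp W S (.seq (.print x) q) s t Q :=
  wp_seq (wp_print (hw ▸ h))

/-- Run a part of the program whose effect is known. -/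
theorem part_seq {p : Cmd v a} {R : State v a → ℕ → Prop} (hp : wp W S p s t R)
    (h : ∀ s' t', Frame p s s' → R s' t' → wp W S q s' t' Q) : wp W S (.seq p q) s t Q :=
  wp_seq (wp_conseq hp h)

end Steps

/-! ### Collecting the edges -/

/-- The content `inp` of the input array represents the instance, all numbers are at most `N`, and
the edges form an acyclic graph: along them `rank` grows, and `sz`, the length of the expansion,
grows by at least the offset. From a place that is `good` all climbs end in strings. -/
structure Valid (I : Inst) (inp : ℕ → ℤ) (N : ℕ) (rank sz : ℕ → ℕ) (good : ℕ → Prop) : Prop where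
  inp0 : inp 0 = I.sig
  inp1 : inp 1 = I.r
  inp2 : inp 2 = I.m
  inp3 : inp 3 = I.nL
  inp_len : ∀ b < I.nb, inp (I.st b) = I.len b
  inp_cd : ∀ b < I.nb, ∀ j < I.len b, inp (I.st b + 1 + 2 * j) = I.cd b j
  inp_ofs : ∀ b < I.nb, ∀ j < I.len b, inp (I.st b + 2 + 2 * j) = I.ofs b j
  inpX : ∀ i < I.nL, 0 < inp (I.st I.nb + 7 * i) ∧ inp (I.st I.nb + 7 * i + 1) + I.r = I.X i ∨
    ¬ 0 < inp (I.st I.nb + 7 * i) ∧ inp (I.st I.nb + 7 * i + 1) = I.X i + (2 + I.sig)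
  inpY : ∀ i < I.nL, 0 < inp (I.st I.nb + 7 * i + 2) ∧
      inp (I.st I.nb + 7 * i + 3) + I.r = I.Y i ∨
    ¬ 0 < inp (I.st I.nb + 7 * i + 2) ∧ inp (I.st I.nb + 7 * i + 3) = I.Y i + (2 + I.sig)
  inp_oX : ∀ i < I.nL, inp (I.st I.nb + 7 * i + 4) = I.oX i
  inp_oY : ∀ i < I.nL, inp (I.st I.nb + 7 * i + 5) = I.oY i
  inp_tl : ∀ i < I.nL, inp (I.st I.nb + 7 * i + 6) = I.tl i
  X_lt : ∀ i < I.nL, I.X i < I.nb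
  Y_lt : ∀ i < I.nL, I.Y i < I.nb
  X_good : ∀ i < I.nL, good (I.X i)
  Y_good : ∀ i < I.nL, good (I.Y i)
  ch_lt : ∀ b < I.nb, ∀ j < I.len b, I.isE b j → I.ch b j < I.r
  rank_lt : ∀ b < I.nb, ∀ j < I.len b, I.isE b j → rank (I.ch b j) < rank b
  sz_le : ∀ b < I.nb, ∀ j < I.len b, I.isE b j → sz (I.ch b j) + I.ofs b j ≤ sz b
  E_ne : ∀ v < I.r, good v → I.E v ≠ []
  good_E : ∀ v, good v → ∀ p ∈ I.E v, good p.1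
  sz_bd : ∀ b < I.nb, sz b ≤ N
  cd_bd : ∀ b < I.nb, ∀ j < I.len b, I.cd b j ≤ N
  ofs_bd : ∀ b < I.nb, ∀ j < I.len b, I.ofs b j ≤ N
  tup_bd : ∀ i < I.nL, |I.oX i| ≤ N ∧ |I.oY i| ≤ N ∧ I.tl i ≤ N
  size_bd : I.st I.nb + 7 * I.nL ≤ N
  sig_bd : I.sig ≤ N

section Verify

variable {I : Inst} {inp : ℕ → ℤ} {N : ℕ} {rank sz : ℕ → ℕ} {good : ℕ → Prop} {W S : ℕ}
  {s : State 32 12} {t : ℕ}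

/-- The constants that the program keeps in variables. -/
structure Consts (I : Inst) (inp : ℕ → ℤ) (s : State 32 12) : Prop where
  zero : s.var v_zero = 0
  one : s.var v_one = 1
  two : s.var v_two = 2
  base : s.var v_base = 2 + I.sig
  r : s.var v_r = I.r
  nb : s.var v_nb = I.nb
  inp : s.arr a_inp = inp

/-- The hypothesis on the text of the command is decided by evaluation. -/
theorem Consts.frame {c : Cmd 32 12} {s' : State 32 12} (h : Consts I inp s) (k : Frame c s s')
    (hc : (c.writes v_zero || c.writes v_one || c.writes v_two || c.writes v_base ||
      c.writes v_r || c.writes v_nb || c.stores a_inp) = false) : Consts I inp s' := by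
  simp only [Bool.or_eq_false_iff] at hc
  obtain ⟨⟨⟨⟨⟨⟨h1, h2⟩, h3⟩, h4⟩, h5⟩, h6⟩, h7⟩ := hc
  exact ⟨(k.var _ h1).trans h.zero, (k.var _ h2).trans h.one, (k.var _ h3).trans h.two,
    (k.var _ h4).trans h.base, (k.var _ h5).trans h.r, (k.var _ h6).trans h.nb,
    (k.arr _ h7).trans h.inp⟩

theorem edge_bd {b j : ℕ} (hb : b < I.nb)
    (hj : j < I.len b) : I.st b + 2 + 2 * j < I.st I.nb := by
  have := I.st_mono (show b + 1 ≤ I.nb from hb)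
  rw [I.st_succ] at this
  omega

/-- Here and below, `8 * N + 16 ≤ 2 ^ W` says that no operation overflows, as all intermediate
values are smaller than that. -/
theorem Valid.tryEdge (hV : Valid I inp N rank sz good) (hK : ((8 * N + 16 : ℕ) : ℤ) ≤ 2 ^ W)
    (hS : I.st I.nb + 7 * I.nL ≤ S) (hC : Consts I inp s) {b j : ℕ} (hb : b < I.nb)
    (hj : j < I.len b) (hpos : s.var v_pos = I.adr (b, j)) (hvb : s.var v_b = b)
    (hrem : s.var v_rem = I.len b - j)
    (hL : Linked I (s.arr a_hd) (s.arr a_nx) (s.arr a_ow) (s.arr a_ct) (I.pre b j)) :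
    wp W S tryEdge s t fun s' t' => t' ≤ t + 20 ∧
      Linked I (s'.arr a_hd) (s'.arr a_nx) (s'.arr a_ow) (s'.arr a_ct) (I.pre b (j + 1)) := by
  obtain ⟨c0, c1, c2, cb, cr, cn, ci⟩ := hC
  have hbd := edge_bd hb hj
  have h1 := hV.size_bd
  have h2 := hV.cd_bd b hb j hj
  have h3 := hV.sig_bd
  have h4 := hV.inp_cd b hb j hj
  have h5 := hV.ofs_bd b hb j hj
  have h6 := hV.inp_ofs b hb j hj
  have hnot : I.isE b j = false → I.pre b (j + 1) = I.pre b j := by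
    intro h; rw [I.pre_succ, h]; simp
  unfold RAM.tryEdge
  simp only [Inst.adr] at hpos
  have hst := I.le_st b
  have hlen : I.len b ≤ N := by
    have := I.st_mono (show b + 1 ≤ I.nb from hb)
    rw [I.st_succ] at this; omega
  refine load_seq (I.st b + 1 + 2 * j) (I.cd b j) (by simp [hpos]) (by omega)
    (by simp [ci, h4]) ?_
  refine sub_seq hK (I.cd b j - (2 + I.sig)) (by simp [cb]) (by omega) ?_
  refine add_seq hK (I.cd b j - (2 + I.sig) + 1) (by simp [c1]) (by omega) ?_
  refine wp_if (fun hp => ?_) (fun hp => ?_) <;> simp at hp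
  swap
  · refine wp_skip ⟨by omega, ?_⟩
    rw [hnot (by simp [Inst.isE]; omega)]; exact hL
  refine sub_seq hK (I.len b - j - 1) (by simp [c1, hrem]) (by omega) ?_
  refine wp_if (fun hp2 => ?_) (fun hp2 => ?_) <;> simp at hp2
  swap
  · refine wp_skip ⟨by omega, ?_⟩
    rw [hnot (by simp [Inst.isE]; omega)]; exact hL
  have hj' : j + 1 < I.len b := by omega
  have h7 := hV.inp_ofs b hb _ hj'
  have h8 := hV.ofs_bd b hb _ hj'
  have hbd' := edge_bd hb hj'
  refine add_seq hK (I.st b + 2 + 2 * j : ℕ) (by simp [c1, hpos]; ring) (by omega) ?_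
  refine load_seq (I.st b + 2 + 2 * j) (I.ofs b j) (by simp) (by omega) (by simp [ci, h6]) ?_
  refine add_seq hK (I.st b + 2 + 2 * (j + 1) : ℕ) (by simp [c2]; ring) (by omega) ?_
  refine load_seq (I.st b + 2 + 2 * (j + 1)) (I.ofs b (j + 1)) (by simp) (by omega)
    (by simp [ci, h7]) ?_
  refine sub_seq hK (I.ofs b (j + 1) - I.ofs b j) (by simp) (by omega) ?_
  refine wp_if (fun hp3 => ?_) (fun hp3 => ?_) <;> simp at hp3
  swap
  · refine wp_skip ⟨by omega, ?_⟩
    rw [hnot (by simp [Inst.isE]; omega)]; exact hL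
  have hE : I.isE b j = true := by simp [Inst.isE]; omega
  have hlt := hV.ch_lt b hb j hj hE
  obtain ⟨v, hv⟩ : ∃ v, I.ch b j = v := ⟨_, rfl⟩
  have hv' : (I.cd b j : ℤ) - (2 + I.sig) = v := by simp only [Inst.ch] at hv; omega
  have hvS : v < S := by have := I.le_st I.nb; simp only [Inst.nb] at *; omega
  have hcnt : (s.arr a_ct v) + 1 ≤ 8 * N + 15 ∧ 0 ≤ s.arr a_ct v := by
    rw [hL.cnt v]
    have h9 := List.length_filter_le (fun p => decide (I.ch p.1 p.2 = v)) (I.pre b j)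
    have h10 := I.length_pre_le b j
    omega
  unfold insertEdge
  refine load_seq v (s.arr a_hd v) (by simp [hv']) hvS (by simp) ?_
  refine store_seq (I.st b + 1 + 2 * j) (s.arr a_hd v) (by simp [hpos]) (by omega) (by simp) ?_
  refine store_seq v (I.st b + 1 + 2 * j : ℕ) (by simp [hv']) (by omega) (by simp [hpos]) ?_
  refine store_seq (I.st b + 1 + 2 * j) b (by simp [hpos]) (by omega) (by simp [hvb]) ?_
  refine load_seq v (s.arr a_ct v) (by simp [hv']) hvS (by simp) ?_
  refine add_seq hK (s.arr a_ct v + 1) (by simp [c1]) (by omega) ?_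
  refine store_last v (s.arr a_ct v + 1) (by simp [hv']) hvS (by simp) ⟨by omega, ?_⟩
  rw [I.pre_succ, if_pos hE]
  have := hL.push (p := (b, j)) (fun q hq => I.adr_lt_of_mem_pre hq) hv
  simpa [Inst.adr] using this

theorem Valid.scanEntries (hV : Valid I inp N rank sz good)
    (hK : ((8 * N + 16 : ℕ) : ℤ) ≤ 2 ^ W)
    (hS : I.st I.nb + 7 * I.nL ≤ S) (hC : Consts I inp s) {b : ℕ} (hb : b < I.nb)
    (hpos : s.var v_pos = I.adr (b, 0)) (hvb : s.var v_b = b)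
    (hrem : s.var v_rem = I.len b)
    (hL : Linked I (s.arr a_hd) (s.arr a_nx) (s.arr a_ow) (s.arr a_ct) (I.pre b 0)) :
    wp W S scanEntries s t fun s' t' => t' ≤ t + 25 * I.len b + 1 ∧
      s'.var v_pos = I.st (b + 1) ∧
      Linked I (s'.arr a_hd) (s'.arr a_nx) (s'.arr a_ow) (s'.arr a_ct) (I.pre (b + 1) 0) := by
  have h1 := hV.size_bd
  have hst := I.st_mono (show b + 1 ≤ I.nb from hb)
  rw [I.st_succ] at hst
  refine wp_while (fun s' t' => ∃ j ≤ I.len b, s'.var v_pos = I.adr (b, j) ∧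
    s'.var v_rem = I.len b - j ∧ t' ≤ t + 25 * j ∧
    Linked I (s'.arr a_hd) (s'.arr a_nx) (s'.arr a_ow) (s'.arr a_ct) (I.pre b j))
    (t + 25 * I.len b) ⟨0, by omega, hpos, by simp [hrem], by omega, hL⟩ ?_ ?_ ?_
  · rintro s' t' ⟨j, hj, -, -, ht, -⟩; omega
  · rintro s' t' ⟨j, hj, hp, hr, ht, hL'⟩ hF hpos'
    have hC' := hC.frame hF rfl
    refine part_seq (hV.tryEdge hK hS hC' hb (by omega) hp ((hF.var _ rfl).trans hvb) hr hL')
      fun s₁ t₁ hF₁ ⟨ht₁, hL₁⟩ => ?_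
    have hC₁ := hC'.frame hF₁ rfl
    have e1 := hF₁.var v_pos rfl
    have e2 := hF₁.var v_rem rfl
    refine add_seq hK (I.adr (b, j + 1)) (by rw [e1, hp, hC₁.two]; simp [Inst.adr]; ring)
      (by simp only [Inst.adr]; omega) ?_
    refine sub_last hK (I.len b - (j + 1 : ℕ)) (by simp [e2, hr, hC₁.one]; ring)
      (by omega) ?_
    exact ⟨j + 1, by omega, by simp, by simp, by omega, by simpa using hL₁⟩
  · rintro s' t' ⟨j, hj, hp, hr, ht, hL'⟩ hF hpos'
    obtain rfl : j = I.len b := by omega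
    refine ⟨by omega, ?_, by rwa [← I.pre_len]⟩
    rw [hp, I.st_succ]; rfl

/-- The edges are collected in time linear in the size of the input. -/
theorem Valid.scan (hV : Valid I inp N rank sz good)
    (hK : ((8 * N + 16 : ℕ) : ℤ) ≤ 2 ^ W)
    (hS : I.st I.nb + 7 * I.nL ≤ S) (hC : Consts I inp s)
    (hpos : s.var v_pos = 4) (hvb : s.var v_b = 0)
    (hL : Linked I (s.arr a_hd) (s.arr a_nx) (s.arr a_ow) (s.arr a_ct) []) :
    wp W S scan s t fun s' t' => t' ≤ t + 25 * I.st I.nb + 1 ∧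
      s'.var v_pos = I.st I.nb ∧
      Linked I (s'.arr a_hd) (s'.arr a_nx) (s'.arr a_ow) (s'.arr a_ct) (I.pre I.nb 0) := by
  have h1 := hV.size_bd
  have hnb := I.le_st I.nb
  refine sub_seq hK I.nb (by simp [hC.nb, hvb]) (by omega) ?_
  refine wp_while (fun s' t' => ∃ b ≤ I.nb, s'.var v_pos = I.st b ∧ s'.var v_b = b ∧
    s'.var v_c = I.nb - b ∧ t' + 50 ≤ t + 25 * I.st b ∧
    Linked I (s'.arr a_hd) (s'.arr a_nx) (s'.arr a_ow) (s'.arr a_ct) (I.pre b 0))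
    (t + 25 * I.st I.nb) ⟨0, by omega, by simpa [I.st_zero] using hpos, by simp [hvb], by simp,
      by rw [I.st_zero]; omega, by simpa [Inst.pre, I.row_zero] using hL⟩ ?_ ?_ ?_
  · rintro s' t' ⟨b, hb, -, -, -, ht, -⟩
    have := I.st_mono hb
    omega
  · rintro s' t' ⟨b, hb, hp, hvb', hc, ht, hL'⟩ hF hpos'
    have hC' := (hC.frame (c := .sub v_c v_nb v_b) ⟨by simp [Cmd.writes]; tauto, by simp, by simp⟩
      rfl).frame hF rfl
    have hb' : b < I.nb := by omega
    have hst := I.st_mono (show b + 1 ≤ I.nb from hb')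
    rw [I.st_succ] at hst
    have hlb := I.le_st b
    refine load_seq (I.st b) (I.len b) hp (by omega) (by rw [hC'.inp, hV.inp_len b hb']) ?_
    refine add_seq hK (I.adr (b, 0)) (by simp [hp, hC'.one, Inst.adr])
      (by simp only [Inst.adr]; omega) ?_
    refine part_seq (hV.scanEntries hK hS
      ⟨by simp [hC'.zero], by simp [hC'.one], by simp [hC'.two], by simp [hC'.base],
        by simp [hC'.r], by simp [hC'.nb], by simp [hC'.inp]⟩ hb'
      (by simp) (by simp [hvb']) (by simp) (by simpa using hL'))
      fun s₁ t₁ hF₁ ⟨ht₁, hp₁, hL₁⟩ => ?_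
    have e1 := hF₁.var v_b rfl
    have e2 := hF₁.var v_nb rfl
    have e3 := hF₁.var v_one rfl
    simp [hvb', hC'.nb, hC'.one] at e1 e2 e3
    refine add_seq hK (b + 1 : ℕ) (by simp [e1, e3]) (by omega) ?_
    refine sub_last hK (I.nb - (b + 1 : ℕ)) (by simp [e2]) (by omega) ?_
    refine ⟨b + 1, by omega, by simp [hp₁], by simp, by simp, ?_, by simpa using hL₁⟩
    rw [I.st_succ]; omega
  · rintro s' t' ⟨b, hb, hp, hvb', hc, ht, hL'⟩ hF hpos'
    obtain rfl : b = I.nb := by omega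
    exact ⟨by omega, hp, hL'⟩

end Verify

/-! ### Contracting rules with a single parent -/

/-- `Rep I v u o`: from `v`, the nodes with a single parent are skipped up to `u`, which lies at
offset `o`. -/
inductive Rep (I : Inst) : ℕ → ℕ → ℕ → Prop
  | root (v : ℕ) (h : (I.E v).length ≠ 1) : Rep I v v 0
  | step (v : ℕ) (p : ℕ × ℕ) (u o : ℕ) (h : I.E v = [p]) (k : Rep I p.1 u o) :
      Rep I v u (I.ofs p.1 p.2 + o)

/-- `Run I dn v k`: after `k` steps to the single parent one reaches, from `v`, a node marked in
`dn` for the first time. -/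
inductive Run (I : Inst) (dn : ℕ → ℤ) : ℕ → ℕ → Prop
  | done (v : ℕ) (h : dn v = 1) : Run I dn v 0
  | step (v : ℕ) (p : ℕ × ℕ) (k : ℕ) (hv : dn v ≠ 1) (h : I.E v = [p]) (hk : Run I dn p.1 k) :
      Run I dn v (k + 1)

/-- The marked nodes have their representatives written down; among the nodes below `b`, those
without a single parent are marked. -/
structure Reps (I : Inst) (rp ro dn : ℕ → ℤ) (b : ℕ) : Prop where
  bool : ∀ v, dn v = 0 ∨ dn v = 1
  rep : ∀ v, dn v = 1 → ∃ u o : ℕ, Rep I v u o ∧ rp v = u ∧ ro v = o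
  root : ∀ v < b, (I.E v).length ≠ 1 → dn v = 1

theorem Rep.not_single {I : Inst} {v u o : ℕ} (h : Rep I v u o) : (I.E u).length ≠ 1 := by
  induction h with
  | root v h => exact h
  | step _ _ _ _ _ _ ih => exact ih

section Verify

variable {I : Inst} {inp : ℕ → ℤ} {N : ℕ} {rank sz : ℕ → ℕ} {good : ℕ → Prop} {W S : ℕ}
  {s : State 32 12} {t : ℕ}

theorem Valid.E_single (hV : Valid I inp N rank sz good) {v : ℕ} {p : ℕ × ℕ} (h : p ∈ I.E v) :
    v < I.r ∧ p.1 < I.nb ∧ rank v < rank p.1 ∧ sz v + I.ofs p.1 p.2 ≤ sz p.1 := by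
  obtain ⟨h1, h2, h3, rfl⟩ := I.mem_E.1 h
  exact ⟨hV.ch_lt _ h1 _ h2 h3, h1, hV.rank_lt _ h1 _ h2 h3, hV.sz_le _ h1 _ h2 h3⟩

theorem Valid.rep_bd (hV : Valid I inp N rank sz good) {v u o : ℕ} (h : Rep I v u o) :
    (v < I.nb → u < I.nb ∧ sz v + o ≤ sz u) ∧ (good v → good u) := by
  induction h with
  | root v h => exact ⟨fun h => ⟨h, le_rfl⟩, id⟩
  | step v p u o h _ ih =>
    have hp : p ∈ I.E v := by simp [h]
    obtain ⟨h1, h2, h3, h4⟩ := hV.E_single hp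
    have := ih.1 h2
    exact ⟨fun _ => ⟨this.1, by omega⟩, fun hg => ih.2 (hV.good_E _ hg _ hp)⟩

/-- Nodes with a single parent have a smaller rank than that parent, so that one can argue by
induction from the parents to the children. -/
theorem Valid.induct (hV : Valid I inp N rank sz good) {P : ℕ → Prop}
    (step : ∀ v, (∀ p ∈ I.E v, P p.1) → P v) (v : ℕ) : P v := by
  obtain ⟨R, hR⟩ : ∃ R, ∀ b < I.nb, rank b ≤ R :=
    ⟨∑ b ∈ Finset.range I.nb, rank b, fun b hb =>
      Finset.single_le_sum (f := rank) (fun _ _ => Nat.zero_le _) (Finset.mem_range.2 hb)⟩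
  suffices H : ∀ n v, R - rank v < n → P v from H _ v (Nat.lt_succ_self _)
  intro n
  induction n with
  | zero => intro v h; omega
  | succ n ih =>
    intro v hv
    refine step v fun p hp => ih _ ?_
    obtain ⟨-, h2, h3, -⟩ := hV.E_single hp
    have := hR _ h2
    omega

/-- Climbing along single parents ends, since the ranks increase. -/
theorem Valid.exists_run (hV : Valid I inp N rank sz good) {dn : ℕ → ℤ}
    (hd : ∀ v < I.nb, (I.E v).length ≠ 1 → dn v = 1) {v : ℕ} (hv : v < I.nb) :
    ∃ k, Run I dn v k := by
  revert hv
  refine hV.induct (P := fun v => v < I.nb → ∃ k, Run I dn v k) (fun v ih hv => ?_) v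
  by_cases h : dn v = 1
  · exact ⟨0, .done v h⟩
  · obtain ⟨p, hp⟩ := List.length_eq_one_iff.1 (not_not.1 fun h' => h (hd v hv h'))
    obtain ⟨k, hk⟩ := ih p (by simp [hp]) (hV.E_single (by simp [hp] : p ∈ I.E v)).2.1
    exact ⟨k + 1, .step v p k h hp hk⟩

/-- The nodes that such a climb passes are different, as their ranks increase. -/
theorem Valid.run_le (hV : Valid I inp N rank sz good) {dn : ℕ → ℤ} {v k : ℕ} (h : Run I dn v k)
    (hv : v < I.nb) :
    k ≤ ((Finset.range I.nb).filter fun w => dn w ≠ 1 ∧ rank v ≤ rank w).card := by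
  induction h with
  | done => exact Nat.zero_le _
  | step v p k hd hE hk ih =>
    obtain ⟨-, h2, h3, -⟩ := hV.E_single (by simp [hE] : p ∈ I.E v)
    refine (ih h2).trans_lt (Finset.card_lt_card ?_)
    refine Finset.ssubset_iff_of_subset (fun w hw => ?_) |>.2 ⟨v, ?_, ?_⟩
    · simp only [Finset.mem_filter] at hw ⊢
      exact ⟨hw.1, hw.2.1, by omega⟩
    · simp [hv, hd]
    · simp; intros; omega

/-- Marking a node of smaller rank, which the climb has left behind, does not shorten the climb. -/
theorem Valid.run_update (hV : Valid I inp N rank sz good) {dn : ℕ → ℤ} {v k w : ℕ}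
    (h : Run I dn v k) (hw : rank w < rank v) : Run I (Function.update dn w 1) v k := by
  induction h with
  | done v h => exact .done v (by rw [Function.update_of_ne (by rintro rfl; omega), h])
  | step v p k hd hE hk ih =>
    obtain ⟨-, h2, h3, -⟩ := hV.E_single (by simp [hE] : p ∈ I.E v)
    exact .step v p k (by rwa [Function.update_of_ne (by rintro rfl; omega)]) hE (ih (by omega))

/-- The edges stand in the arrays of the machine. -/
def Edges (I : Inst) (s : State 32 12) : Prop :=
  Linked I (s.arr a_hd) (s.arr a_nx) (s.arr a_ow) (s.arr a_ct) (I.pre I.nb 0)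

theorem Edges.frame {c : Cmd 32 12} {s' : State 32 12} (h : Edges I s) (k : Frame c s s')
    (hc : (c.stores a_hd || c.stores a_nx || c.stores a_ow || c.stores a_ct) = false) :
    Edges I s' := by
  simp only [Bool.or_eq_false_iff] at hc
  obtain ⟨⟨⟨h1, h2⟩, h3⟩, h4⟩ := hc
  simp only [Edges, k.arr _ h1, k.arr _ h2, k.arr _ h3, k.arr _ h4] at h ⊢
  exact h

theorem Edges.chain (h : Edges I s) (v : ℕ) : Chain (s.arr a_nx) (s.arr a_hd v) ((I.E v).map I.adr) :=
  Linked.chain h v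

theorem Edges.cnt (h : Edges I s) (v : ℕ) : s.arr a_ct v = (I.E v).length := by
  rw [Linked.cnt h v, Inst.E, List.length_reverse]

theorem Edges.own (h : Edges I s) {v : ℕ} {p : ℕ × ℕ} (hp : p ∈ I.E v) :
    s.arr a_ow (I.adr p) = p.1 :=
  Linked.own h p (List.mem_of_mem_filter (List.mem_reverse.1 hp))

theorem Valid.inp_edge (hV : Valid I inp N rank sz good) {v : ℕ} {p : ℕ × ℕ} (hp : p ∈ I.E v) :
    inp (I.adr p + 1) = I.ofs p.1 p.2 ∧ I.adr p + 1 < I.st I.nb ∧ I.ofs p.1 p.2 ≤ N := by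
  refine ⟨?_, I.adr_lt hp, ?_⟩ <;> obtain ⟨h1, h2, -⟩ := I.mem_E.1 hp
  · rw [← hV.inp_ofs _ h1 _ h2]; simp only [Inst.adr]; congr 1; omega
  · exact hV.ofs_bd _ h1 _ h2

theorem length_E_le (v : ℕ) : (I.E v).length ≤ I.st I.nb := by
  rw [Inst.E, List.length_reverse]
  exact (List.length_filter_le _ _).trans (by simpa using I.length_pre_le I.nb 0)

theorem wp_markRoot (hS : I.nb < S) (hC : Consts I inp s) {b : ℕ} (hb : b < I.nb)
    (hvb : s.var v_b = b) (hr : (I.E b).length ≠ 1)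
    (hR : Reps I (s.arr a_rp) (s.arr a_ro) (s.arr a_dn) b) :
    wp W S markRoot s t fun s' t' => t' ≤ t + 3 ∧
      Reps I (s'.arr a_rp) (s'.arr a_ro) (s'.arr a_dn) (b + 1) := by
  refine store_seq b b hvb (by omega) hvb ?_
  refine store_seq b 0 hvb (by omega) (by simp [hC.zero]) ?_
  refine store_last b 1 hvb (by omega) (by simp [hC.one]) ⟨by omega, ?_⟩
  simp
  refine ⟨fun v => ?_, fun v => ?_, fun v hv hr' => ?_⟩
  · by_cases h : v = b
    · simp [h]
    · rw [Function.update_of_ne h]; exact hR.bool v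
  · by_cases h : v = b
    · subst h; intro _; exact ⟨v, 0, .root v hr, by simp, by simp⟩
    · rw [Function.update_of_ne h, Function.update_of_ne h, Function.update_of_ne h]
      exact hR.rep v
  · by_cases h : v = b
    · simp [h]
    · rw [Function.update_of_ne h]; exact hR.root v (by omega) hr'

theorem Valid.markRoots (hV : Valid I inp N rank sz good)
    (hK : ((8 * N + 16 : ℕ) : ℤ) ≤ 2 ^ W)
    (hS : I.st I.nb + 7 * I.nL ≤ S) (hC : Consts I inp s) (hE : Edges I s)
    (hR : Reps I (s.arr a_rp) (s.arr a_ro) (s.arr a_dn) 0) :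
    wp W S markRoots s t fun s' t' => t' ≤ t + 15 * I.nb + 3 ∧
      Reps I (s'.arr a_rp) (s'.arr a_ro) (s'.arr a_dn) I.nb := by
  have h1 := hV.size_bd
  have hnb := I.le_st I.nb
  refine const_seq hK (by omega) ?_
  refine sub_seq hK I.nb (by simp [hC.nb]) (by omega) ?_
  refine wp_while (fun s' t' => ∃ b ≤ I.nb, s'.var v_b = b ∧
    s'.var v_c = I.nb - b ∧ t' ≤ t + 2 + 15 * b ∧
    Reps I (s'.arr a_rp) (s'.arr a_ro) (s'.arr a_dn) b)
    (t + 15 * I.nb + 2) ⟨0, by omega, by simp, by simp, by omega, by simpa using hR⟩ ?_ ?_ ?_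
  · rintro s' t' ⟨b, hb, -, -, ht, -⟩; omega
  · rintro s' t' ⟨b, hb, hvb, hc, ht, hR'⟩ hF hpos
    have hC' : Consts I inp s' := Consts.frame
      ⟨by simp [hC.zero], by simp [hC.one], by simp [hC.two], by simp [hC.base],
        by simp [hC.r], by simp [hC.nb], by simp [hC.inp]⟩ hF rfl
    have hE' : Edges I s' := Edges.frame (by simpa [Edges] using hE) hF rfl
    have hb' : b < I.nb := by omega
    have hl := length_E_le (I := I) b
    refine load_seq b (I.E b).length hvb (by omega) (hE'.cnt b) ?_
    refine sub_seq hK ((I.E b).length - 1) (by simp [hC'.one]) (by omega) ?_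
    refine part_seq (R := fun s₁ t₁ => t₁ ≤ t' + 10 ∧
      Reps I (s₁.arr a_rp) (s₁.arr a_ro) (s₁.arr a_dn) (b + 1)) ?_ fun s₁ t₁ hF₁ ⟨ht₁, hR₁⟩ => ?_
    · have hC2 : ∀ z w, Consts I inp ((s'.set v_h z).set v_h w) := fun z w =>
        ⟨by simp [hC'.zero], by simp [hC'.one], by simp [hC'.two], by simp [hC'.base],
        by simp [hC'.r], by simp [hC'.nb], by simp [hC'.inp]⟩
      refine wp_if (fun hp => ?_) (fun hp => ?_) <;> simp at hp
      · exact wp_conseq (wp_markRoot (by omega) (hC2 _ _) hb' (by simp [hvb]) (by omega)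
          (by simpa using hR')) fun s₁ t₁ _ h => ⟨by omega, h.2⟩
      · refine sub_seq hK (1 - (I.E b).length) (by simp [hC'.zero]) (by omega) ?_
        refine wp_if (fun hp2 => ?_) (fun hp2 => ?_) <;> simp at hp2
        · refine wp_conseq (wp_markRoot (I := I) (inp := inp) (b := b) (by omega)
            ⟨by simp [hC'.zero], by simp [hC'.one], by simp [hC'.two], by simp [hC'.base],
            by simp [hC'.r], by simp [hC'.nb], by simp [hC'.inp]⟩ hb' (by simp [hvb])
            (by simp [hp2])
            (by simpa using hR')) fun s₁ t₁ _ h => ⟨by omega, h.2⟩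
        · refine wp_skip ⟨by omega, ?_⟩
          have : (I.E b).length = 1 := by
            have : (I.E b).length ≠ 0 := by simpa using hp2
            omega
          refine ⟨by simpa using hR'.bool, by simpa using hR'.rep, fun v hv hr => ?_⟩
          have : v ≠ b := by rintro rfl; exact hr this
          simpa using hR'.root v (by omega) hr
    · have e1 := hF₁.var v_b rfl
      have e2 := hF₁.var v_nb rfl
      have e3 := hF₁.var v_one rfl
      simp [hvb, hC'.nb, hC'.one] at e1 e2 e3
      refine add_seq hK (b + 1 : ℕ) (by simp [e1, e3]) (by omega) ?_
      refine sub_last hK (I.nb - (b + 1 : ℕ)) (by simp [e2]) (by omega) ?_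
      exact ⟨b + 1, by omega, by simp, by simp, by omega, by simpa using hR₁⟩
  · rintro s' t' ⟨b, hb, hvb, hc, ht, hR'⟩ hF hpos
    obtain rfl : b = I.nb := by omega
    exact ⟨by omega, hR'⟩

theorem Valid.step (hV : Valid I inp N rank sz good)
    (hK : ((8 * N + 16 : ℕ) : ℤ) ≤ 2 ^ W)
    (hS : I.st I.nb + 7 * I.nL ≤ S) (hC : Consts I inp s) (hE : Edges I s) {u : ℕ} {p : ℕ × ℕ}
    (hu : s.var v_u = u) (hp : I.E u = [p]) :
    wp W S step s t fun s' t' => t' = t + 3 ∧ s'.var v_e = I.adr p ∧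
      s'.var v_off = I.ofs p.1 p.2 := by
  have hm : p ∈ I.E u := by simp [hp]
  obtain ⟨hin, had, hof⟩ := hV.inp_edge hm
  obtain ⟨hur, -⟩ := hV.E_single hm
  have h1 := hV.size_bd
  have hnb := I.le_st I.nb
  have hch := hE.chain u
  rw [hp] at hch
  have hnb' : I.nb = I.r + I.m := rfl
  refine load_seq u (I.adr p) hu (by omega) hch.1 ?_
  refine add_seq hK (I.adr p + 1 : ℕ) (by simp [hC.one]) (by omega) ?_
  refine load_last (I.adr p + 1) (I.ofs p.1 p.2) (by simp) (by omega) (by simp [hC.inp, hin]) ?_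
  simp

/-- The climb adds up the offsets on the way to the first marked node. -/
theorem Valid.climbUp (hV : Valid I inp N rank sz good)
    (hK : ((8 * N + 16 : ℕ) : ℤ) ≤ 2 ^ W)
    (hS : I.st I.nb + 7 * I.nL ≤ S) (hC : Consts I inp s) (hE : Edges I s)
    (hR : Reps I (s.arr a_rp) (s.arr a_ro) (s.arr a_dn) I.nb) {v n : ℕ} (hv : v < I.nb)
    (hvb : s.var v_b = v) (hn : Run I (s.arr a_dn) v n) :
    wp W S climbUp s t fun s' t' => t' ≤ t + 6 + 9 * n ∧ s'.var v_k = n ∧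
      ∃ u D : ℕ, u < I.nb ∧ s'.var v_u = u ∧ s'.var v_D = D ∧ s.arr a_dn u = 1 ∧
        sz v + D ≤ sz u ∧ ∀ w o, Rep I u w o → Rep I v w (D + o) := by
  have h1 := hV.size_bd
  have hnb := I.le_st I.nb
  have hd01 : ∀ v, 0 ≤ s.arr a_dn v ∧ s.arr a_dn v ≤ 1 := fun v => by
    rcases hR.bool v with h | h <;> omega
  have hnle : n ≤ N := by
    refine (hV.run_le hn hv).trans ((Finset.card_filter_le _ _).trans ?_)
    simp; omega
  have hdv := hd01 v
  refine add_seq hK v (by simp [hC.zero, hvb]) (by omega) ?_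
  refine const_seq hK (by omega) ?_
  refine const_seq hK (by omega) ?_
  refine load_seq v (s.arr a_dn v) (by simp) (by omega) (by simp) ?_
  refine sub_seq hK (1 - s.arr a_dn v) (by simp [hC.one]) (by omega) ?_
  refine wp_while (fun s' t' => ∃ u D k n', u < I.nb ∧ s'.var v_u = u ∧ s'.var v_D = (D : ℕ) ∧
      s'.var v_k = (k : ℕ) ∧ s'.var v_d = 1 - s.arr a_dn u ∧ Run I (s.arr a_dn) u n' ∧
      k + n' = n ∧ sz v + D ≤ sz u ∧ (∀ w o, Rep I u w o → Rep I v w (D + o)) ∧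
      t' ≤ t + 5 + 9 * k) (t + 5 + 9 * n)
    ⟨v, 0, 0, n, hv, by simp, by simp, by simp, by simp, hn, by omega, by omega,
      fun w o h => by simpa using h, by omega⟩ ?_ ?_ ?_
  · rintro s' t' ⟨u, D, k, n', -, -, -, -, -, -, hkn, -, -, ht⟩; omega
  · rintro s' t' ⟨u, D, k, n', hu, hvu, hD, hk, hd, hrun, hkn, hsz, hrep, ht⟩ hF hpos
    have hC' : Consts I inp s' := Consts.frame
      ⟨by simp [hC.zero], by simp [hC.one], by simp [hC.two], by simp [hC.base],
        by simp [hC.r], by simp [hC.nb], by simp [hC.inp]⟩ hF rfl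
    have hE' : Edges I s' := Edges.frame (by simpa [Edges] using hE) hF rfl
    have hdn : s'.arr a_dn = s.arr a_dn := (hF.arr _ rfl).trans (by simp)
    cases hrun with
    | done _ h => rw [hd, h] at hpos; omega
    | step _ p k' hne hp hk' =>
      have hm : p ∈ I.E u := by simp [hp]
      obtain ⟨hin, had, hof⟩ := hV.inp_edge hm
      obtain ⟨hur, hpn, -, hsp⟩ := hV.E_single hm
      have hszb := hV.sz_bd _ hpn
      have hdp := hd01 p.1
      refine part_seq (hV.step hK hS hC' hE' hvu hp) fun s₁ t₁ hF₁ ⟨ht₁, he₁, ho₁⟩ => ?_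
      have e1 := (hF₁.var v_D rfl).trans hD
      have e2 := (hF₁.var v_k rfl).trans hk
      have e3 := (hF₁.var v_one rfl).trans hC'.one
      have hE₁ := hE'.frame hF₁ rfl
      have hdn₁ : s₁.arr a_dn = s.arr a_dn := (hF₁.arr _ rfl).trans hdn
      refine add_seq hK (D + I.ofs p.1 p.2 : ℕ) (by simp [e1, ho₁]) (by omega) ?_
      refine load_seq (I.adr p) p.1 (by simp [he₁]) (by omega) (by simp [hE₁.own hm]) ?_
      refine add_seq hK (k + 1 : ℕ) (by simp [e2, e3]) (by omega) ?_
      refine load_seq p.1 (s.arr a_dn p.1) (by simp) (by omega) (by simp [hdn₁]) ?_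
      refine sub_last hK (1 - s.arr a_dn p.1) (by simp [e3]) (by omega) ?_
      refine ⟨p.1, D + I.ofs p.1 p.2, k + 1, k', hpn, by simp, by simp, by simp, by simp, hk',
        by omega, by omega, fun w o h => ?_, by omega⟩
      rw [add_assoc]
      exact hrep _ _ (.step _ _ _ _ hp h)
  · rintro s' t' ⟨u, D, k, n', hu, hvu, hD, hk, hd, hrun, hkn, hsz, hrep, ht⟩ hF hpos
    cases hrun with
    | done _ h => exact ⟨by omega, by simp [hk]; omega, u, D, hu, hvu, hD, h, hsz, hrep⟩
    | step _ p k' hne hp hk' =>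
      rcases hR.bool u with h | h
      · rw [hd, h] at hpos; omega
      · exact absurd h hne

/-- The number of nodes that are not marked. -/
def unmarked (I : Inst) (dn : ℕ → ℤ) : ℕ := ((Finset.range I.nb).filter fun w => dn w ≠ 1).card

theorem unmarked_update {dn : ℕ → ℤ} {v : ℕ} (hv : v < I.nb) (hd : dn v ≠ 1) :
    unmarked I (Function.update dn v 1) + 1 = unmarked I dn := by
  have : (Finset.range I.nb).filter (fun w => Function.update dn v 1 w ≠ 1) =
      ((Finset.range I.nb).filter fun w => dn w ≠ 1).erase v := by
    ext w
    by_cases h : w = v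
    · simp [h]
    · simp [h]
  rw [unmarked, this, Finset.card_erase_add_one (by simp [hv, hd]), unmarked]

/-- The second climb takes time proportional to the number of nodes that it marks; `unmarked` is the
potential that pays for it, and for the first climb. -/
theorem Valid.climbMark (hV : Valid I inp N rank sz good)
    (hK : ((8 * N + 16 : ℕ) : ℤ) ≤ 2 ^ W)
    (hS : I.st I.nb + 7 * I.nL ≤ S) (hC : Consts I inp s) (hE : Edges I s)
    (hR : Reps I (s.arr a_rp) (s.arr a_ro) (s.arr a_dn) I.nb) {v n : ℕ} (hv : v < I.nb)
    (hvb : s.var v_b = v) (hn : Run I (s.arr a_dn) v n) {u D : ℕ} (hu : u < I.nb)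
    (hvu : s.var v_u = u) (hvD : s.var v_D = D) (hvk : s.var v_k = n) (hdu : s.arr a_dn u = 1)
    (hsz : sz v + D ≤ sz u) (hrep : ∀ w o, Rep I u w o → Rep I v w (D + o)) :
    wp W S climbMark s t fun s' t' => t' ≤ t + 5 + 10 * n ∧
      Reps I (s'.arr a_rp) (s'.arr a_ro) (s'.arr a_dn) I.nb ∧ s'.arr a_dn v = 1 ∧
      (∀ w, s.arr a_dn w = 1 → s'.arr a_dn w = 1) ∧
      unmarked I (s'.arr a_dn) + n = unmarked I (s.arr a_dn) := by
  have h1 := hV.size_bd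
  have hnb := I.le_st I.nb
  have hnle : n ≤ N := by
    refine (hV.run_le hn hv).trans ((Finset.card_filter_le _ _).trans ?_)
    simp; omega
  obtain ⟨x, o, hxo, hx, ho⟩ := hR.rep u hdu
  obtain ⟨hxn, hxs⟩ := (hV.rep_bd hxo).1 hu
  have hxN := hV.sz_bd x hxn
  have hvx := hrep _ _ hxo
  refine load_seq u x hvu (by omega) hx ?_
  refine load_seq u o (by simp [hvu]) (by omega) (by simp [ho]) ?_
  refine add_seq hK (D + o : ℕ) (by simp [hvD]) (by omega) ?_
  refine add_seq hK v (by simp [hvb, hC.zero]) (by omega) ?_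
  refine wp_while (fun s' t' => ∃ w k o, w < I.nb ∧ s'.var v_u = w ∧ s'.var v_D = (o : ℕ) ∧
      s'.var v_k = (k : ℕ) ∧ Run I (s'.arr a_dn) w k ∧ Rep I w x o ∧
      Reps I (s'.arr a_rp) (s'.arr a_ro) (s'.arr a_dn) I.nb ∧
      (∀ w, s.arr a_dn w = 1 → s'.arr a_dn w = 1) ∧ (w = v ∨ s'.arr a_dn v = 1) ∧
      unmarked I (s'.arr a_dn) + n = unmarked I (s.arr a_dn) + k ∧ k ≤ n ∧
      t' + 10 * k ≤ t + 4 + 10 * n) (t + 4 + 10 * n)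
    ⟨v, n, D + o, hv, by simp, by simp, by simp [hvk], by simpa using hn, hvx, by simpa using hR,
      by simp, by simp, by simp, le_rfl, by omega⟩ ?_ ?_ ?_
  · rintro s' t' ⟨w, k, o, -, -, -, -, -, -, -, -, -, -, -, ht⟩; omega
  · rintro s' t' ⟨w, k, o, hw, hvw, hD, hk, hrun, hwx, hR', hmono, hvd, hun, hkn, ht⟩ hF hpos
    have hC' : Consts I inp s' := Consts.frame
      ⟨by simp [hC.zero], by simp [hC.one], by simp [hC.two], by simp [hC.base],
        by simp [hC.r], by simp [hC.nb], by simp [hC.inp]⟩ hF rfl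
    have hE' : Edges I s' := Edges.frame (by simpa [Edges] using hE) hF rfl
    have hx' : s'.var v_x = x := (hF.var _ rfl).trans (by simp)
    cases hrun with
    | done _ h => simp [hk] at hpos
    | step _ p k' hne hp hk' =>
      have hm : p ∈ I.E w := by simp [hp]
      obtain ⟨hin, had, hof⟩ := hV.inp_edge hm
      obtain ⟨hur, hpn, hrk, hsp⟩ := hV.E_single hm
      refine store_seq w x hvw (by omega) hx' ?_
      refine store_seq w o hvw (by omega) (by simp [hD]) ?_
      refine store_seq w 1 hvw (by omega) (by simp [hC'.one]) ?_
      obtain ⟨o', hxo', ho'⟩ : ∃ o', Rep I p.1 x o' ∧ o = I.ofs p.1 p.2 + o' := by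
        cases hwx with
        | root _ h => exact absurd (by rw [hp]; rfl) h
        | step _ p' _ o' h' k' =>
          obtain rfl : p = p' := by simpa [hp] using h'
          exact ⟨o', k', rfl⟩
      have hso := ((hV.rep_bd hxo').1 hpn).2
      refine part_seq (hV.step hK hS ⟨by simp [hC'.zero], by simp [hC'.one], by simp [hC'.two],
        by simp [hC'.base], by simp [hC'.r], by simp [hC'.nb], by simp [hC'.inp]⟩
        (by simpa [Edges] using hE') (by simp [hvw]) hp) fun s₁ t₁ hF₁ ⟨ht₁, he₁, hof₁⟩ => ?_
      have e1 := hF₁.var v_D rfl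
      have e2 := hF₁.var v_k rfl
      have e3 := hF₁.var v_one rfl
      have e4 := hF₁.arr a_dn rfl
      have e5 := hF₁.arr a_rp rfl
      have e6 := hF₁.arr a_ro rfl
      have e7 := hF₁.arr a_ow rfl
      simp [hC'.one, hD, hk] at e1 e2 e3 e4 e5 e6 e7
      refine sub_seq hK o' (by simp [e1, hof₁, ho']) (by omega) ?_
      refine load_seq (I.adr p) p.1 (by simp [he₁]) (by omega) (by simp [e7, hE'.own hm]) ?_
      refine sub_last hK k' (by simp [e2, e3]) (by omega) ?_
      have hU := unmarked_update hw hne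
      refine ⟨p.1, k', o', hpn, by simp, by simp, by simp, ?_, hxo', ?_, ?_, ?_, ?_, by omega,
        by omega⟩
      · simpa [e4] using hV.run_update hk' hrk
      · simp only [State.set_arr, e4, e5, e6]
        refine ⟨fun z => ?_, fun z => ?_, fun z hz hr' => ?_⟩ <;> by_cases h : z = w
        · simp [h]
        · rw [Function.update_of_ne h]; exact hR'.bool z
        · subst h; intro _; exact ⟨x, o, hwx, by simp, by simp⟩
        · rw [Function.update_of_ne h, Function.update_of_ne h, Function.update_of_ne h]
          exact hR'.rep z
        · simp [h]
        · rw [Function.update_of_ne h]; exact hR'.root z hz hr'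
      · intro z hz
        simp only [State.set_arr, e4]
        by_cases h : z = w
        · simp [h]
        · rw [Function.update_of_ne h]; exact hmono z hz
      · right
        simp only [State.set_arr, e4]
        by_cases h : v = w
        · simp [h]
        · rw [Function.update_of_ne h]; exact hvd.resolve_left (Ne.symm h)
      · simp only [State.set_arr, e4]; omega
  · rintro s' t' ⟨w, k, o, hw, hvw, hD, hk, hrun, hwx, hR', hmono, hvd, hun, hkn, ht⟩ hF hpos
    obtain rfl : k = 0 := by omega
    cases hrun with
    | done _ h => exact ⟨by omega, hR', by rcases hvd with rfl | h' <;> assumption, hmono,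
        by omega⟩

/-- All representatives are found in linear time, since no node is marked twice. -/
theorem Valid.contract (hV : Valid I inp N rank sz good)
    (hK : ((8 * N + 16 : ℕ) : ℤ) ≤ 2 ^ W)
    (hS : I.st I.nb + 7 * I.nL ≤ S) (hC : Consts I inp s) (hE : Edges I s)
    (hR : Reps I (s.arr a_rp) (s.arr a_ro) (s.arr a_dn) 0) :
    wp W S contract s t fun s' t' => t' ≤ t + 60 * I.nb + 10 ∧
      ∀ v < I.nb, ∃ u o : ℕ, Rep I v u o ∧ s'.arr a_rp v = u ∧ s'.arr a_ro v = o := by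
  have h1 := hV.size_bd
  have hnb := I.le_st I.nb
  refine part_seq (hV.markRoots hK hS hC hE hR) fun s₀ t₀ hF₀ ⟨ht₀, hR₀⟩ => ?_
  have hC₀ := hC.frame hF₀ rfl
  have hE₀ := hE.frame hF₀ rfl
  refine const_seq hK (by omega) ?_
  refine sub_seq hK I.nb (by simp [hC₀.nb]) (by omega) ?_
  refine wp_while (fun s' t' => ∃ b ≤ I.nb, s'.var v_b = b ∧
    s'.var v_c = I.nb - b ∧ t' + 20 * unmarked I (s'.arr a_dn) ≤ t + 40 * I.nb + 8 + 20 * b ∧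
    Reps I (s'.arr a_rp) (s'.arr a_ro) (s'.arr a_dn) I.nb ∧ ∀ v < b, s'.arr a_dn v = 1)
    (t + 60 * I.nb + 8) ⟨0, by omega, by simp, by simp, ?_, by simpa using hR₀, by simp⟩ ?_ ?_ ?_
  · have : unmarked I (s₀.arr a_dn) ≤ I.nb := (Finset.card_filter_le _ _).trans (by simp)
    simp; omega
  · rintro s' t' ⟨b, hb, -, -, ht, -⟩; omega
  · rintro s' t' ⟨b, hb, hvb, hc, ht, hR', hdone⟩ hF hpos
    have hC' : Consts I inp s' := Consts.frame
      ⟨by simp [hC₀.zero], by simp [hC₀.one], by simp [hC₀.two], by simp [hC₀.base],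
        by simp [hC₀.r], by simp [hC₀.nb], by simp [hC₀.inp]⟩ hF rfl
    have hE' : Edges I s' := Edges.frame (by simpa [Edges] using hE₀) hF rfl
    have hb' : b < I.nb := by omega
    obtain ⟨n, hn⟩ := hV.exists_run hR'.root hb'
    refine part_seq (hV.climbUp hK hS hC' hE' hR' hb' hvb hn) fun s₁ t₁ hF₁
      ⟨ht₁, hk₁, u, D, hu, hvu, hvD, hdu, hsz, hrep⟩ => ?_
    have e1 := hF₁.arr a_dn rfl
    have e2 := hF₁.arr a_rp rfl
    have e3 := hF₁.arr a_ro rfl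
    refine part_seq (hV.climbMark hK hS (hC'.frame hF₁ rfl) (hE'.frame hF₁ rfl)
      (by rw [e1, e2, e3]; exact hR') hb' ((hF₁.var _ rfl).trans hvb) (by rw [e1]; exact hn) hu hvu
      hvD hk₁ (by rw [e1]; exact hdu) hsz hrep) fun s₂ t₂ hF₂ ⟨ht₂, hR₂, hd₂, hm₂, hun₂⟩ => ?_
    have f1 := (hF₂.var v_b rfl).trans ((hF₁.var _ rfl).trans hvb)
    have f2 := (hF₂.var v_one rfl).trans ((hF₁.var _ rfl).trans hC'.one)
    have f3 := (hF₂.var v_nb rfl).trans ((hF₁.var _ rfl).trans hC'.nb)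
    rw [e1] at hun₂ hm₂
    refine add_seq hK (b + 1 : ℕ) (by simp [f1, f2]) (by omega) ?_
    refine sub_last hK (I.nb - (b + 1 : ℕ)) (by simp [f3]) (by omega) ?_
    refine ⟨b + 1, by omega, by simp, by simp, by simp; omega, by simpa using hR₂, fun v hv => ?_⟩
    simp only [State.set_arr]
    rcases Nat.lt_succ_iff_lt_or_eq.1 hv with h | rfl
    · exact hm₂ _ (hdone _ h)
    · exact hd₂
  · rintro s' t' ⟨b, hb, hvb, hc, ht, hR', hdone⟩ hF hpos
    obtain rfl : b = I.nb := by omega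
    exact ⟨by omega, fun v hv => hR'.rep v (hdone v hv)⟩

end Verify

/-! ### Enumerating the climbs from a place -/

/-- `P v o` lists the places `(x, a)` in the strings at which the offset `o` relative to the
expansion of right-hand side `v` lies. -/
structure Paths (I : Inst) (P : ℕ → ℤ → List (ℕ × ℤ)) : Prop where
  text : ∀ v o, I.r ≤ v → P v o = [(v - I.r, o)]
  rule : ∀ v o, v < I.r → P v o = (I.E v).flatMap fun p => P p.1 (o + I.ofs p.1 p.2)

/-- What the first phases of the program establish. -/
structure Ready (I : Inst) (inp : ℕ → ℤ) (s : State 32 12) : Prop where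
  consts : Consts I inp s
  edges : Edges I s
  reps : ∀ v < I.nb, ∃ u o : ℕ, Rep I v u o ∧ s.arr a_rp v = u ∧ s.arr a_ro v = o

/-- The entries of the stack: the node branches or is a string, and the offset is in range. -/
structure Pending (I : Inst) (N : ℕ) (sz : ℕ → ℕ) (good : ℕ → Prop) (p : ℕ × ℤ) : Prop where
  lt : p.1 < I.nb
  good : good p.1
  branch : (I.E p.1).length ≠ 1
  le : -(N : ℤ) ≤ p.2
  le' : p.2 ≤ N + sz p.1

section Verify

variable {I : Inst} {inp : ℕ → ℤ} {N : ℕ} {rank sz : ℕ → ℕ} {good : ℕ → Prop} {W S : ℕ}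
  {s : State 32 12} {t : ℕ} {P : ℕ → ℤ → List (ℕ × ℤ)}

theorem Ready.frame {c : Cmd 32 12} {s' : State 32 12} (h : Ready I inp s) (k : Frame c s s')
    (hc : (c.writes v_zero || c.writes v_one || c.writes v_two || c.writes v_base ||
      c.writes v_r || c.writes v_nb || c.stores a_inp) = false)
    (hc' : (c.stores a_hd || c.stores a_nx || c.stores a_ow || c.stores a_ct) = false)
    (hc'' : (c.stores a_rp || c.stores a_ro) = false) : Ready I inp s' := by
  simp only [Bool.or_eq_false_iff] at hc''
  refine ⟨h.consts.frame k hc, h.edges.frame k hc', ?_⟩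
  rw [k.arr _ hc''.1, k.arr _ hc''.2]
  exact h.reps

theorem Ready.set (h : Ready I inp s) {x : Fin 32} (z : ℤ)
    (hx : (decide (x = v_zero) || decide (x = v_one) || decide (x = v_two) || decide (x = v_base) ||
      decide (x = v_r) || decide (x = v_nb)) = false) : Ready I inp (s.set x z) := by
  have : Frame (.const x z : Cmd 32 12) s (s.set x z) :=
    ⟨fun y hy => by simp [Cmd.writes] at hy; simp [Ne.symm hy], by simp, by simp⟩
  refine h.frame this ?_ rfl rfl
  simpa [Cmd.writes, Cmd.stores] using hx

/-- Skipping the nodes with a single parent does not change where the climbs end. -/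
theorem Paths.rep (hP : Paths I P) (hV : Valid I inp N rank sz good) {v u a : ℕ} (h : Rep I v u a)
    (o : ℤ) : P v o = P u (o + a) := by
  induction h generalizing o with
  | root => simp
  | step v p u a h _ ih =>
    have := hV.E_single (by simp [h] : p ∈ I.E v)
    rw [hP.rule v o this.1, h]
    simp only [List.flatMap_cons, List.flatMap_nil, List.append_nil]
    rw [ih]; push_cast; congr 1; ring

/-- From a good place there is a climb: every climb can be continued until it reaches a string. -/
theorem Paths.pos (hP : Paths I P) (hV : Valid I inp N rank sz good) {v : ℕ} (hv : good v) (o : ℤ) :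
    1 ≤ (P v o).length := by
  revert hv o
  refine hV.induct (P := fun v => good v → ∀ o, 1 ≤ (P v o).length) (fun v ih hv o => ?_) v
  by_cases h : v < I.r
  · rw [hP.rule v o h]
    obtain ⟨p, l, hpl⟩ := List.exists_cons_of_ne_nil (hV.E_ne v h hv)
    have hp : p ∈ I.E v := by simp [hpl]
    have := ih p hp (hV.good_E v hv p hp) (o + I.ofs p.1 p.2)
    rw [hpl, List.flatMap_cons, List.length_append]
    omega
  · rw [hP.text v o (by omega)]; simp

/-- Every entry of the stack will yield an end of a climb, so that the stack is not higher than the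
number of these ends. -/
theorem Paths.length_le (hP : Paths I P) (hV : Valid I inp N rank sz good) :
    ∀ l : List (ℕ × ℤ), (∀ p ∈ l, Pending I N sz good p) →
      l.length ≤ (l.flatMap fun p => P p.1 p.2).length
  | [], _ => by simp
  | p :: l, h => by
    have h1 := hP.pos hV (h p (by simp)).good p.2
    have h2 := hP.length_le hV l fun q hq => h q (by simp [hq])
    rw [List.flatMap_cons, List.length_append, List.length_cons]
    omega

/-- What is pushed is the representative, which has the same climbs and branches or is a string. -/
theorem Valid.push (hV : Valid I inp N rank sz good)
    (hK : ((8 * N + 16 : ℕ) : ℤ) ≤ 2 ^ W) (hS : I.st I.nb + 7 * I.nL ≤ S) (hSN : S ≤ N)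
    (hR : Ready I inp s) (hP : Paths I P) {l : List (ℕ × ℤ)} {v : ℕ} {o : ℤ} (hv : v < I.nb)
    (hg : good v) (ho : -(N : ℤ) ≤ o) (ho' : o ≤ N + sz v) (hvu : s.var v_u = v)
    (hvo : s.var v_o = o) (hsp : s.var v_sp = l.length) (hlS : l.length < S)
    (hst : Stored (s.arr a_sB) (s.arr a_sO) l) :
    wp W S push s t fun s' t' => t' = t + 6 ∧ ∃ p : ℕ × ℤ, Pending I N sz good p ∧
      P p.1 p.2 = P v o ∧ Stored (s'.arr a_sB) (s'.arr a_sO) (p :: l) ∧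
      s'.var v_sp = (p :: l).length := by
  have h1 := hV.size_bd
  have hnb := I.le_st I.nb
  obtain ⟨u, a, hrep, hru, hra⟩ := hR.reps v hv
  obtain ⟨hbd, hgd⟩ := hV.rep_bd hrep
  obtain ⟨hu, hsz⟩ := hbd hv
  have hsu := hV.sz_bd u hu
  refine load_seq v a hvu (by omega) hra ?_
  refine add_seq hK (o + a) (by simp [hvo]) (by omega) ?_
  refine load_seq v u (by simp [hvu]) (by omega) (by simp [hru]) ?_
  refine store_seq l.length u (by simp [hsp]) hlS (by simp) ?_
  refine store_seq l.length (o + a) (by simp [hsp]) hlS (by simp) ?_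
  refine add_last hK (l.length + 1 : ℕ) (by simp [hsp, hR.consts.one]) (by omega)
    ⟨by omega, (u, o + a), ⟨hu, hgd hg, hrep.not_single, by simp; omega, by simp; omega⟩,
      (hP.rep hV hrep o).symm, ?_, by simp⟩
  simpa using hst.push (u, o + a)

theorem Valid.pushParents (hV : Valid I inp N rank sz good)
    (hK : ((8 * N + 16 : ℕ) : ℤ) ≤ 2 ^ W) (hS : I.st I.nb + 7 * I.nL ≤ S) (hSN : S ≤ N)
    (hR : Ready I inp s) (hP : Paths I P) {l : List (ℕ × ℤ)} {v : ℕ} {o : ℤ}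
    (hg : good v) (ho : -(N : ℤ) ≤ o) (ho' : o ≤ N + sz v)
    (hve : s.var v_e = s.arr a_hd v)
    (hvg : s.var v_g = o) (hsp : s.var v_sp = l.length) (hlS : l.length + (I.E v).length ≤ S)
    (hl : ∀ p ∈ l, Pending I N sz good p) (hst : Stored (s.arr a_sB) (s.arr a_sO) l) :
    wp W S pushParents s t fun s' t' => t' ≤ t + 15 * (I.E v).length + 1 ∧ ∃ l' : List (ℕ × ℤ),
      (∀ p ∈ l', Pending I N sz good p) ∧ l'.length = l.length + (I.E v).length ∧
      ((l'.flatMap fun p => P p.1 p.2).Perm ((l.flatMap fun p => P p.1 p.2) ++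
        (I.E v).flatMap fun p => P p.1 (o + I.ofs p.1 p.2))) ∧
      Stored (s'.arr a_sB) (s'.arr a_sO) l' ∧ s'.var v_sp = l'.length := by
  have h1 := hV.size_bd
  have hnb := I.le_st I.nb
  refine wp_while (fun s' t' => ∃ (l' : List (ℕ × ℤ)) (D R : List (ℕ × ℕ)), I.E v = D ++ R ∧
      Chain (s.arr a_nx) (s'.var v_e) (R.map I.adr) ∧
      (∀ p ∈ l', Pending I N sz good p) ∧ l'.length = l.length + D.length ∧
      ((l'.flatMap fun p => P p.1 p.2).Perm ((l.flatMap fun p => P p.1 p.2) ++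
        D.flatMap fun p => P p.1 (o + I.ofs p.1 p.2))) ∧
      Stored (s'.arr a_sB) (s'.arr a_sO) l' ∧ s'.var v_sp = l'.length ∧
      t' ≤ t + 15 * D.length) (t + 15 * (I.E v).length)
    ⟨l, [], I.E v, rfl, by rw [hve]; exact hR.edges.chain v, hl, by simp, by simp, hst, hsp,
      by simp⟩ ?_ ?_ ?_
  · rintro s' t' ⟨l', D, R, hDR, -, -, -, -, -, -, ht⟩
    rw [hDR, List.length_append]; omega
  · rintro s' t' ⟨l', D, R, hDR, hch, hl', hlen, hperm, hst', hsp', ht⟩ hF hpos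
    have hR' := hR.frame hF rfl rfl rfl
    cases R with
    | nil => simp only [List.map_nil, Chain] at hch; omega
    | cons p R =>
      have hm : p ∈ I.E v := by simp [hDR]
      obtain ⟨hin, had, hof⟩ := hV.inp_edge hm
      obtain ⟨hur, hpn, -, hsp2⟩ := hV.E_single hm
      have hszb := hV.sz_bd _ hpn
      have hnx : s'.arr a_nx = s.arr a_nx := hF.arr _ rfl
      obtain ⟨hc1, hc2, hc3⟩ := hch
      rw [hDR] at hlS ⊢
      simp only [List.length_append, List.length_cons] at hlS ⊢
      refine load_seq (I.adr p) p.1 hc1 (by omega) (hR'.edges.own hm) ?_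
      refine add_seq hK (I.adr p + 1 : ℕ) (by simp [hc1, hR'.consts.one]) (by omega) ?_
      refine load_seq (I.adr p + 1) (I.ofs p.1 p.2) (by simp) (by omega)
        (by simp [hR'.consts.inp, hin]) ?_
      have hvg' := (hF.var v_g rfl).trans hvg
      refine add_seq hK (o + I.ofs p.1 p.2) (by simp [hvg']) (by omega) ?_
      refine part_seq (hV.push (l := l') (v := p.1) (o := o + I.ofs p.1 p.2) hK hS hSN
        ((((hR'.set _ rfl).set _ rfl).set _ rfl).set _ rfl) hP hpn (hV.good_E v hg p hm)
        (by omega) (by omega) (by simp) (by simp) (by simp [hsp']) (by omega)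
        (by simpa using hst')) fun s₁ t₁ hF₁ ⟨ht₁, x, hx, hPx, hst₁, hsp₁⟩ => ?_
      have e1 := hF₁.var v_e rfl
      have e2 := hF₁.arr a_nx rfl
      simp [hc1, hnx] at e1 e2
      refine load_last (I.adr p) (s.arr a_nx (I.adr p)) e1 (by omega) (by rw [e2]) ?_
      refine ⟨x :: l', D ++ [p], R, by simp, by simpa using hc3, ?_, by simp; omega, ?_,
        by simpa using hst₁, by simpa using hsp₁, by simp; omega⟩
      · intro q hq
        rcases List.mem_cons.1 hq with rfl | hq
        · exact hx
        · exact hl' q hq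
      · simp only [List.flatMap_cons, List.flatMap_append, List.flatMap_nil, List.append_nil, hPx]
        rw [← List.append_assoc]
        exact List.perm_append_comm.trans (hperm.append_right _)
  · rintro s' t' ⟨l', D, R, hDR, hch, hl', hlen, hperm, hst', hsp', ht⟩ hF hpos
    cases R with
    | nil =>
      obtain rfl : D = I.E v := by simpa using hDR.symm
      exact ⟨by omega, l', hl', hlen, hperm, hst', hsp'⟩
    | cons p R => exact absurd hch.2.1 (by have := hch.1; omega)

/-- All climbs from the stack are found in time proportional to their number: an entry that is popped
is a string, or it is replaced by at least two entries, each of which yields an end of a climb. -/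
theorem Valid.climb (hV : Valid I inp N rank sz good)
    (hK : ((8 * N + 16 : ℕ) : ℤ) ≤ 2 ^ W) (hS : I.st I.nb + 7 * I.nL ≤ S) (hSN : S ≤ N)
    (hR : Ready I inp s) (hP : Paths I P) {l₀ r₀ : List (ℕ × ℤ)}
    (hsp : s.var v_sp = l₀.length) (hl₀ : ∀ p ∈ l₀, Pending I N sz good p)
    (hst : Stored (s.arr a_sB) (s.arr a_sO) l₀) (hrc : s.var v_rc = r₀.length)
    (hr₀ : Stored (s.arr a_tT) (s.arr a_tO) r₀)
    (hlS : r₀.length + (l₀.flatMap fun p => P p.1 p.2).length ≤ S) :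
    wp W S climb s t fun s' t' =>
      t' ≤ t + 120 * (l₀.flatMap fun p => P p.1 p.2).length + 1 ∧
      ∃ r' : List (ℕ × ℤ), r'.Perm (l₀.flatMap fun p => P p.1 p.2) ∧
        Stored (s'.arr a_tT) (s'.arr a_tO) (r' ++ r₀) ∧ s'.var v_rc = (r' ++ r₀).length := by
  have h1 := hV.size_bd
  have hnb := I.le_st I.nb
  have hlen₀ := hP.length_le hV l₀ hl₀
  -- The elapsed time is paid with 120 units for each end found and 60 units for each new entry of the
  -- stack. Popping an entry with `k ≥ 2` parents pays `60 * (k - 1) ≥ 30 * k` units.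
  refine wp_while (fun s' t' => ∃ l r' : List (ℕ × ℤ), (∀ p ∈ l, Pending I N sz good p) ∧
      (r' ++ l.flatMap fun p => P p.1 p.2).Perm (l₀.flatMap fun p => P p.1 p.2) ∧
      Stored (s'.arr a_sB) (s'.arr a_sO) l ∧ s'.var v_sp = l.length ∧
      Stored (s'.arr a_tT) (s'.arr a_tO) (r' ++ r₀) ∧ s'.var v_rc = (r' ++ r₀).length ∧
      t' + 120 * (l.flatMap fun p => P p.1 p.2).length ≤
        t + 120 * (l₀.flatMap fun p => P p.1 p.2).length + 60 * l.length)
    (t + 120 * (l₀.flatMap fun p => P p.1 p.2).length)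
    ⟨l₀, [], hl₀, by simp, hst, hsp, hr₀, hrc, by omega⟩ ?_ ?_ ?_
  · rintro s' t' ⟨l, r', hl, -, -, -, -, -, ht⟩
    have := hP.length_le hV l hl
    omega
  · rintro s' t' ⟨l, r', hl, hperm, hst', hsp', hr', hrc', ht⟩ hF hpos
    have hR' := hR.frame hF rfl rfl rfl
    cases l with
    | nil => simp [hsp'] at hpos
    | cons p l =>
      obtain ⟨hpn, hpg, hpb, hpl, hpl'⟩ := hl p (by simp)
      have hl2 : ∀ q ∈ l, Pending I N sz good q := fun q hq => hl q (by simp [hq])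
      have hszb := hV.sz_bd _ hpn
      have hlenle := hP.length_le hV _ hl
      have hplen := hperm.length_eq
      have hllen := hP.length_le hV l hl2
      simp only [List.length_append, List.flatMap_cons, List.length_cons] at hlenle hplen ht
      obtain ⟨hs1, hs2, hs3⟩ := hst'
      have hnbr : I.nb = I.r + I.m := rfl
      refine sub_seq hK l.length (by simp [hsp', hR'.consts.one]) (by omega) ?_
      refine load_seq l.length p.1 (by simp) (by omega) (by simpa using hs1) ?_
      refine load_seq l.length p.2 (by simp) (by omega) (by simpa using hs2) ?_
      refine sub_seq hK (p.1 - I.r) (by simp [hR'.consts.r]) (by omega) ?_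
      refine add_seq hK (p.1 - I.r + 1) (by simp [hR'.consts.one]) (by omega) ?_
      refine wp_if (fun hp => ?_) (fun hp => ?_) <;> simp at hp
      · have hrp : I.r ≤ p.1 := by omega
        rw [hP.text _ _ hrp, List.length_singleton] at hplen ht
        simp only [List.length_append] at hrc'
        refine store_seq (r' ++ r₀).length (p.1 - I.r) (by simp [hrc'])
          (by rw [List.length_append]; omega) (by simp) ?_
        refine store_seq (r' ++ r₀).length p.2 (by simp [hrc'])
          (by rw [List.length_append]; omega) (by simp) ?_
        refine add_last hK (r'.length + r₀.length + 1 : ℕ) (by simp [hR'.consts.one, hrc'])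
          (by omega) ?_
        refine ⟨l, (p.1 - I.r, p.2) :: r', hl2, ?_, by simpa using hs3, by simp, ?_,
          by simp, by omega⟩
        · refine List.Perm.trans ?_ hperm
          rw [List.flatMap_cons, hP.text _ _ hrp, List.singleton_append, List.cons_append]
          exact List.perm_middle.symm
        · have := hr'.push (p.1 - I.r, p.2)
          simpa [Nat.cast_sub hrp] using this
      · have hpr : p.1 < I.r := by omega
        have hk2 : 2 ≤ (I.E p.1).length := by
          have := List.length_pos_of_ne_nil (hV.E_ne p.1 hpr hpg)
          omega
        have hPp := hP.rule p.1 p.2 hpr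
        have hEl : (I.E p.1).length ≤ (P p.1 p.2).length := by
          rw [hPp]
          have H : ∀ E : List (ℕ × ℕ), (∀ q ∈ E, good q.1) →
              E.length ≤ (E.flatMap fun q => P q.1 (p.2 + I.ofs q.1 q.2)).length := by
            intro E hE
            induction E with
            | nil => simp
            | cons q E ih =>
              have h2 := hP.pos hV (hE q (by simp)) (p.2 + I.ofs q.1 q.2)
              have h3 := ih fun q hq => hE q (by simp [hq])
              rw [List.flatMap_cons, List.length_append, List.length_cons]
              omega
          exact H _ fun q hq => hV.good_E _ hpg q hq
        refine load_seq p.1 (s'.arr a_hd p.1) (by simp) (by omega) (by simp) ?_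
        refine wp_conseq (hV.pushParents (l := l) (v := p.1) (o := p.2) hK hS hSN
          ((((((hR'.set _ rfl).set _ rfl).set _ rfl).set _ rfl).set _ rfl).set _ rfl) hP hpg hpl
          hpl' (by simp) (by simp) (by simp) (by omega) hl2 (by simpa using hs3))
          fun s₁ t₁ hF₁ ⟨ht₁, l', hl', hlen', hperm', hst₁, hsp₁⟩ => ?_
        have e1 := hF₁.arr a_tT rfl
        have e2 := hF₁.arr a_tO rfl
        have e3 := hF₁.var v_rc rfl
        simp [hrc'] at e1 e2 e3
        have hpl2 := hperm'.length_eq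
        rw [← hPp] at hperm' hpl2
        rw [List.length_append] at hpl2
        refine ⟨l', r', hl', ?_, hst₁, hsp₁, by rw [e1, e2]; exact hr', by simp [e3], by omega⟩
        refine List.Perm.trans ?_ hperm
        rw [List.flatMap_cons]
        exact (hperm'.trans List.perm_append_comm).append_left _
  · rintro s' t' ⟨l, r', hl, hperm, hst', hsp', hr', hrc', ht⟩ hF hpos
    obtain rfl : l = [] := List.length_eq_zero_iff.1 (by omega)
    exact ⟨by simp only [List.flatMap_nil, List.length_nil] at ht; omega, r', by simpa using hperm, hr', hrc'⟩

end Verify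

/-! ### Pairing the climbs, and the whole program -/

/-- The report of all pairs of a place in `A` with a place in `B`. -/
def pairs (A B : List (ℕ × ℤ)) (l : ℕ) : List ℤ :=
  A.flatMap fun p => B.flatMap fun q => [(p.1 : ℤ), (q.1 : ℤ), p.2, q.2, (l : ℤ)]

/-- The possible outputs for the first `i` tuples: the order in which the places of a node are
found is left open. -/
def Outs (I : Inst) (P : ℕ → ℤ → List (ℕ × ℤ)) : ℕ → List ℤ → Prop
  | 0, o => o = []
  | i + 1, o => ∃ o' A B, Outs I P i o' ∧ A.Perm (P (I.X i) (I.oX i)) ∧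
      B.Perm (P (I.Y i) (I.oY i)) ∧ o = o' ++ pairs A B (I.tl i)

theorem Stored.append_right {A B : ℕ → ℤ} : ∀ {l₁ l₂ : List (ℕ × ℤ)}, Stored A B (l₁ ++ l₂) →
    Stored A B l₂
  | [], _, h => h
  | _ :: _, _, h => Stored.append_right h.2.2

section Verify

variable {I : Inst} {inp : ℕ → ℤ} {N : ℕ} {rank sz : ℕ → ℕ} {good : ℕ → Prop} {W S : ℕ}
  {s : State 32 12} {t : ℕ} {P : ℕ → ℤ → List (ℕ × ℤ)}

theorem Valid.expand (hV : Valid I inp N rank sz good)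
    (hK : ((8 * N + 16 : ℕ) : ℤ) ≤ 2 ^ W) (hS : I.st I.nb + 7 * I.nL ≤ S) (hSN : S ≤ N)
    (hR : Ready I inp s) (hP : Paths I P) {r₀ : List (ℕ × ℤ)} {p q v : ℕ} {o : ℤ}
    (hp : s.var v_pos = p) (hpS : p + 1 < S) (hq : s.var v_q = q) (hqS : q < S)
    (hv : v < I.nb) (hg : good v) (hinq : inp q = o) (ho : |o| ≤ N)
    (hin : 0 < inp p ∧ inp (p + 1) + I.r = v ∨ ¬ 0 < inp p ∧ inp (p + 1) = v + (2 + I.sig))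
    (hrc : s.var v_rc = r₀.length) (hr₀ : Stored (s.arr a_tT) (s.arr a_tO) r₀)
    (hlS : r₀.length + (P v o).length ≤ S) :
    wp W S expand s t fun s' t' => t' ≤ t + 120 * (P v o).length + 16 ∧
      s'.var v_pos = p + 2 ∧
      ∃ r' : List (ℕ × ℤ), r'.Perm (P v o) ∧
        Stored (s'.arr a_tT) (s'.arr a_tO) (r' ++ r₀) ∧ s'.var v_rc = (r' ++ r₀).length := by
  have h1 := hV.size_bd
  have hnb := I.le_st I.nb
  have hsz := hV.sz_bd v hv
  have hsig := hV.sig_bd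
  have hnbr : I.nb = I.r + I.m := rfl
  obtain ⟨ho1, ho2⟩ := abs_le.1 ho
  refine load_seq p (inp p) hp (by omega) (by rw [hR.consts.inp]) ?_
  refine add_seq hK (p + 1 : ℕ) (by simp [hp, hR.consts.one]) (by omega) ?_
  refine load_seq (p + 1) (inp (p + 1)) (by simp) (by omega) (by simp [hR.consts.inp]) ?_
  refine add_seq hK (p + 2 : ℕ) (by simp [hR.consts.one]; ring) (by omega) ?_
  refine part_seq (R := fun s₁ t₁ => t₁ = t + 6 ∧ s₁.var v_u = v) ?_
    fun s₁ t₁ hF₁ ⟨ht₁, hu₁⟩ => ?_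
  · refine wp_if (fun h => ?_) (fun h => ?_) <;> simp at h
    · obtain ⟨-, hin⟩ | ⟨hin, -⟩ := hin
      · exact add_last hK v (by simp [hR.consts.r, hin]) (by omega) ⟨by omega, by simp⟩
      · omega
    · obtain ⟨hin, -⟩ | ⟨-, hin⟩ := hin
      · omega
      · exact sub_last hK v (by simp [hR.consts.base, hin]) (by omega) ⟨by omega, by simp⟩
  have hR₁ : Ready I inp s₁ :=
    ((((hR.set _ rfl).set _ rfl).set _ rfl).set _ rfl).frame hF₁ rfl rfl rfl
  have e1 := hF₁.var v_pos rfl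
  have e2 := hF₁.var v_q rfl
  have e3 := hF₁.var v_rc rfl
  have e4 := hF₁.arr a_tT rfl
  have e5 := hF₁.arr a_tO rfl
  simp [hq, hrc] at e1 e2 e3 e4 e5
  refine load_seq q o e2 hqS (by rw [hR₁.consts.inp, hinq]) ?_
  refine const_seq hK (by omega) ?_
  refine part_seq (hV.push (l := []) (v := v) (o := o) hK hS hSN ((hR₁.set _ rfl).set _ rfl) hP hv hg
    (by omega) (by omega) (by simp [hu₁]) (by simp) (by simp) (by simp; omega) trivial)
    fun s₂ t₂ hF₂ ⟨ht₂, x, hx, hPx, hst₂, hsp₂⟩ => ?_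
  have f1 := hF₂.var v_pos rfl
  have f3 := hF₂.var v_rc rfl
  have f4 := hF₂.arr a_tT rfl
  have f5 := hF₂.arr a_tO rfl
  simp [e1, e3, e4, e5] at f1 f3 f4 f5
  have hflat : ([x].flatMap fun p => P p.1 p.2) = P v o := by simp [hPx]
  refine wp_conseq (hV.climb (l₀ := [x]) (r₀ := r₀) hK hS hSN
    (((hR₁.set _ rfl).set _ rfl).frame hF₂ rfl rfl rfl) hP hsp₂ (by simpa using hx) hst₂ f3
    (by rw [f4, f5]; exact hr₀) (by rw [hflat]; exact hlS))
    fun s₃ t₃ hF₃ ⟨ht₃, r', hr', hst₃, hrc₃⟩ => ?_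
  rw [hflat] at ht₃ hr'
  exact ⟨by omega, by rw [hF₃.var v_pos rfl, f1], r', hr', hst₃, hrc₃⟩

/-- The lists that the arrays hold grow at their far end, while `Stored` reads them from there; hence
the reversals. -/
theorem wp_printPairs (hK : ((8 * N + 16 : ℕ) : ℤ) ≤ 2 ^ W) (hSN : S ≤ N)
    (hC : Consts I inp s) {rX rY : List (ℕ × ℤ)} {l : ℕ}
    (hnX : s.var v_nX = rX.length) (hrc : s.var v_rc = (rY ++ rX).length)
    (hst : Stored (s.arr a_tT) (s.arr a_tO) (rY ++ rX)) (hlen : s.var v_len = l)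
    (hlS : (rY ++ rX).length ≤ S) :
    wp W S printPairs s t fun s' t' => t' ≤ t + 3 + rX.length * (8 + 10 * rY.length) ∧
      s'.out = s.out ++ pairs rX.reverse rY.reverse l := by
  have hgX : ∀ i (hi : i < rX.length), s.arr a_tT i = (rX.reverse[i]'(by simpa using hi)).1 ∧
      s.arr a_tO i = (rX.reverse[i]'(by simpa using hi)).2 := fun i hi =>
    hst.append_right.get i hi
  have hgY : ∀ j (hj : j < rY.length), s.arr a_tT (rX.length + j) =
      (rY.reverse[j]'(by simpa using hj)).1 ∧
      s.arr a_tO (rX.length + j) = (rY.reverse[j]'(by simpa using hj)).2 := fun j hj => by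
    have := hst.get (rX.length + j) (by simp; omega)
    simp only [List.reverse_append] at this
    have e : rX.length + j - rX.reverse.length = j := by simp
    rw [List.getElem_append_right (by simp)] at this
    simp only [e] at this
    exact this
  rw [List.length_append] at hlS hrc
  refine const_seq hK (by omega) ?_
  refine sub_seq hK rX.length (by simp [hnX]) (by omega) ?_
  refine wp_while (fun s' t' => ∃ i ≤ rX.length, s'.var v_i = i ∧
      s'.var v_c = rX.length - i ∧
      s'.out = s.out ++ pairs (rX.reverse.take i) rY.reverse l ∧
      t' ≤ t + 2 + i * (8 + 10 * rY.length)) (t + 2 + rX.length * (8 + 10 * rY.length))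
    ⟨0, by omega, by simp, by simp, by simp [pairs], by omega⟩ ?_ ?_ ?_
  · rintro s' t' ⟨i, hi, -, -, -, ht⟩
    have := Nat.mul_le_mul_right (8 + 10 * rY.length) hi
    omega
  · rintro s' t' ⟨i, hi, hvi, hvc, hout, ht⟩ hF hpos
    have hi' : i < rX.length := by omega
    have hC' : Consts I inp s' := Consts.frame
      ⟨by simp [hC.zero], by simp [hC.one], by simp [hC.two], by simp [hC.base],
        by simp [hC.r], by simp [hC.nb], by simp [hC.inp]⟩ hF rfl
    have e1 := hF.var v_nX rfl
    have e2 := hF.var v_rc rfl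
    have e3 := hF.arr a_tT rfl
    have e4 := hF.arr a_tO rfl
    have e5 := hF.var v_len rfl
    simp [hnX, hrc, hlen] at e1 e2 e3 e4 e5
    obtain ⟨hx1, hx2⟩ := hgX i hi'
    obtain ⟨p, hp⟩ : ∃ p, p = rX.reverse[i]'(by simpa using hi') := ⟨_, rfl⟩
    rw [← hp] at hx1 hx2
    refine load_seq i p.1 hvi (by omega) (by rw [e3, hx1]) ?_
    refine load_seq i p.2 (by simp [hvi]) (by omega) (by simp [e4, hx2]) ?_
    refine add_seq hK rX.length (by simp [e1, hC'.zero]) (by omega) ?_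
    refine sub_seq hK rY.length (by simp [e2]) (by omega) ?_
    refine part_seq (R := fun s₁ t₁ => t₁ ≤ t' + 6 + 10 * rY.length ∧
      s₁.out = s'.out ++ rY.reverse.flatMap fun q => [(p.1 : ℤ), (q.1 : ℤ), p.2, q.2, (l : ℤ)]) ?_
      fun s₁ t₁ hF₁ ⟨ht₁, hout₁⟩ => ?_
    · refine wp_while (fun s₁ t₁ => ∃ j ≤ rY.length, s₁.var v_j = (rX.length + j : ℕ) ∧
        s₁.var v_d = rY.length - j ∧
        s₁.out = s'.out ++ (rY.reverse.take j).flatMap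
          (fun q => [(p.1 : ℤ), (q.1 : ℤ), p.2, q.2, (l : ℤ)]) ∧
        t₁ ≤ t' + 5 + 10 * j) (t' + 5 + 10 * rY.length)
        ⟨0, by omega, by simp, by simp, by simp, by omega⟩ ?_ ?_ ?_
      · rintro s₁ t₁ ⟨j, hj, -, -, -, ht₁⟩; omega
      · rintro s₁ t₁ ⟨j, hj, hvj, hvd, hout₁, ht₁⟩ hF₁ hpos₁
        have hj' : j < rY.length := by omega
        have g2 := hF₁.var v_rc rfl
        have g3 := hF₁.arr a_tT rfl
        have g4 := hF₁.arr a_tO rfl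
        have g5 := hF₁.var v_len rfl
        have g6 := hF₁.var v_x rfl
        have g7 := hF₁.var v_a rfl
        have g8 := hF₁.var v_one rfl
        simp [e2, e3, e4, e5, hC'.one] at g2 g3 g4 g5 g6 g7 g8
        obtain ⟨hy1, hy2⟩ := hgY j hj'
        obtain ⟨q, hq⟩ : ∃ q, q = rY.reverse[j]'(by simpa using hj') := ⟨_, rfl⟩
        rw [← hq] at hy1 hy2
        refine load_seq (rX.length + j) q.1 hvj (by omega) (by rw [g3, hy1]) ?_
        refine load_seq (rX.length + j) q.2 (by simp [hvj]) (by omega) (by simp [g4, hy2]) ?_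
        refine print_seq p.1 (by simp [g6]) ?_
        refine print_seq q.1 (by simp) ?_
        refine print_seq p.2 (by simp [g7]) ?_
        refine print_seq q.2 (by simp) ?_
        refine print_seq l (by simp [g5]) ?_
        refine add_seq hK (rX.length + (j + 1) : ℕ) (by simp [hvj, g8]; ring) (by omega) ?_
        refine sub_last hK (rY.length - (j + 1 : ℕ)) (by simp [g2]; ring) (by omega) ?_
        refine ⟨j + 1, by omega, by simp, by simp, ?_, by omega⟩
        rw [← List.take_append_getElem (by simpa using hj'), ← hq]
        simp [hout₁]
      · rintro s₁ t₁ ⟨j, hj, hvj, hvd, hout₁, ht₁⟩ hF₁ hpos₁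
        obtain rfl : j = rY.length := by omega
        rw [List.take_of_length_le (by simp)] at hout₁
        exact ⟨by omega, hout₁⟩
    · have g1 := hF₁.var v_i rfl
      have g2 := hF₁.var v_one rfl
      have g3 := hF₁.var v_nX rfl
      simp [hvi, hC'.one, e1] at g1 g2 g3
      refine add_seq hK (i + 1 : ℕ) (by simp [g1, g2]) (by omega) ?_
      refine sub_last hK (rX.length - (i + 1 : ℕ)) (by simp [g3]) (by omega) ?_
      refine ⟨i + 1, by omega, by simp, by simp, ?_, by rw [Nat.add_one_mul]; omega⟩
      rw [← List.take_append_getElem (by simpa using hi'), ← hp]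
      simp [hout₁, hout, pairs]
  · rintro s' t' ⟨i, hi, hvi, hvc, hout, ht⟩ hF hpos
    obtain rfl : i = rX.length := by omega
    rw [List.take_of_length_le (by simp)] at hout
    exact ⟨by omega, hout⟩

/-- A tuple takes time proportional to the number of its matches: each of the two numbers of climbs
is at least one, so that their sum is at most their product plus one. -/
theorem Valid.tuple (hV : Valid I inp N rank sz good)
    (hK : ((8 * N + 16 : ℕ) : ℤ) ≤ 2 ^ W) (hS : I.st I.nb + 7 * I.nL ≤ S) (hSN : S ≤ N)
    (hR : Ready I inp s) (hP : Paths I P) {i : ℕ} (hi : i < I.nL)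
    (hPS : (P (I.X i) (I.oX i)).length + (P (I.Y i) (I.oY i)).length ≤ S)
    (hpos : s.var v_pos = (I.st I.nb + 7 * i : ℕ)) :
    wp W S tuple s t fun s' t' =>
      t' ≤ t + 400 * ((P (I.X i) (I.oX i)).length * (P (I.Y i) (I.oY i)).length) ∧
      s'.var v_pos = (I.st I.nb + 7 * (i + 1) : ℕ) ∧
      ∃ A B, A.Perm (P (I.X i) (I.oX i)) ∧ B.Perm (P (I.Y i) (I.oY i)) ∧
        s'.out = s.out ++ pairs A B (I.tl i) := by
  have h1 := hV.size_bd
  obtain ⟨hb1, hb2, hb3⟩ := hV.tup_bd i hi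
  obtain ⟨p, hp⟩ : ∃ p, p = I.st I.nb + 7 * i := ⟨_, rfl⟩
  have hpX := hV.inpX i hi
  have hpY := hV.inpY i hi
  have hoX := hV.inp_oX i hi
  have hoY := hV.inp_oY i hi
  have htl := hV.inp_tl i hi
  rw [← hp] at hpos hpX hpY hoX hoY htl
  refine const_seq hK (by omega) ?_
  refine add_seq hK (p + 2 : ℕ) (by simp [hpos, hR.consts.two]) (by omega) ?_
  refine add_seq hK (p + 4 : ℕ) (by simp [hR.consts.two]; ring) (by omega) ?_
  refine part_seq (hV.expand (r₀ := []) (p := p) (q := p + 4) (v := I.X i) (o := I.oX i) hK hS hSN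
    (((hR.set _ rfl).set _ rfl).set _ rfl) hP (by simp [hpos]) (by omega) (by simp) (by omega)
    (hV.X_lt i hi) (hV.X_good i hi) hoX hb1 hpX (by simp) trivial (by simp; omega))
    fun s₁ t₁ hF₁ ⟨ht₁, hpos₁, rX, hrX, hst₁, hrc₁⟩ => ?_
  rw [List.append_nil] at hst₁ hrc₁
  have hR₁ := (((hR.set (x := v_rc) 0 rfl).set (x := v_q) (p + 2 : ℕ) rfl).set (x := v_q)
    (p + 4 : ℕ) rfl).frame hF₁ rfl rfl rfl
  have hlX := hrX.length_eq
  refine add_seq hK rX.length (by simp [hrc₁, hR₁.consts.zero]) (by omega) ?_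
  refine add_seq hK (p + 4 : ℕ) (by simp [hpos₁, hR₁.consts.two]; ring) (by omega) ?_
  refine add_seq hK (p + 5 : ℕ) (by simp [hR₁.consts.one]; ring) (by omega) ?_
  refine part_seq (hV.expand (r₀ := rX) (p := p + 2) (q := p + 5) (v := I.Y i) (o := I.oY i) hK hS
    hSN (((hR₁.set _ rfl).set _ rfl).set _ rfl) hP (by simp [hpos₁]) (by omega) (by simp) (by omega)
    (hV.Y_lt i hi) (hV.Y_good i hi) hoY hb2 hpY (by simp [hrc₁]) (by simpa using hst₁)
    (by omega))
    fun s₂ t₂ hF₂ ⟨ht₂, hpos₂, rY, hrY, hst₂, hrc₂⟩ => ?_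
  have hR₂ := (((hR₁.set (x := v_nX) rX.length rfl).set (x := v_q) (p + 4 : ℕ) rfl).set (x := v_q)
    (p + 5 : ℕ) rfl).frame hF₂ rfl rfl rfl
  have hlY := hrY.length_eq
  have f1 := hF₂.var v_nX rfl
  have f2 := hF₂.out rfl
  simp [hF₁.out rfl] at f1 f2
  refine add_seq hK (p + 6 : ℕ) (by simp [hpos₂, hR₂.consts.two]; ring) (by omega) ?_
  refine load_seq (p + 6) (I.tl i) (by simp) (by omega) (by simp [hR₂.consts.inp, htl]) ?_
  refine add_seq hK (p + 7 : ℕ) (by simp [hR₂.consts.one]; ring) (by omega) ?_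
  refine wp_conseq (wp_printPairs (rX := rX) (rY := rY) (l := I.tl i) hK hSN
    (((hR₂.set _ rfl).set _ rfl).set _ rfl).consts (by simp [f1]) (by simp [hrc₂])
    (by simpa using hst₂) (by simp) (by rw [List.length_append]; omega))
    fun s₃ t₃ hF₃ ⟨ht₃, hout₃⟩ => ?_
  refine ⟨?_, ?_, rX.reverse, rY.reverse, rX.reverse_perm.trans hrX, rY.reverse_perm.trans hrY, ?_⟩
  · have hx := hP.pos hV (hV.X_good i hi) (I.oX i)
    have hy := hP.pos hV (hV.Y_good i hi) (I.oY i)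
    rw [← hlX] at hx ht₁ ⊢
    rw [← hlY] at hy ht₂ ⊢
    obtain ⟨a, ha⟩ : ∃ a, rX.length = a + 1 := ⟨rX.length - 1, by omega⟩
    obtain ⟨b, hb⟩ : ∃ b, rY.length = b + 1 := ⟨rY.length - 1, by omega⟩
    rw [ha] at ht₁ ht₃ ⊢
    rw [hb] at ht₂ ht₃ ⊢
    nlinarith [Nat.zero_le (a * b)]
  · rw [hF₃.var v_pos rfl]; simp; omega
  · rw [hout₃]; simp [f2]

/-- The whole program takes time linear in the size of the input and the number of matches; cells are
needed for the input and for the climbs of one tuple. -/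
theorem Valid.run (hV : Valid I inp N rank sz good)
    (hK : ((8 * N + 16 : ℕ) : ℤ) ≤ 2 ^ W) (hS : I.st I.nb + 7 * I.nL ≤ S) (hSN : S ≤ N)
    (hP : Paths I P)
    (hPS : ∀ i < I.nL, (P (I.X i) (I.oX i)).length + (P (I.Y i) (I.oY i)).length ≤ S)
    {input : List ℤ} (hinp : ∀ n, input.getD n 0 = inp n) :
    ∃ t s', Exec W S prog.code (prog.init input) t s' ∧ Outs I P I.nL s'.out ∧
      t ≤ 500 * (I.st I.nb + ∑ i ∈ Finset.range I.nL,
        ((P (I.X i) (I.oX i)).length * (P (I.Y i) (I.oY i)).length)) := by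
  obtain ⟨s₀, hs₀⟩ : ∃ s₀ : State 32 12, s₀ = prog.init input := ⟨_, rfl⟩
  have hv : ∀ x, s₀.var x = 0 := by subst hs₀; exact fun _ => rfl
  have ha0 : s₀.arr a_inp = inp := by
    have : (prog.init input).arr a_inp =
      fun n => if (0 : Fin 12) = 0 then input.getD n 0 else 0 := rfl
    rw [hs₀, this]; funext n; rw [if_pos rfl, hinp]
  have ha : ∀ A, A ≠ a_inp → s₀.arr A = fun _ => 0 := by
    subst hs₀
    intro A hA
    have : (prog.init input).arr A = fun n => if A = 0 then input.getD n 0 else 0 := rfl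
    rw [this]; funext n; rw [if_neg hA]
  have ho : s₀.out = [] := by subst hs₀; rfl
  rw [← hs₀]
  suffices H : wp W S mainCode s₀ 0 fun s' t' => Outs I P I.nL s'.out ∧
      t' ≤ 500 * (I.st I.nb + ∑ i ∈ Finset.range I.nL,
        ((P (I.X i) (I.oX i)).length * (P (I.Y i) (I.oY i)).length)) by
    obtain ⟨t, s', h1, h2, h3⟩ := H
    exact ⟨t, s', h1, h2, by omega⟩
  have h1 := hV.size_bd
  have hnb := I.le_st I.nb
  have hsig := hV.sig_bd
  have hnbr : I.nb = I.r + I.m := rfl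
  refine part_seq (R := fun s₁ t₁ => t₁ = 10 ∧ Consts I inp s₁ ∧ s₁.var v_pos = 4 ∧
    s₁.var v_nL = I.nL) ?_ fun s₁ t₁ hF₁ ⟨ht₁, hC₁, hpos₁, hnL₁⟩ => ?_
  · refine const_seq hK (by omega) ?_
    refine const_seq hK (by omega) ?_
    refine const_seq hK (by omega) ?_
    refine const_seq hK (by omega) ?_
    refine load_seq 0 I.sig (by simp [hv]) (by omega) (by simp [ha0, hV.inp0]) ?_
    refine add_seq hK (2 + I.sig) (by simp; ring) (by omega) ?_
    refine load_seq 1 I.r (by simp) (by omega) (by simp [ha0, hV.inp1]) ?_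
    refine load_seq 2 I.m (by simp) (by omega) (by simp [ha0, hV.inp2]) ?_
    refine add_seq hK (I.nb : ℕ) (by simp [hnbr]; ring) (by omega) ?_
    refine load_last 3 I.nL (by simp) (by omega) (by simp [ha0, hV.inp3]) ?_
    refine ⟨by omega, ⟨by simp [hv], by simp, by simp, by simp, by simp, by simp, by simp [ha0]⟩,
      by simp, by simp⟩
  have z : ∀ A, A ≠ a_inp → header.stores A = false → s₁.arr A = fun _ => 0 := fun A hA h => by
    rw [hF₁.arr A h, ha A hA]
  refine part_seq (hV.scan hK hS hC₁ hpos₁ ((hF₁.var v_b rfl).trans (hv _)) ?_)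
    fun s₂ t₂ hF₂ ⟨ht₂, hpos₂, hL₂⟩ => ?_
  · rw [z a_hd (by decide) rfl, z a_nx (by decide) rfl, z a_ow (by decide) rfl,
      z a_ct (by decide) rfl]
    exact ⟨fun v => rfl, by simp, by simp⟩
  have hC₂ := hC₁.frame hF₂ rfl
  refine part_seq (hV.contract hK hS hC₂ hL₂ ?_) fun s₃ t₃ hF₃ ⟨ht₃, hrep₃⟩ => ?_
  · rw [hF₂.arr a_rp rfl, hF₂.arr a_ro rfl, hF₂.arr a_dn rfl, z a_rp (by decide) rfl,
      z a_ro (by decide) rfl, z a_dn (by decide) rfl]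
    exact ⟨by simp, by simp, by simp⟩
  have hR₃ : Ready I inp s₃ := ⟨hC₂.frame hF₃ rfl, Edges.frame hL₂ hF₃ rfl, hrep₃⟩
  have hpos₃ : s₃.var v_pos = I.st I.nb := (hF₃.var _ rfl).trans hpos₂
  have hnL₃ : s₃.var v_nL = I.nL := (hF₃.var _ rfl).trans ((hF₂.var _ rfl).trans hnL₁)
  have hout₃ : s₃.out = [] := by
    rw [hF₃.out rfl, hF₂.out rfl, hF₁.out rfl, ho]
  have hpp : ∀ i < I.nL, 1 ≤ (P (I.X i) (I.oX i)).length * (P (I.Y i) (I.oY i)).length :=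
    fun i hi => Nat.mul_pos (hP.pos hV (hV.X_good i hi) _) (hP.pos hV (hV.Y_good i hi) _)
  refine wp_while (fun s' t' => ∃ i ≤ I.nL, s'.var v_nL = I.nL - i ∧
      s'.var v_pos = (I.st I.nb + 7 * i : ℕ) ∧ Outs I P i s'.out ∧
      t' ≤ t₃ + 410 * ∑ i ∈ Finset.range i,
        ((P (I.X i) (I.oX i)).length * (P (I.Y i) (I.oY i)).length))
    (t₃ + 410 * ∑ i ∈ Finset.range I.nL,
        ((P (I.X i) (I.oX i)).length * (P (I.Y i) (I.oY i)).length))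
    ⟨0, by omega, by simp [hnL₃], by simp [hpos₃], hout₃, by simp⟩ ?_ ?_ ?_
  · rintro s' t' ⟨i, hi, -, -, -, ht⟩
    have := Finset.sum_le_sum_of_subset (f := fun i =>
      (P (I.X i) (I.oX i)).length * (P (I.Y i) (I.oY i)).length) (Finset.range_mono hi)
    omega
  · rintro s' t' ⟨i, hi, hnL, hpos, hout, ht⟩ hF hp
    have hi' : i < I.nL := by omega
    have hR' := hR₃.frame hF rfl rfl rfl
    refine part_seq (hV.tuple hK hS hSN hR' hP hi' (hPS i hi') hpos)
      fun s₄ t₄ hF₄ ⟨ht₄, hpos₄, A, B, hA, hB, hout₄⟩ => ?_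
    have e1 := hF₄.var v_nL rfl
    have e2 := hF₄.var v_one rfl
    refine sub_last hK (I.nL - (i + 1 : ℕ)) (by rw [e1, e2, hnL, hR'.consts.one]; simp; ring)
      (by omega) ?_
    refine ⟨i + 1, by omega, by simp, by simp [hpos₄], ⟨s'.out, A, B, hout, hA, hB, hout₄⟩, ?_⟩
    rw [Finset.sum_range_succ]
    have := hpp i hi'
    omega
  · rintro s' t' ⟨i, hi, hnL, hpos, hout, ht⟩ hF hp
    obtain rfl : i = I.nL := by omega
    exact ⟨hout, by omega⟩

end Verify

end RAM

/-! ### Right-hand sides and expansions -/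

/-- The length of the `efexp` expansion of a string of symbols. -/
def elen (l : List GSym) : ℕ := (l.map fun A => A.efexp.length).sum

/-- The symbols of `l`, each with the position at which its `efexp` expansion starts if that of `l`
starts at `s`. -/
def place : ℕ → List GSym → List (GSym × ℕ)
  | _, [] => []
  | s, A :: l => (A, s) :: place (s + A.efexp.length) l

/-- A right-hand side without its first and its last two symbols. -/
def middle (F : List GSym) : List GSym := (F.drop 1).take (F.length - 3)

@[simp] theorem elen_nil : elen [] = 0 := rfl
@[simp] theorem elen_cons (A : GSym) (l : List GSym) : elen (A :: l) = A.efexp.length + elen l := by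
  simp [elen]
@[simp] theorem elen_append (l l' : List GSym) : elen (l ++ l') = elen l + elen l' := by
  simp [elen]

theorem place_append (s : ℕ) (l l' : List GSym) :
    place s (l ++ l') = place s l ++ place (s + elen l) l' := by
  induction l generalizing s with
  | nil => simp [place]
  | cons A l ih => simp [place, ih, add_assoc]

theorem place_add (s c : ℕ) (l : List GSym) :
    place (s + c) l = (place c l).map fun p => (p.1, s + p.2) := by
  induction l generalizing c with
  | nil => rfl
  | cons A l ih => simp [place, add_assoc, ih]

theorem place_eq (s : ℕ) (l : List GSym) :
    place s l = (place 0 l).map fun p => (p.1, s + p.2) := by simpa using place_add s 0 l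

@[simp] theorem length_place (s : ℕ) (l : List GSym) : (place s l).length = l.length := by
  induction l generalizing s with
  | nil => rfl
  | cons A l ih => simp [place, ih]

theorem getElem_place (s : ℕ) (l : List GSym) (j : ℕ) (hj : j < (place s l).length) :
    (place s l)[j] = (l[j]'(by simpa using hj), s + elen (l.take j)) := by
  induction l generalizing s j with
  | nil => simp [place] at hj
  | cons A l ih =>
    cases j with
    | zero => simp [place]
    | succ j => simp [place, ih, add_assoc]

theorem middle_append (A B C : GSym) (M : List GSym) : middle (A :: (M ++ [B, C])) = M := by
  simp [middle]

theorem exists_middle {F : List GSym} (h : 3 ≤ F.length) :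
    ∃ A B C, F = A :: (middle F ++ [B, C]) := by
  obtain ⟨A, F, rfl⟩ := List.exists_cons_of_length_pos (by omega : 0 < F.length)
  simp only [List.length_cons] at h
  have h2 : F.drop (F.length - 2) = [F[F.length - 2], F[F.length - 1]] := by
    apply List.ext_getElem
    · simp; omega
    · intro i h1 h2
      simp only [List.length_cons, List.length_nil] at h2
      have : i = 0 ∨ i = 1 := by omega
      rcases this with rfl | rfl
      · simp
      · simp only [List.getElem_drop, List.getElem_cons_succ, List.getElem_cons_zero]
        congr 1; omega
  refine ⟨A, F[F.length - 2], F[F.length - 1], ?_⟩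
  rw [← h2]
  simp [middle]

@[simp] theorem length_flank (s : List GSym) : (flank s).length = s.length + 3 := by simp [flank]
@[simp] theorem middle_flank (s : List GSym) : middle (flank s) = s := middle_append _ _ _ s

theorem efexpInit_eq : ∀ F : List GSym,
    GSym.efexpInit F = (F.take (F.length - 2)).flatMap GSym.efexp
  | [] => by simp [GSym.efexpInit]
  | [A] => by simp [GSym.efexpInit]
  | [A, B] => by simp [GSym.efexpInit]
  | A :: B :: C :: F => by
    rw [GSym.efexpInit, efexpInit_eq (B :: C :: F)]
    simp

theorem efexp_rule (F : List GSym) : (GSym.rule F).efexp = (middle F).flatMap GSym.efexp := by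
  cases F with
  | nil => simp [GSym.efexp, GSym.efexpTail, middle]
  | cons A F => simp [GSym.efexp, GSym.efexpTail, middle, efexpInit_eq]

theorem length_efexp_rule (F : List GSym) : (GSym.rule F).efexp.length = elen (middle F) := by
  rw [efexp_rule, List.length_flatMap, elen]

theorem zip_offsets (A B C : GSym) (M : List GSym) :
    (A :: (M ++ [B, C])).zip (offsets (A :: (M ++ [B, C]))) =
      (A, 0) :: (place 0 M ++ [(B, elen M), (C, elen M)]) := by
  apply List.ext_getElem
  · simp [offsets]
  intro j h1 h2
  simp only [List.getElem_zip, offsets, List.getElem_map, List.getElem_range]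
  rcases j with _ | j
  · simp
  simp only [List.getElem_cons_succ, List.length_cons, List.length_append, length_place,
    List.length_nil] at h2 ⊢
  have hd : ∀ n, ((A :: (M ++ [B, C])).take (n + 1)).drop 1 = (M ++ [B, C]).take n := by simp
  rcases lt_or_ge j M.length with hj | hj
  · rw [List.getElem_append_left (by simpa using hj), List.getElem_append_left (by simpa using hj),
      getElem_place, show min (j + 1) (M.length + (0 + 1 + 1) + 1 - 2) = j + 1 by omega, hd,
      List.take_append_of_le_length (by omega), elen, zero_add]
  · rw [List.getElem_append_right (by simpa using hj), List.getElem_append_right (by simpa using hj),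
      show min (j + 1) (M.length + (0 + 1 + 1) + 1 - 2) = M.length + 1 by omega, hd]
    have : j - M.length = 0 ∨ j - M.length = 1 := by omega
    rcases this with h | h <;> simp [h, elen]

/-! ### Cuts -/

/-- The list consists of the cuts of a string of length `n` from position `a` on: each one starts
two positions before the end of the previous one. -/
def CutsFrom (n : ℕ) : ℕ → List (ℕ × ℕ) → Prop
  | _, [] => False
  | a, [c] => c.1 = a ∧ c.2 + 1 = n ∧ a + 3 ≤ c.2
  | a, c :: d :: l => c.1 = a ∧ a + 3 ≤ c.2 ∧ CutsFrom n (c.2 - 2) (d :: l)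

theorem not_isLType_dollar (h : GSym → ℕ) : ∀ r, ¬ IsLType h (.dollar :: r)
  | [] => id
  | B :: r => by
    rintro (hlt | ⟨rfl, hr⟩)
    · simp [key] at hlt
    · exact not_isLType_dollar h r hr

theorem mem_localMinima {h : GSym → ℕ} {s : List GSym} {j : ℕ} (hj : j ∈ localMinima h (flank s)) :
    2 ≤ j ∧ j < s.length + 1 := by
  classical
  simp only [localMinima, List.mem_filter, List.mem_range, length_flank, decide_eq_true_eq] at hj
  obtain ⟨-, h1, h2, h3, h4⟩ := hj
  refine ⟨?_, by omega⟩
  by_contra hlt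
  obtain rfl : j = 1 := by omega
  exact not_isLType_dollar h _ h4

theorem localMinima_sorted (h : GSym → ℕ) (s : List GSym) :
    (localMinima h s).Pairwise (· < ·) := by
  classical
  exact List.Pairwise.filter _ List.pairwise_lt_range


theorem cutsFrom_zip {n : ℕ} : ∀ (lm : List ℕ) (a : ℕ), lm.Pairwise (· < ·) →
    (∀ j ∈ lm, a + 2 ≤ j ∧ j + 2 < n) → a + 4 ≤ n →
    CutsFrom n a ((a :: lm.map (· - 1)).zip (lm.map (· + 1) ++ [n - 1]))
  | [], a, _, _, h => by
    exact ⟨rfl, by simp only []; omega, by simp only []; omega⟩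
  | j :: lm, a, hs, hb, h => by
    have hj := hb j (by simp)
    have ih := cutsFrom_zip (n := n) lm (j - 1) hs.of_cons (fun j' hj' => by
      have := hb j' (by simp [hj'])
      have := (List.pairwise_cons.1 hs).1 j' hj'
      omega) (by omega)
    simp only [List.map_cons, List.cons_append, List.zip_cons_cons]
    obtain ⟨c, l, hl⟩ : ∃ c l, ((j - 1) :: lm.map (· - 1)).zip (lm.map (· + 1) ++ [n - 1]) =
        c :: l := by
      cases lm <;> simp
    rw [hl] at ih ⊢
    exact ⟨rfl, by omega, by simpa using ih⟩

/-- Consecutive phrases of a nonempty string overlap in the three positions around a local minimum. -/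
theorem cutsFrom_cuts (h : GSym → ℕ) {s : List GSym} (hs : s ≠ []) :
    CutsFrom (s.length + 3) 0 (cuts h (flank s)) := by
  have := List.length_pos_of_ne_nil hs
  rw [cuts, length_flank]
  exact cutsFrom_zip _ 0 (localMinima_sorted h _)
    (fun j hj => by have := mem_localMinima hj; omega) (by omega)

theorem cuts_nil (h : GSym → ℕ) : cuts h (flank []) = [(0, 2)] := by
  have : localMinima h (flank []) = [] := by
    rw [List.eq_nil_iff_forall_not_mem]
    intro j hj
    have := mem_localMinima hj
    simp at this; omega
  simp [cuts, this]

/-- The middles of consecutive phrases partition the string. -/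
theorem CutsFrom.flatMap {n : ℕ} {FS : List GSym} (hn : FS.length = n) :
    ∀ {a : ℕ} {L : List (ℕ × ℕ)}, CutsFrom n a L →
      (L.flatMap fun c => (FS.drop (c.1 + 1)).take (c.2 - 2 - c.1)) =
        (FS.drop (a + 1)).take (n - 3 - a)
  | a, [c], h => by
    obtain ⟨rfl, h2, -⟩ := h
    simp only [List.flatMap_cons, List.flatMap_nil, List.append_nil]
    congr 1; omega
  | a, c :: d :: l, h => by
    obtain ⟨rfl, h2, h3⟩ := h
    have ih := CutsFrom.flatMap hn h3
    have hb : c.2 - 2 + 4 ≤ n := by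
      cases l with
      | nil => obtain ⟨_, h4, h5⟩ := h3; omega
      | cons e l =>
        clear ih
        have H : ∀ (l : List (ℕ × ℕ)) (a : ℕ), CutsFrom n a l → a + 4 ≤ n := by
          intro l
          induction l with
          | nil => intro a h; exact h.elim
          | cons c l ih =>
            intro a h
            cases l with
            | nil => obtain ⟨_, h4, h5⟩ := h; omega
            | cons d l => have := ih _ h.2.2; have := h.2.1; omega
        exact H _ _ h3
    rw [List.flatMap_cons, ih]
    have e : FS.drop (c.2 - 2 + 1) = (FS.drop (c.1 + 1)).drop (c.2 - 2 - c.1) := by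
      rw [List.drop_drop]; congr 1; omega
    rw [e, show n - 3 - c.1 = (c.2 - 2 - c.1) + (n - 3 - (c.2 - 2)) by omega, List.take_add]

theorem CutsFrom.bound {n : ℕ} : ∀ {a : ℕ} {L : List (ℕ × ℕ)}, CutsFrom n a L →
    ∀ c ∈ L, a ≤ c.1 ∧ c.1 + 3 ≤ c.2 ∧ c.2 < n
  | a, [c], h, d, hd => by
    obtain rfl : d = c := by simpa using hd
    obtain ⟨rfl, h2, h3⟩ := h
    omega
  | a, c :: d :: l, h, e, he => by
    obtain ⟨h1, h2, h3⟩ := h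
    have hd := CutsFrom.bound h3 d (by simp)
    rcases List.mem_cons.1 he with rfl | he
    · have : d.1 = e.2 - 2 := by
        cases l with
        | nil => exact h3.1
        | cons => exact h3.1
      omega
    · have := CutsFrom.bound h3 e he
      omega

theorem cuts_bound {h : GSym → ℕ} {s : List GSym} {c : ℕ × ℕ} (hc : c ∈ cuts h (flank s)) :
    c.1 + 2 ≤ c.2 ∧ c.2 < s.length + 3 ∧ (s ≠ [] → c.1 + 3 ≤ c.2) := by
  by_cases hs : s = []
  · subst hs
    rw [cuts_nil] at hc
    obtain rfl : c = (0, 2) := by simpa using hc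
    simp
  · have := (cutsFrom_cuts h hs).bound c hc
    exact ⟨by omega, this.2.2, fun _ => this.2.1⟩

theorem middle_slice {FS : List GSym} {x y : ℕ} (h1 : x + 2 ≤ y) (h2 : y < FS.length) :
    middle ((FS.drop x).take (y + 1 - x)) = (FS.drop (x + 1)).take (y - 2 - x) := by
  rw [middle, List.length_take, List.length_drop, List.drop_take, List.drop_drop, List.take_take]
  congr 1; omega

/-- Without the first and the last two symbols of each, the phrases partition the string. -/
theorem flatMap_middle_phrases (h : GSym → ℕ) (s : List GSym) :
    (phrases h (flank s)).flatMap middle = s := by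
  by_cases hs : s = []
  · subst hs; rw [phrases, cuts_nil]; rfl
  rw [phrases, List.flatMap_map]
  have := (cutsFrom_cuts h hs).flatMap (FS := flank s) (length_flank s)
  rw [show (flank s).drop (0 + 1) = s ++ [.dollar, .hash] by simp [flank]] at this
  simp only [Nat.sub_zero, Nat.add_sub_cancel, List.take_left'] at this
  refine Eq.trans (List.flatMap_congr fun c hc => ?_) this
  have := cuts_bound hc
  rw [middle_slice this.1 (by rw [length_flank]; exact this.2.1)]

theorem phrases_ne_nil (h : GSym → ℕ) (s : List GSym) : phrases h (flank s) ≠ [] := by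
  simp only [phrases, cuts, ne_eq, List.map_eq_nil_iff]
  cases localMinima h (flank s) <;> simp

theorem mem_phrases {h : GSym → ℕ} {s F : List GSym} (hF : F ∈ phrases h (flank s)) :
    3 ≤ F.length ∧ (s ≠ [] → middle F ≠ []) ∧ (∀ A ∈ F, A ∈ flank s) ∧ ∀ A ∈ middle F, A ∈ s := by
  simp only [phrases, List.mem_map] at hF
  obtain ⟨c, hc, rfl⟩ := hF
  obtain ⟨h1, h2, h3⟩ := cuts_bound hc
  refine ⟨by simp; omega, fun hs => ?_, fun A hA => List.mem_of_mem_drop (List.mem_of_mem_take hA),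
    fun A hA => ?_⟩
  · have := h3 hs
    rw [middle_slice h1 (by simpa using h2)]
    refine List.ne_nil_of_length_pos ?_
    simp; omega
  · rw [← flatMap_middle_phrases h s, List.mem_flatMap]
    exact ⟨_, by rw [phrases, List.mem_map]; exact ⟨c, hc, rfl⟩, hA⟩

/-- The nodes below a node: the symbols in the middle of its right-hand side, with their starting
positions. -/
def kids : GSym × ℕ → List (GSym × ℕ)
  | (.rule Q, s) => place s (middle Q)
  | _ => []

theorem place_kids (t : ℕ) (L : List (List GSym)) :
    place t (L.flatMap middle) = (place t (L.map .rule)).flatMap kids := by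
  induction L generalizing t with
  | nil => rfl
  | cons F L ih =>
    simp [place, place_append, ih, kids, length_efexp_rule]

/-- The positions at one level of the parse tree, in terms of those at the next higher level. -/
theorem place_parse (h : ℕ → GSym → ℕ) (t : List ℕ) (i : ℕ) :
    place 0 (parse h t i) = (place 0 (parse h t (i + 1))).flatMap kids := by
  rw [parse, ← place_kids, flatMap_middle_phrases]

theorem elen_map_rule (L : List (List GSym)) : elen (L.map .rule) = elen (L.flatMap middle) := by
  induction L with
  | nil => rfl
  | cons F L ih => simp [ih, length_efexp_rule]

/-- The `efexp` expansions of the nodes of a level partition the text. -/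
theorem elen_parse (h : ℕ → GSym → ℕ) (t : List ℕ) (i : ℕ) : elen (parse h t i) = t.length := by
  induction i with
  | zero => simp [parse, elen, Function.comp_def, GSym.efexp]
  | succ i ih => rw [parse, elen_map_rule, flatMap_middle_phrases, ih]

theorem efexp_parse_ne_nil (h : ℕ → GSym → ℕ) {t : List ℕ} (ht : t ≠ []) (i : ℕ) :
    parse h t i ≠ [] ∧ ∀ A ∈ parse h t i, A.efexp ≠ [] := by
  induction i with
  | zero =>
    refine ⟨by simpa [parse] using ht, fun A hA => ?_⟩
    obtain ⟨c, -, rfl⟩ := List.mem_map.1 hA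
    simp [GSym.efexp]
  | succ i ih =>
    refine ⟨by simpa [parse] using phrases_ne_nil _ _, fun A hA => ?_⟩
    obtain ⟨F, hF, rfl⟩ := List.mem_map.1 hA
    obtain ⟨-, h2, -, h4⟩ := mem_phrases hF
    obtain ⟨A, hA⟩ := List.exists_mem_of_ne_nil _ (h2 ih.1)
    rw [efexp_rule]
    intro h0
    exact ih.2 A (h4 A hA) (List.flatMap_eq_nil_iff.1 h0 A hA)

mutual
/-- The height of a symbol. -/
def GSym.lvl : GSym → ℕ
  | .letter _ => 0
  | .dollar => 0
  | .hash => 0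
  | .rule F => GSym.lvlList F + 1
/-- The maximal height of the symbols of a string. -/
def GSym.lvlList : List GSym → ℕ
  | [] => 0
  | A :: F => max (GSym.lvl A) (GSym.lvlList F)
end

theorem lvlList_eq {F : List GSym} {n : ℕ} (h : ∀ A ∈ F, A.lvl ≤ n) (h' : ∃ A ∈ F, A.lvl = n) :
    GSym.lvlList F = n := by
  have H : ∀ F : List GSym, (∀ A ∈ F, A.lvl ≤ n) → GSym.lvlList F ≤ n := by
    intro F hF
    induction F with
    | nil => simp [GSym.lvlList]
    | cons A F ih =>
      exact max_le (hF A (by simp)) (ih fun B hB => hF B (by simp [hB]))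
  have H' : ∀ F : List GSym, ∀ A ∈ F, A.lvl ≤ GSym.lvlList F := by
    intro F A hA
    induction F with
    | nil => simp at hA
    | cons B F ih =>
      rcases List.mem_cons.1 hA with rfl | hA
      · exact le_max_left _ _
      · exact (ih hA).trans (le_max_right _ _)
  obtain ⟨A, hA, rfl⟩ := h'
  exact le_antisymm (H F h) (H' F A hA)

/-- The level of a node is determined by its label. -/
theorem lvl_parse (h : ℕ → GSym → ℕ) (t : List ℕ) (i : ℕ) :
    ∀ A ∈ parse h t i, A.lvl = i := by
  induction i with
  | zero =>
    intro A hA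
    obtain ⟨c, -, rfl⟩ := List.mem_map.1 hA
    rfl
  | succ i ih =>
    intro A hA
    obtain ⟨F, hF, rfl⟩ := List.mem_map.1 hA
    obtain ⟨h1, h2, h3, h4⟩ := mem_phrases hF
    rw [GSym.lvl, lvlList_eq (n := i)]
    · intro A hA
      have := h3 A hA
      simp only [flank, List.mem_cons, List.mem_append, List.not_mem_nil, or_false] at this
      rcases this with rfl | hA | rfl | rfl
      · exact Nat.zero_le _
      · exact (ih A hA).le
      · exact Nat.zero_le _
      · exact Nat.zero_le _
    · by_cases hs : parse h t i = []
      · obtain rfl : i = 0 := by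
          cases i with
          | zero => rfl
          | succ i => exact absurd hs (by simpa [parse] using phrases_ne_nil _ _)
        obtain ⟨A, F, rfl⟩ := List.exists_cons_of_length_pos (by omega : 0 < F.length)
        refine ⟨A, by simp, ?_⟩
        have := h3 A (by simp)
        simp only [hs, flank, List.nil_append, List.mem_cons, List.not_mem_nil, or_false] at this
        rcases this with rfl | rfl | rfl <;> rfl
      · obtain ⟨A, hA⟩ := List.exists_mem_of_ne_nil _ (h2 hs)
        exact ⟨A, List.mem_of_mem_drop (List.mem_of_mem_take hA), ih A (h4 A hA)⟩

/-! ### Nodes and the positions they cover -/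

theorem CutsFrom.index {n : ℕ} : ∀ {a : ℕ} {L : List (ℕ × ℕ)}, CutsFrom n a L →
    (L.getD 0 (0, 0)).1 = a ∧ (L.getD (L.length - 1) (0, 0)).2 + 1 = n ∧ L ≠ [] ∧
      ∀ k, k + 1 < L.length → (L.getD (k + 1) (0, 0)).1 + 2 = (L.getD k (0, 0)).2
  | a, [c], h => by
    obtain ⟨h1, h2, h3⟩ := h
    exact ⟨by simpa using h1, by simpa using h2, by simp, by simp⟩
  | a, c :: d :: l, h => by
    obtain ⟨h1, h2, h3⟩ := h
    obtain ⟨i1, i2, -, i3⟩ := CutsFrom.index h3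
    refine ⟨by simpa using h1, by simpa using i2, by simp, fun k hk => ?_⟩
    cases k with
    | zero => simp at i1 ⊢; omega
    | succ k => simpa using i3 k (by simpa using hk)

section Geometry

variable (h : ℕ → GSym → ℕ) (t : List ℕ)

/-- The number of nodes on level `i`. -/
noncomputable def pl (i : ℕ) : ℕ := (parse h t i).length
/-- The flanked string of level `i`. -/
noncomputable def fs (i : ℕ) : List GSym := flank (parse h t i)
/-- The first symbol, in the flanked string of level `i`, of phrase `k`. -/
noncomputable def lo (i k : ℕ) : ℕ := ((cuts (h i) (fs h t i)).getD k (0, 0)).1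
/-- The last symbol, in the flanked string of level `i`, of phrase `k`. -/
noncomputable def hi (i k : ℕ) : ℕ := ((cuts (h i) (fs h t i)).getD k (0, 0)).2
/-- The spans of the symbols of the flanked string of level `i`. -/
noncomputable def fspans (i : ℕ) : List (ℕ × ℕ) :=
  (0, 0) :: (spans h t i ++ [(t.length + 1, t.length + 1), (t.length + 2, t.length + 2)])
/-- The first position that symbol `j` of the flanked string of level `i` covers. -/
noncomputable def sL (i j : ℕ) : ℕ := ((fspans h t i).getD j (0, 0)).1
/-- The last position that symbol `j` of the flanked string of level `i` covers. -/
noncomputable def sR (i j : ℕ) : ℕ := ((fspans h t i).getD j (0, 0)).2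
/-- The length of the `efexp` expansion of the first `j` symbols of the flanked string of
level `i`. -/
noncomputable def pe (i j : ℕ) : ℕ := elen ((fs h t i).take j)

theorem length_fs (i : ℕ) : (fs h t i).length = pl h t i + 3 := length_flank _

theorem pl_zero : pl h t 0 = t.length := by simp [pl, parse]

theorem length_cuts (i : ℕ) : (cuts (h i) (fs h t i)).length = pl h t (i + 1) := by
  simp [pl, parse, phrases, fs]

theorem length_spans (i : ℕ) : (spans h t i).length = pl h t i := by
  cases i with
  | zero => simp [spans, pl, parse]
  | succ i => simp [spans, pl, parse, phrases]

theorem cuts_index (i : ℕ) : lo h t i 0 = 0 ∧ hi h t i (pl h t (i + 1) - 1) = pl h t i + 2 ∧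
    0 < pl h t (i + 1) ∧ ∀ k, k + 1 < pl h t (i + 1) → lo h t i (k + 1) + 2 = hi h t i k := by
  by_cases hs : parse h t i = []
  · have : cuts (h i) (fs h t i) = [(0, 2)] := by rw [fs, hs, cuts_nil]
    have hl := length_cuts h t i
    rw [this, List.length_singleton] at hl
    simp only [lo, hi, this, ← hl]
    simp [pl, hs]
  · obtain ⟨h1, h2, h3, h4⟩ := (cutsFrom_cuts (h i) hs).index
    have hl := length_cuts h t i
    refine ⟨h1, ?_, ?_, fun k hk => h4 k (by rw [← hl] at hk; exact hk)⟩
    · rw [← hl]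
      have : (parse h t i).length = pl h t i := rfl
      simp only [hi, fs]; omega
    · rw [← hl]; exact List.length_pos_of_ne_nil h3

theorem cut_mem {i k : ℕ} (hk : k < pl h t (i + 1)) :
    (lo h t i k, hi h t i k) ∈ cuts (h i) (fs h t i) := by
  rw [← length_cuts] at hk
  simp only [lo, hi, List.getD_eq_getElem?_getD, List.getElem?_eq_getElem hk, Option.getD_some]
  exact List.getElem_mem hk

theorem cut_bound {i k : ℕ} (hk : k < pl h t (i + 1)) : lo h t i k + 2 ≤ hi h t i k ∧
    hi h t i k ≤ pl h t i + 2 ∧ (1 < pl h t (i + 1) → lo h t i k + 3 ≤ hi h t i k) := by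
  obtain ⟨h1, h2, h3⟩ := cuts_bound (cut_mem h t hk)
  refine ⟨h1, by simp only [pl]; omega, fun hp => h3 fun hs => ?_⟩
  have := length_cuts h t i
  rw [fs, hs, cuts_nil, List.length_singleton] at this
  omega

theorem cut_mono {i k k' : ℕ} (hkk : k ≤ k') (hk : k' < pl h t (i + 1)) :
    lo h t i k ≤ lo h t i k' ∧ hi h t i k ≤ hi h t i k' := by
  induction k', hkk using Nat.le_induction with
  | base => exact ⟨le_rfl, le_rfl⟩
  | succ k' hkk ih =>
    have := ih (by omega)
    have h1 := (cuts_index h t i).2.2.2 k' hk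
    have h2 := (cut_bound h t hk).2.2 (by omega)
    have h3 := (cut_bound h t (show k' < pl h t (i + 1) by omega)).2.2 (by omega)
    omega

/-- Every symbol of the flanked string lies in a phrase. -/
theorem exists_cut {i j : ℕ} (hj : j ≤ pl h t i + 2) :
    ∃ k < pl h t (i + 1), lo h t i k ≤ j ∧ j ≤ hi h t i k := by
  obtain ⟨h0, h1, h2, h3⟩ := cuts_index h t i
  have H : ∀ n, n < pl h t (i + 1) → lo h t i n ≤ j ∨ ∃ k < n, lo h t i k ≤ j ∧ j ≤ hi h t i k := by
    intro n hn
    induction n with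
    | zero => left; omega
    | succ n ih =>
      rcases ih (by omega) with hl | ⟨k, hk, hl⟩
      · by_cases hjn : j ≤ hi h t i n
        · exact .inr ⟨n, by omega, hl, hjn⟩
        · left; have := h3 n hn; omega
      · exact .inr ⟨k, by omega, hl⟩
  rcases H (pl h t (i + 1) - 1) (by omega) with hl | ⟨k, hk, hl⟩
  · exact ⟨_, by omega, hl, by omega⟩
  · exact ⟨k, by omega, hl⟩

theorem sL_zero (i : ℕ) : sL h t i 0 = 0 := rfl
theorem sR_zero (i : ℕ) : sR h t i 0 = 0 := rfl

theorem fspans_succ {i k : ℕ} (hk : k < pl h t i) :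
    (fspans h t i).getD (k + 1) (0, 0) = (spans h t i)[k]'(by rwa [length_spans]) := by
  have : k < (spans h t i).length := by rwa [length_spans]
  simp only [fspans, List.getD_cons_succ]
  rw [List.getD_append _ _ _ _ this, List.getD_eq_getElem _ _ this]

theorem fspans_end (i e : ℕ) : (fspans h t i).getD (pl h t i + 1 + e) (0, 0) =
    [(t.length + 1, t.length + 1), (t.length + 2, t.length + 2)].getD e (0, 0) := by
  rw [fspans, show pl h t i + 1 + e = pl h t i + e + 1 by omega, List.getD_cons_succ,
    List.getD_append_right _ _ _ _ (by rw [length_spans]; omega), length_spans,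
    Nat.add_sub_cancel_left]

theorem s_dollar (i : ℕ) : sL h t i (pl h t i + 1) = t.length + 1 ∧
    sR h t i (pl h t i + 1) = t.length + 1 := by
  have := fspans_end h t i 0
  simp only [sL, sR]
  rw [add_zero] at this
  rw [this]; simp

theorem s_hash (i : ℕ) : sL h t i (pl h t i + 2) = t.length + 2 ∧
    sR h t i (pl h t i + 2) = t.length + 2 := by
  have := fspans_end h t i 1
  simp only [sL, sR]
  rw [show pl h t i + 2 = pl h t i + 1 + 1 by omega, this]; simp

theorem s_level_zero {k : ℕ} (hk : k < t.length) : sL h t 0 (k + 1) = k + 1 ∧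
    sR h t 0 (k + 1) = k + 1 := by
  simp only [sL, sR, fspans_succ h t (i := 0) (k := k) (by rwa [pl_zero])]
  simp [spans]

theorem s_succ {i k : ℕ} (hk : k < pl h t (i + 1)) :
    sL h t (i + 1) (k + 1) = sL h t i (lo h t i k) ∧
    sR h t (i + 1) (k + 1) = sR h t i (hi h t i k) := by
  have hk' : k < (cuts (h i) (fs h t i)).length := by rwa [length_cuts]
  rw [sL, sR, fspans_succ h t hk]
  have e : (cuts (h i) (flank (parse h t i))).getD k (0, 0) =
      (cuts (h i) (flank (parse h t i)))[k]'hk' :=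
    List.getD_eq_getElem _ _ hk'
  simp only [spans, List.getElem_map, sL, sR, lo, hi, fs, fspans, e]
  exact ⟨rfl, rfl⟩

theorem index_cases {n j : ℕ} (hj : j ≤ n + 2) :
    j = 0 ∨ (∃ k < n, j = k + 1) ∨ j = n + 1 ∨ j = n + 2 := by
  rcases j with _ | j
  · exact .inl rfl
  · rcases lt_or_ge j n with h | h
    · exact .inr (.inl ⟨j, h, rfl⟩)
    · omega

/-- The covered intervals are ordered, nonempty, and leave no gaps. At the right end the order is
only claimed up to the closing `$`, which is what the last node and the `$` next to it share. -/
structure Ordered (i : ℕ) : Prop where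
  monoL : ∀ j j', j ≤ j' → j' ≤ pl h t i + 2 → sL h t i j ≤ sL h t i j'
  monoR : ∀ j j', j ≤ j' → j' ≤ pl h t i + 2 →
    min (sR h t i j) (t.length + 1) ≤ min (sR h t i j') (t.length + 1)
  le : ∀ j ≤ pl h t i + 2, sL h t i j ≤ sR h t i j
  next : ∀ j, j + 1 ≤ pl h t i + 2 → sL h t i (j + 1) ≤ sR h t i j + 1

theorem ordered_zero : Ordered h t 0 := by
  obtain ⟨d1, d2⟩ := s_dollar h t 0
  obtain ⟨e1, e2⟩ := s_hash h t 0
  have hL : ∀ j ≤ pl h t 0 + 2, sL h t 0 j = j ∧ sR h t 0 j = j := by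
    intro j hj
    rcases index_cases hj with rfl | ⟨k, hk, rfl⟩ | rfl | rfl
    · exact ⟨rfl, rfl⟩
    · exact s_level_zero h t (by rwa [pl_zero] at hk)
    · rw [d1, d2, pl_zero]; simp
    · rw [e1, e2, pl_zero]; simp
  refine ⟨fun j j' h1 h2 => ?_, fun j j' h1 h2 => ?_, fun j hj => ?_, fun j hj => ?_⟩
  · rw [(hL j (by omega)).1, (hL j' h2).1]; exact h1
  · rw [(hL j (by omega)).2, (hL j' h2).2]; omega
  · rw [(hL j hj).1, (hL j hj).2]
  · rw [(hL (j + 1) hj).1, (hL j (by omega)).2]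

theorem ordered_succ {i : ℕ} (ho : Ordered h t i) : Ordered h t (i + 1) := by
  obtain ⟨d1, d2⟩ := s_dollar h t (i + 1)
  obtain ⟨e1, e2⟩ := s_hash h t (i + 1)
  obtain ⟨d1', d2'⟩ := s_dollar h t i
  obtain ⟨e1', e2'⟩ := s_hash h t i
  obtain ⟨c1, c2, c3, c4⟩ := cuts_index h t i
  have hle1 : ∀ k < pl h t (i + 1), sL h t (i + 1) (k + 1) ≤ t.length + 1 := by
    intro k hk
    have := cut_bound h t hk
    rw [(s_succ h t hk).1, ← d1']
    exact ho.monoL _ _ (by omega) (by omega)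
  have hle : ∀ j ≤ pl h t (i + 1) + 2, sL h t (i + 1) j ≤ sR h t (i + 1) j := by
    intro j hj
    rcases index_cases hj with rfl | ⟨k, hk, rfl⟩ | rfl | rfl
    · exact le_rfl
    · have := cut_bound h t hk
      rw [(s_succ h t hk).1, (s_succ h t hk).2]
      exact (ho.monoL _ _ (by omega) this.2.1).trans (ho.le _ this.2.1)
    · rw [d1, d2]
    · rw [e1, e2]
  refine ⟨fun j j' h1 h2 => ?_, fun j j' h1 h2 => ?_, hle, fun j hj => ?_⟩
  · rcases index_cases h2 with rfl | ⟨k', hk', rfl⟩ | rfl | rfl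
    · obtain rfl : j = 0 := by omega
      rfl
    · rcases j with _ | k
      · exact Nat.zero_le _
      · rw [(s_succ h t hk').1, (s_succ h t (by omega : k < _)).1]
        have := cut_bound h t hk'
        exact ho.monoL _ _ (cut_mono h t (by omega) hk').1 (by omega)
    · rw [d1]
      rcases index_cases (h1.trans h2) with rfl | ⟨k, hk, rfl⟩ | rfl | rfl
      · exact Nat.zero_le _
      · exact hle1 k hk
      · rw [d1]
      · omega
    · rw [e1]
      rcases index_cases (h1.trans h2) with rfl | ⟨k, hk, rfl⟩ | rfl | rfl
      · exact Nat.zero_le _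
      · have := hle1 k hk; omega
      · rw [d1]; omega
      · rw [e1]
  · rcases index_cases h2 with rfl | ⟨k', hk', rfl⟩ | rfl | rfl
    · obtain rfl : j = 0 := by omega
      rfl
    · rcases j with _ | k
      · rw [sR_zero]; omega
      · rw [(s_succ h t hk').2, (s_succ h t (by omega : k < _)).2]
        exact ho.monoR _ _ (cut_mono h t (by omega) hk').2 (cut_bound h t hk').2.1
    · rw [d2]; omega
    · rw [e2]; omega
  · rcases index_cases (show j ≤ _ from (Nat.le_succ j).trans hj) with rfl | ⟨k, hk, rfl⟩ | rfl | rfl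
    · rw [sR_zero, (s_succ h t c3).1, c1, sL_zero]; omega
    · rcases Nat.lt_or_ge (k + 1) (pl h t (i + 1)) with hk2 | hk2
      · rw [(s_succ h t hk2).1, (s_succ h t hk).2]
        have h5 := c4 k hk2
        have h6 := cut_bound h t hk
        exact ((ho.monoL _ _ (by omega) h6.2.1).trans (ho.le _ h6.2.1)).trans (Nat.le_succ _)
      · obtain rfl : k = pl h t (i + 1) - 1 := by omega
        rw [(s_succ h t hk).2, c2, e2', show pl h t (i + 1) - 1 + 1 + 1 = pl h t (i + 1) + 1 by omega,
          d1]; omega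
    · rw [d2, show pl h t (i + 1) + 1 + 1 = pl h t (i + 1) + 2 by omega, e1]
    · omega

theorem ordered (i : ℕ) : Ordered h t i := by
  induction i with
  | zero => exact ordered_zero h t
  | succ i ih => exact ordered_succ h t ih


/-! ### The lowest node that covers an occurrence -/

/-- Node `k` of level `i` covers `t[a .. a+len-1]` and its two neighbours. -/
def Cov (a len i k : ℕ) : Prop :=
  k < pl h t i ∧ sL h t i (k + 1) ≤ a ∧ a + len + 1 ≤ sR h t i (k + 1)

/-- Every position of a level lies in some phrase, so that a covering node has a covering parent. -/
theorem Cov.up {a len i k : ℕ} (hlen : a + len ≤ t.length) (hc : Cov h t a len i k) :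
    ∃ k', Cov h t a len (i + 1) k' := by
  obtain ⟨h1, h2, h3⟩ := hc
  obtain ⟨k', hk', h4, h5⟩ := exists_cut h t (i := i) (j := k + 1) (by omega)
  have ho := ordered h t i
  obtain ⟨e1, e2⟩ := s_succ h t hk'
  have h6 := ho.monoL _ _ h4 (by omega)
  have h7 := ho.monoR _ _ h5 (cut_bound h t hk').2.1
  exact ⟨k', hk', by omega, by omega⟩

/-- A node that covers an occurrence has a child that does so if any node of the level of its
children does. -/
theorem Cov.down {a len i k j : ℕ} (hlen : a + len ≤ t.length) (hc : Cov h t a len (i + 1) k)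
    (hj : j ≤ pl h t i + 2) (h1 : sL h t i j ≤ a) (h2 : a + len + 1 ≤ sR h t i j) :
    ∃ j', lo h t i k ≤ j' ∧ j' ≤ hi h t i k ∧ sL h t i j' ≤ a ∧ a + len + 1 ≤ sR h t i j' := by
  obtain ⟨c1, c2, c3⟩ := hc
  have ho := ordered h t i
  obtain ⟨e1, e2⟩ := s_succ h t c1
  have hb := cut_bound h t c1
  rw [e1] at c2
  rw [e2] at c3
  by_cases hlo : j < lo h t i k
  · have := ho.monoR _ _ hlo.le (by omega)
    exact ⟨_, le_rfl, by omega, c2, by omega⟩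
  by_cases hhi : hi h t i k < j
  · have := ho.monoL _ _ hhi.le (by omega)
    exact ⟨_, by omega, le_rfl, by omega, c3⟩
  exact ⟨j, by omega, by omega, h1, h2⟩

/-- The only positions of a level that cover more than one position of the text are the nodes of the
positive levels. -/
theorem narrow {i j : ℕ} (hj : j ≤ pl h t i + 2) (hlt : sL h t i j + 1 ≤ sR h t i j) :
    ∃ k, j = k + 1 ∧ k < pl h t i ∧ 1 ≤ i := by
  obtain ⟨d1, d2⟩ := s_dollar h t i
  obtain ⟨e1, e2⟩ := s_hash h t i
  rcases index_cases hj with rfl | ⟨k, hk, rfl⟩ | rfl | rfl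
  · rw [sR_zero] at hlt; omega
  · refine ⟨k, rfl, hk, ?_⟩
    by_contra hi
    obtain rfl : i = 0 := by omega
    rw [pl_zero] at hk
    have := s_level_zero h t hk
    omega
  · omega
  · omega

/-- Whether a covering node is lowest can be read off the intervals of its children. -/
theorem Cov.lowest_iff {a len i k : ℕ} (hlen : a + len ≤ t.length) (hc : Cov h t a len (i + 1) k) :
    (∀ i' k', 1 ≤ i' → i' < i + 1 → ¬ Cov h t a len i' k') ↔
      ∀ j, lo h t i k ≤ j → j ≤ hi h t i k → ¬ (sL h t i j ≤ a ∧ a + len + 1 ≤ sR h t i j) := by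
  constructor
  · rintro H j h1 h2 ⟨h3, h4⟩
    have hb := cut_bound h t hc.1
    obtain ⟨k', rfl, hk', hi⟩ := narrow h t (i := i) (j := j) (by omega) (by omega)
    exact H i k' hi (by omega) ⟨hk', h3, h4⟩
  · intro H i' k' h1 h2 hc'
    have : ∃ k'', Cov h t a len i k'' := by
      clear H hc
      induction i, (show i' ≤ i by omega) using Nat.le_induction with
      | base => exact ⟨k', hc'⟩
      | succ n hn ih =>
        obtain ⟨k'', hk''⟩ := ih (by omega)
        exact hk''.up h t hlen
    obtain ⟨k'', h3, h4, h5⟩ := this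
    obtain ⟨j, h6, h7, h8⟩ := hc.down h t hlen (by omega) h4 h5
    exact H j h6 h7 h8

/-- Whether a covering node is the rightmost one of its level can be read off its children, too: the
next node begins with the third last child of this one, as the phrases overlap in three symbols. -/
theorem Cov.rightmost_iff {a len i k : ℕ} (hlen : a + len ≤ t.length)
    (hc : Cov h t a len (i + 1) k) :
    (∀ k', k < k' → ¬ Cov h t a len (i + 1) k') ↔
      (hi h t i k = pl h t i + 2 ∨ a < sL h t i (hi h t i k - 2)) := by
  obtain ⟨c0, cl, cp, cn⟩ := cuts_index h t i
  have ho := ordered h t (i + 1)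
  obtain ⟨h1, h2, h3⟩ := hc
  rcases Nat.lt_or_ge (k + 1) (pl h t (i + 1)) with hk | hk
  · have e1 := (s_succ h t hk).1
    have e2 := cn k hk
    have e3 := cut_bound h t hk
    have e4 := e3.2.2 (by omega)
    rw [show lo h t i (k + 1) = hi h t i k - 2 by omega] at e1
    rw [← e1]
    have hne : hi h t i k ≠ pl h t i + 2 := by omega
    simp only [hne, false_or]
    have hR := ho.monoR (k + 1) (k + 1 + 1) (by omega) (by omega)
    constructor
    · intro H
      by_contra hlt
      exact H (k + 1) (by omega) ⟨hk, by omega, by omega⟩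
    · rintro H k' hk' ⟨h4, h5, h6⟩
      have := ho.monoL (k + 1 + 1) (k' + 1) (by omega) (by omega)
      omega
  · have hk1 : k = pl h t (i + 1) - 1 := by omega
    rw [← hk1] at cl
    simp only [cl, true_or, iff_true]
    intro k' hk' hc'
    have := hc'.1
    omega

/-! ### Nodes with equal labels -/

theorem pe_add (i l n : ℕ) : pe h t i (l + n) = pe h t i l + elen (((fs h t i).drop l).take n) := by
  rw [pe, List.take_add, elen_append, pe]

theorem pe_one (i : ℕ) : pe h t i 1 = 0 := by simp [pe, fs, flank, GSym.efexp]

theorem pe_end (i e : ℕ) (he : e ≤ 2) : pe h t i (pl h t i + 1 + e) = t.length := by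
  have : (fs h t i).take (pl h t i + 1 + e) =
      .dollar :: (parse h t i ++ [GSym.dollar, .hash].take e) := by
    rw [fs, flank, show pl h t i + 1 + e = pl h t i + e + 1 by omega, List.take_succ_cons, pl,
      List.take_length_add_append]
  rw [pe, this]
  have : e = 0 ∨ e = 1 ∨ e = 2 := by omega
  rcases this with rfl | rfl | rfl <;> simp [GSym.efexp, elen_parse]

theorem label_eq {i k : ℕ} (hk : k < pl h t (i + 1)) :
    (parse h t (i + 1))[k]? =
      some (.rule (((fs h t i).drop (lo h t i k)).take (hi h t i k + 1 - lo h t i k))) := by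
  have hk' : k < (cuts (h i) (fs h t i)).length := by rwa [length_cuts]
  have e1 : (parse h t (i + 1)) = (cuts (h i) (fs h t i)).map fun c =>
    .rule (((fs h t i).drop c.1).take (c.2 + 1 - c.1)) := by
    simp [parse, phrases, fs, Function.comp_def]
  rw [e1, List.getElem?_map, List.getElem?_eq_getElem hk']
  simp only [lo, hi, List.getD_eq_getElem _ _ hk', Option.map_some]

theorem fs_succ (i k : ℕ) (hk : k < pl h t i) : (fs h t i)[k + 1]? = (parse h t i)[k]? := by
  simp only [fs, flank, List.getElem?_cons_succ]
  rw [List.getElem?_append_left hk]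

theorem fs_end (i e : ℕ) : (fs h t i)[pl h t i + 1 + e]? = [GSym.dollar, .hash][e]? := by
  rw [fs, flank, show pl h t i + 1 + e = pl h t i + e + 1 by omega, List.getElem?_cons_succ,
    List.getElem?_append_right (by simp [pl]), pl, Nat.add_sub_cancel_left]

theorem parse_ne_flank {i : ℕ} {A : GSym} (hA : A ∈ parse h t i) : A ≠ .dollar ∧ A ≠ .hash := by
  cases i with
  | zero => obtain ⟨c, -, rfl⟩ := List.mem_map.1 hA; simp
  | succ i => obtain ⟨F, -, rfl⟩ := List.mem_map.1 hA; simp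

/-- The `efexp` expansion of a node starts where that of its second child starts. -/
theorem pe_succ {i k : ℕ} (hk : k < pl h t (i + 1)) :
    pe h t (i + 1) (k + 1) = pe h t i (lo h t i k + 1) := by
  obtain ⟨c0, cl, cp, cn⟩ := cuts_index h t i
  induction k with
  | zero => rw [c0, pe_one, pe_one]
  | succ k ih =>
    have hk' : k < pl h t (i + 1) := by omega
    have h2 := cn k hk
    have h3 := cut_bound h t hk'
    have h4 := h3.2.2 (by omega)
    rw [pe_add h t (i + 1) (k + 1) 1, ih hk',
      show lo h t i (k + 1) + 1 = lo h t i k + 1 + (hi h t i k - 2 - lo h t i k) by omega,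
      pe_add h t i (lo h t i k + 1)]
    congr 1
    have hl := label_eq h t hk'
    rw [← fs_succ h t (i + 1) k hk'] at hl
    obtain ⟨hlt, hl⟩ := List.getElem?_eq_some_iff.1 hl
    rw [List.drop_eq_getElem_cons hlt, hl]
    simp only [List.take_succ_cons, List.take_zero, elen_cons, elen_nil, add_zero]
    rw [length_efexp_rule, middle_slice h3.1 (by rw [length_fs]; omega)]

theorem efStart_eq (i k : ℕ) (hk : k < pl h t i) : elen ((parse h t i).take k) = pe h t i (k + 1) := by
  rw [pe, fs, flank, List.take_succ_cons, List.take_append_of_le_length hk.le]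
  simp [GSym.efexp]

/-- The symbol at position `u` of the flanked text. -/
def ft (t : List ℕ) (u : ℕ) : Option GSym := (flank (t.map .letter))[u]?

/-- Position `j` of level `i` in `t`, and position `j'` in `t'`, cover the same text, shifted by the
difference of the starting positions of the `efexp` expansions. -/
structure Alike (t' : List ℕ) (i j j' : ℕ) : Prop where
  left : sL h t' i j' + pe h t i j = sL h t i j + pe h t' i j'
  right : sR h t' i j' + pe h t i j = sR h t i j + pe h t' i j'
  text : ∀ u u', sL h t i j ≤ u → u ≤ sR h t i j → u' + pe h t i j = u + pe h t' i j' →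
    ft t u = ft t' u'

theorem ft_eq (u : ℕ) : ft t u = (fs h t 0)[u]? := rfl

theorem fs_zero (i : ℕ) : (fs h t i)[0]? = some .dollar := rfl

/-- Nodes with equal labels have the same numbers of children, with equal symbols; the children
start at the same distances from the nodes. -/
theorem children {t' : List ℕ} {i k k' : ℕ} (hk : k < pl h t (i + 1)) (hk' : k' < pl h t' (i + 1))
    (he : (parse h t (i + 1))[k]? = (parse h t' (i + 1))[k']?) :
    ∃ n, 2 ≤ n ∧ hi h t i k = lo h t i k + n ∧ hi h t' i k' = lo h t' i k' + n ∧ ∀ m ≤ n,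
      (fs h t i)[lo h t i k + m]? = (fs h t' i)[lo h t' i k' + m]? ∧
      (lo h t i k + m = 0 ↔ lo h t' i k' + m = 0) ∧
      pe h t i (lo h t i k + m) + pe h t' (i + 1) (k' + 1) =
        pe h t' i (lo h t' i k' + m) + pe h t (i + 1) (k + 1) := by
  rw [label_eq h t hk, label_eq h t' hk'] at he
  have he := GSym.rule.inj (Option.some.inj he)
  have b := cut_bound h t hk
  have b' := cut_bound h t' hk'
  obtain ⟨n, hn⟩ : ∃ n, hi h t i k = lo h t i k + n := ⟨_, (Nat.add_sub_cancel' (by omega)).symm⟩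
  obtain ⟨n', hn'⟩ : ∃ n', hi h t' i k' = lo h t' i k' + n' :=
    ⟨_, (Nat.add_sub_cancel' (by omega)).symm⟩
  have hlen := congrArg List.length he
  simp only [List.length_take, List.length_drop, length_fs] at hlen
  obtain rfl : n = n' := by omega
  rw [hn, hn', show lo h t i k + n + 1 - lo h t i k = n + 1 by omega,
    show lo h t' i k' + n + 1 - lo h t' i k' = n + 1 by omega] at he
  have hsym : ∀ m ≤ n, (fs h t i)[lo h t i k + m]? = (fs h t' i)[lo h t' i k' + m]? := by
    intro m hm
    have := congrArg (fun l => l[m]?) he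
    simpa [List.getElem?_take, Nat.lt_succ_of_le hm] using this
  -- Only the first phrase starts with the symbol `$`.
  have hdollar : ∀ (t : List ℕ) j, j ≤ pl h t i → (fs h t i)[j]? = some .dollar → j = 0 := by
    intro t j hj hd
    rcases j with _ | j
    · rfl
    · have hj' : j < (parse h t i).length := by
        have : (parse h t i).length = pl h t i := rfl
        omega
      rw [fs_succ h t i j hj, List.getElem?_eq_getElem hj'] at hd
      exact absurd (Option.some.inj hd) (parse_ne_flank h t (List.getElem_mem hj')).1
  have hlo0 : lo h t i k = 0 ↔ lo h t' i k' = 0 := by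
    have h1 := hsym 0 (by omega)
    simp only [add_zero] at h1
    constructor
    · intro h2
      rw [h2, fs_zero] at h1
      exact hdollar t' _ (by omega) h1.symm
    · intro h2
      rw [h2, fs_zero] at h1
      exact hdollar t _ (by omega) h1
  have hpe : ∀ m ≤ n + 1, pe h t i (lo h t i k + m) + pe h t' i (lo h t' i k') =
      pe h t' i (lo h t' i k' + m) + pe h t i (lo h t i k) := by
    intro m hm
    rw [pe_add, pe_add]
    have := congrArg (fun l => elen (l.take m)) he
    simp only [List.take_take, min_eq_left hm] at this
    omega
  refine ⟨n, by omega, hn, hn', fun m hm => ⟨hsym m hm, ?_, ?_⟩⟩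
  · rcases m with _ | m
    · simpa using hlo0
    · omega
  · have p := pe_succ h t hk
    have p' := pe_succ h t' hk'
    have h1 := hpe 1 (by omega)
    have h2 := hpe m (by omega)
    omega

/-- Positions with equal symbols cover equal texts, by induction over the levels. The extra condition
separates the two occurrences of the flanking symbol that a level begins and almost ends with. -/
theorem alike {t' : List ℕ} {i : ℕ} : ∀ {j j' : ℕ}, j ≤ pl h t i + 2 → j' ≤ pl h t' i + 2 →
    (fs h t i)[j]? = (fs h t' i)[j']? → (j = 0 ↔ j' = 0) → Alike h t t' i j j' := by
  -- The symbols that flank a level behave alike on all levels.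
  have flanks : ∀ {i j j' : ℕ}, j ≤ pl h t i + 2 → j' ≤ pl h t' i + 2 →
      (fs h t i)[j]? = (fs h t' i)[j']? → (j = 0 ↔ j' = 0) → Alike h t t' i j j' ∨
      ∃ k k', j = k + 1 ∧ j' = k' + 1 ∧ k < pl h t i ∧ k' < pl h t' i := by
    intro i j j' hj hj' he h0
    obtain ⟨d1, d2⟩ := s_dollar h t i
    obtain ⟨e1, e2⟩ := s_hash h t i
    obtain ⟨d1', d2'⟩ := s_dollar h t' i
    obtain ⟨e1', e2'⟩ := s_hash h t' i
    have p1 := pe_end h t i 0 (by omega)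
    have p2 := pe_end h t i 1 (by omega)
    have p1' := pe_end h t' i 0 (by omega)
    have p2' := pe_end h t' i 1 (by omega)
    have f1 := fs_end h t i 0
    have f2 := fs_end h t i 1
    have f1' := fs_end h t' i 0
    have f2' := fs_end h t' i 1
    have q1 := fs_end h t 0 0
    have q2 := fs_end h t 0 1
    have q1' := fs_end h t' 0 0
    have q2' := fs_end h t' 0 1
    rw [pl_zero, ← ft_eq] at q1 q2 q1' q2'
    have nof : ∀ (t : List ℕ) k, k < pl h t i → (fs h t i)[k + 1]? ≠ some .dollar ∧
        (fs h t i)[k + 1]? ≠ some .hash := by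
      intro t k hk
      have hk' : k < (parse h t i).length := hk
      rw [fs_succ h t i k hk, List.getElem?_eq_getElem hk']
      have := parse_ne_flank h t (List.getElem_mem hk')
      simpa using this
    rcases index_cases hj with rfl | ⟨k, hk, rfl⟩ | rfl | rfl
    · have hj0 := h0.1 rfl
      subst hj0
      left
      refine ⟨by simp [sL_zero, pe], by simp [sR_zero, pe], fun u u' h1 h2 h3 => ?_⟩
      rw [sR_zero] at h2
      have p0 : pe h t i 0 = 0 := by simp [pe]
      have p0' : pe h t' i 0 = 0 := by simp [pe]
      obtain rfl : u = 0 := by omega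
      obtain rfl : u' = 0 := by omega
      rfl
    · rcases index_cases hj' with rfl | ⟨k', hk', rfl⟩ | rfl | rfl
      · omega
      · exact .inr ⟨k, k', rfl, rfl, hk, hk'⟩
      · exact absurd (he.trans f1') (nof t k hk).1
      · exact absurd (he.trans f2') (nof t k hk).2
    · rcases index_cases hj' with rfl | ⟨k', hk', rfl⟩ | rfl | rfl
      · omega
      · exact absurd (he.symm.trans f1) (nof t' k' hk').1
      · left
        simp only [add_zero] at p1 p1' q1 q1'
        refine ⟨by omega, by omega, fun u u' h1 h2 h3 => ?_⟩
        rw [show u = t.length + 1 by omega, show u' = t'.length + 1 by omega, q1, q1']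
      · rw [show pl h t i + 1 = pl h t i + 1 + 0 by rfl, f1,
          show pl h t' i + 2 = pl h t' i + 1 + 1 by rfl, f2'] at he
        simp at he
    · rcases index_cases hj' with rfl | ⟨k', hk', rfl⟩ | rfl | rfl
      · omega
      · exact absurd (he.symm.trans f2) (nof t' k' hk').2
      · rw [show pl h t' i + 1 = pl h t' i + 1 + 0 by rfl, f1',
          show pl h t i + 2 = pl h t i + 1 + 1 by rfl, f2] at he
        simp at he
      · left
        rw [show pl h t i + 1 + 1 = pl h t i + 2 by rfl] at p2
        rw [show pl h t' i + 1 + 1 = pl h t' i + 2 by rfl] at p2'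
        refine ⟨by omega, by omega, fun u u' h1 h2 h3 => ?_⟩
        rw [show u = t.length + 1 + 1 by omega, show u' = t'.length + 1 + 1 by omega, q2, q2']
  induction i with
  | zero =>
    intro j j' hj hj' he h0
    rcases flanks hj hj' he h0 with hA | ⟨k, k', rfl, rfl, hk, hk'⟩
    · exact hA
    have hp : ∀ (t : List ℕ) k, k < pl h t 0 → pe h t 0 (k + 1) = k := by
      intro t k hk
      rw [← efStart_eq h t 0 k hk]
      have : k ≤ t.length := by rw [pl_zero] at hk; omega
      simp [parse, elen, Function.comp_def, GSym.efexp, this]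
    have s1 := s_level_zero h t (by rwa [pl_zero] at hk)
    have s2 := s_level_zero h t' (by rwa [pl_zero] at hk')
    have p1 := hp t k hk
    have p2 := hp t' k' hk'
    refine ⟨by omega, by omega, fun u u' h1 h2 h3 => ?_⟩
    rw [show u = k + 1 by omega, show u' = k' + 1 by omega]
    exact he
  | succ i ih =>
    intro j j' hj hj' he h0
    rcases flanks hj hj' he h0 with hA | ⟨k, k', rfl, rfl, hk, hk'⟩
    · exact hA
    rw [fs_succ h t _ k hk, fs_succ h t' _ k' hk'] at he
    obtain ⟨n, hn2, hn, hn', hch⟩ := children h t hk hk' he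
    have b := cut_bound h t hk
    have b' := cut_bound h t' hk'
    have hA : ∀ m ≤ n, Alike h t t' i (lo h t i k + m) (lo h t' i k' + m) := by
      intro m hm
      exact ih (by omega) (by omega) (hch m hm).1 (hch m hm).2.1
    obtain ⟨s1, s2⟩ := s_succ h t hk
    obtain ⟨s1', s2'⟩ := s_succ h t' hk'
    have hpe0 := (hch 0 (by omega)).2.2
    have hpen := (hch n le_rfl).2.2
    have hA0 := hA 0 (by omega)
    have hAn := hA n le_rfl
    rw [hn] at s2
    rw [hn'] at s2'
    have l0 := hA0.left
    have rn := hAn.right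
    simp only [add_zero] at l0 hpe0
    refine ⟨by omega, by omega, fun u u' h1 h2 h3 => ?_⟩
    rw [s1] at h1
    rw [s2] at h2
    -- The intervals of the children leave no gap, so that one of them contains `u`.
    have : ∃ m ≤ n, sL h t i (lo h t i k + m) ≤ u ∧ u ≤ sR h t i (lo h t i k + m) := by
      have H : ∀ n' ≤ n, u ≤ sR h t i (lo h t i k + n') →
          ∃ m ≤ n', sL h t i (lo h t i k + m) ≤ u ∧ u ≤ sR h t i (lo h t i k + m) := by
        intro n'
        induction n' with
        | zero => intro _ h4; exact ⟨0, le_rfl, h1, h4⟩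
        | succ n' ih' =>
          intro h4 h5
          by_cases h6 : sL h t i (lo h t i k + (n' + 1)) ≤ u
          · exact ⟨n' + 1, le_rfl, h6, h5⟩
          · have h7 := (ordered h t i).next (lo h t i k + n') (by omega)
            rw [add_assoc] at h7
            obtain ⟨m, hm, h8⟩ := ih' (by omega) (by omega)
            exact ⟨m, by omega, h8⟩
      exact H n le_rfl h2
    obtain ⟨m, hm, h4, h5⟩ := this
    have hpem := (hch m hm).2.2
    exact (hA m hm).text u u' h4 h5 (by omega)

end Geometry

/-! ### Loci and maximal exact matches -/

section Locus

variable (h : ℕ → GSym → ℕ) (R : ℕ) (t : List ℕ)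

/-- Node `k` of level `i` is the lowest one, and the rightmost one of its level, that covers
`t[a .. a+len-1]` and its two neighbours. -/
structure IsLow (a len i k : ℕ) : Prop where
  one_le : 1 ≤ i
  le : i ≤ R
  cov : Cov h t a len i k
  low : ∀ i' k', 1 ≤ i' → i' < i → ¬ Cov h t a len i' k'
  right : ∀ k', k < k' → ¬ Cov h t a len i k'

theorem IsLow.unique {h : ℕ → GSym → ℕ} {R : ℕ} {t : List ℕ} {a len i k i' k' : ℕ}
    (H : IsLow h R t a len i k) (H' : IsLow h R t a len i' k') : i = i' ∧ k = k' := by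
  have h1 : ¬ i < i' := fun hlt => H'.low i k H.one_le hlt H.cov
  have h2 : ¬ i' < i := fun hlt => H.low i' k' H'.one_le hlt H'.cov
  obtain rfl : i = i' := by omega
  have h3 : ¬ k < k' := fun hlt => H.right k' hlt H'.cov
  have h4 : ¬ k' < k := fun hlt => H'.right k hlt H.cov
  exact ⟨rfl, by omega⟩

/-- An occurrence that some node covers has a lowest and rightmost covering node. -/
theorem exists_isLow {a len i k : ℕ} (h1 : 1 ≤ i) (h2 : i ≤ R) (hc : Cov h t a len i k) :
    ∃ i k, IsLow h R t a len i k := by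
  classical
  have hex : ∃ i, 1 ≤ i ∧ i ≤ R ∧ ∃ k, Cov h t a len i k := ⟨i, h1, h2, k, hc⟩
  obtain ⟨g1, g2, g3⟩ := Nat.find_spec hex
  obtain ⟨k₁, hk₁⟩ := g3
  obtain ⟨k₂, hk₂, hmax⟩ : ∃ k, Cov h t a len (Nat.find hex) k ∧
      ∀ k', k < k' → ¬ Cov h t a len (Nat.find hex) k' := by
    let s := (Finset.range (pl h t (Nat.find hex))).filter fun k => Cov h t a len (Nat.find hex) k
    have hs : s.Nonempty := ⟨k₁, by simp [s, hk₁, hk₁.1]⟩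
    refine ⟨s.max' hs, (Finset.mem_filter.1 (s.max'_mem hs)).2, fun k' hk' hc' => ?_⟩
    have := s.le_max' k' (by simp [s, hc', hc'.1])
    omega
  refine ⟨_, k₂, g1, g2, hk₂, fun i' k' h3 h4 h5 => ?_, hmax⟩
  exact Nat.find_min hex h4 ⟨h3, h4.le.trans g2, k', h5⟩

theorem ft_zero (t : List ℕ) : ft t 0 = some .dollar := rfl

theorem ft_succ (t : List ℕ) {j : ℕ} (hj : j < t.length) : ft t (j + 1) = some (.letter t[j]) := by
  simp [ft, flank, List.getElem?_append_left, hj]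

theorem ft_last (t : List ℕ) : ft t (t.length + 1) = some .dollar := by
  simp [ft, flank]

/-- The locus of an occurrence is determined by the label of the node and the position relative to
it: below every node with the same label the same text occurs at the same relative position, and
that node is the lowest one there, too. -/
theorem IsLow.transfer {h : ℕ → GSym → ℕ} {R : ℕ} {t t' : List ℕ} {a len i k k' : ℕ}
    (H : IsLow h R t a len i k) (hpos : 1 ≤ len) (hlen : a + len ≤ t.length)
    (hk' : k' < pl h t' i) (he : (parse h t i)[k]? = (parse h t' i)[k']?) :
    ∃ a', a' + elen ((parse h t i).take k) = a + elen ((parse h t' i).take k') ∧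
      a' + len ≤ t'.length ∧ IsLow h R t' a' len i k' ∧
      ∀ u ≤ len + 1, ft t (a + u) = ft t' (a' + u) := by
  obtain ⟨h1, h2, hc, hlow, hright⟩ := H
  obtain ⟨i, rfl⟩ : ∃ i₀, i = i₀ + 1 := ⟨i - 1, by omega⟩
  have hk := hc.1
  have hA := alike h t (t' := t') (i := i + 1) (j := k + 1) (j' := k' + 1) (by omega) (by omega)
    (by rw [fs_succ h t _ k hk, fs_succ h t' _ k' hk', he]) (by simp)
  obtain ⟨-, c1, c2⟩ := hc
  have hl := hA.left
  have hr := hA.right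
  obtain ⟨a', ha'⟩ : ∃ a', a' + pe h t (i + 1) (k + 1) = a + pe h t' (i + 1) (k' + 1) :=
    ⟨a + pe h t' (i + 1) (k' + 1) - pe h t (i + 1) (k + 1), by omega⟩
  have htext : ∀ u ≤ len + 1, ft t (a + u) = ft t' (a' + u) := fun u hu =>
    hA.text _ _ (by omega) (by omega) (by omega)
  have hlen' : a' + len ≤ t'.length := by
    have h3 := htext len (by omega)
    obtain ⟨l, rfl⟩ : ∃ l, len = l + 1 := ⟨len - 1, by omega⟩
    rw [← add_assoc, ← add_assoc, ft_succ t (by omega)] at h3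
    by_contra hlt
    have h4 : a' + l < (flank (t'.map GSym.letter)).length - 1 := by
      obtain ⟨h5, -⟩ := List.getElem?_eq_some_iff.1 h3.symm
      omega
    simp only [length_flank, List.length_map] at h4
    have h6 : a' + l + 1 = t'.length + 1 ∨ a' + l + 1 = t'.length + 2 := by omega
    rcases h6 with h6 | h6
    · rw [h6, ft_last] at h3; simp at h3
    · rw [h6] at h3; simp [ft, flank] at h3
  have hc' : Cov h t' a' len (i + 1) k' := ⟨hk', by omega, by omega⟩
  have hc : Cov h t a len (i + 1) k := ⟨hk, c1, c2⟩
  obtain ⟨n, hn2, hn, hn', hch⟩ := children h t hk hk' he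
  have b := cut_bound h t hk
  have b' := cut_bound h t' hk'
  have hAc : ∀ m ≤ n, Alike h t t' i (lo h t i k + m) (lo h t' i k' + m) := fun m hm =>
    alike h t (by omega) (by omega) (hch m hm).1 (hch m hm).2.1
  refine ⟨a', ?_, hlen', ⟨h1, h2, hc', ?_, ?_⟩, htext⟩
  · rw [efStart_eq h t _ k hk, efStart_eq h t' _ k' hk', ha']
  · rw [hc'.lowest_iff h t' hlen']
    rw [hc.lowest_iff h t hlen] at hlow
    rintro j h3 h4 ⟨h5, h6⟩
    obtain ⟨m, rfl⟩ : ∃ m, j = lo h t' i k' + m := ⟨_, (Nat.add_sub_cancel' h3).symm⟩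
    have hm : m ≤ n := by omega
    have q1 := (hAc m hm).left
    have q2 := (hAc m hm).right
    have q3 := (hch m hm).2.2
    exact hlow (lo h t i k + m) (by omega) (by omega) ⟨by omega, by omega⟩
  · rw [hc'.rightmost_iff h t' hlen']
    rw [hc.rightmost_iff h t hlen] at hright
    rcases hright with h3 | h3
    · left
      have h4 := (hch n le_rfl).1
      rw [← hn, ← hn', h3, show pl h t i + 2 = pl h t i + 1 + 1 by rfl, fs_end] at h4
      rcases index_cases b'.2.1 with h5 | ⟨j, hj, h5⟩ | h5 | h5
      · rw [h5, fs_zero] at h4; simp at h4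
      · have hj' : j < (parse h t' i).length := hj
        rw [h5, fs_succ h t' i j hj, List.getElem?_eq_getElem hj'] at h4
        exact absurd (Option.some.inj h4).symm (parse_ne_flank h t' (List.getElem_mem hj')).2
      · rw [h5, show pl h t' i + 1 = pl h t' i + 1 + 0 by rfl, fs_end] at h4; simp at h4
      · exact h5
    · right
      have q1 := (hAc (n - 2) (by omega)).left
      have q3 := (hch (n - 2) (by omega)).2.2
      rw [show hi h t i k - 2 = lo h t i k + (n - 2) by omega] at h3
      rw [show hi h t' i k' - 2 = lo h t' i k' + (n - 2) by omega]
      omega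

end Locus

theorem ft_eq_dollar_left {t : List ℕ} {a : ℕ} (ha : a < t.length) :
    ft t a = some .dollar ↔ a = 0 := by
  cases a with
  | zero => simp [ft_zero]
  | succ a => simp [ft_succ t (by omega : a < t.length)]

theorem ft_eq_dollar_right {t : List ℕ} {a : ℕ} (ha : a ≤ t.length) (h0 : 0 < a) :
    ft t (a + 1) = some .dollar ↔ a = t.length := by
  rcases Nat.lt_or_ge a t.length with h | h
  · simp [ft_succ t h]; omega
  · obtain rfl : a = t.length := by omega
    simp [ft_last]

/-- Whether an occurrence of two substrings is a maximal exact match depends only on the substrings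
and their neighbours in the flanked texts. -/
theorem isMEM_iff {T : List (List ℕ)} {x y a b len : ℕ} (hpos : 1 ≤ len) :
    IsMEM T ⟨x, y, a, b, len⟩ ↔ ∃ s t, T[x]? = some s ∧ T[y]? = some t ∧
      a + len ≤ s.length ∧ b + len ≤ t.length ∧
      (∀ u, 1 ≤ u → u ≤ len → ft s (a + u) = ft t (b + u)) ∧
      ¬ (ft s a = ft t b ∧ ft s a ≠ some .dollar) ∧
      ¬ (ft s (a + (len + 1)) = ft t (b + (len + 1)) ∧ ft s (a + (len + 1)) ≠ some .dollar) := by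
  unfold IsMEM
  simp only
  refine exists_congr fun s => exists_congr fun t => and_congr_right fun _ =>
    and_congr_right fun _ => and_congr_right fun h1 => and_congr_right fun h2 => ?_
  refine and_congr ?_ (and_congr ?_ ?_)
  · constructor
    · intro he u hu1 hu2
      obtain ⟨u, rfl⟩ : ∃ v, u = v + 1 := ⟨u - 1, by omega⟩
      have := congrArg (fun l => l[u]?) he
      simp only [List.getElem?_take, show u < len by omega, if_true, List.getElem?_drop] at this
      rw [← add_assoc, ← add_assoc, ft_succ s (by omega), ft_succ t (by omega)]
      rw [List.getElem?_eq_getElem (by omega), List.getElem?_eq_getElem (by omega)] at this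
      simp only [Option.some.inj this]
    · intro H
      apply List.ext_getElem
      · simp; omega
      · intro u hu1 hu2
        simp only [List.length_take, List.length_drop] at hu1
        have := H (u + 1) (by omega) (by omega)
        rw [← add_assoc, ← add_assoc, ft_succ s (by omega), ft_succ t (by omega)] at this
        simpa using this
  · have e := ft_eq_dollar_left (by omega : a < s.length)
    simp only [ne_eq, e]
    cases a with
    | zero => simp
    | succ a =>
      cases b with
      | zero => simp [ft_zero, ft_succ s (by omega : a < s.length)]
      | succ b =>
        simp only [ft_succ s (by omega : a < s.length), ft_succ t (by omega : b < t.length)]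
        simp [List.getElem?_eq_getElem (by omega : a < s.length),
          List.getElem?_eq_getElem (by omega : b < t.length)]
  · have e := ft_eq_dollar_right h1 (by omega)
    simp only [← add_assoc, ne_eq, e]
    by_cases e1 : a + len = s.length
    · simp [e1]
    · by_cases e2 : b + len = t.length
      · rw [e2, ft_last, ft_succ s (by omega)]; simp
      · simp only [ft_succ s (by omega : a + len < s.length),
          ft_succ t (by omega : b + len < t.length)]
        simp [List.getElem?_eq_getElem (by omega : a + len < s.length),
          List.getElem?_eq_getElem (by omega : b + len < t.length), e1, e2]

namespace FFGram

variable {𝒢 : FFGram}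

theorem covers_iff {x a len i k : ℕ} {t : List ℕ} (ht : 𝒢.T[x]? = some t) :
    𝒢.Covers x a len i k ↔ Cov 𝒢.h t a len i k := by
  simp only [Covers, ht, Option.some.injEq, Cov]
  constructor
  · rintro ⟨_, r, rfl, hr, h1, h2⟩
    obtain ⟨hk, hr⟩ := List.getElem?_eq_some_iff.1 hr
    rw [length_spans] at hk
    refine ⟨hk, ?_⟩
    rw [sL, sR, fspans_succ _ _ hk, hr]
    exact ⟨h1, h2⟩
  · rintro ⟨hk, h1, h2⟩
    rw [sL, fspans_succ _ _ hk] at h1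
    rw [sR, fspans_succ _ _ hk] at h2
    exact ⟨t, _, rfl, List.getElem?_eq_getElem _, h1, h2⟩

theorem isLowest_iff {x a len i k : ℕ} {t : List ℕ} (ht : 𝒢.T[x]? = some t) :
    𝒢.IsLowest x a len i k ↔ IsLow 𝒢.h 𝒢.rounds t a len i k := by
  simp only [IsLowest, covers_iff ht]
  exact ⟨fun ⟨h1, h2, h3, h4, h5⟩ => ⟨h1, h2, h3, h4, h5⟩,
    fun ⟨h1, h2, h3, h4, h5⟩ => ⟨h1, h2, h3, h4, h5⟩⟩

theorem efStart_eq_elen {x i k : ℕ} {t : List ℕ} (ht : 𝒢.T[x]? = some t) :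
    𝒢.efStart x i k = elen ((parse 𝒢.h t i).take k) := by
  rw [efStart, elen, List.getD_eq_getElem?_getD, ht]; rfl

theorem label_of {x i k : ℕ} {t : List ℕ} (ht : 𝒢.T[x]? = some t) :
    𝒢.label x i k = (parse 𝒢.h t i)[k]? := by
  rw [label, ht]; rfl

/-- Offset `o` relative to the place `X` is, in the occurrence of `X` concerned, position `a` of
string `x`. -/
inductive At (𝒢 : FFGram) : Place → ℤ → ℕ → ℤ → Prop
  | node (i k : ℕ) (F : List GSym) (x : ℕ) (o : ℤ) (h1 : 1 ≤ i) (h2 : i ≤ 𝒢.rounds)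
      (hF : 𝒢.label x i k = some (.rule F)) :
      At 𝒢 (.nonterminal F) o x (𝒢.efStart x i k + o)
  | text (x : ℕ) (o : ℤ) (hx : x < 𝒢.T.length) : At 𝒢 (.text x) o x o

/-- The locus of `T_x[a .. a+len-1]`: its label, and the relative position. -/
inductive Locus (𝒢 : FFGram) (x a len : ℕ) : Place → ℤ → Prop
  | node (i k : ℕ) (F : List GSym) (hlow : 𝒢.IsLowest x a len i k)
      (hF : 𝒢.label x i k = some (.rule F)) :
      Locus 𝒢 x a len (.nonterminal F) ((a : ℤ) - (𝒢.efStart x i k : ℤ))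
  | start (hx : x < 𝒢.T.length)
      (h : ∀ i k, 1 ≤ i → i ≤ 𝒢.rounds → ¬ 𝒢.Covers x a len i k) :
      Locus 𝒢 x a len (.text x) (a : ℤ)

/-- An occurrence has only one locus, which makes the matches of different tuples different. -/
theorem Locus.unique {x a len : ℕ} {X X' : Place} {o o' : ℤ} (hx : x < 𝒢.T.length)
    (H : 𝒢.Locus x a len X o) (H' : 𝒢.Locus x a len X' o') : X = X' ∧ o = o' := by
  have ht : 𝒢.T[x]? = some 𝒢.T[x] := List.getElem?_eq_getElem hx
  cases H with
  | node i k F hlow hF =>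
    cases H' with
    | node i' k' F' hlow' hF' =>
      rw [isLowest_iff ht] at hlow hlow'
      obtain ⟨rfl, rfl⟩ := hlow.unique hlow'
      obtain rfl : F = F' := by simpa [hF] using hF'
      exact ⟨rfl, rfl⟩
    | start _ h => exact absurd hlow.2.2.1 (h i k hlow.1 hlow.2.1)
  | start _ h =>
    cases H' with
    | node i' k' F' hlow' hF' => exact absurd hlow'.2.2.1 (h i' k' hlow'.1 hlow'.2.1)
    | start _ h => exact ⟨rfl, rfl⟩

theorem PrimaryUnder.locus {x a len : ℕ} {X : Place} {o : ℤ} (H : 𝒢.PrimaryUnder x a len X o) :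
    𝒢.Locus x a len X o := by
  cases H with
  | node i k F hlow _ hF => exact .node i k F hlow hF
  | start hx h => exact .start hx h

theorem mem_parse_rule {t : List ℕ} {i : ℕ} (hi : 1 ≤ i) {A : GSym} (hA : A ∈ parse 𝒢.h t i) :
    ∃ F, A = .rule F ∧ F ∈ phrases (𝒢.h (i - 1)) (flank (parse 𝒢.h t (i - 1))) := by
  obtain ⟨i, rfl⟩ : ∃ i₀, i = i₀ + 1 := ⟨i - 1, by omega⟩
  obtain ⟨F, hF, rfl⟩ := List.mem_map.1 hA
  exact ⟨F, rfl, hF⟩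

theorem lt_of_label {x i k : ℕ} {A : GSym} (hF : 𝒢.label x i k = some A) :
    ∃ t, 𝒢.T[x]? = some t ∧ x < 𝒢.T.length ∧ (parse 𝒢.h t i)[k]? = some A ∧ k < pl 𝒢.h t i := by
  rw [label, Option.bind_eq_some_iff] at hF
  obtain ⟨t, ht, hk⟩ := hF
  exact ⟨t, ht, (List.getElem?_eq_some_iff.1 ht).1, hk, (List.getElem?_eq_some_iff.1 hk).1⟩

/-- Every occurrence has a locus, since the start symbol remains if no other node covers it. -/
theorem exists_locus {x a len : ℕ} (hx : x < 𝒢.T.length) : ∃ X o, 𝒢.Locus x a len X o := by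
  have ht : 𝒢.T[x]? = some 𝒢.T[x] := List.getElem?_eq_getElem hx
  by_cases hc : ∃ i k, 1 ≤ i ∧ i ≤ 𝒢.rounds ∧ 𝒢.Covers x a len i k
  · obtain ⟨i, k, h1, h2, h3⟩ := hc
    rw [covers_iff ht] at h3
    obtain ⟨i, k, hlow⟩ := exists_isLow _ 𝒢.rounds _ h1 h2 h3
    have hk : k < (parse 𝒢.h 𝒢.T[x] i).length := hlow.cov.1
    obtain ⟨F, hF, -⟩ := mem_parse_rule hlow.one_le (List.getElem_mem hk)
    exact ⟨_, _, .node i k F ((isLowest_iff ht).2 hlow)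
      (by rw [label_of ht, List.getElem?_eq_getElem hk, hF])⟩
  · refine ⟨_, _, .start hx fun i k h1 h2 h3 => hc ⟨i, k, h1, h2, h3⟩⟩

/-- Occurrences under nodes with the same label, at the same relative position, have the same
locus and the same text, including the neighbours. -/
theorem Locus.transfer {x a len : ℕ} {X : Place} {o : ℤ} {s : List ℕ} (H : 𝒢.Locus x a len X o)
    (hs : 𝒢.T[x]? = some s) (hpos : 1 ≤ len) (hlen : a + len ≤ s.length) {x' : ℕ} {z : ℤ}
    (hz : 𝒢.At X o x' z) :
    ∃ (a' : ℕ) (t : List ℕ), z = a' ∧ 𝒢.T[x']? = some t ∧ a' + len ≤ t.length ∧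
      𝒢.Locus x' a' len X o ∧ ∀ u ≤ len + 1, ft s (a + u) = ft t (a' + u) := by
  cases H with
  | node i k F hlow hF =>
    cases hz with
    | node i' k' _ _ _ h1 h2 hF' =>
      obtain ⟨t, ht, hx', hk', hlt'⟩ := lt_of_label hF'
      have hk : (parse 𝒢.h s i)[k]? = some (.rule F) := by rw [← label_of hs, hF]
      obtain rfl : i = i' := by
        rw [← lvl_parse 𝒢.h s i _ (List.mem_of_getElem? hk),
          lvl_parse 𝒢.h t i' _ (List.mem_of_getElem? hk')]
      rw [isLowest_iff hs] at hlow
      obtain ⟨a', e1, e2, e3, e4⟩ := hlow.transfer hpos hlen hlt' (by rw [hk, hk'])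
      have e5 := efStart_eq_elen (i := i) (k := k) hs
      have e6 := efStart_eq_elen (i := i) (k := k') ht
      refine ⟨a', t, by rw [e5, e6]; omega, ht, e2, ?_, e4⟩
      have : (a : ℤ) - 𝒢.efStart x i k = (a' : ℤ) - 𝒢.efStart x' i k' := by
        rw [e5, e6]; omega
      rw [this]
      exact .node i k' F ((isLowest_iff ht).2 e3) hF'
  | start hx h =>
    cases hz with
    | text _ _ hx' => exact ⟨a, s, rfl, hs, hlen, .start hx h, fun _ _ => rfl⟩

/-- The leftmost node with the label of the locus. -/
theorem Locus.exists_primary {x a len : ℕ} {X : Place} {o : ℤ} {s : List ℕ}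
    (H : 𝒢.Locus x a len X o) (hs : 𝒢.T[x]? = some s) (hpos : 1 ≤ len)
    (hlen : a + len ≤ s.length) :
    𝒢.At X o x a ∧ ∃ (x' a' : ℕ) (t : List ℕ), 𝒢.T[x']? = some t ∧ a' + len ≤ t.length ∧
      𝒢.PrimaryUnder x' a' len X o ∧ ∀ u ≤ len + 1, ft s (a + u) = ft t (a' + u) := by
  classical
  have H₀ := H
  cases H with
  | node i k F hlow hF =>
    refine ⟨?_, ?_⟩
    · have := At.node i k F x ((a : ℤ) - 𝒢.efStart x i k) hlow.1 hlow.2.1 hF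
      rwa [add_sub_cancel] at this
    have hex : ∃ x' k', 𝒢.label x' i k' = some (.rule F) := ⟨x, k, hF⟩
    have hex' := Nat.find_spec hex
    have hlab := Nat.find_spec hex'
    have hA := At.node i _ F _ ((a : ℤ) - 𝒢.efStart x i k) hlow.1 hlow.2.1 hlab
    obtain ⟨a', t, e1, ht, e2, hloc, e3⟩ := H₀.transfer hs hpos hlen hA
    refine ⟨_, a', t, ht, e2, ?_, e3⟩
    have hk : (parse 𝒢.h s i)[k]? = some (.rule F) := by rw [← label_of hs, hF]
    obtain ⟨t', ht', -, hk', hlt'⟩ := lt_of_label hlab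
    obtain rfl : t = t' := by simpa [ht] using ht'
    have hlow' := hlow
    rw [isLowest_iff hs] at hlow'
    obtain ⟨a'', f1, -, f3, -⟩ := hlow'.transfer hpos hlen hlt' (by rw [hk, hk'])
    have e5 := efStart_eq_elen (i := i) (k := k) hs
    have e6 := efStart_eq_elen (i := i) (k := Nat.find hex') ht
    obtain rfl : a' = a'' := by omega
    have : (a : ℤ) - 𝒢.efStart x i k = (a' : ℤ) - 𝒢.efStart (Nat.find hex) i (Nat.find hex') := by
      omega
    rw [this]
    refine .node i _ F ((isLowest_iff ht).2 f3) (fun x'' k'' hl => ?_) hlab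
    rw [hlab] at hl
    have g1 : Nat.find hex ≤ x'' := Nat.find_min' hex ⟨k'', hl⟩
    rcases g1.lt_or_eq with g1 | g1
    · exact .inl g1
    · refine .inr ⟨g1, Nat.find_min' hex' (by rw [g1]; exact hl)⟩
  | start hx h =>
    exact ⟨.text x _ hx, x, a, s, hs, hlen, .start hx h, fun _ _ => rfl⟩

theorem At.lt {X : Place} {o : ℤ} {x : ℕ} {z : ℤ} (H : 𝒢.At X o x z) : x < 𝒢.T.length := by
  cases H with
  | node i k F _ _ h1 h2 hF => obtain ⟨_, -, h, -⟩ := lt_of_label hF; exact h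
  | text _ _ hx => exact hx

/-- Every maximal exact match stems from a primary one. -/
theorem exists_prMEM {M : Match} (hM : IsMEM 𝒢.T M) (hpos : 1 ≤ M.len) :
    ∃ p, 𝒢.IsPrMEM p ∧ p.len = M.len ∧ 𝒢.At p.X p.oX M.x M.a ∧ 𝒢.At p.Y p.oY M.y M.b := by
  have hM := (isMEM_iff hpos).1 hM
  obtain ⟨s, t, hs, ht, h1, h2, h3, h4, h5⟩ := hM
  obtain ⟨X, oX, hX⟩ := 𝒢.exists_locus (a := M.a) (len := M.len) (List.getElem?_eq_some_iff.1 hs).1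
  obtain ⟨Y, oY, hY⟩ := 𝒢.exists_locus (a := M.b) (len := M.len) (List.getElem?_eq_some_iff.1 ht).1
  obtain ⟨aX, x, a, s', hs', l1, p1, e1⟩ := hX.exists_primary hs hpos h1
  obtain ⟨aY, y, b, t', ht', l2, p2, e2⟩ := hY.exists_primary ht hpos h2
  refine ⟨⟨X, Y, oX, oY, M.len⟩, ⟨⟨x, y, a, b, M.len⟩, ?_, rfl, p1, p2⟩, rfl, aX, aY⟩
  refine (isMEM_iff hpos).2 ⟨s', t', hs', ht', l1, l2, fun u hu1 hu2 => ?_, ?_, ?_⟩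
  · rw [← e1 u (by omega), ← e2 u (by omega)]
    exact h3 u hu1 hu2
  · have f1 := e1 0 (by omega)
    have f2 := e2 0 (by omega)
    simp only [add_zero] at f1 f2
    rwa [← f1, ← f2]
  · rwa [← e1 _ le_rfl, ← e2 _ le_rfl]

/-- All pairs of occurrences that a primary match stands for are maximal exact matches, and their
loci are given by the tuple. -/
theorem IsPrMEM.isMEM {p : PrTuple} (hp : 𝒢.IsPrMEM p) (hpos : 1 ≤ p.len) {x y : ℕ} {z w : ℤ}
    (hz : 𝒢.At p.X p.oX x z) (hw : 𝒢.At p.Y p.oY y w) :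
    ∃ a b : ℕ, z = a ∧ w = b ∧ IsMEM 𝒢.T ⟨x, y, a, b, p.len⟩ ∧
      𝒢.Locus x a p.len p.X p.oX ∧ 𝒢.Locus y b p.len p.Y p.oY := by
  obtain ⟨M, hM, hlen, hX, hY⟩ := hp
  rw [← hlen] at hpos ⊢
  have hM := (isMEM_iff hpos).1 hM
  obtain ⟨s, t, hs, ht, h1, h2, h3, h4, h5⟩ := hM
  obtain ⟨a, s', ez, hs', l1, p1, e1⟩ := hX.locus.transfer hs hpos h1 hz
  obtain ⟨b, t', ew, ht', l2, p2, e2⟩ := hY.locus.transfer ht hpos h2 hw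
  refine ⟨a, b, ez, ew, ?_, p1, p2⟩
  refine (isMEM_iff hpos).2 ⟨s', t', hs', ht', l1, l2, fun u hu1 hu2 => ?_, ?_, ?_⟩
  · rw [← e1 u (by omega), ← e2 u (by omega)]
    exact h3 u hu1 hu2
  · have f1 := e1 0 (by omega)
    have f2 := e2 0 (by omega)
    simp only [add_zero] at f1 f2
    rwa [← f1, ← f2]
  · rwa [← e1 _ le_rfl, ← e2 _ le_rfl]

end FFGram

theorem mem_place {s : ℕ} {l : List GSym} {p : GSym × ℕ} (h : p ∈ place s l) :
    p.1 ∈ l ∧ s ≤ p.2 ∧ p.2 + p.1.efexp.length ≤ s + elen l := by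
  induction l generalizing s with
  | nil => simp [place] at h
  | cons A l ih =>
    rw [place, List.mem_cons] at h
    rw [elen_cons]
    rcases h with rfl | h
    · refine ⟨by simp, le_rfl, by simp only; omega⟩
    · have := ih h
      exact ⟨List.mem_cons_of_mem _ this.1, by omega, by omega⟩

theorem exists_place {s : ℕ} {l : List GSym} {A : GSym} (h : A ∈ l) : ∃ c, (A, c) ∈ place s l := by
  induction l generalizing s with
  | nil => simp at h
  | cons B l ih =>
    rcases List.mem_cons.1 h with rfl | h
    · exact ⟨s, by simp [place]⟩
    · obtain ⟨c, hc⟩ := ih (s := s + B.efexp.length) h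
      exact ⟨c, by simp [place, hc]⟩

theorem mem_place_iff {s : ℕ} {l : List GSym} {A : GSym} {c : ℕ} :
    (A, c) ∈ place s l ↔ ∃ k, l[k]? = some A ∧ c = s + elen (l.take k) := by
  constructor
  · intro h
    obtain ⟨k, hk, he⟩ := List.getElem_of_mem h
    rw [getElem_place, Prod.mk.injEq] at he
    exact ⟨k, by rw [List.getElem?_eq_getElem (by simpa using hk), he.1], he.2.symm⟩
  · rintro ⟨k, hk, rfl⟩
    obtain ⟨hk', rfl⟩ := List.getElem?_eq_some_iff.1 hk
    rw [← getElem_place s l k (by rwa [length_place])]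
    exact List.getElem_mem _

/-- Symbols with nonempty expansions occupy disjoint intervals. -/
theorem place_unique {l : List GSym} (hl : ∀ A ∈ l, A.efexp ≠ []) {s u : ℕ} {p q : GSym × ℕ}
    (hp : p ∈ place s l) (hq : q ∈ place s l) (hp1 : p.2 ≤ u) (hp2 : u < p.2 + p.1.efexp.length)
    (hq1 : q.2 ≤ u) (hq2 : u < q.2 + q.1.efexp.length) : p = q := by
  induction l generalizing s with
  | nil => simp [place] at hp
  | cons A l ih =>
    rw [place, List.mem_cons] at hp hq
    rcases hp with rfl | hp <;> rcases hq with rfl | hq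
    · rfl
    · have := mem_place hq; simp only at hp1 hp2; omega
    · have := mem_place hp; simp only at hq1 hq2; omega
    · exact ih (fun B hB => hl B (by simp [hB])) hp hq

theorem lvl_le_lvlList {A : GSym} {F : List GSym} (hA : A ∈ F) : A.lvl ≤ GSym.lvlList F := by
  induction F with
  | nil => simp at hA
  | cons B F ih =>
    rcases List.mem_cons.1 hA with rfl | hA
    · exact le_max_left _ _
    · exact (ih hA).trans (le_max_right _ _)

theorem lvlList_le {F : List GSym} {n : ℕ} (hF : ∀ A ∈ F, A.lvl ≤ n) : GSym.lvlList F ≤ n := by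
  induction F with
  | nil => simp [GSym.lvlList]
  | cons A F ih => exact max_le (hF A (by simp)) (ih fun B hB => hF B (by simp [hB]))

namespace FFGram

variable {𝒢 : FFGram}

/-! ### Right-hand sides and positions -/

theorem mem_nonterminals {F : List GSym} :
    F ∈ 𝒢.nonterminals ↔ ∃ i < 𝒢.rounds, ∃ t ∈ 𝒢.T, GSym.rule F ∈ parse 𝒢.h t (i + 1) := by
  simp only [nonterminals, List.mem_toFinset, List.mem_flatMap, List.mem_range]
  refine exists_congr fun i => and_congr_right fun _ => exists_congr fun t =>
    and_congr_right fun _ => ?_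
  rw [parse, List.mem_map]
  constructor
  · intro h; exact ⟨F, h, rfl⟩
  · rintro ⟨F', h, h'⟩; cases h'; exact h

theorem hasRhs_nonterminal {F Q : List GSym} :
    𝒢.HasRhs (.nonterminal F) Q ↔ F ∈ 𝒢.nonterminals ∧ Q = F := Iff.rfl

theorem hasRhs_text {x : ℕ} {Q : List GSym} :
    𝒢.HasRhs (.text x) Q ↔ ∃ t, 𝒢.T[x]? = some t ∧ Q = flank (parse 𝒢.h t 𝒢.rounds) := by
  simp only [HasRhs, startParts, List.getElem?_map, Option.map_eq_some_iff]
  exact exists_congr fun t => and_congr_right fun _ => eq_comm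

theorem HasRhs.unique {X : Place} {Q Q' : List GSym} (h : 𝒢.HasRhs X Q) (h' : 𝒢.HasRhs X Q') :
    Q = Q' := by
  cases X with
  | nonterminal F => exact h.2.trans h'.2.symm
  | text x => exact Option.some.inj (Eq.trans (Eq.symm h) h')

theorem HasRhs.length {X : Place} {Q : List GSym} (h : 𝒢.HasRhs X Q) : 3 ≤ Q.length := by
  cases X with
  | nonterminal F =>
    obtain ⟨h, rfl⟩ := hasRhs_nonterminal.1 h
    obtain ⟨i, -, t, -, hF⟩ := mem_nonterminals.1 h
    rw [parse, List.mem_map] at hF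
    obtain ⟨F', hF, he⟩ := hF
    cases he
    exact (mem_phrases hF).1
  | text x =>
    obtain ⟨t, -, rfl⟩ := hasRhs_text.1 h
    simp

/-- The symbols of a right-hand side, apart from `$` and `#`, stem from one level of a parse
tree. -/
theorem HasRhs.symbols {X : Place} {Q : List GSym} (h : 𝒢.HasRhs X Q) :
    ∃ t ∈ 𝒢.T, ∃ i ≤ 𝒢.rounds, (∀ A ∈ Q, A ∈ flank (parse 𝒢.h t i)) ∧
      ∀ A ∈ middle Q, A ∈ parse 𝒢.h t i := by
  cases X with
  | nonterminal F =>
    obtain ⟨h, rfl⟩ := hasRhs_nonterminal.1 h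
    obtain ⟨i, hi, t, ht, hF⟩ := mem_nonterminals.1 h
    rw [parse, List.mem_map] at hF
    obtain ⟨F', hF, he⟩ := hF
    cases he
    obtain ⟨-, -, h3, h4⟩ := mem_phrases hF
    exact ⟨t, ht, i, hi.le, h3, h4⟩
  | text x =>
    obtain ⟨t, ht, rfl⟩ := hasRhs_text.1 h
    exact ⟨t, List.mem_of_getElem? ht, _, le_rfl, fun _ h => h, fun _ h => by simpa using h⟩

theorem mem_flank {A : GSym} {s : List GSym} : A ∈ flank s ↔ A = .dollar ∨ A = .hash ∨ A ∈ s := by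
  simp only [flank, List.mem_cons, List.mem_append, List.not_mem_nil, or_false]
  tauto

theorem HasRhs.mem_nonterminals {X : Place} {Q F : List GSym} (h : 𝒢.HasRhs X Q)
    (hF : GSym.rule F ∈ Q) : F ∈ 𝒢.nonterminals := by
  obtain ⟨t, ht, i, hi, h1, -⟩ := h.symbols
  have h2 := h1 _ hF
  simp only [mem_flank, reduceCtorEq, false_or] at h2
  have h3 := lvl_parse _ _ _ _ h2
  rw [GSym.lvl] at h3
  obtain ⟨i, rfl⟩ : ∃ j, i = j + 1 := ⟨i - 1, by omega⟩
  exact FFGram.mem_nonterminals.2 ⟨i, by omega, t, ht, h2⟩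

theorem HasRhs.letter {X : Place} {Q : List GSym} {a : ℕ} (h : 𝒢.HasRhs X Q)
    (hF : GSym.letter a ∈ Q) : ∃ t ∈ 𝒢.T, a ∈ t := by
  obtain ⟨t, ht, i, hi, h1, -⟩ := h.symbols
  have h2 := h1 _ hF
  simp only [mem_flank, reduceCtorEq, false_or] at h2
  have h3 := lvl_parse _ _ _ _ h2
  rw [GSym.lvl] at h3
  subst h3
  rw [parse, List.mem_map] at h2
  obtain ⟨_, h2, h3⟩ := h2
  cases h3
  exact ⟨t, ht, h2⟩

theorem HasRhs.lvlList_le {X : Place} {Q : List GSym} (h : 𝒢.HasRhs X Q) :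
    GSym.lvlList Q ≤ 𝒢.rounds := by
  obtain ⟨t, ht, i, hi, h1, -⟩ := h.symbols
  refine _root_.lvlList_le fun A hA => ?_
  rcases mem_flank.1 (h1 A hA) with rfl | rfl | h
  · exact Nat.zero_le _
  · exact Nat.zero_le _
  · exact (lvl_parse _ _ _ _ h).trans_le hi

/-- Induction from the nonterminals in a right-hand side to the right-hand side. -/
theorem HasRhs.induct {motive : List GSym → Prop}
    (step : ∀ X Q, 𝒢.HasRhs X Q →
      (∀ R, GSym.rule R ∈ Q → 𝒢.HasRhs (.nonterminal R) R → motive R) → motive Q)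
    {X : Place} {Q : List GSym} (h : 𝒢.HasRhs X Q) : motive Q := by
  suffices H : ∀ n X Q, GSym.lvlList Q < n → 𝒢.HasRhs X Q → motive Q from
    H _ X Q (Nat.lt_succ_self _) h
  intro n
  induction n with
  | zero => intro _ _ h; omega
  | succ n ih =>
    intro X Q hn hQ
    refine step X Q hQ fun R hR hR' => ih _ R ?_ hR'
    have := lvl_le_lvlList hR
    rw [GSym.lvl] at this
    omega

/-- `A` occurs at offset `c` in the middle of the right-hand side of `X`. -/
def Child (𝒢 : FFGram) (X : Place) (A : GSym) (c : ℕ) : Prop :=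
  ∃ Q, 𝒢.HasRhs X Q ∧ (A, c) ∈ place 0 (middle Q)

theorem at_nonterminal_iff {F : List GSym} {o : ℤ} {x : ℕ} {z : ℤ} :
    𝒢.At (.nonterminal F) o x z ↔ ∃ (t : List ℕ) (i s : ℕ), 𝒢.T[x]? = some t ∧ 1 ≤ i ∧
      i ≤ 𝒢.rounds ∧ (GSym.rule F, s) ∈ place 0 (parse 𝒢.h t i) ∧ z = s + o := by
  constructor
  · intro h
    cases h with
    | node i k F _ _ h1 h2 hF =>
      obtain ⟨t, ht, -, hk, -⟩ := lt_of_label hF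
      refine ⟨t, i, _, ht, h1, h2, mem_place_iff.2 ⟨k, hk, rfl⟩, ?_⟩
      rw [efStart_eq_elen ht, zero_add]
  · rintro ⟨t, i, s, ht, h1, h2, h3, rfl⟩
    obtain ⟨k, hk, rfl⟩ := mem_place_iff.1 h3
    rw [zero_add, ← efStart_eq_elen ht]
    exact .node i k F x o h1 h2 (by rw [label_of ht, hk])

theorem at_text_iff {y : ℕ} {o : ℤ} {x : ℕ} {z : ℤ} :
    𝒢.At (.text y) o x z ↔ y = x ∧ z = o ∧ x < 𝒢.T.length := by
  constructor
  · intro h; cases h with | text _ _ h => exact ⟨rfl, rfl, h⟩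
  · rintro ⟨rfl, rfl, h⟩; exact .text _ _ h

theorem mem_kids {q : GSym × ℕ} {A : GSym} {s : ℕ} :
    (A, s) ∈ kids q ↔ ∃ Q c, q.1 = .rule Q ∧ (A, c) ∈ place 0 (middle Q) ∧ s = q.2 + c := by
  obtain ⟨B, s'⟩ := q
  cases B with
  | rule Q =>
    simp only [kids, place_eq s', List.mem_map, Prod.mk.injEq, GSym.rule.injEq]
    constructor
    · rintro ⟨⟨A', c⟩, h, rfl, rfl⟩; exact ⟨Q, c, rfl, h, rfl⟩
    · rintro ⟨_, c, rfl, h, rfl⟩; exact ⟨(A, c), h, rfl, rfl⟩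
  | _ => simp [kids]

/-- A position below a place is a position below the child at that offset. -/
theorem At.down {X : Place} {F : List GSym} {c : ℕ} (hc : 𝒢.Child X (.rule F) c) {o : ℤ} {x : ℕ}
    {z : ℤ} (h : 𝒢.At X (o + c) x z) : 𝒢.At (.nonterminal F) o x z := by
  obtain ⟨Q, hQ, hc⟩ := hc
  rw [at_nonterminal_iff]
  cases X with
  | nonterminal Q' =>
    obtain ⟨hQ, rfl⟩ := hasRhs_nonterminal.1 hQ
    obtain ⟨t, i, s, ht, h1, h2, h3, rfl⟩ := at_nonterminal_iff.1 h
    obtain ⟨i, rfl⟩ : ∃ j, i = j + 1 := ⟨i - 1, by omega⟩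
    have h4 : (GSym.rule F, s + c) ∈ place 0 (parse 𝒢.h t i) := by
      rw [place_parse, List.mem_flatMap]
      exact ⟨_, h3, mem_kids.2 ⟨_, c, rfl, hc, rfl⟩⟩
    have h5 := lvl_parse _ _ _ _ (mem_place h4).1
    rw [GSym.lvl] at h5
    exact ⟨t, i, s + c, ht, by omega, by omega, h4, by push_cast; ring⟩
  | text y =>
    obtain ⟨t, ht, rfl⟩ := hasRhs_text.1 hQ
    obtain ⟨rfl, rfl, hx⟩ := at_text_iff.1 h
    rw [middle_flank] at hc
    have h5 := lvl_parse _ _ _ _ (mem_place hc).1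
    rw [GSym.lvl] at h5
    exact ⟨t, 𝒢.rounds, c, ht, by omega, le_rfl, hc, by ring⟩

/-- Every node has a parent, which may be the start symbol. -/
theorem At.up {F : List GSym} {o : ℤ} {x : ℕ} {z : ℤ} (h : 𝒢.At (.nonterminal F) o x z) :
    ∃ X c, 𝒢.Child X (.rule F) c ∧ 𝒢.At X (o + c) x z := by
  obtain ⟨t, i, s, ht, h1, h2, h3, rfl⟩ := at_nonterminal_iff.1 h
  rcases h2.lt_or_eq with h2 | rfl
  · rw [place_parse, List.mem_flatMap] at h3
    obtain ⟨⟨A, s'⟩, h3, h4⟩ := h3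
    obtain ⟨Q, c, rfl, hc, rfl⟩ := mem_kids.1 h4
    have hQ : Q ∈ 𝒢.nonterminals :=
      mem_nonterminals.2 ⟨i, h2, t, List.mem_of_getElem? ht, (mem_place h3).1⟩
    refine ⟨.nonterminal Q, c, ⟨Q, ⟨hQ, rfl⟩, hc⟩, at_nonterminal_iff.2
      ⟨t, i + 1, s', ht, by omega, h2, h3, by push_cast; ring⟩⟩
  · refine ⟨.text x, s, ⟨_, hasRhs_text.2 ⟨t, ht, rfl⟩, by rwa [middle_flank]⟩, at_text_iff.2
      ⟨rfl, by ring, (List.getElem?_eq_some_iff.1 ht).1⟩⟩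

/-- Every node has a unique parent. -/
theorem At.parent_unique {x : ℕ} {t : List ℕ} (ht : 𝒢.T[x]? = some t) (hne : t ≠ [])
    {F : List GSym} {X X' : Place} {c c' : ℕ} (hc : 𝒢.Child X (.rule F) c)
    (hc' : 𝒢.Child X' (.rule F) c') {o z : ℤ} (h : 𝒢.At X (o + c) x z)
    (h' : 𝒢.At X' (o + c') x z) : X = X' ∧ c = c' := by
  obtain ⟨Q, hQ, hc⟩ := hc
  obtain ⟨Q', hQ', hc'⟩ := hc'
  have key : ∀ {X : Place} {Q : List GSym} {c : ℕ}, 𝒢.HasRhs X Q →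
      (GSym.rule F, c) ∈ place 0 (middle Q) → 𝒢.At X (o + c) x z →
      (X = .text x ∧ (GSym.rule F).lvl = 𝒢.rounds ∧ z = o + c) ∨
      ∃ i s, X = .nonterminal Q ∧ (GSym.rule F).lvl = i ∧ i < 𝒢.rounds ∧
        (GSym.rule Q, s) ∈ place 0 (parse 𝒢.h t (i + 1)) ∧ z = s + (o + c) := by
    intro X Q c hQ hc h
    cases X with
    | nonterminal Q' =>
      obtain ⟨hQ, rfl⟩ := hasRhs_nonterminal.1 hQ
      obtain ⟨t', i, s, ht', h1, h2, h3, rfl⟩ := at_nonterminal_iff.1 h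
      obtain rfl : t = t' := by simpa [ht] using ht'
      obtain ⟨i, rfl⟩ : ∃ j, i = j + 1 := ⟨i - 1, by omega⟩
      have h4 : (GSym.rule F, s + c) ∈ place 0 (parse 𝒢.h t i) := by
        rw [place_parse, List.mem_flatMap]
        exact ⟨_, h3, mem_kids.2 ⟨_, c, rfl, hc, rfl⟩⟩
      exact .inr ⟨i, s, rfl, lvl_parse _ _ _ _ (mem_place h4).1, by omega, h3, rfl⟩
    | text y =>
      obtain ⟨t', ht', rfl⟩ := hasRhs_text.1 hQ
      obtain ⟨rfl, rfl, hx⟩ := at_text_iff.1 h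
      rw [middle_flank] at hc
      exact .inl ⟨rfl, lvl_parse _ _ _ _ (mem_place hc).1, rfl⟩
  rcases key hQ hc h with ⟨rfl, l1, e1⟩ | ⟨i, s, rfl, l1, hi, m1, e1⟩ <;>
    rcases key hQ' hc' h' with ⟨rfl, l2, e2⟩ | ⟨i', s', rfl, l2, hi', m2, e2⟩
  · exact ⟨rfl, by omega⟩
  · omega
  · omega
  · obtain rfl : i = i' := by omega
    have b1 := (mem_place hc).2.2
    have b2 := (mem_place hc').2.2
    simp only at b1 b2
    have hF : (GSym.rule F).efexp ≠ [] := by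
      have h4 : (GSym.rule F, s + c) ∈ place 0 (parse 𝒢.h t i) := by
        rw [place_parse, List.mem_flatMap]
        exact ⟨_, m1, mem_kids.2 ⟨_, c, rfl, hc, rfl⟩⟩
      exact (efexp_parse_ne_nil 𝒢.h hne i).2 _ (mem_place h4).1
    have := List.length_pos_of_ne_nil hF
    have g1 := length_efexp_rule Q
    have g2 := length_efexp_rule Q'
    have := place_unique (u := s + c) (efexp_parse_ne_nil 𝒢.h hne (i + 1)).2 m1 m2
      (by simp only; omega) (by simp only; omega) (by simp only; omega) (by simp only; omega)
    simp only [Prod.mk.injEq, GSym.rule.injEq] at this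
    obtain ⟨rfl, rfl⟩ := this
    exact ⟨rfl, by omega⟩

/-- Every nonterminal has an occurrence in the parse trees. -/
theorem exists_at {F : List GSym} (hF : F ∈ 𝒢.nonterminals) (o : ℤ) :
    ∃ x z, 𝒢.At (.nonterminal F) o x z := by
  obtain ⟨i, hi, t, ht, h⟩ := mem_nonterminals.1 hF
  obtain ⟨x, hx⟩ := List.getElem?_of_mem ht
  obtain ⟨c, hc⟩ := exists_place (s := 0) h
  exact ⟨x, _, at_nonterminal_iff.2 ⟨t, i + 1, c, hx, by omega, hi, hc, rfl⟩⟩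

/-- At a node with a nonempty expansion the text is nonempty, and conversely. -/
theorem At.ne_nil {F : List GSym} {o : ℤ} {x : ℕ} {z : ℤ} (h : 𝒢.At (.nonterminal F) o x z) :
    ∃ t, 𝒢.T[x]? = some t ∧ (t ≠ [] ↔ (GSym.rule F).efexp ≠ []) := by
  obtain ⟨t, i, s, ht, h1, h2, h3, rfl⟩ := at_nonterminal_iff.1 h
  refine ⟨t, ht, fun hne => (efexp_parse_ne_nil 𝒢.h hne i).2 _ (mem_place h3).1, ?_⟩
  rintro h rfl
  have h4 := (mem_place h3).2.2
  have := List.length_pos_of_ne_nil h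
  simp only [elen_parse, List.length_nil] at h4
  omega

/-! ### Nonterminals with a single occurrence -/

/-- All places with their right-hand sides. -/
noncomputable def rhsList (𝒢 : FFGram) : List (Place × List GSym) :=
  𝒢.nonterminals.toList.map (fun F => (.nonterminal F, F)) ++
    𝒢.startParts.zipIdx.map fun p => (.text p.2, p.1)

theorem mem_rhsList {X : Place} {Q : List GSym} : (X, Q) ∈ 𝒢.rhsList ↔ 𝒢.HasRhs X Q := by
  simp only [rhsList, List.mem_append, List.mem_map, Finset.mem_toList, Prod.mk.injEq, Prod.exists]
  constructor
  · rintro (⟨F, h, rfl, rfl⟩ | ⟨Q', x, h, rfl, rfl⟩)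
    · exact ⟨h, rfl⟩
    · exact List.mem_zipIdx_iff_getElem?.1 h
  · intro h
    cases X with
    | nonterminal F => exact .inl ⟨F, h.1, rfl, h.2.symm⟩
    | text x => exact .inr ⟨Q, x, List.mem_zipIdx_iff_getElem?.2 h, rfl, rfl⟩

/-- The occurrences of a nonterminal in the right-hand sides. -/
noncomputable def occList (𝒢 : FFGram) (F : List GSym) : List (Place × ℕ) :=
  𝒢.rhsList.flatMap fun p =>
    ((p.2.zip (offsets p.2)).filter fun q => q.1 = .rule F).map fun q => (p.1, q.2)

theorem mem_occList {F : List GSym} {X : Place} {c : ℕ} :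
    (X, c) ∈ 𝒢.occList F ↔ ∃ Q, 𝒢.HasRhs X Q ∧ (GSym.rule F, c) ∈ Q.zip (offsets Q) := by
  simp only [occList, List.mem_flatMap, List.mem_map, List.mem_filter, decide_eq_true_eq,
    Prod.exists, Prod.mk.injEq, mem_rhsList]
  constructor
  · rintro ⟨X, Q, h, A, c, ⟨h', rfl⟩, rfl, rfl⟩; exact ⟨Q, h, h'⟩
  · rintro ⟨Q, h, h'⟩; exact ⟨X, Q, h, _, c, ⟨h', rfl⟩, rfl, rfl⟩

@[simp] theorem length_offsets (F : List GSym) : (offsets F).length = F.length := by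
  simp [offsets]

theorem length_filter_zip (Q : List GSym) (A : GSym) :
    ((Q.zip (offsets Q)).filter fun q => q.1 = A).length = Q.count A := by
  have h : Q = (Q.zip (offsets Q)).map Prod.fst := (List.map_fst_zip (by simp)).symm
  conv_rhs => rw [h]
  rw [List.count, List.countP_map, List.countP_eq_length_filter]
  congr 2

/-- The list has as many entries as the number of occurrences that governs the simplification. -/
theorem length_occList (F : List GSym) : (𝒢.occList F).length = 𝒢.occurrences F := by
  rw [occList, List.length_flatMap]
  simp only [List.length_map, length_filter_zip]
  rw [rhsList, List.map_append, List.sum_append, List.map_map, List.map_map, occurrences]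
  congr 1
  · rw [← Finset.sum_map_toList]; rfl
  · conv_rhs => rw [← List.zipIdx_map_fst 0 𝒢.startParts, List.map_map]
    rfl

theorem HasRhs.count_le {X : Place} {Q : List GSym} (h : 𝒢.HasRhs X Q) (F : List GSym) :
    Q.count (.rule F) ≤ 𝒢.occurrences F := by
  rw [← length_occList, occList, List.length_flatMap]
  refine le_trans (le_of_eq ?_) (List.single_le_sum (fun _ _ => Nat.zero_le _) _
    (List.mem_map.2 ⟨(X, Q), mem_rhsList.2 h, rfl⟩))
  rw [List.length_map, length_filter_zip]

theorem mem_zip_of_mem_place {Q : List GSym} (hQ : 3 ≤ Q.length) {A : GSym} {c : ℕ}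
    (h : (A, c) ∈ place 0 (middle Q)) : (A, c) ∈ Q.zip (offsets Q) := by
  obtain ⟨A', B, C, e⟩ := exists_middle hQ
  rw [e, zip_offsets]
  simp [h]

theorem Child.mem_occList {X : Place} {F : List GSym} {c : ℕ} (h : 𝒢.Child X (.rule F) c) :
    (X, c) ∈ 𝒢.occList F := by
  obtain ⟨Q, hQ, hc⟩ := h
  exact FFGram.mem_occList.2 ⟨Q, hQ, mem_zip_of_mem_place hQ.length hc⟩

theorem occList_unique {F : List GSym} (h1 : 𝒢.occurrences F = 1) {p q : Place × ℕ}
    (hp : p ∈ 𝒢.occList F) (hq : q ∈ 𝒢.occList F) : p = q := by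
  rw [← length_occList] at h1
  obtain ⟨r, hr⟩ := List.length_eq_one_iff.1 h1
  rw [hr, List.mem_singleton] at hp hq
  rw [hp, hq]

/-- The only occurrence of a nonterminal lies in the middle of a right-hand side. -/
theorem HasRhs.ne_rule {X : Place} {M : List GSym} {A B C : GSym}
    (h : 𝒢.HasRhs X (A :: (M ++ [B, C]))) {F : List GSym} (h1 : 𝒢.occurrences F = 1) :
    A ≠ .rule F ∧ B ≠ .rule F ∧ C ≠ .rule F := by
  suffices H : GSym.rule F ∈ A :: (M ++ [B, C]) → GSym.rule F ∈ M by
    by_contra hc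
    have hm : GSym.rule F ∈ M := H (by
      simp only [List.mem_cons, List.mem_append, List.not_mem_nil, or_false]
      by_contra hn
      exact hc ⟨fun e => hn (.inl e.symm), fun e => hn (.inr (.inr (.inl e.symm))),
        fun e => hn (.inr (.inr (.inr e.symm)))⟩)
    have h2 := h.count_le F
    rw [h1] at h2
    have h3 := List.count_pos_iff.2 hm
    simp only [List.count_cons, List.count_append, List.count_nil] at h2
    apply hc
    refine ⟨?_, ?_, ?_⟩ <;> rintro rfl <;> simp at h2 <;> omega
  intro hm
  obtain ⟨x, z, hz⟩ := exists_at (h.mem_nonterminals hm) 0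
  obtain ⟨Y, c, hc, -⟩ := hz.up
  have hm' := hm
  rw [← List.map_fst_zip (l₁ := A :: (M ++ [B, C])) (l₂ := offsets (A :: (M ++ [B, C])))
    (by simp), List.mem_map] at hm'
  obtain ⟨⟨_, c'⟩, hz, rfl⟩ := hm'
  have := occList_unique h1 hc.mem_occList (mem_occList.2 ⟨_, h, hz⟩)
  simp only [Prod.mk.injEq] at this
  obtain ⟨rfl, rfl⟩ := this
  obtain ⟨Q, hQ, hc⟩ := hc
  obtain rfl := hQ.unique h
  rw [middle_append] at hc
  exact (mem_place hc).1

end FFGram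

/-- The entries of `l` whose offset is smaller than that of the next entry; `z` takes the place of
the offset after the last entry. -/
def heavy (z : ℕ) : List (GSym × ℕ) → List (GSym × ℕ)
  | [] => []
  | [p] => if p.2 < z then [p] else []
  | p :: q :: l => if p.2 < q.2 then p :: heavy z (q :: l) else heavy z (q :: l)

/-- The first offset of `l`, or `z` if there is none. -/
def firstOfs (z : ℕ) : List (GSym × ℕ) → ℕ
  | [] => z
  | p :: _ => p.2

theorem heavy_cons (z : ℕ) (p : GSym × ℕ) (l : List (GSym × ℕ)) :
    heavy z (p :: l) = (if p.2 < firstOfs z l then [p] else []) ++ heavy z l := by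
  cases l with
  | nil => exact (List.append_nil _).symm
  | cons q l =>
    change (if p.2 < q.2 then p :: heavy z (q :: l) else heavy z (q :: l)) =
      (if p.2 < q.2 then [p] else []) ++ heavy z (q :: l)
    split_ifs <;> rfl

theorem firstOfs_append (z : ℕ) (l l' : List (GSym × ℕ)) :
    firstOfs z (l ++ l') = firstOfs (firstOfs z l') l := by
  cases l <;> rfl

theorem heavy_append (z : ℕ) (l l' : List (GSym × ℕ)) :
    heavy z (l ++ l') = heavy (firstOfs z l') l ++ heavy z l' := by
  induction l with
  | nil => rfl
  | cons p l ih =>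
    rw [List.cons_append, heavy_cons, heavy_cons, ih, firstOfs_append, List.append_assoc]

theorem heavy_map (z c : ℕ) (l : List (GSym × ℕ)) :
    heavy (c + z) (l.map fun q => (q.1, c + q.2)) = (heavy z l).map fun q => (q.1, c + q.2) := by
  induction l with
  | nil => rfl
  | cons p l ih =>
    have : firstOfs (c + z) (l.map fun q => (q.1, c + q.2)) = c + firstOfs z l := by
      cases l <;> rfl
    rw [List.map_cons, heavy_cons, heavy_cons, ih, this]
    simp only [Nat.add_lt_add_iff_left, List.map_append]
    split_ifs <;> rfl

theorem mem_heavy {z : ℕ} {l : List (GSym × ℕ)} {p : GSym × ℕ} :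
    p ∈ heavy z l ↔ ∃ j, ∃ h : j < l.length, l[j] = p ∧
      p.2 < if h' : j + 1 < l.length then l[j + 1].2 else z := by
  induction l with
  | nil => simp [heavy]
  | cons q l ih =>
    rw [heavy_cons, List.mem_append, ih]
    constructor
    · rintro (h | ⟨j, hj, e, h⟩)
      · split_ifs at h with h'
        · obtain rfl := List.mem_singleton.1 h
          refine ⟨0, by simp, rfl, ?_⟩
          cases l <;> simpa [firstOfs] using h'
        · simp at h
      · exact ⟨j + 1, by simpa using hj, by simpa using e, by simpa using h⟩
    · rintro ⟨j, hj, e, h⟩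
      cases j with
      | zero =>
        left
        obtain rfl : q = p := e
        rw [if_pos, List.mem_singleton]
        cases l <;> simpa [firstOfs] using h
      | succ j => exact .inr ⟨j, by simpa using hj, by simpa using e, by simpa using h⟩

namespace FFGram

variable {𝒢 : FFGram}

/-! ### The simplified grammar -/

open Classical in
/-- What becomes of an entry of a right-hand side in the simplification. -/
noncomputable def expand (𝒢 : FFGram) (p : GSym × ℕ) : List (GSym × ℕ) :=
  match p.1 with
  | .rule Q => if 𝒢.occurrences Q = 1 then (𝒢.simplified Q).map fun q => (q.1, p.2 + q.2) else [p]
  | _ => [p]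

theorem expand_one {R : List GSym} (h : 𝒢.occurrences R = 1) (c : ℕ) :
    𝒢.expand (.rule R, c) = (𝒢.simplified R).map fun q => (q.1, c + q.2) := by
  simp [expand, h]

theorem expand_of_ne {A : GSym} (h : ∀ R, 𝒢.occurrences R = 1 → A ≠ .rule R) (c : ℕ) :
    𝒢.expand (A, c) = [(A, c)] := by
  cases A with
  | rule R =>
    have : 𝒢.occurrences R ≠ 1 := fun h' => h R h' rfl
    simp [expand, this]
  | _ => rfl

/-- The depth to which rules are expanded is immaterial once it is at least the level. -/
theorem inline_stable (d : ℕ) : ∀ (d' : ℕ) (F : List GSym), GSym.lvlList F ≤ d →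
    GSym.lvlList F ≤ d' → 𝒢.inline d F = 𝒢.inline d' F := by
  have h0 : ∀ (d' : ℕ) (F : List GSym), GSym.lvlList F = 0 → 𝒢.inline d' F = F.zip (offsets F) := by
    intro d' F hF
    cases d' with
    | zero => rfl
    | succ d' =>
      rw [inline]
      conv_rhs => rw [← List.flatMap_singleton' (F.zip (offsets F))]
      refine List.flatMap_congr fun p hp => ?_
      obtain ⟨A, c⟩ := p
      have := lvl_le_lvlList (List.of_mem_zip hp).1
      cases A with
      | rule R => rw [GSym.lvl] at this; omega
      | _ => rfl
  induction d with
  | zero =>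
    intro d' F h _
    rw [h0 d' F (by omega), h0 0 F (by omega)]
  | succ d ih =>
    intro d' F h h'
    cases d' with
    | zero => rw [h0 _ F (by omega), h0 _ F (by omega)]
    | succ d' =>
      rw [inline, inline]
      refine List.flatMap_congr fun p hp => ?_
      obtain ⟨A, c⟩ := p
      have := lvl_le_lvlList (List.of_mem_zip hp).1
      cases A with
      | rule R =>
        rw [GSym.lvl] at this
        simp only
        rw [ih d' R (by omega) (by omega)]
      | _ => rfl

theorem HasRhs.simplified {X : Place} {F : List GSym} (h : 𝒢.HasRhs X F) :
    𝒢.simplified F = (F.zip (offsets F)).flatMap 𝒢.expand := by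
  rw [FFGram.simplified, inline_stable (𝒢.rounds) (𝒢.rounds + 1) F h.lvlList_le
    (h.lvlList_le.trans (Nat.le_succ _)), inline]
  refine List.flatMap_congr fun p hp => ?_
  obtain ⟨A, c⟩ := p
  cases A <;> rfl

theorem HasRhs.simplified_eq {X : Place} {A B C : GSym} {M : List GSym}
    (h : 𝒢.HasRhs X (A :: (M ++ [B, C]))) :
    𝒢.simplified (A :: (M ++ [B, C])) =
      (A, 0) :: ((place 0 M).flatMap 𝒢.expand ++ [(B, elen M), (C, elen M)]) := by
  rw [h.simplified, zip_offsets, List.flatMap_cons, List.flatMap_append, List.flatMap_cons,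
    List.flatMap_cons, List.flatMap_nil, expand_of_ne fun R hR => (h.ne_rule hR).1,
    expand_of_ne fun R hR => (h.ne_rule hR).2.1, expand_of_ne fun R hR => (h.ne_rule hR).2.2]
  rfl

theorem HasRhs.exists_eq {X : Place} {Q : List GSym} (h : 𝒢.HasRhs X Q) :
    ∃ A B C, Q = A :: (middle Q ++ [B, C]) ∧ 𝒢.simplified Q =
      (A, 0) :: ((place 0 (middle Q)).flatMap 𝒢.expand ++
        [(B, elen (middle Q)), (C, elen (middle Q))]) := by
  obtain ⟨A, B, C, e⟩ := exists_middle h.length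
  refine ⟨A, B, C, e, ?_⟩
  rw [e] at h
  conv_lhs => rw [e]
  rw [h.simplified_eq]

/-- The entries of the simplified right-hand side between which the offset grows. -/
noncomputable def heavyEntries (𝒢 : FFGram) (Q : List GSym) : List (GSym × ℕ) :=
  heavy (elen (middle Q)) (𝒢.simplified Q)

/-- Replacing an entry by a right-hand side keeps its offset as the first one, so that entries before
it are not affected. -/
theorem firstOfs_expand {X : Place} {Q : List GSym} (hQ : 𝒢.HasRhs X Q) (z : ℕ) {A : GSym}
    (hA : A ∈ Q) (c : ℕ) : firstOfs z (𝒢.expand (A, c)) = c := by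
  by_cases h : ∃ R, 𝒢.occurrences R = 1 ∧ A = .rule R
  · obtain ⟨R, h, rfl⟩ := h
    obtain ⟨A, B, C, -, e⟩ := HasRhs.exists_eq (X := .nonterminal R) ⟨hQ.mem_nonterminals hA, rfl⟩
    rw [expand_one h, e]
    rfl
  · rw [expand_of_ne fun R h1 h2 => h ⟨R, h1, h2⟩]
    rfl

theorem mem_of_mem_middle {A : GSym} {Q : List GSym} (h : A ∈ middle Q) : A ∈ Q :=
  List.mem_of_mem_drop (List.mem_of_mem_take h)

/-- The offset grows by the length of the expansion of each symbol of the middle, so that the entries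
that replace a symbol can be treated separately. -/
theorem HasRhs.heavyEntries {X : Place} {Q : List GSym} (hQ : 𝒢.HasRhs X Q) :
    𝒢.heavyEntries Q = (place 0 (middle Q)).flatMap fun p =>
      heavy (p.2 + p.1.efexp.length) (𝒢.expand p) := by
  obtain ⟨A, B, C, -, e⟩ := hQ.exists_eq
  have first : ∀ (M : List GSym) (s : ℕ), (∀ A ∈ M, A ∈ Q) →
      firstOfs (s + elen M) ((place s M).flatMap 𝒢.expand) = s := by
    intro M s hM
    cases M with
    | nil => rfl
    | cons A M =>
      rw [place, List.flatMap_cons, firstOfs_append, firstOfs_expand hQ _ (hM A (by simp))]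
  have key : ∀ (M : List GSym) (s : ℕ), (∀ A ∈ M, A ∈ Q) →
      heavy (s + elen M) ((place s M).flatMap 𝒢.expand) =
        (place s M).flatMap fun p => heavy (p.2 + p.1.efexp.length) (𝒢.expand p) := by
    intro M
    induction M with
    | nil => intros; rfl
    | cons A M ih =>
      intro s hM
      have hM' : ∀ A ∈ M, A ∈ Q := fun B hB => hM B (by simp [hB])
      rw [place, List.flatMap_cons, List.flatMap_cons, heavy_append, elen_cons, ← add_assoc,
        first _ _ hM', ih _ hM']
  have hm : ∀ A ∈ middle Q, A ∈ Q := fun A => mem_of_mem_middle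
  have k1 := key _ 0 hm
  have k2 := first _ 0 hm
  rw [zero_add] at k1 k2
  have h1 : heavy (elen (middle Q)) [(B, elen (middle Q)), (C, elen (middle Q))] = [] := by
    simp [heavy]
  have h2 : firstOfs (elen (middle Q)) [(B, elen (middle Q)), (C, elen (middle Q))] =
    elen (middle Q) := rfl
  rw [FFGram.heavyEntries, e, heavy_cons, firstOfs_append, heavy_append, h1, h2, k1, k2,
    if_neg (lt_irrefl 0), List.append_nil, List.nil_append]

/-- Offsets grow exactly at symbols with nonempty expansion from the middle of a right-hand side, be
it the original one or one that has been substituted. The first and the last two symbols of each are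
thus recognized by the offsets alone. -/
theorem HasRhs.mem_heavyEntries {X : Place} {Q : List GSym} (hQ : 𝒢.HasRhs X Q) {A : GSym}
    {c : ℕ} : (A, c) ∈ 𝒢.heavyEntries Q ↔
      ((A, c) ∈ place 0 (middle Q) ∧ A.efexp ≠ [] ∧ ∀ R, 𝒢.occurrences R = 1 → A ≠ .rule R) ∨
      ∃ R c' c'', (GSym.rule R, c') ∈ place 0 (middle Q) ∧ 𝒢.occurrences R = 1 ∧
        (A, c'') ∈ 𝒢.heavyEntries R ∧ c = c' + c'' := by
  rw [hQ.heavyEntries, List.mem_flatMap]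
  have one : ∀ {R c'}, 𝒢.occurrences R = 1 →
      ((A, c) ∈ heavy (c' + (GSym.rule R).efexp.length) (𝒢.expand (.rule R, c')) ↔
        ∃ c'', (A, c'') ∈ 𝒢.heavyEntries R ∧ c = c' + c'') := by
    intro R c' h
    rw [expand_one h, heavy_map, length_efexp_rule, List.mem_map, Prod.exists]
    constructor
    · rintro ⟨A, c'', h, e⟩; cases e; exact ⟨c'', h, rfl⟩
    · rintro ⟨c'', h, rfl⟩; exact ⟨A, c'', h, rfl⟩
  have ne : ∀ {B c'}, (∀ R, 𝒢.occurrences R = 1 → B ≠ .rule R) →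
      ((A, c) ∈ heavy (c' + B.efexp.length) (𝒢.expand (B, c')) ↔
        (A, c) = (B, c') ∧ B.efexp ≠ []) := by
    intro B c' h
    rw [expand_of_ne h, heavy]
    split_ifs with h'
    · simp only [lt_add_iff_pos_right, List.length_pos_iff] at h'
      simp [h']
    · simp only [lt_add_iff_pos_right, List.length_pos_iff, not_not] at h'
      simp [h']
  constructor
  · rintro ⟨⟨B, c'⟩, h1, h2⟩
    by_cases h : ∃ R, 𝒢.occurrences R = 1 ∧ B = .rule R
    · obtain ⟨R, h, rfl⟩ := h
      obtain ⟨c'', h3, rfl⟩ := (one h).1 h2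
      exact .inr ⟨R, c', c'', h1, h, h3, rfl⟩
    · have hn : ∀ R, 𝒢.occurrences R = 1 → B ≠ .rule R := fun R h1 h2 => h ⟨R, h1, h2⟩
      obtain ⟨e, h3⟩ := (ne hn).1 h2
      cases e
      exact .inl ⟨h1, h3, hn⟩
  · rintro (⟨h1, h2, h3⟩ | ⟨R, c', c'', h1, h2, h3, rfl⟩)
    · exact ⟨_, h1, (ne h3).2 ⟨rfl, h2⟩⟩
    · exact ⟨_, h1, (one h2).2 ⟨c'', h3, rfl⟩⟩

/-- The offsets of a simplified right-hand side increase up to the length of the expansion. -/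
theorem HasRhs.sorted {X : Place} {Q : List GSym} (hQ : 𝒢.HasRhs X Q) :
    (𝒢.simplified Q).Pairwise (fun p q => p.2 ≤ q.2) ∧
      ∀ p ∈ 𝒢.simplified Q, p.2 ≤ elen (middle Q) := by
  refine HasRhs.induct (𝒢 := 𝒢) (motive := fun Q =>
    (𝒢.simplified Q).Pairwise (fun p q => p.2 ≤ q.2) ∧
      ∀ p ∈ 𝒢.simplified Q, p.2 ≤ elen (middle Q)) (fun X Q hQ ih => ?_) hQ
  have one : ∀ A ∈ Q, ∀ c, (𝒢.expand (A, c)).Pairwise (fun p q => p.2 ≤ q.2) ∧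
      ∀ p ∈ 𝒢.expand (A, c), c ≤ p.2 ∧ p.2 ≤ c + A.efexp.length := by
    intro A hA c
    by_cases h : ∃ R, 𝒢.occurrences R = 1 ∧ A = .rule R
    · obtain ⟨R, h, rfl⟩ := h
      obtain ⟨h1, h2⟩ := ih R hA ⟨hQ.mem_nonterminals hA, rfl⟩
      rw [expand_one h, List.pairwise_map]
      refine ⟨h1.imp fun h => Nat.add_le_add_left h c, fun p hp => ?_⟩
      obtain ⟨q, hq, rfl⟩ := List.mem_map.1 hp
      have := h2 q hq
      rw [length_efexp_rule]
      simp only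
      omega
    · rw [expand_of_ne fun R h1 h2 => h ⟨R, h1, h2⟩]
      simp
  have key : ∀ (M : List GSym) (s : ℕ), (∀ A ∈ M, A ∈ Q) →
      ((place s M).flatMap 𝒢.expand).Pairwise (fun p q => p.2 ≤ q.2) ∧
      ∀ p ∈ (place s M).flatMap 𝒢.expand, s ≤ p.2 ∧ p.2 ≤ s + elen M := by
    intro M
    induction M with
    | nil => intro s _; simp [place]
    | cons A M ih =>
      intro s hM
      obtain ⟨h1, h2⟩ := ih (s + A.efexp.length) fun B hB => hM B (by simp [hB])
      obtain ⟨h3, h4⟩ := one A (hM A (by simp)) s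
      rw [place, List.flatMap_cons, List.pairwise_append, elen_cons]
      refine ⟨⟨h3, h1, fun p hp q hq => ?_⟩, fun p hp => ?_⟩
      · have := h4 p hp; have := h2 q hq; omega
      · rcases List.mem_append.1 hp with hp | hp
        · have := h4 p hp; omega
        · have := h2 p hp; omega
  obtain ⟨A, B, C, -, e⟩ := hQ.exists_eq
  obtain ⟨h1, h2⟩ := key (middle Q) 0 fun A => mem_of_mem_middle
  rw [zero_add] at h2
  have h3 : ∀ p ∈ (place 0 (middle Q)).flatMap 𝒢.expand ++
      [(B, elen (middle Q)), (C, elen (middle Q))], p.2 ≤ elen (middle Q) := by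
    intro p hp
    rcases List.mem_append.1 hp with hp | hp
    · exact (h2 p hp).2
    · simp only [List.mem_cons, List.not_mem_nil, or_false] at hp
      rcases hp with rfl | rfl <;> exact le_rfl
  rw [e]
  refine ⟨List.pairwise_cons.2 ⟨fun _ _ => Nat.zero_le _, List.pairwise_append.2 ⟨h1, ?_, ?_⟩⟩, ?_⟩
  · simp
  · intro p hp q hq
    have := h2 p hp
    simp only [List.mem_cons, List.not_mem_nil, or_false] at hq
    rcases hq with rfl | rfl <;> exact this.2
  · intro p hp
    rcases List.mem_cons.1 hp with rfl | hp
    · exact Nat.zero_le _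
    · exact h3 p hp

/-- The symbols of a simplified right-hand side are letters, `$`, `#`, or nonterminals of the
simplified grammar. -/
theorem HasRhs.mem_simplified {X : Place} {Q : List GSym} (hQ : 𝒢.HasRhs X Q) {A : GSym} {c : ℕ}
    (hA : (A, c) ∈ 𝒢.simplified Q) :
    (∀ a, A = .letter a → ∃ t ∈ 𝒢.T, a ∈ t) ∧
    ∀ R, A = .rule R → R ∈ 𝒢.nonterminals ∧ 𝒢.occurrences R ≠ 1 ∧ A.lvl ≤ GSym.lvlList Q := by
  revert A c
  refine HasRhs.induct (𝒢 := 𝒢) (motive := fun Q => ∀ {A : GSym} {c : ℕ},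
    (A, c) ∈ 𝒢.simplified Q → (∀ a, A = .letter a → ∃ t ∈ 𝒢.T, a ∈ t) ∧
    ∀ R, A = .rule R → R ∈ 𝒢.nonterminals ∧ 𝒢.occurrences R ≠ 1 ∧ A.lvl ≤ GSym.lvlList Q)
    (fun X Q hQ ih => ?_) hQ
  intro A c hA
  rw [hQ.simplified, List.mem_flatMap] at hA
  obtain ⟨⟨B, c'⟩, hB, hA⟩ := hA
  have hB' := (List.of_mem_zip hB).1
  by_cases h : ∃ R, 𝒢.occurrences R = 1 ∧ B = .rule R
  · obtain ⟨R, h, rfl⟩ := h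
    rw [expand_one h, List.mem_map] at hA
    obtain ⟨q, hq, e⟩ := hA
    cases e
    obtain ⟨h1, h2⟩ := ih R hB' ⟨hQ.mem_nonterminals hB', rfl⟩ hq
    refine ⟨h1, fun R' hR' => ⟨(h2 R' hR').1, (h2 R' hR').2.1, (h2 R' hR').2.2.trans ?_⟩⟩
    have := lvl_le_lvlList hB'
    rw [GSym.lvl] at this
    omega
  · rw [expand_of_ne fun R h1 h2 => h ⟨R, h1, h2⟩, List.mem_singleton] at hA
    cases hA
    refine ⟨fun a ha => ?_, fun R hR => ?_⟩
    · subst ha; exact hQ.letter hB'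
    · subst hR
      exact ⟨hQ.mem_nonterminals hB', fun h1 => h ⟨R, h1, rfl⟩, lvl_le_lvlList hB'⟩

/-- The expansions of these entries lie within that of the right-hand side. -/
theorem HasRhs.heavy_le {X : Place} {Q : List GSym} (hQ : 𝒢.HasRhs X Q) {A : GSym} {c : ℕ}
    (hA : (A, c) ∈ 𝒢.heavyEntries Q) : c + A.efexp.length ≤ elen (middle Q) := by
  revert A c
  refine HasRhs.induct (𝒢 := 𝒢) (motive := fun Q => ∀ {A : GSym} {c : ℕ},
    (A, c) ∈ 𝒢.heavyEntries Q → c + A.efexp.length ≤ elen (middle Q)) (fun X Q hQ ih => ?_) hQ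
  intro A c hA
  rcases hQ.mem_heavyEntries.1 hA with ⟨h1, -, -⟩ | ⟨R, c', c'', h1, h2, h3, rfl⟩
  · simpa using (mem_place h1).2.2
  · have hR := mem_of_mem_middle (mem_place h1).1
    have h4 := ih R hR ⟨hQ.mem_nonterminals hR, rfl⟩ h3
    have h5 := (mem_place h1).2.2
    rw [length_efexp_rule] at h5
    omega

/-! ### The size of the simplified grammar -/

/-- The length of a simplified right-hand side grows by at most those of the right-hand sides that
are substituted into it. -/
theorem HasRhs.length_simplified {X : Place} {Q : List GSym} (hQ : 𝒢.HasRhs X Q) :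
    (𝒢.simplified Q).length ≤ Q.length +
      ∑ R ∈ 𝒢.nonterminals with 𝒢.occurrences R = 1,
        Q.count (.rule R) * (𝒢.simplified R).length := by
  have key : ∀ l : List (GSym × ℕ), (∀ p ∈ l, p.1 ∈ Q) → (l.flatMap 𝒢.expand).length ≤ l.length +
      ∑ R ∈ 𝒢.nonterminals with 𝒢.occurrences R = 1,
        (l.map Prod.fst).count (.rule R) * (𝒢.simplified R).length := by
    intro l hl
    induction l with
    | nil => simp
    | cons p l ih =>
      have ih := ih fun p hp => hl p (by simp [hp])
      obtain ⟨A, c⟩ := p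
      have hA := hl (A, c) (by simp)
      simp only [List.flatMap_cons, List.map_cons, List.length_append, List.length_cons,
        List.count_cons, add_mul, Finset.sum_add_distrib]
      suffices H : (𝒢.expand (A, c)).length ≤ 1 + ∑ R ∈ 𝒢.nonterminals with 𝒢.occurrences R = 1,
          (if A == .rule R then 1 else 0) * (𝒢.simplified R).length by omega
      by_cases h : ∃ R, 𝒢.occurrences R = 1 ∧ A = .rule R
      · obtain ⟨R, h, rfl⟩ := h
        rw [expand_one h, List.length_map]
        refine le_trans (le_of_eq ?_) ((Finset.single_le_sum (fun _ _ => Nat.zero_le _)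
          (Finset.mem_filter.2 ⟨hQ.mem_nonterminals hA, h⟩)).trans (Nat.le_add_left _ 1))
        simp
      · rw [expand_of_ne fun R h1 h2 => h ⟨R, h1, h2⟩]
        simp
  have h := key (Q.zip (offsets Q)) fun p hp => (List.of_mem_zip hp).1
  rw [← hQ.simplified, List.map_fst_zip (by simp)] at h
  simpa using h

/-- Simplification does not increase the total length of the right-hand sides. -/
theorem sum_simplified_le :
    ∑ F ∈ 𝒢.nonterminals with 𝒢.occurrences F ≠ 1, (𝒢.simplified F).length +
      (𝒢.startParts.map fun F => (𝒢.simplified F).length).sum ≤ 𝒢.size := by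
  have hs : ∀ f : List GSym → ℕ, (𝒢.rhsList.map fun p => f p.2).sum =
      ∑ F ∈ 𝒢.nonterminals, f F + (𝒢.startParts.map f).sum := by
    intro f
    rw [rhsList, List.map_append, List.sum_append, List.map_map, List.map_map]
    congr 1
    · rw [← Finset.sum_map_toList]; rfl
    · conv_rhs => rw [← List.zipIdx_map_fst 0 𝒢.startParts, List.map_map]
      rfl
  have h1 : (𝒢.rhsList.map fun p => (𝒢.simplified p.2).length).sum ≤
      (𝒢.rhsList.map fun p => p.2.length + ∑ R ∈ 𝒢.nonterminals with 𝒢.occurrences R = 1,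
        p.2.count (.rule R) * (𝒢.simplified R).length).sum :=
    List.sum_le_sum fun p hp => (mem_rhsList.1 hp).length_simplified
  have h2 : ∀ l : List (Place × List GSym), (l.map fun p => p.2.length +
      ∑ R ∈ 𝒢.nonterminals with 𝒢.occurrences R = 1,
        p.2.count (.rule R) * (𝒢.simplified R).length).sum = (l.map fun p => p.2.length).sum +
      ∑ R ∈ 𝒢.nonterminals with 𝒢.occurrences R = 1,
        (l.map fun p => p.2.count (.rule R)).sum * (𝒢.simplified R).length := by
    intro l
    induction l with
    | nil => simp
    | cons p l ih =>
      simp only [List.map_cons, List.sum_cons, ih, add_mul, Finset.sum_add_distrib]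
      omega
  rw [h2, hs fun Q => (𝒢.simplified Q).length, hs fun Q => Q.length] at h1
  have h3 : ∑ R ∈ 𝒢.nonterminals with 𝒢.occurrences R = 1,
      (𝒢.rhsList.map fun p => p.2.count (.rule R)).sum * (𝒢.simplified R).length =
      ∑ R ∈ 𝒢.nonterminals with 𝒢.occurrences R = 1, (𝒢.simplified R).length := by
    refine Finset.sum_congr rfl fun R hR => ?_
    rw [hs fun Q => Q.count (.rule R)]
    have : 𝒢.occurrences R = 1 := (Finset.mem_filter.1 hR).2
    rw [occurrences] at this
    rw [this, one_mul]
  rw [h3, ← Finset.sum_filter_add_sum_filter_not 𝒢.nonterminals fun R => 𝒢.occurrences R = 1] at h1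
  have h4 : 𝒢.size = ∑ F ∈ 𝒢.nonterminals, F.length + (𝒢.startParts.map List.length).sum := rfl
  simp only [ne_eq]
  have h5 : (𝒢.startParts.map fun Q => Q.length).sum = (𝒢.startParts.map List.length).sum := rfl
  omega

end FFGram

namespace FFGram

variable {𝒢 : FFGram}

/-! ### Relocation -/

/-- The place still exists in the simplified grammar. -/
def Kept (𝒢 : FFGram) (X : Place) : Prop := ∀ F, X = .nonterminal F → 𝒢.occurrences F ≠ 1

theorem Relocates.kept {X X' : Place} {o o' : ℤ} (h : 𝒢.Relocates X o X' o') : 𝒢.Kept X' := by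
  induction h with
  | text => intro F h; cases h
  | keep F o h => intro F' h'; cases h'; exact h
  | up _ _ _ _ _ _ _ _ _ _ _ ih => exact ih

theorem Kept.relocates {X : Place} (h : 𝒢.Kept X) (o : ℤ) : 𝒢.Relocates X o X o := by
  cases X with
  | nonterminal F => exact .keep F o (h F rfl)
  | text x => exact .text x o

/-- A place that is removed occurs only once, so that it moves to a unique place. -/
theorem Relocates.unique {X X₁ X₂ : Place} {o o₁ o₂ : ℤ} (h₁ : 𝒢.Relocates X o X₁ o₁)
    (h₂ : 𝒢.Relocates X o X₂ o₂) : X₁ = X₂ ∧ o₁ = o₂ := by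
  induction h₁ with
  | text x o => cases h₂; exact ⟨rfl, rfl⟩
  | keep F o h =>
    cases h₂ with
    | keep => exact ⟨rfl, rfl⟩
    | up _ _ h' => exact absurd h' h
  | up F o h Y Q hQ c hc X' o' hY ih =>
    cases h₂ with
    | keep _ _ h' => exact absurd h h'
    | up _ _ _ Y' Q' hQ' c' hc' _ _ hY' =>
      have := occList_unique h (mem_occList.2 ⟨Q, hQ, hc⟩) (mem_occList.2 ⟨Q', hQ', hc'⟩)
      cases this
      exact ih hY'

theorem Child.of_occurrences {F Q : List GSym} {X : Place} {c : ℕ} (h : 𝒢.occurrences F = 1)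
    (hQ : 𝒢.HasRhs X Q) (hc : (GSym.rule F, c) ∈ Q.zip (offsets Q)) : 𝒢.Child X (.rule F) c := by
  obtain ⟨x, z, hz⟩ := exists_at (hQ.mem_nonterminals (List.of_mem_zip hc).1) 0
  obtain ⟨Y, c', hY, -⟩ := hz.up
  have := occList_unique h (FFGram.mem_occList.2 ⟨Q, hQ, hc⟩) hY.mem_occList
  cases this
  exact hY

theorem Child.relocates {F : List GSym} {X X' : Place} {c : ℕ} {o o' : ℤ}
    (hc : 𝒢.Child X (.rule F) c) (h : 𝒢.occurrences F = 1) (hX : 𝒢.Relocates X (o + c) X' o') :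
    𝒢.Relocates (.nonterminal F) o X' o' := by
  obtain ⟨Q, hQ, hc⟩ := hc
  exact .up F o h X Q hQ c (mem_zip_of_mem_place hQ.length hc) X' o' hX

theorem At.hasRhs {X : Place} {o : ℤ} {x : ℕ} {z : ℤ} (h : 𝒢.At X o x z) :
    ∃ Q, 𝒢.HasRhs X Q := by
  cases X with
  | nonterminal F =>
    obtain ⟨t, i, s, ht, h1, h2, h3, -⟩ := at_nonterminal_iff.1 h
    obtain ⟨i, rfl⟩ : ∃ j, i = j + 1 := ⟨i - 1, by omega⟩
    exact ⟨F, mem_nonterminals.2 ⟨i, h2, t, List.mem_of_getElem? ht, (mem_place h3).1⟩, rfl⟩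
  | text y =>
    obtain ⟨rfl, -, hx⟩ := at_text_iff.1 h
    exact ⟨_, hasRhs_text.2 ⟨_, List.getElem?_eq_getElem hx, rfl⟩⟩

/-- Relocation does not change the positions in the strings that a place with an offset denotes. -/
theorem Relocates.at {X X' : Place} {o o' : ℤ} (h : 𝒢.Relocates X o X' o') {x : ℕ} {z : ℤ} :
    𝒢.At X o x z ↔ 𝒢.At X' o' x z := by
  induction h with
  | text => exact Iff.rfl
  | keep => exact Iff.rfl
  | up F o h Y Q hQ c hc X' o' hY ih =>
    rw [← ih]
    have hch := Child.of_occurrences h hQ hc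
    refine ⟨fun H => ?_, At.down hch⟩
    obtain ⟨Y', c', hc', H'⟩ := H.up
    have := occList_unique h hc'.mem_occList hch.mem_occList
    cases this
    exact H'

/-- Every place is moved to some place that is kept, since levels increase on the way. -/
theorem exists_relocates {X : Place} {Q : List GSym} (hQ : 𝒢.HasRhs X Q) (o : ℤ) :
    ∃ X' o', 𝒢.Relocates X o X' o' := by
  suffices H : ∀ n X Q o, 𝒢.rounds - GSym.lvlList Q < n → 𝒢.HasRhs X Q →
      ∃ X' o', 𝒢.Relocates X o X' o' from H _ X Q o (Nat.lt_succ_self _) hQ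
  intro n
  induction n with
  | zero => intro _ _ _ h; omega
  | succ n ih =>
    intro X Q o hn hQ
    cases X with
    | text x => exact ⟨_, _, .text x o⟩
    | nonterminal F =>
      obtain ⟨hF, rfl⟩ := hasRhs_nonterminal.1 hQ
      by_cases h1 : 𝒢.occurrences Q = 1
      · obtain ⟨x, z, hz⟩ := exists_at hF o
        obtain ⟨Y, c, hY, -⟩ := hz.up
        have hY' := hY
        obtain ⟨R, hR, hc⟩ := hY
        have h2 := lvl_le_lvlList (mem_of_mem_middle (mem_place hc).1)
        have h3 := hR.lvlList_le
        simp only [GSym.lvl] at h2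
        obtain ⟨X', o', h⟩ := ih Y R (o + c) (by omega) hR
        exact ⟨X', o', hY'.relocates h1 h⟩
      · exact ⟨_, _, .keep Q o h1⟩

/-! ### Climbing in the simplified grammar -/

/-- The entries of a right-hand side that is substituted reappear, shifted by the offset. -/
theorem Relocates.heavyEntries {X X' : Place} {o o' : ℤ} (h : 𝒢.Relocates X o X' o')
    {Q : List GSym} (hQ : 𝒢.HasRhs X Q) :
    ∃ Q', 𝒢.HasRhs X' Q' ∧ ∃ c : ℕ, o' = o + c ∧
      ∀ A d, (A, d) ∈ 𝒢.heavyEntries Q → (A, c + d) ∈ 𝒢.heavyEntries Q' := by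
  induction h generalizing Q with
  | text => exact ⟨Q, hQ, 0, by simp, fun A d h => by simpa using h⟩
  | keep => exact ⟨Q, hQ, 0, by simp, fun A d h => by simpa using h⟩
  | up F o h Y R hR c hc X' o' hY ih =>
    obtain ⟨Q', hQ', c', rfl, H⟩ := ih hR
    obtain ⟨R', hR', hc'⟩ := Child.of_occurrences h hR hc
    obtain rfl := hR.unique hR'
    obtain ⟨-, rfl⟩ := hasRhs_nonterminal.1 hQ
    refine ⟨Q', hQ', c' + c, by push_cast; ring, fun A d hd => ?_⟩
    rw [add_assoc]
    exact H A _ (hR.mem_heavyEntries.2 (.inr ⟨_, c, d, hc', h, hd, rfl⟩))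

/-- A nonterminal of a simplified right-hand side is a child of a place that is relocated to the
latter. -/
theorem HasRhs.heavy_parent {Y : Place} {Q : List GSym} (hQ : 𝒢.HasRhs Y Q) {F : List GSym} {c : ℕ}
    (hc : (GSym.rule F, c) ∈ 𝒢.heavyEntries Q) :
    (GSym.rule F).efexp ≠ [] ∧ ∃ X c₁, 𝒢.Child X (.rule F) c₁ ∧
      ∀ o X' o', 𝒢.Relocates Y (o + c) X' o' → 𝒢.Relocates X (o + c₁) X' o' := by
  suffices H : ∀ (Y : Place), 𝒢.HasRhs Y Q → (GSym.rule F).efexp ≠ [] ∧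
      ∃ X c₁, 𝒢.Child X (.rule F) c₁ ∧
      ∀ o X' o', 𝒢.Relocates Y (o + c) X' o' → 𝒢.Relocates X (o + c₁) X' o' from H Y hQ
  revert c
  refine HasRhs.induct (𝒢 := 𝒢) (motive := fun Q => ∀ {c},
      (GSym.rule F, c) ∈ 𝒢.heavyEntries Q → ∀ (Y : Place), 𝒢.HasRhs Y Q →
      (GSym.rule F).efexp ≠ [] ∧ ∃ X c₁, 𝒢.Child X (.rule F) c₁ ∧
      ∀ o X' o', 𝒢.Relocates Y (o + c) X' o' → 𝒢.Relocates X (o + c₁) X' o')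
    (fun _ Q _ ih => ?_) hQ
  intro c hc Y hQ
  rcases hQ.mem_heavyEntries.1 hc with ⟨h1, h2, -⟩ | ⟨R, c', c'', h1, h2, h3, rfl⟩
  · exact ⟨h2, Y, c, ⟨Q, hQ, h1⟩, fun _ _ _ h => h⟩
  · have hR := mem_of_mem_middle (mem_place h1).1
    have hR' : 𝒢.HasRhs (.nonterminal R) R := ⟨hQ.mem_nonterminals hR, rfl⟩
    obtain ⟨h4, X, c₁, hX, H⟩ := ih R hR hR' h3 _ hR'
    refine ⟨h4, X, c₁, hX, fun o X' o' h => H o X' o' ?_⟩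
    have h5 : 𝒢.Child Y (.rule R) c' := ⟨Q, hQ, h1⟩
    refine h5.relocates h2 ?_
    rwa [add_assoc, add_comm (c'' : ℤ), ← Nat.cast_add]

/-- The positions of a nonterminal of the simplified grammar, in terms of those of the places
above it. -/
theorem at_iff_heavy {F : List GSym} (hF : 𝒢.occurrences F ≠ 1) (hne : (GSym.rule F).efexp ≠ [])
    {o z : ℤ} {x : ℕ} :
    𝒢.At (.nonterminal F) o x z ↔ ∃ X Q c, 𝒢.Kept X ∧ 𝒢.HasRhs X Q ∧
      (GSym.rule F, c) ∈ 𝒢.heavyEntries Q ∧ 𝒢.At X (o + (c : ℕ)) x z := by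
  constructor
  · intro h
    obtain ⟨X, c₁, ⟨Q, hQ, hc⟩, h'⟩ := h.up
    obtain ⟨X', o', hr⟩ := exists_relocates hQ (o + c₁)
    obtain ⟨Q', hQ', c, rfl, H⟩ := hr.heavyEntries hQ
    refine ⟨X', Q', c + c₁, hr.kept, hQ', H _ _ (hQ.mem_heavyEntries.2 (.inl ⟨hc, hne, ?_⟩)), ?_⟩
    · intro R hR h; cases h; exact hF hR
    · have := hr.at.1 h'
      convert this using 1
      push_cast; ring
  · rintro ⟨X, Q, c, hX, hQ, hc, h⟩
    obtain ⟨-, Y, c₁, hY, H⟩ := hQ.heavy_parent hc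
    exact At.down hY ((H o X _ (hX.relocates _)).at.2 h)

/-- In the simplified grammar, too, an occurrence of a nonterminal has only one parent. -/
theorem heavy_unique {x : ℕ} {t : List ℕ} (ht : 𝒢.T[x]? = some t) (hne : t ≠ [])
    {F Q Q' : List GSym} {X X' : Place} {c c' : ℕ} (hX : 𝒢.Kept X) (hX' : 𝒢.Kept X')
    (hQ : 𝒢.HasRhs X Q) (hQ' : 𝒢.HasRhs X' Q') (hc : (GSym.rule F, c) ∈ 𝒢.heavyEntries Q)
    (hc' : (GSym.rule F, c') ∈ 𝒢.heavyEntries Q') {o z : ℤ} (h : 𝒢.At X (o + c) x z)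
    (h' : 𝒢.At X' (o + c') x z) : X = X' ∧ c = c' := by
  obtain ⟨-, Y, c₁, hY, H⟩ := hQ.heavy_parent hc
  obtain ⟨-, Y', c₁', hY', H'⟩ := hQ'.heavy_parent hc'
  have r := H o X _ (hX.relocates _)
  have r' := H' o X' _ (hX'.relocates _)
  obtain ⟨rfl, rfl⟩ := At.parent_unique ht hne hY hY' (r.at.2 h) (r'.at.2 h')
  obtain ⟨rfl, e⟩ := r.unique r'
  exact ⟨rfl, by omega⟩

end FFGram

/-! ### The output of the program -/

namespace RAM

theorem Inst.nodup_E (I : Inst) (v : ℕ) : (I.E v).Nodup := by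
  have step : ∀ b j, (I.pre b 0).Nodup → (I.pre b j).Nodup := by
    intro b j h
    induction j with
    | zero => exact h
    | succ j ih =>
      rw [I.pre_succ]
      split_ifs with h'
      · refine List.nodup_append.2 ⟨ih, List.nodup_singleton _, ?_⟩
        rintro p hp q hq rfl
        rw [List.mem_singleton] at hq
        subst hq
        exact lt_irrefl _ (I.adr_lt_of_mem_pre hp)
      · rwa [List.append_nil]
  have base : ∀ b, (I.pre b 0).Nodup := by
    intro b
    induction b with
    | zero => simp [Inst.pre, Inst.row_zero]
    | succ b ih => rw [← I.pre_len]; exact step b _ ih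
  exact List.nodup_reverse.2 ((base _).filter _)

/-- The strings, with positions, that a climb of at most `n` steps reaches. -/
def Inst.ascend (I : Inst) : ℕ → ℕ → ℤ → List (ℕ × ℤ)
  | 0, _, _ => []
  | n + 1, v, o =>
    if I.r ≤ v then [(v - I.r, o)]
    else (I.E v).flatMap fun p => Inst.ascend I n p.1 (o + I.ofs p.1 p.2)

/-- There is a function that gives the ends of all climbs, since these are finite. -/
theorem Valid.exists_paths {I : Inst} {inp : ℕ → ℤ} {N : ℕ} {rank sz : ℕ → ℕ} {good : ℕ → Prop}
    (hV : Valid I inp N rank sz good) : ∃ P, Paths I P := by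
  obtain ⟨R, hR⟩ : ∃ R, ∀ b < I.nb, rank b ≤ R :=
    ⟨∑ b ∈ Finset.range I.nb, rank b, fun b hb =>
      Finset.single_le_sum (f := rank) (fun _ _ => Nat.zero_le _) (Finset.mem_range.2 hb)⟩
  have stable : ∀ n n' v o, R - rank v < n → R - rank v < n' →
      I.ascend n v o = I.ascend n' v o := by
    intro n
    induction n with
    | zero => intro _ _ _ h; omega
    | succ n ih =>
      intro n' v o h h'
      obtain ⟨n', rfl⟩ : ∃ k, n' = k + 1 := ⟨n' - 1, by omega⟩
      rw [Inst.ascend, Inst.ascend]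
      split_ifs with hv
      · rfl
      · refine List.flatMap_congr fun p hp => ?_
        obtain ⟨h1, h2, h3, rfl⟩ := I.mem_E.1 hp
        have h4 := hV.rank_lt _ h1 _ h2 h3
        have h5 := hR _ h1
        exact ih _ _ _ (by omega) (by omega)
  refine ⟨I.ascend (R + 2), ⟨fun v o hv => by rw [Inst.ascend, if_pos hv], fun v o hv => ?_⟩⟩
  rw [Inst.ascend, if_neg (by omega)]
  refine List.flatMap_congr fun p hp => stable _ _ _ _ (by omega) (by omega)

theorem exists_outs (I : Inst) (P : ℕ → ℤ → List (ℕ × ℤ)) : ∀ n, ∃ out, Outs I P n out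
  | 0 => ⟨[], rfl⟩
  | n + 1 => by
    obtain ⟨out, h⟩ := exists_outs I P n
    exact ⟨_, out, _, _, h, List.Perm.refl _, List.Perm.refl _, rfl⟩

/-- What is printed for a tuple is the code of a list of matches. -/
theorem pairs_eq {A B : List (ℕ × ℤ)} (l : ℕ) (hA : ∀ p ∈ A, 0 ≤ p.2) (hB : ∀ p ∈ B, 0 ≤ p.2) :
    pairs A B l = (A.flatMap fun p => B.map fun q =>
      (⟨p.1, q.1, p.2.toNat, q.2.toNat, l⟩ : Match)).flatMap Match.code := by
  rw [pairs, List.flatMap_assoc]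
  refine List.flatMap_congr fun p hp => ?_
  rw [List.flatMap_map]
  refine List.flatMap_congr fun q hq => ?_
  simp [Match.code, hA p hp, hB q hq]

/-- If every pair of climbs for a tuple gives a match and no match arises twice, the output is the
list of these matches. -/
theorem Outs.matches {I : Inst} {P : ℕ → ℤ → List (ℕ × ℤ)} :
    ∀ {n : ℕ} {out : List ℤ}, Outs I P n out →
      (∀ i < n, ((P (I.X i) (I.oX i)).Nodup ∧ ∀ p ∈ P (I.X i) (I.oX i), 0 ≤ p.2) ∧
        (P (I.Y i) (I.oY i)).Nodup ∧ ∀ p ∈ P (I.Y i) (I.oY i), 0 ≤ p.2) →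
      (∀ i < n, ∀ i' < n, ∀ p, p ∈ P (I.X i) (I.oX i) → p ∈ P (I.X i') (I.oX i') →
        ∀ q, q ∈ P (I.Y i) (I.oY i) → q ∈ P (I.Y i') (I.oY i') → I.tl i = I.tl i' → i = i') →
      ∃ Ms : List Match, out = Ms.flatMap Match.code ∧ Ms.Nodup ∧
        (∀ M : Match, M ∈ Ms ↔ ∃ i < n, M.len = I.tl i ∧ (M.x, (M.a : ℤ)) ∈ P (I.X i) (I.oX i) ∧
          (M.y, (M.b : ℤ)) ∈ P (I.Y i) (I.oY i)) ∧
        Ms.length = ∑ i ∈ Finset.range n,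
          (P (I.X i) (I.oX i)).length * (P (I.Y i) (I.oY i)).length
  | 0, out, h, _, _ => by
    obtain rfl : out = [] := h
    exact ⟨[], rfl, List.nodup_nil, by simp, by simp⟩
  | n + 1, out, h, h1, h2 => by
    obtain ⟨o', A, B, ho, hA, hB, rfl⟩ := h
    obtain ⟨Ms, rfl, m1, m2, m3⟩ := Outs.matches ho (fun i hi => h1 i (by omega))
      fun i hi i' hi' => h2 i (by omega) i' (by omega)
    obtain ⟨⟨n1, p1⟩, n2, p2⟩ := h1 n (by omega)
    have pA : ∀ p ∈ A, 0 ≤ p.2 := fun p hp => p1 p (hA.mem_iff.1 hp)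
    have pB : ∀ p ∈ B, 0 ≤ p.2 := fun p hp => p2 p (hB.mem_iff.1 hp)
    have hm : ∀ M : Match, (M ∈ A.flatMap fun p => B.map fun q =>
        (⟨p.1, q.1, p.2.toNat, q.2.toNat, I.tl n⟩ : Match)) ↔ M.len = I.tl n ∧
        (M.x, (M.a : ℤ)) ∈ P (I.X n) (I.oX n) ∧ (M.y, (M.b : ℤ)) ∈ P (I.Y n) (I.oY n) := by
      rintro ⟨x, y, a, b, len⟩
      rw [← hA.mem_iff, ← hB.mem_iff]
      simp only [List.mem_flatMap, List.mem_map, Match.mk.injEq, Prod.exists]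
      constructor
      · rintro ⟨x, a', h3, y, b', h4, rfl, rfl, rfl, rfl, rfl⟩
        have e1 : 0 ≤ a' := pA _ h3
        have e2 : 0 ≤ b' := pB _ h4
        rw [Int.toNat_of_nonneg e1, Int.toNat_of_nonneg e2]
        exact ⟨rfl, h3, h4⟩
      · rintro ⟨rfl, h3, h4⟩
        exact ⟨x, a, h3, y, b, h4, rfl, rfl, by simp, by simp, rfl⟩
    refine ⟨Ms ++ A.flatMap fun p => B.map fun q => ⟨p.1, q.1, p.2.toNat, q.2.toNat, I.tl n⟩,
      ?_, List.nodup_append.2 ⟨m1, ?_, ?_⟩, fun M => ?_, ?_⟩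
    · rw [List.flatMap_append, pairs_eq _ pA pB]
    · rw [List.nodup_flatMap]
      refine ⟨fun p hp => ?_, ?_⟩
      · refine List.Nodup.map_on ?_ (hB.nodup_iff.2 n2)
        rintro ⟨y, b⟩ hq ⟨y', b'⟩ hq' h
        simp only [Match.mk.injEq] at h
        have e1 : 0 ≤ b := pB _ hq
        have e2 : 0 ≤ b' := pB _ hq'
        rw [Prod.mk.injEq]
        omega
      · refine (hA.nodup_iff.2 n1).pairwise_of_forall_ne ?_
        rintro ⟨x, a⟩ hp ⟨x', a'⟩ hp' hne M hM hM'
        obtain ⟨q, -, rfl⟩ := List.mem_map.1 hM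
        obtain ⟨q', -, h⟩ := List.mem_map.1 hM'
        simp only [Match.mk.injEq] at h
        have e1 : 0 ≤ a := pA _ hp
        have e2 : 0 ≤ a' := pA _ hp'
        apply hne
        rw [Prod.mk.injEq]
        omega
    · rintro M hM M' hM' rfl
      obtain ⟨i, hi, g1, g2, g3⟩ := (m2 M).1 hM
      obtain ⟨k1, k2, k3⟩ := (hm M).1 hM'
      have := h2 i (by omega) n (by omega) _ g2 k2 _ g3 k3 (by omega)
      omega
    · rw [List.mem_append, m2, hm]
      constructor
      · rintro (⟨i, hi, h⟩ | h)
        · exact ⟨i, by omega, h⟩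
        · exact ⟨n, by omega, h⟩
      · rintro ⟨i, hi, h⟩
        rcases Nat.lt_succ_iff_lt_or_eq.1 hi with hi | rfl
        · exact .inl ⟨i, hi, h⟩
        · exact .inr h
    · rw [List.length_append, m3, Finset.sum_range_succ, ← hA.length_eq, ← hB.length_eq]
      simp [List.length_flatMap]

end RAM

/-! ### The input of the program -/

/-- The number of a place among the right-hand sides of the simplified grammar, where those of the
rules precede those of the start symbol. -/
def Place.num (rules : List (List GSym)) : Place → ℕ
  | .nonterminal F => rules.idxOf F
  | .text x => rules.length + x

theorem getD_flatMap {α : Type*} (f : α → List ℤ) {l : List α} {b : ℕ} (hb : b < l.length)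
    (rest : List ℤ) {k : ℕ} (hk : k < (f l[b]).length) :
    (l.flatMap f ++ rest).getD (((l.take b).flatMap f).length + k) 0 = (f l[b]).getD k 0 := by
  have e : l = l.take b ++ l[b] :: l.drop (b + 1) := by simp
  have e' : l.flatMap f = (l.take b).flatMap f ++ (f l[b] ++ (l.drop (b + 1)).flatMap f) := by
    conv_lhs => rw [e]
    rw [List.flatMap_append, List.flatMap_cons]
  rw [e', List.append_assoc, List.getD_append_right _ _ _ _ (Nat.le_add_right _ _),
    Nat.add_sub_cancel_left, List.append_assoc, List.getD_append _ _ _ _ hk]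

theorem length_codeRhs (letters : List ℕ) (rules : List (List GSym)) (E : List (GSym × ℕ)) :
    (codeRhs letters rules E).length = 1 + 2 * E.length := by
  simp only [codeRhs, List.length_cons, List.length_flatMap, List.length_nil, List.map_const',
    List.sum_replicate, smul_eq_mul]
  omega

theorem getD_codeRhs {letters : List ℕ} {rules : List (List GSym)} {E : List (GSym × ℕ)} {j : ℕ}
    (hj : j < E.length) :
    (codeRhs letters rules E).getD (1 + 2 * j) 0 = E[j].1.code letters rules ∧
      (codeRhs letters rules E).getD (2 + 2 * j) 0 = E[j].2 := by
  have h : ∀ k < 2, (codeRhs letters rules E).getD (1 + 2 * j + k) 0 =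
      [E[j].1.code letters rules, (E[j].2 : ℤ)].getD k 0 := by
    intro k hk
    have := getD_flatMap (fun p : GSym × ℕ => [p.1.code letters rules, (p.2 : ℤ)]) hj []
      (k := k) (by simpa using hk)
    rw [List.append_nil] at this
    rw [← this, codeRhs, show 1 + 2 * j + k = (2 * j + k) + 1 by ring, List.getD_cons_succ]
    congr 2
    simp only [List.length_flatMap, List.length_cons, List.length_nil, List.map_const',
      List.sum_replicate, smul_eq_mul, List.length_take]
    omega
  refine ⟨by simpa using h 0 (by omega), ?_⟩
  have := h 1 (by omega)
  rw [show 2 + 2 * j = 1 + 2 * j + 1 by ring, this]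
  rfl

namespace FFGram

/-- The right-hand sides of the original grammar that belong to the places of the simplified one. -/
noncomputable def rhs (𝒢 : FFGram) (rules : List (List GSym)) (b : ℕ) : List GSym :=
  (rules ++ 𝒢.startParts).getD b []

/-- The numbers that the input consists of. -/
noncomputable def toInst (𝒢 : FFGram) (letters : List ℕ) (rules : List (List GSym))
    (L : List PrTuple) : RAM.Inst where
  sig := letters.length
  r := rules.length
  m := 𝒢.T.length
  nL := L.length
  len b := (𝒢.simplified (𝒢.rhs rules b)).length
  cd b j := (((𝒢.simplified (𝒢.rhs rules b)).getD j (.dollar, 0)).1.code letters rules).toNat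
  ofs b j := ((𝒢.simplified (𝒢.rhs rules b)).getD j (.dollar, 0)).2
  X i := (L.getD i ⟨.text 0, .text 0, 0, 0, 0⟩).X.num rules
  Y i := (L.getD i ⟨.text 0, .text 0, 0, 0, 0⟩).Y.num rules
  oX i := (L.getD i ⟨.text 0, .text 0, 0, 0, 0⟩).oX
  oY i := (L.getD i ⟨.text 0, .text 0, 0, 0, 0⟩).oY
  tl i := (L.getD i ⟨.text 0, .text 0, 0, 0, 0⟩).len

variable {𝒢 : FFGram} {letters : List ℕ} {rules : List (List GSym)} {L : List PrTuple}

theorem length_startParts : 𝒢.startParts.length = 𝒢.T.length := by simp [startParts]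

theorem toInst_nb : (𝒢.toInst letters rules L).nb = rules.length + 𝒢.T.length := rfl

/-- Each number belongs to a place of the simplified grammar. -/
theorem exists_place_num (hr : 𝒢.EnumeratesRules rules) {b : ℕ}
    (hb : b < rules.length + 𝒢.T.length) :
    ∃ X, 𝒢.Kept X ∧ 𝒢.HasRhs X (𝒢.rhs rules b) ∧ X.num rules = b := by
  rcases Nat.lt_or_ge b rules.length with h | h
  · have e : 𝒢.rhs rules b = rules[b] := by
      rw [rhs, List.getD_append _ _ _ _ h, List.getD_eq_getElem _ _ h]
    have hF := (hr.2 rules[b]).1 (List.getElem_mem h)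
    refine ⟨.nonterminal rules[b], ?_, ⟨hF.1, e⟩, List.Nodup.idxOf_getElem hr.1 b h⟩
    intro F h; cases h; exact hF.2
  · have h' : b - rules.length < 𝒢.startParts.length := by rw [length_startParts]; omega
    have e : 𝒢.rhs rules b = 𝒢.startParts[b - rules.length] := by
      rw [rhs, List.getD_append_right _ _ _ _ h, List.getD_eq_getElem _ _ h']
    refine ⟨.text (b - rules.length), (fun F h => by cases h), ?_, ?_⟩
    · rw [e]; exact List.getElem?_eq_getElem h'
    · simp only [Place.num]; omega

theorem Kept.num (hr : 𝒢.EnumeratesRules rules) {X : Place} {Q : List GSym} (hX : 𝒢.Kept X)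
    (hQ : 𝒢.HasRhs X Q) :
    X.num rules < rules.length + 𝒢.T.length ∧ 𝒢.rhs rules (X.num rules) = Q := by
  cases X with
  | nonterminal F =>
    obtain ⟨hF, rfl⟩ := hasRhs_nonterminal.1 hQ
    have h := List.idxOf_lt_length_of_mem ((hr.2 Q).2 ⟨hF, hX Q rfl⟩)
    simp only [Place.num]
    refine ⟨by omega, ?_⟩
    rw [rhs, List.getD_append _ _ _ _ h, List.getD_eq_getElem _ _ h, List.getElem_idxOf]
  | text x =>
    obtain ⟨h, e⟩ := List.getElem?_eq_some_iff.1 (show 𝒢.startParts[x]? = some Q from hQ)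
    have h' := h
    rw [length_startParts] at h'
    simp only [Place.num]
    refine ⟨by omega, ?_⟩
    rw [rhs, List.getD_append_right _ _ _ _ (by omega), Nat.add_sub_cancel_left,
      List.getD_eq_getElem _ _ h, e]

theorem Kept.num_lt_iff (hr : 𝒢.EnumeratesRules rules) {X : Place} {Q : List GSym}
    (hX : 𝒢.Kept X) (hQ : 𝒢.HasRhs X Q) :
    X.num rules < rules.length ↔ ∃ F, X = .nonterminal F := by
  cases X with
  | nonterminal F =>
    have h := List.idxOf_lt_length_of_mem ((hr.2 F).2 ⟨(hasRhs_nonterminal.1 hQ).1, hX F rfl⟩)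
    simp [Place.num, h]
  | text x => simp [Place.num]

theorem Kept.num_inj (hr : 𝒢.EnumeratesRules rules) {X X' : Place} {Q Q' : List GSym}
    (hX : 𝒢.Kept X) (hX' : 𝒢.Kept X') (hQ : 𝒢.HasRhs X Q) (hQ' : 𝒢.HasRhs X' Q')
    (h : X.num rules = X'.num rules) : X = X' := by
  have e : Q = Q' := by rw [← (hX.num hr hQ).2, ← (hX'.num hr hQ').2, h]
  have h1 := hX.num_lt_iff hr hQ
  have h2 := hX'.num_lt_iff hr hQ'
  rw [h] at h1
  cases X with
  | nonterminal F =>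
    obtain ⟨F', rfl⟩ := h2.1 (h1.2 ⟨F, rfl⟩)
    rw [← (hasRhs_nonterminal.1 hQ).2, ← (hasRhs_nonterminal.1 hQ').2, e]
  | text x =>
    cases X' with
    | nonterminal F => obtain ⟨_, h⟩ := h1.1 (h2.2 ⟨F, rfl⟩); cases h
    | text x' => simp only [Place.num] at h; congr 1; omega

theorem HasRhs.code_bound (hl : 𝒢.EnumeratesLetters letters) (hr : 𝒢.EnumeratesRules rules)
    {X : Place} {Q : List GSym} (hQ : 𝒢.HasRhs X Q) {A : GSym} {c : ℕ}
    (hA : (A, c) ∈ 𝒢.simplified Q) :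
    (0 ≤ A.code letters rules ∧ A.code letters rules ≤ (2 + letters.length + rules.length : ℕ)) ∧
    (∀ R, A = .rule R → R ∈ rules) ∧
    ((∀ R, A ≠ .rule R) → A.code letters rules < (2 + letters.length : ℕ)) := by
  obtain ⟨h1, h2⟩ := hQ.mem_simplified hA
  cases A with
  | dollar => simp [GSym.code]; omega
  | hash => simp [GSym.code]; omega
  | letter a =>
    have := List.idxOf_lt_length_of_mem ((hl.2 a).2 (h1 a rfl))
    simp [GSym.code]; omega
  | rule R =>
    obtain ⟨h3, h4, -⟩ := h2 R rfl
    have h5 := (hr.2 R).2 ⟨h3, h4⟩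
    have := List.idxOf_lt_length_of_mem h5
    refine ⟨⟨by simp only [GSym.code]; omega, by simp only [GSym.code]; omega⟩, ?_, ?_⟩
    · intro R' h; cases h; exact h5
    · intro h; exact absurd rfl (h R)

theorem entry_mem {b j : ℕ} (hj : j < (𝒢.toInst letters rules L).len b) :
    (𝒢.simplified (𝒢.rhs rules b)).getD j (.dollar, 0) ∈ 𝒢.simplified (𝒢.rhs rules b) := by
  rw [List.getD_eq_getElem _ _ hj]
  exact List.getElem_mem hj

theorem ofs_mono (hr : 𝒢.EnumeratesRules rules) {b i j : ℕ}
    (hb : b < (𝒢.toInst letters rules L).nb) (hij : i ≤ j)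
    (hj : j < (𝒢.toInst letters rules L).len b) :
    (𝒢.toInst letters rules L).ofs b i ≤ (𝒢.toInst letters rules L).ofs b j := by
  rcases hij.eq_or_lt with rfl | hij
  · exact le_rfl
  obtain ⟨X, -, hX, -⟩ := exists_place_num hr hb
  have h := List.pairwise_iff_getElem.1 hX.sorted.1 i j (hij.trans hj) hj hij
  simp only [toInst]
  rw [List.getD_eq_getElem _ _ hj, List.getD_eq_getElem _ _ (hij.trans hj)]
  exact h

/-- The edges that the program finds are the entries of the simplified right-hand sides between
which the offset grows. -/
theorem isE_spec (hl : 𝒢.EnumeratesLetters letters) (hr : 𝒢.EnumeratesRules rules) {b j : ℕ}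
    (hb : b < (𝒢.toInst letters rules L).nb) (hj : j < (𝒢.toInst letters rules L).len b)
    (h : (𝒢.toInst letters rules L).isE b j) :
    ∃ R ∈ rules, (𝒢.toInst letters rules L).ch b j = rules.idxOf R ∧
      (GSym.rule R, (𝒢.toInst letters rules L).ofs b j) ∈ 𝒢.heavyEntries (𝒢.rhs rules b) := by
  obtain ⟨X, -, hX, -⟩ := exists_place_num hr hb
  simp only [RAM.Inst.isE, decide_eq_true_eq, Bool.decide_and, Bool.and_eq_true] at h
  obtain ⟨h1, h2, h3⟩ := h
  have hm := entry_mem hj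
  have hg := List.getD_eq_getElem (𝒢.simplified (𝒢.rhs rules b)) (.dollar, 0) hj
  obtain ⟨⟨A, c⟩, hp⟩ : ∃ p, p = (𝒢.simplified (𝒢.rhs rules b)).getD j (.dollar, 0) := ⟨_, rfl⟩
  have hcd : (𝒢.toInst letters rules L).cd b j = (A.code letters rules).toNat := by
    simp only [toInst]; rw [← hp]
  have hof : (𝒢.toInst letters rules L).ofs b j = c := by
    simp only [toInst]; rw [← hp]
  rw [← hp] at hm hg
  obtain ⟨⟨b1, b2⟩, b3, b4⟩ := hX.code_bound hl hr hm
  have hsig : (𝒢.toInst letters rules L).sig = letters.length := rfl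
  have hA : ∃ R, A = .rule R := by
    by_contra hn
    have := b4 fun R hR => hn ⟨R, hR⟩
    omega
  obtain ⟨R, rfl⟩ := hA
  refine ⟨R, b3 R rfl, ?_, ?_⟩
  · rw [RAM.Inst.ch, hcd, hsig]
    simp only [GSym.code]
    omega
  · rw [hof, heavyEntries, mem_heavy]
    refine ⟨j, hj, hg.symm, ?_⟩
    have h2' : j + 1 < (𝒢.simplified (𝒢.rhs rules b)).length := h2
    rw [dif_pos h2', ← List.getD_eq_getElem _ (GSym.dollar, 0) h2']
    have h4 : (𝒢.toInst letters rules L).ofs b (j + 1) =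
      ((𝒢.simplified (𝒢.rhs rules b)).getD (j + 1) (.dollar, 0)).2 := rfl
    omega

/-- Conversely, each of these entries yields an edge. -/
theorem exists_isE (hr : 𝒢.EnumeratesRules rules) {b c : ℕ} {R : List GSym}
    (hb : b < (𝒢.toInst letters rules L).nb)
    (h : (GSym.rule R, c) ∈ 𝒢.heavyEntries (𝒢.rhs rules b)) :
    ∃ j, j < (𝒢.toInst letters rules L).len b ∧ (𝒢.toInst letters rules L).isE b j ∧
      (𝒢.toInst letters rules L).ch b j = rules.idxOf R ∧
      (𝒢.toInst letters rules L).ofs b j = c := by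
  obtain ⟨X, -, hX, -⟩ := exists_place_num hr hb
  rw [heavyEntries, mem_heavy] at h
  obtain ⟨j, hj, hg, h⟩ := h
  rw [← List.getD_eq_getElem _ (GSym.dollar, 0) hj] at hg
  have hof : (𝒢.toInst letters rules L).ofs b j = c := by
    simp only [toInst]; rw [hg]
  have hcd : (𝒢.toInst letters rules L).cd b j = 2 + letters.length + rules.idxOf R := by
    simp only [toInst]; rw [hg]; rfl
  have hsig : (𝒢.toInst letters rules L).sig = letters.length := rfl
  have hj1 : j + 1 < (𝒢.simplified (𝒢.rhs rules b)).length := by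
    by_contra hn
    rw [dif_neg hn] at h
    obtain ⟨A, B, C, -, e⟩ := hX.exists_eq
    have e' : 𝒢.simplified (𝒢.rhs rules b) =
        ((A, 0) :: ((place 0 (middle (𝒢.rhs rules b))).flatMap 𝒢.expand ++
          [(B, elen (middle (𝒢.rhs rules b)))])) ++ [(C, elen (middle (𝒢.rhs rules b)))] := by
      rw [e]; simp
    have hlen := congrArg List.length e'
    rw [List.length_append, List.length_singleton] at hlen
    rw [e', List.getD_append_right _ _ _ _ (by omega), show j - _ = 0 by omega] at hg
    cases hg
    simp at h
  refine ⟨j, hj, ?_, ?_, hof⟩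
  · simp only [RAM.Inst.isE, decide_eq_true_eq]
    rw [dif_pos hj1, ← List.getD_eq_getElem _ (GSym.dollar, 0) hj1] at h
    refine ⟨by omega, hj1, ?_⟩
    rw [hof]; exact h
  · rw [RAM.Inst.ch, hcd, hsig]; omega

/-- Along a right-hand side the edges have different offsets. -/
theorem isE_inj (hr : 𝒢.EnumeratesRules rules) {b j j' : ℕ}
    (hb : b < (𝒢.toInst letters rules L).nb)
    (hj : j < (𝒢.toInst letters rules L).len b) (hj' : j' < (𝒢.toInst letters rules L).len b)
    (h : (𝒢.toInst letters rules L).isE b j) (h' : (𝒢.toInst letters rules L).isE b j')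
    (e : (𝒢.toInst letters rules L).ofs b j = (𝒢.toInst letters rules L).ofs b j') : j = j' := by
  simp only [RAM.Inst.isE, decide_eq_true_eq] at h h'
  rcases lt_trichotomy j j' with hlt | rfl | hlt
  · have := ofs_mono (L := L) (letters := letters) hr hb hlt hj'
    simp only [Nat.succ_eq_add_one] at this
    omega
  · rfl
  · have := ofs_mono (L := L) (letters := letters) hr hb hlt hj
    simp only [Nat.succ_eq_add_one] at this
    omega

/-! ### The layout of the input -/

theorem codeInput_eq : 𝒢.codeInput letters rules L =
    [(letters.length : ℤ), (rules.length : ℤ), (𝒢.T.length : ℤ), (L.length : ℤ)] ++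
      ((rules ++ 𝒢.startParts).flatMap (fun F => codeRhs letters rules (𝒢.simplified F)) ++
        L.flatMap (PrTuple.code letters rules)) := by
  simp [codeInput]

theorem length_take_codeRhs {b : ℕ} (hb : b ≤ rules.length + 𝒢.T.length) :
    4 + (((rules ++ 𝒢.startParts).take b).flatMap
      fun F => codeRhs letters rules (𝒢.simplified F)).length =
      (𝒢.toInst letters rules L).st b := by
  induction b with
  | zero => simp [RAM.Inst.st_zero]
  | succ b ih =>
    have hb' : b < (rules ++ 𝒢.startParts).length := by
      rw [List.length_append, length_startParts]; omega
    rw [RAM.Inst.st_succ, ← ih (by omega), List.take_succ_eq_append_getElem hb',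
      List.flatMap_append, List.length_append, List.flatMap_cons, List.flatMap_nil,
      List.append_nil, length_codeRhs]
    have : (𝒢.toInst letters rules L).len b =
        (𝒢.simplified (rules ++ 𝒢.startParts)[b]).length := by
      simp only [toInst, rhs]; rw [List.getD_eq_getElem _ _ hb']
    omega

theorem getD_codeInput {b k : ℕ} (hb : b < rules.length + 𝒢.T.length)
    (hk : k < 1 + 2 * (𝒢.toInst letters rules L).len b) :
    (𝒢.codeInput letters rules L).getD ((𝒢.toInst letters rules L).st b + k) 0 =
      (codeRhs letters rules (𝒢.simplified (𝒢.rhs rules b))).getD k 0 := by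
  have hb' : b < (rules ++ 𝒢.startParts).length := by
    rw [List.length_append, length_startParts]; omega
  have e : 𝒢.rhs rules b = (rules ++ 𝒢.startParts)[b] := by
    rw [rhs, List.getD_eq_getElem _ _ hb']
  rw [← length_take_codeRhs hb.le, codeInput_eq, List.getD_append_right _ _ _ _ (by simp; omega)]
  rw [e, ← getD_flatMap (fun F => codeRhs letters rules (𝒢.simplified F)) hb'
    (L.flatMap (PrTuple.code letters rules)) (k := k)]
  · congr 1
    simp only [List.length_cons, List.length_nil]
    omega
  · rw [length_codeRhs, ← e]; exact hk

theorem length_code (q : PrTuple) : (q.code letters rules).length = 7 := by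
  obtain ⟨X, Y, oX, oY, len⟩ := q
  cases X <;> cases Y <;> rfl

theorem length_flatMap_code (L : List PrTuple) :
    (L.flatMap (PrTuple.code letters rules)).length = 7 * L.length := by
  simp only [List.length_flatMap, length_code, List.map_const', List.sum_replicate, smul_eq_mul]
  omega

theorem take_all : (rules ++ 𝒢.startParts).take (rules.length + 𝒢.T.length) =
    rules ++ 𝒢.startParts := by
  apply List.take_of_length_le
  rw [List.length_append, length_startParts]

theorem length_codeInput : (𝒢.codeInput letters rules L).length =
    (𝒢.toInst letters rules L).st (𝒢.toInst letters rules L).nb + 7 * L.length := by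
  rw [toInst_nb, ← length_take_codeRhs le_rfl, take_all, codeInput_eq]
  simp only [List.length_append, length_flatMap_code, List.length_cons, List.length_nil]
  omega

theorem getD_codeInput_tuple {i k : ℕ} (hi : i < L.length) (hk : k < 7) :
    (𝒢.codeInput letters rules L).getD ((𝒢.toInst letters rules L).st
      (𝒢.toInst letters rules L).nb + 7 * i + k) 0 = (L[i].code letters rules).getD k 0 := by
  rw [toInst_nb, ← length_take_codeRhs le_rfl, take_all, codeInput_eq,
    List.getD_append_right _ _ _ _ (by simp; omega),
    List.getD_append_right _ _ _ _ (by simp only [List.length_cons, List.length_nil]; omega)]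
  have := getD_flatMap (PrTuple.code letters rules) hi [] (k := k) (by rw [length_code]; exact hk)
  rw [List.append_nil, length_flatMap_code, List.length_take, min_eq_left hi.le] at this
  rw [← this]
  congr 1
  simp only [List.length_cons, List.length_nil]
  omega

end FFGram

namespace FFGram

variable {𝒢 : FFGram} {letters : List ℕ} {rules : List (List GSym)} {L : List PrTuple} {τ : ℕ}

/-! ### The instance meets the requirements of the program -/

theorem length_le_textLength {t : List ℕ} (ht : t ∈ 𝒢.T) : t.length ≤ 𝒢.textLength :=
  List.single_le_sum (fun _ _ => Nat.zero_le _) _ (List.mem_map_of_mem ht)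

theorem HasRhs.elen_le {X : Place} {Q : List GSym} (hQ : 𝒢.HasRhs X Q) :
    elen (middle Q) ≤ 𝒢.textLength := by
  cases X with
  | nonterminal F =>
    obtain ⟨hF, rfl⟩ := hasRhs_nonterminal.1 hQ
    obtain ⟨i, -, t, ht, h⟩ := FFGram.mem_nonterminals.1 hF
    obtain ⟨c, hc⟩ := exists_place (s := 0) h
    have h1 := (mem_place hc).2.2
    have h2 := length_le_textLength ht
    rw [elen_parse, length_efexp_rule] at h1
    omega
  | text x =>
    obtain ⟨t, ht, rfl⟩ := hasRhs_text.1 hQ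
    rw [middle_flank, elen_parse]
    exact length_le_textLength (List.mem_of_getElem? ht)

theorem length_letters_le (hl : 𝒢.EnumeratesLetters letters) : letters.length ≤ 𝒢.textLength := by
  have h : letters.Subperm 𝒢.T.flatten := hl.1.subperm fun c hc => by
    obtain ⟨t, ht, hc⟩ := (hl.2 c).1 hc
    exact List.mem_flatten.2 ⟨t, ht, hc⟩
  have := h.length_le
  rwa [List.length_flatten] at this

theorem Locus.at {x a len : ℕ} {X : Place} {o : ℤ} (h : 𝒢.Locus x a len X o) :
    𝒢.At X o x a := by
  cases h with
  | node i k F hlow hF =>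
    have := At.node i k F x ((a : ℤ) - 𝒢.efStart x i k) hlow.1 hlow.2.1 hF
    rwa [add_sub_cancel] at this
  | start hx _ => exact .text x a hx

/-- A tuple of the list, with one of the matches it stands for. -/
theorem IsPrMEMList.exists_match (hL : 𝒢.IsPrMEMList τ L) {q : PrTuple} (hq : q ∈ L) :
    𝒢.Kept q.X ∧ 𝒢.Kept q.Y ∧ τ < q.len ∧ ∃ x y a b : ℕ, IsMEM 𝒢.T ⟨x, y, a, b, q.len⟩ ∧
      𝒢.At q.X q.oX x a ∧ 𝒢.At q.Y q.oY y b := by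
  obtain ⟨p, ⟨⟨x, y, a, b, len⟩, hM, hlen, hX, hY⟩, hτ, e, rX, rY⟩ := (hL.2 q).1 hq
  simp only at hlen
  subst hlen
  refine ⟨rX.kept, rY.kept, by omega, x, y, a, b, by rwa [e], rX.at.1 hX.locus.at,
    rY.at.1 hY.locus.at⟩

/-- The offset of an occurrence in a string is at most the length of the string, in absolute value. -/
theorem At.bound {X : Place} {o : ℤ} {x a : ℕ} (h : 𝒢.At X o x a) {t : List ℕ}
    (ht : 𝒢.T[x]? = some t) (ha : a ≤ t.length) : |o| ≤ 𝒢.textLength := by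
  have hn := length_le_textLength (List.mem_of_getElem? ht)
  rw [abs_le]
  cases X with
  | nonterminal F =>
    obtain ⟨t', i, s, ht', -, -, h3, e⟩ := at_nonterminal_iff.1 h
    obtain rfl : t = t' := by simpa [ht] using ht'
    have h4 := (mem_place h3).2.2
    rw [elen_parse] at h4
    simp only at h4
    omega
  | text y =>
    obtain ⟨-, e, -⟩ := at_text_iff.1 h
    omega

/-- The places of the tuples are strings or have a nonempty expansion, as the strings in question are
not empty. -/
theorem At.good (hr : 𝒢.EnumeratesRules rules) {X : Place} (hX : 𝒢.Kept X) {o z : ℤ} {x : ℕ}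
    (h : 𝒢.At X o x z) {t : List ℕ} (ht : 𝒢.T[x]? = some t) (hne : t ≠ []) :
    rules.length ≤ X.num rules ∨ elen (middle (𝒢.rhs rules (X.num rules))) ≠ 0 := by
  obtain ⟨Q, hQ⟩ := h.hasRhs
  cases X with
  | text y => left; simp [Place.num]
  | nonterminal F =>
    right
    obtain ⟨t', ht', H⟩ := h.ne_nil
    obtain rfl : t = t' := by simpa [ht] using ht'
    rw [(hX.num hr hQ).2, (hasRhs_nonterminal.1 hQ).2, ← length_efexp_rule]
    exact (List.length_pos_of_ne_nil (H.1 hne)).ne'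

theorem getD_mem_or {i : ℕ} (hi : i < L.length) (d : PrTuple) : L.getD i d ∈ L := by
  rw [List.getD_eq_getElem _ _ hi]; exact List.getElem_mem hi

/-- The program computes the number of a place from the two integers that encode it. -/
theorem num_spec {X : Place} {n m : ℤ}
    (e : [n, m] = X.code letters rules) :
    0 < n ∧ m + rules.length = X.num rules ∨
      ¬ 0 < n ∧ m = X.num rules + (2 + letters.length) := by
  cases X with
  | text x =>
    simp only [Place.code, List.cons.injEq] at e
    obtain ⟨rfl, rfl, -⟩ := e
    left; simp [Place.num, add_comm]
  | nonterminal F =>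
    simp only [Place.code, GSym.code, List.cons.injEq] at e
    obtain ⟨rfl, rfl, -⟩ := e
    right; simp [Place.num]; ring

/-- The rank of a right-hand side is its level, its size the length of its `efexp` expansion; it is
good if it belongs to a string or if that expansion is not empty. `N` bounds all numbers. -/
theorem valid (hl : 𝒢.EnumeratesLetters letters) (hr : 𝒢.EnumeratesRules rules)
    (hL : 𝒢.IsPrMEMList τ L) {N : ℕ}
    (hN : (𝒢.toInst letters rules L).st (𝒢.toInst letters rules L).nb + 7 * L.length +
      (2 + letters.length + rules.length) + 𝒢.textLength ≤ N) :
    RAM.Valid (𝒢.toInst letters rules L) (fun n => (𝒢.codeInput letters rules L).getD n 0) N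
      (fun b => GSym.lvlList (𝒢.rhs rules b)) (fun b => elen (middle (𝒢.rhs rules b)))
      (fun b => rules.length ≤ b ∨ elen (middle (𝒢.rhs rules b)) ≠ 0) := by
  have hcode : ∀ b < (𝒢.toInst letters rules L).nb, ∀ j < (𝒢.toInst letters rules L).len b,
      (0 : ℤ) ≤ ((𝒢.simplified (𝒢.rhs rules b)).getD j (.dollar, 0)).1.code letters rules ∧
      ((𝒢.simplified (𝒢.rhs rules b)).getD j (.dollar, 0)).1.code letters rules ≤
        (2 + letters.length + rules.length : ℕ) := by
    intro b hb j hj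
    obtain ⟨X, -, hX, -⟩ := exists_place_num hr hb
    exact (hX.code_bound hl hr (entry_mem hj)).1
  have hofs : ∀ b < (𝒢.toInst letters rules L).nb, ∀ j < (𝒢.toInst letters rules L).len b,
      (𝒢.toInst letters rules L).ofs b j ≤ 𝒢.textLength := by
    intro b hb j hj
    obtain ⟨X, -, hX, -⟩ := exists_place_num hr hb
    exact (hX.sorted.2 _ (entry_mem hj)).trans hX.elen_le
  have htup : ∀ i < L.length, ∀ k < 7, (𝒢.codeInput letters rules L).getD
      ((𝒢.toInst letters rules L).st (𝒢.toInst letters rules L).nb + 7 * i + k) 0 =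
      ((L.getD i ⟨.text 0, .text 0, 0, 0, 0⟩).code letters rules).getD k 0 := by
    intro i hi k hk
    rw [getD_codeInput_tuple hi hk, List.getD_eq_getElem _ _ hi]
  have hmatch : ∀ i < L.length, _ := fun i hi =>
    hL.exists_match (getD_mem_or hi ⟨.text 0, .text 0, 0, 0, 0⟩)
  have hcodeEq : ∀ q : PrTuple, ∃ n₁ m₁ n₂ m₂, q.code letters rules =
      [n₁, m₁, n₂, m₂, q.oX, q.oY, (q.len : ℤ)] ∧ [n₁, m₁] = q.X.code letters rules ∧
      [n₂, m₂] = q.Y.code letters rules := by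
    rintro ⟨X, Y, oX, oY, len⟩
    cases X <;> cases Y <;> exact ⟨_, _, _, _, rfl, rfl, rfl⟩
  have hne : ∀ {x y a b len : ℕ}, τ < len → IsMEM 𝒢.T ⟨x, y, a, b, len⟩ → ∃ s t, 𝒢.T[x]? = some s ∧
      𝒢.T[y]? = some t ∧ s ≠ [] ∧ t ≠ [] ∧ a ≤ s.length ∧ b ≤ t.length ∧ len ≤ s.length := by
    rintro x y a b len hlt ⟨s, t, hs, ht, h1, h2, -⟩
    simp only at h1 h2 hs ht
    exact ⟨s, t, hs, ht, List.ne_nil_of_length_pos (by omega),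
      List.ne_nil_of_length_pos (by omega), by omega, by omega, by omega⟩
  exact {
    inp0 := by rw [codeInput_eq]; rfl
    inp1 := by rw [codeInput_eq]; rfl
    inp2 := by rw [codeInput_eq]; rfl
    inp3 := by rw [codeInput_eq]; rfl
    inp_len := by
      intro b hb
      have := getD_codeInput (L := L) (letters := letters) (k := 0) hb (by omega)
      rw [add_zero] at this
      rw [this]; rfl
    inp_cd := by
      intro b hb j hj
      have := getD_codeInput (L := L) (letters := letters) (k := 1 + 2 * j) hb (by omega)
      rw [← add_assoc] at this
      have h2 := (hcode b hb j hj).1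
      rw [this, (getD_codeRhs hj).1]
      simp only [toInst]
      rw [Int.toNat_of_nonneg h2, List.getD_eq_getElem _ _ hj]
    inp_ofs := by
      intro b hb j hj
      have := getD_codeInput (L := L) (letters := letters) (k := 2 + 2 * j) hb (by omega)
      rw [← add_assoc] at this
      rw [this, (getD_codeRhs hj).2]
      simp only [toInst]
      rw [List.getD_eq_getElem _ _ hj]
    inpX := by
      intro i hi
      have h0 := htup i hi 0 (by omega)
      have h1 := htup i hi 1 (by omega)
      obtain ⟨k1, -, -, x, y, a, b, -, hA, -⟩ := hmatch i hi
      obtain ⟨Q, hQ⟩ := hA.hasRhs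
      obtain ⟨n₁, m₁, n₂, m₂, e, e1, -⟩ := hcodeEq (L.getD i ⟨.text 0, .text 0, 0, 0, 0⟩)
      rw [e] at h0 h1
      rw [add_zero] at h0
      rw [h0, h1]
      exact num_spec e1
    inpY := by
      intro i hi
      have h0 := htup i hi 2 (by omega)
      have h1 := htup i hi 3 (by omega)
      obtain ⟨-, k1, -, x, y, a, b, -, -, hA⟩ := hmatch i hi
      obtain ⟨Q, hQ⟩ := hA.hasRhs
      obtain ⟨n₁, m₁, n₂, m₂, e, -, e1⟩ := hcodeEq (L.getD i ⟨.text 0, .text 0, 0, 0, 0⟩)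
      rw [e] at h0 h1
      rw [h0, h1]
      exact num_spec e1
    inp_oX := by
      intro i hi
      obtain ⟨n₁, m₁, n₂, m₂, e, -⟩ := hcodeEq (L.getD i ⟨.text 0, .text 0, 0, 0, 0⟩)
      rw [htup i hi 4 (by omega), e]; rfl
    inp_oY := by
      intro i hi
      obtain ⟨n₁, m₁, n₂, m₂, e, -⟩ := hcodeEq (L.getD i ⟨.text 0, .text 0, 0, 0, 0⟩)
      rw [htup i hi 5 (by omega), e]; rfl
    inp_tl := by
      intro i hi
      obtain ⟨n₁, m₁, n₂, m₂, e, -⟩ := hcodeEq (L.getD i ⟨.text 0, .text 0, 0, 0, 0⟩)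
      rw [htup i hi 6 (by omega), e]; rfl
    X_lt := by
      intro i hi
      obtain ⟨k1, -, -, x, y, a, b, -, hA, -⟩ := hmatch i hi
      obtain ⟨Q, hQ⟩ := hA.hasRhs
      exact (k1.num hr hQ).1
    Y_lt := by
      intro i hi
      obtain ⟨-, k1, -, x, y, a, b, -, -, hA⟩ := hmatch i hi
      obtain ⟨Q, hQ⟩ := hA.hasRhs
      exact (k1.num hr hQ).1
    X_good := by
      intro i hi
      obtain ⟨k1, -, hτ, x, y, a, b, hM, hA, -⟩ := hmatch i hi
      obtain ⟨s, t, hs, ht, n1, n2, -⟩ := hne hτ hM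
      exact hA.good hr k1 hs n1
    Y_good := by
      intro i hi
      obtain ⟨-, k1, hτ, x, y, a, b, hM, -, hA⟩ := hmatch i hi
      obtain ⟨s, t, hs, ht, n1, n2, -⟩ := hne hτ hM
      exact hA.good hr k1 ht n2
    ch_lt := by
      intro b hb j hj h
      obtain ⟨R, hR, e, -⟩ := isE_spec hl hr hb hj h
      rw [e]
      exact List.idxOf_lt_length_of_mem hR
    rank_lt := by
      intro b hb j hj h
      obtain ⟨R, hR, e, h'⟩ := isE_spec hl hr hb hj h
      obtain ⟨X, -, hX, -⟩ := exists_place_num hr hb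
      obtain ⟨h1, h2⟩ := (hr.2 R).1 hR
      have h3 : 𝒢.Kept (.nonterminal R) := fun F hF => by cases hF; exact h2
      have h4 := (h3.num hr (Q := R) ⟨h1, rfl⟩).2
      simp only [Place.num] at h4
      rw [e, h4]
      obtain ⟨j, hj, e, -⟩ := mem_heavy.1 h'
      have := ((hX.mem_simplified (e ▸ List.getElem_mem hj)).2 R rfl).2.2
      rw [GSym.lvl] at this
      omega
    sz_le := by
      intro b hb j hj h
      obtain ⟨R, hR, e, h'⟩ := isE_spec hl hr hb hj h
      obtain ⟨X, -, hX, -⟩ := exists_place_num hr hb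
      obtain ⟨h1, h2⟩ := (hr.2 R).1 hR
      have h3 : 𝒢.Kept (.nonterminal R) := fun F hF => by cases hF; exact h2
      have h4 := (h3.num hr (Q := R) ⟨h1, rfl⟩).2
      simp only [Place.num] at h4
      rw [e, h4, ← length_efexp_rule]
      have := hX.heavy_le h'
      omega
    E_ne := by
      intro v hv hg
      have hv' : v < rules.length := hv
      obtain ⟨X, k1, hX, e⟩ := exists_place_num hr (b := v) (by omega)
      obtain ⟨F, rfl⟩ := (k1.num_lt_iff hr hX).1 (by omega)
      obtain ⟨hF, eF⟩ := hasRhs_nonterminal.1 hX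
      have hne' : (GSym.rule F).efexp ≠ [] := by
        intro h0
        rcases hg with hg | hg
        · omega
        · rw [eF, ← length_efexp_rule, h0] at hg; exact hg rfl
      obtain ⟨x, z, hz⟩ := exists_at hF 0
      obtain ⟨Y, Q, c, k2, hQ, hc, -⟩ := (at_iff_heavy (k1 F rfl) hne').1 hz
      obtain ⟨n1, n2⟩ := k2.num hr hQ
      rw [← n2] at hc
      obtain ⟨j, hj, h1, h2, -⟩ := exists_isE (L := L) (letters := letters) hr n1 hc
      refine List.ne_nil_of_mem (a := (Y.num rules, j)) (RAM.Inst.mem_E _ |>.2 ⟨n1, hj, h1, ?_⟩)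
      rw [h2, ← e]; rfl
    good_E := by
      intro v hv p hp
      obtain ⟨h1, h2, h3, h4⟩ := (RAM.Inst.mem_E _).1 hp
      obtain ⟨R, hR, e, h'⟩ := isE_spec hl hr h1 h2 h3
      obtain ⟨X, -, hX, -⟩ := exists_place_num hr h1
      have h5 := hX.heavy_le h'
      have h6 := List.length_pos_of_ne_nil (hX.heavy_parent h').1
      exact .inr (by omega)
    sz_bd := by
      intro b hb
      obtain ⟨X, -, hX, -⟩ := exists_place_num hr hb
      have := hX.elen_le
      omega
    cd_bd := by
      intro b hb j hj
      have := hcode b hb j hj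
      simp only [toInst] at hN ⊢
      omega
    ofs_bd := by
      intro b hb j hj
      have := hofs b hb j hj
      omega
    tup_bd := by
      intro i hi
      obtain ⟨-, -, hτ, x, y, a, b, hM, hA, hB⟩ := hmatch i hi
      obtain ⟨s, t, hs, ht, -, -, b1, b2, b3⟩ := hne hτ hM
      have h1 := hA.bound hs b1
      have h2 := hB.bound ht b2
      have h3 := length_le_textLength (List.mem_of_getElem? hs)
      have h4 : (𝒢.textLength : ℤ) ≤ N := by omega
      refine ⟨h1.trans h4, h2.trans h4, ?_⟩
      simp only [toInst]
      omega
    size_bd := by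
      have : (𝒢.toInst letters rules L).nL = L.length := rfl
      omega
    sig_bd := by
      have : (𝒢.toInst letters rules L).sig = letters.length := rfl
      omega }

/-- The climbs from a place end exactly in the occurrences of that place, each of which is found
once. -/
theorem mem_paths (hl : 𝒢.EnumeratesLetters letters) (hr : 𝒢.EnumeratesRules rules) {N : ℕ}
    {inp : ℕ → ℤ} {rank sz : ℕ → ℕ} {good : ℕ → Prop}
    (hV : RAM.Valid (𝒢.toInst letters rules L) inp N rank sz good) {P : ℕ → ℤ → List (ℕ × ℤ)}
    (hP : RAM.Paths (𝒢.toInst letters rules L) P) (v : ℕ) : ∀ X Q, 𝒢.Kept X → 𝒢.HasRhs X Q →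
      X.num rules = v → (∀ F, X = .nonterminal F → (GSym.rule F).efexp ≠ []) → ∀ o,
      (P v o).Nodup ∧ ∀ x z, (x, z) ∈ P v o ↔ 𝒢.At X o x z := by
  refine hV.induct (P := fun v => ∀ X Q, 𝒢.Kept X → 𝒢.HasRhs X Q →
      X.num rules = v → (∀ F, X = .nonterminal F → (GSym.rule F).efexp ≠ []) → ∀ o,
      (P v o).Nodup ∧ ∀ x z, (x, z) ∈ P v o ↔ 𝒢.At X o x z) (fun v ih => ?_) v
  rintro X Q k1 hQ rfl hne o
  cases X with
  | text x =>
    obtain ⟨h, -⟩ := List.getElem?_eq_some_iff.1 (show 𝒢.startParts[x]? = some Q from hQ)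
    rw [length_startParts] at h
    have hle : (𝒢.toInst letters rules L).r ≤ Place.num rules (.text x) := Nat.le_add_right _ _
    have e : Place.num rules (.text x) - (𝒢.toInst letters rules L).r = x :=
      Nat.add_sub_cancel_left _ _
    rw [hP.text _ _ hle, e]
    refine ⟨List.nodup_singleton _, fun x' z => ?_⟩
    rw [List.mem_singleton, Prod.mk.injEq, at_text_iff]
    constructor
    · rintro ⟨rfl, rfl⟩; exact ⟨rfl, rfl, h⟩
    · rintro ⟨rfl, rfl, -⟩; exact ⟨rfl, rfl⟩
  | nonterminal F =>
    have hF : F ∈ rules := (hr.2 F).2 ⟨(hasRhs_nonterminal.1 hQ).1, k1 F rfl⟩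
    have hlt : Place.num rules (.nonterminal F) < (𝒢.toInst letters rules L).r :=
      List.idxOf_lt_length_of_mem hF
    have hne := hne F rfl
    have hspec : ∀ p ∈ (𝒢.toInst letters rules L).E (Place.num rules (.nonterminal F)),
        ∃ Y R, 𝒢.Kept Y ∧ 𝒢.HasRhs Y R ∧ Y.num rules = p.1 ∧
        (GSym.rule F, (𝒢.toInst letters rules L).ofs p.1 p.2) ∈ 𝒢.heavyEntries R ∧
        ∀ o', (P p.1 o').Nodup ∧ ∀ x z, (x, z) ∈ P p.1 o' ↔ 𝒢.At Y o' x z := by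
      intro p hp
      obtain ⟨h1, h2, h3, h4⟩ := (RAM.Inst.mem_E _).1 hp
      obtain ⟨R, hR, e, h'⟩ := isE_spec hl hr h1 h2 h3
      obtain rfl : R = F := by
        rw [e] at h4
        exact (List.idxOf_inj hR).1 h4
      obtain ⟨Y, k2, hY, e2⟩ := exists_place_num hr h1
      refine ⟨Y, _, k2, hY, e2, h', ih p hp Y _ k2 hY e2 fun F' hF' => ?_⟩
      have h5 := hY.heavy_le h'
      have h6 := List.length_pos_of_ne_nil hne
      subst hF'
      rw [(hasRhs_nonterminal.1 hY).2, ← length_efexp_rule] at h5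
      exact List.ne_nil_of_length_pos (by omega)
    have hmem : ∀ x z, (x, z) ∈ P (Place.num rules (.nonterminal F)) o ↔
        𝒢.At (.nonterminal F) o x z := by
      intro x z
      rw [hP.rule _ _ hlt, List.mem_flatMap, at_iff_heavy (k1 F rfl) hne]
      constructor
      · rintro ⟨p, hp, h⟩
        obtain ⟨Y, R, k2, hY, e2, h', H⟩ := hspec p hp
        exact ⟨Y, R, _, k2, hY, h', ((H _).2 x z).1 h⟩
      · rintro ⟨Y, R, c, k2, hY, hc, h⟩
        obtain ⟨n1, n2⟩ := k2.num hr hY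
        rw [← n2] at hc
        obtain ⟨j, hj, h1, h2, h3⟩ := exists_isE (L := L) (letters := letters) hr n1 hc
        have hp : (Y.num rules, j) ∈
            (𝒢.toInst letters rules L).E (Place.num rules (.nonterminal F)) :=
          (RAM.Inst.mem_E _).2 ⟨n1, hj, h1, h2⟩
        refine ⟨_, hp, ?_⟩
        obtain ⟨Y', R', k2', hY', e2', h'', H⟩ := hspec _ hp
        obtain rfl := k2'.num_inj hr k2 hY' hY e2'
        refine ((H _).2 x z).2 ?_
        rwa [h3]
    refine ⟨?_, hmem⟩
    rw [hP.rule _ _ hlt, List.nodup_flatMap]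
    refine ⟨fun p hp => ?_, ((RAM.Inst.nodup_E _ _).pairwise_of_forall_ne ?_)⟩
    · obtain ⟨Y, R, -, -, -, -, H⟩ := hspec p hp
      exact (H _).1
    · rintro ⟨b, j⟩ hp ⟨b', j'⟩ hp' hpp ⟨x, z⟩ h h'
      obtain ⟨Y, R, k2, hY, e2, hc, H⟩ := hspec _ hp
      obtain ⟨Y', R', k2', hY', e2', hc', H'⟩ := hspec _ hp'
      have hz := ((H _).2 x z).1 h
      have hz' := ((H' _).2 x z).1 h'
      have hF' : 𝒢.At (.nonterminal F) o x z :=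
        (at_iff_heavy (k1 F rfl) hne).2 ⟨Y, R, _, k2, hY, hc, hz⟩
      obtain ⟨t, ht, ht'⟩ := hF'.ne_nil
      obtain ⟨rfl, e⟩ := heavy_unique ht (ht'.2 hne) k2 k2' hY hY' hc hc' hz hz'
      simp only at e e2 e2'
      obtain rfl : b = b' := by rw [← e2, ← e2']
      obtain ⟨h1, h2, h3, -⟩ := (RAM.Inst.mem_E _).1 hp
      obtain ⟨-, h2', h3', -⟩ := (RAM.Inst.mem_E _).1 hp'
      exact hpp (Prod.ext rfl (isE_inj hr h1 h2 h2' h3 h3' e))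

end FFGram

namespace FFGram

variable {𝒢 : FFGram} {letters : List ℕ} {rules : List (List GSym)} {L : List PrTuple} {τ : ℕ}

/-! ### Bounds -/

theorem three_mul_length_le : 3 * 𝒢.T.length ≤ 𝒢.size := by
  have h : 3 * 𝒢.startParts.length ≤ (𝒢.startParts.map List.length).sum := by
    have := List.card_nsmul_le_sum (𝒢.startParts.map List.length) 3 (by
      intro n hn
      obtain ⟨F, hF, rfl⟩ := List.mem_map.1 hn
      obtain ⟨x, hx⟩ := List.getElem?_of_mem hF
      exact HasRhs.length (X := .text x) hx)
    rw [List.length_map, smul_eq_mul] at this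
    omega
  rw [length_startParts] at h
  have : 𝒢.size = ∑ F ∈ 𝒢.nonterminals, F.length + (𝒢.startParts.map List.length).sum := rfl
  omega

theorem three_le_size : 3 ≤ 𝒢.size := by
  have := List.length_pos_of_ne_nil 𝒢.T_ne
  have := 𝒢.three_mul_length_le
  omega

/-- The right-hand sides in the input have total length at most `G`, the size of the grammar before
the simplification. -/
theorem sum_len_le (hr : 𝒢.EnumeratesRules rules) :
    ∑ b ∈ Finset.range (𝒢.toInst letters rules L).nb, (𝒢.toInst letters rules L).len b ≤
      𝒢.size := by
  refine le_trans (le_of_eq ?_) 𝒢.sum_simplified_le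
  have e : ∀ b, (𝒢.toInst letters rules L).len b =
      (𝒢.simplified ((rules ++ 𝒢.startParts).getD b [])).length := fun _ => rfl
  have key : ∀ l : List (List GSym), ∑ b ∈ Finset.range l.length,
      (𝒢.simplified (l.getD b [])).length = (l.map fun F => (𝒢.simplified F).length).sum := by
    intro l
    induction l with
    | nil => rfl
    | cons F l ih => simp [Finset.sum_range_succ', ← ih, add_comm]
  simp only [e]
  rw [toInst_nb, show rules.length + 𝒢.T.length = (rules ++ 𝒢.startParts).length by
    rw [List.length_append, length_startParts], key, List.map_append, List.sum_append]
  congr 1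
  rw [← List.sum_toFinset _ hr.1]
  refine Finset.sum_congr ?_ fun _ _ => rfl
  ext F
  rw [List.mem_toFinset, hr.2, Finset.mem_filter]

/-- The right-hand sides take at most `4 + 3 * G` cells of the input: one for each length, and two for
each entry. -/
theorem st_le (hr : 𝒢.EnumeratesRules rules) :
    (𝒢.toInst letters rules L).st (𝒢.toInst letters rules L).nb ≤ 4 + 3 * 𝒢.size ∧
      rules.length ≤ 𝒢.size := by
  have h := sum_len_le (L := L) (letters := letters) hr
  have hlen : ∀ b ∈ Finset.range (𝒢.toInst letters rules L).nb,
      1 ≤ (𝒢.toInst letters rules L).len b := by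
    intro b hb
    obtain ⟨X, -, hX, -⟩ := exists_place_num hr (Finset.mem_range.1 hb)
    obtain ⟨A, B, C, -, e⟩ := hX.exists_eq
    simp only [toInst]
    rw [e]; simp
  have h1 := Finset.card_nsmul_le_sum _ _ _ hlen
  rw [Finset.card_range, smul_eq_mul, mul_one] at h1
  change _ ≤ ∑ b ∈ Finset.range (𝒢.toInst letters rules L).nb,
    (𝒢.toInst letters rules L).len b at h1
  rw [RAM.Inst.st, Finset.sum_add_distrib, ← Finset.mul_sum, Finset.sum_const, Finset.card_range,
    smul_eq_mul, mul_one]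
  have : rules.length ≤ (𝒢.toInst letters rules L).nb := Nat.le_add_right _ _
  omega

/-- A crude bound on the number of matches. -/
theorem length_matches_le {Ms : List Match} (hn : Ms.Nodup)
    (hM : ∀ M ∈ Ms, IsMEM 𝒢.T M) : Ms.length ≤ (𝒢.size + 𝒢.textLength) ^ 5 := by
  have h3 := 𝒢.three_le_size
  have hm := 𝒢.three_mul_length_le
  obtain ⟨g, hg⟩ : ∃ g, g = 𝒢.size + 𝒢.textLength := ⟨_, rfl⟩
  rw [← hg]
  let f : Match → Fin g × Fin g × Fin g × Fin g × Fin g := fun M =>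
    have : NeZero g := ⟨by omega⟩
    (Fin.ofNat g M.x, Fin.ofNat g M.y, Fin.ofNat g M.a, Fin.ofNat g M.b, Fin.ofNat g M.len)
  have hb : ∀ M ∈ Ms, M.x < g ∧ M.y < g ∧ M.a < g ∧ M.b < g ∧ M.len < g := by
    intro M hMs
    obtain ⟨s, t, hs, ht, h1, h2, -⟩ := hM M hMs
    have e1 := (List.getElem?_eq_some_iff.1 hs).1
    have e2 := (List.getElem?_eq_some_iff.1 ht).1
    have e3 := length_le_textLength (List.mem_of_getElem? hs)
    have e4 := length_le_textLength (List.mem_of_getElem? ht)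
    omega
  have hinj : ∀ M ∈ Ms, ∀ M' ∈ Ms, f M = f M' → M = M' := by
    rintro ⟨x, y, a, b, l⟩ h ⟨x', y', a', b', l'⟩ h' e
    obtain ⟨b1, b2, b3, b4, b5⟩ := hb _ h
    obtain ⟨c1, c2, c3, c4, c5⟩ := hb _ h'
    simp only at b1 b2 b3 b4 b5 c1 c2 c3 c4 c5
    simp only [f, Prod.mk.injEq, Fin.ext_iff, Fin.val_ofNat, Nat.mod_eq_of_lt, b1, b2, b3, b4, b5,
      c1, c2, c3, c4, c5] at e
    simp [e]
  have hn' := List.Nodup.map_on (fun M h M' h' => hinj M h M' h') hn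
  have := hn'.length_le_card
  rw [List.length_map] at this
  refine this.trans (le_of_eq ?_)
  simp only [Fintype.card_prod, Fintype.card_fin]
  ring

/-- Every integer of the input fits into a word. -/
theorem codeInput_fits (hl : 𝒢.EnumeratesLetters letters) (hr : 𝒢.EnumeratesRules rules)
    {N W : ℕ} {rank sz : ℕ → ℕ} {good : ℕ → Prop}
    (hV : RAM.Valid (𝒢.toInst letters rules L)
      (fun n => (𝒢.codeInput letters rules L).getD n 0) N rank sz good)
    (hN : rules.length + 𝒢.T.length + 2 + letters.length ≤ N)
    (hK : (N : ℤ) < 2 ^ W) : ∀ z ∈ 𝒢.codeInput letters rules L, RAM.Fits W z := by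
  suffices H : ∀ z ∈ 𝒢.codeInput letters rules L, |z| ≤ N from
    fun z hz => (H z hz).trans_lt hK
  have hsz := hV.size_bd
  have hnL : (𝒢.toInst letters rules L).nL = L.length := rfl
  rw [hnL] at hsz
  have nat : ∀ {n : ℕ}, n ≤ N → |(n : ℤ)| ≤ N := by
    intro n hn
    rw [Nat.abs_cast]; exact_mod_cast hn
  intro z hz
  rw [codeInput_eq, List.mem_append, List.mem_append] at hz
  rcases hz with hz | hz | hz
  · simp only [List.mem_cons, List.not_mem_nil, or_false] at hz
    rcases hz with rfl | rfl | rfl | rfl <;> exact nat (by omega)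
  · obtain ⟨F, hF, hz⟩ := List.mem_flatMap.1 hz
    obtain ⟨b, hb, rfl⟩ := List.getElem_of_mem hF
    have e : 𝒢.rhs rules b = (rules ++ 𝒢.startParts)[b] := by
      rw [rhs, List.getD_eq_getElem _ _ hb]
    rw [List.length_append, length_startParts] at hb
    rw [← e] at hz
    obtain ⟨X, -, hX, -⟩ := exists_place_num hr hb
    rw [codeRhs, List.mem_cons, List.mem_flatMap] at hz
    rcases hz with rfl | ⟨⟨A, c⟩, hp, hz⟩
    · have h1 : (𝒢.toInst letters rules L).st (b + 1) ≤
        (𝒢.toInst letters rules L).st (𝒢.toInst letters rules L).nb :=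
        RAM.Inst.st_mono _ hb
      rw [RAM.Inst.st_succ] at h1
      have h2 : (𝒢.toInst letters rules L).len b = (𝒢.simplified (𝒢.rhs rules b)).length := rfl
      exact nat (by omega)
    · obtain ⟨j, hj, e⟩ := List.getElem_of_mem hp
      simp only [List.mem_cons, List.not_mem_nil, or_false] at hz
      rcases hz with rfl | rfl
      · have := (hX.code_bound hl hr hp).1
        rw [abs_of_nonneg this.1]
        omega
      · have h1 := hV.ofs_bd b hb j hj
        simp only [toInst] at h1
        rw [List.getD_eq_getElem _ _ hj, e] at h1
        exact nat h1
  · obtain ⟨q, hq, hz⟩ := List.mem_flatMap.1 hz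
    obtain ⟨i, hi, rfl⟩ := List.getElem_of_mem hq
    obtain ⟨b1, b2, b3⟩ := hV.tup_bd i hi
    have hX := hV.X_lt i hi
    have hY := hV.Y_lt i hi
    simp only [toInst] at b1 b2 b3 hX hY
    rw [List.getD_eq_getElem _ _ hi] at b1 b2 b3 hX hY
    have place : ∀ X : Place, X.num rules < rules.length + 𝒢.T.length →
        ∀ z ∈ X.code letters rules, |z| ≤ N := by
      intro X hX z hz
      cases X with
      | nonterminal F =>
        simp only [Place.code, List.mem_cons, List.not_mem_nil, or_false] at hz
        simp only [Place.num] at hX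
        rcases hz with rfl | rfl
        · simp
        · exact nat (by omega)
      | text x =>
        simp only [Place.code, List.mem_cons, List.not_mem_nil, or_false] at hz
        simp only [Place.num] at hX
        rcases hz with rfl | rfl
        · simp; omega
        · exact nat (by omega)
    simp only [PrTuple.code, List.mem_append, List.mem_cons, List.not_mem_nil, or_false] at hz
    rcases hz with (hz | hz) | rfl | rfl | rfl
    · exact place _ hX z hz
    · exact place _ hY z hz
    · exact b1
    · exact b2
    · exact nat b3

/-! ### The matches reported -/

/-- The tuple that a given maximal exact match stems from. -/
theorem exists_tuple (hL : 𝒢.IsPrMEMList τ L) {M : Match} (hM : IsMEM 𝒢.T M) (hτ : τ < M.len) :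
    ∃ q ∈ L, q.len = M.len ∧ 𝒢.At q.X q.oX M.x M.a ∧ 𝒢.At q.Y q.oY M.y M.b := by
  obtain ⟨p, hp, e, hX, hY⟩ := exists_prMEM hM (by omega)
  obtain ⟨Q, hQ⟩ := hX.hasRhs
  obtain ⟨R, hR⟩ := hY.hasRhs
  obtain ⟨X', oX', rX⟩ := exists_relocates hQ p.oX
  obtain ⟨Y', oY', rY⟩ := exists_relocates hR p.oY
  exact ⟨⟨X', Y', oX', oY', p.len⟩, (hL.2 _).2 ⟨p, hp, by omega, rfl, rX, rY⟩, e, rX.at.1 hX,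
    rY.at.1 hY⟩

theorem IsPrMEMList.isMEM (hL : 𝒢.IsPrMEMList τ L) {q : PrTuple} (hq : q ∈ L) {x y : ℕ} {z w : ℤ}
    (hz : 𝒢.At q.X q.oX x z) (hw : 𝒢.At q.Y q.oY y w) :
    0 ≤ z ∧ 0 ≤ w ∧ IsMEM 𝒢.T ⟨x, y, z.toNat, w.toNat, q.len⟩ ∧ τ < q.len := by
  obtain ⟨p, hp, hτ, e, rX, rY⟩ := (hL.2 q).1 hq
  obtain ⟨a, b, rfl, rfl, hM, -, -⟩ := hp.isMEM (by omega) (rX.at.2 hz) (rY.at.2 hw)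
  exact ⟨by omega, by omega, by simpa [e] using hM, by omega⟩

/-- Different tuples stand for different matches. -/
theorem IsPrMEMList.unique (hL : 𝒢.IsPrMEMList τ L) {q q' : PrTuple} (hq : q ∈ L) (hq' : q' ∈ L)
    {x y : ℕ} {z w : ℤ} (hz : 𝒢.At q.X q.oX x z) (hz' : 𝒢.At q'.X q'.oX x z)
    (hw : 𝒢.At q.Y q.oY y w) (hw' : 𝒢.At q'.Y q'.oY y w) (hlen : q.len = q'.len) : q = q' := by
  obtain ⟨p, hp, hτ, e, rX, rY⟩ := (hL.2 q).1 hq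
  obtain ⟨p', hp', hτ', e', rX', rY'⟩ := (hL.2 q').1 hq'
  obtain ⟨a, b, rfl, rfl, -, lX, lY⟩ := hp.isMEM (by omega) (rX.at.2 hz) (rY.at.2 hw)
  obtain ⟨a', b', ea, eb, -, lX', lY'⟩ := hp'.isMEM (by omega) (rX'.at.2 hz') (rY'.at.2 hw')
  obtain rfl : a = a' := by omega
  obtain rfl : b = b' := by omega
  have el : p.len = p'.len := by omega
  rw [← el] at lX' lY'
  obtain ⟨X, Y, oX, oY, len⟩ := q
  obtain ⟨X', Y', oX', oY', len'⟩ := q'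
  obtain ⟨pX, poX⟩ := lX.unique hz.lt lX'
  obtain ⟨pY, poY⟩ := lY.unique hw.lt lY'
  rw [← pX, ← poX] at rX'
  rw [← pY, ← poY] at rY'
  have h1 := rX.unique rX'
  have h2 := rY.unique rY'
  simp only at h1 h2 hlen
  rw [PrTuple.mk.injEq]
  exact ⟨h1.1, h2.1, h1.2, h2.2, hlen⟩

/-- Whatever the order in which the climbs are found, the output lists the matches. -/
theorem outs_matches (hl : 𝒢.EnumeratesLetters letters) (hr : 𝒢.EnumeratesRules rules)
    (hL : 𝒢.IsPrMEMList τ L) {N : ℕ} {inp : ℕ → ℤ} {rank sz : ℕ → ℕ} {good : ℕ → Prop}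
    (hV : RAM.Valid (𝒢.toInst letters rules L) inp N rank sz good) {P : ℕ → ℤ → List (ℕ × ℤ)}
    (hP : RAM.Paths (𝒢.toInst letters rules L) P) {out : List ℤ}
    (ho : RAM.Outs (𝒢.toInst letters rules L) P (𝒢.toInst letters rules L).nL out) :
    ∃ Ms : List Match, out = Ms.flatMap Match.code ∧ Ms.Nodup ∧
      (∀ M : Match, M ∈ Ms ↔ IsMEM 𝒢.T M ∧ τ < M.len) ∧
      Ms.length = ∑ i ∈ Finset.range (𝒢.toInst letters rules L).nL,
        (P ((𝒢.toInst letters rules L).X i) ((𝒢.toInst letters rules L).oX i)).length *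
        (P ((𝒢.toInst letters rules L).Y i) ((𝒢.toInst letters rules L).oY i)).length := by
  have hmatch : ∀ i (hi : i < L.length), _ := fun i hi => hL.exists_match (List.getElem_mem hi)
  have paths : ∀ {X : Place} {o z : ℤ} {x : ℕ}, 𝒢.Kept X → 𝒢.At X o x z →
      (∃ t, 𝒢.T[x]? = some t ∧ t ≠ []) →
      (P (X.num rules) o).Nodup ∧ ∀ x z, (x, z) ∈ P (X.num rules) o ↔ 𝒢.At X o x z := by
    rintro X o z x k1 hA ⟨t, ht, hne⟩
    obtain ⟨Q, hQ⟩ := hA.hasRhs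
    refine mem_paths hl hr hV hP _ X Q k1 hQ rfl ?_ o
    rintro F rfl
    obtain ⟨t', ht', H⟩ := hA.ne_nil
    obtain rfl : t = t' := by simpa [ht] using ht'
    exact H.1 hne
  have hI : ∀ i (hi : i < L.length),
      (𝒢.toInst letters rules L).X i = (L[i].X).num rules ∧
      (𝒢.toInst letters rules L).Y i = (L[i].Y).num rules ∧
      (𝒢.toInst letters rules L).oX i = L[i].oX ∧ (𝒢.toInst letters rules L).oY i = L[i].oY ∧
      (𝒢.toInst letters rules L).tl i = L[i].len := by
    intro i hi
    simp only [toInst, List.getD_eq_getElem _ _ hi, and_self]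
  have hpaths : ∀ i (hi : i < L.length),
      ((P (L[i].X.num rules) L[i].oX).Nodup ∧ ∀ x z, (x, z) ∈ P (L[i].X.num rules) L[i].oX ↔
        𝒢.At L[i].X L[i].oX x z) ∧
      ((P (L[i].Y.num rules) L[i].oY).Nodup ∧ ∀ x z, (x, z) ∈ P (L[i].Y.num rules) L[i].oY ↔
        𝒢.At L[i].Y L[i].oY x z) := by
    intro i hi
    obtain ⟨kX, kY, hτ, x, y, a, b, ⟨s, t, hs, ht, h1, h2, -⟩, hX, hY⟩ := hmatch i hi
    simp only at h1 h2 hs ht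
    exact ⟨paths kX hX ⟨s, hs, List.ne_nil_of_length_pos (by omega)⟩,
      paths kY hY ⟨t, ht, List.ne_nil_of_length_pos (by omega)⟩⟩
  refine Exists.imp (fun Ms => ?_) (ho.matches (fun i hi => ?_) fun i hi i' hi' => ?_)
  · rintro ⟨h1, h2, h3, h4⟩
    refine ⟨h1, h2, fun M => ?_, h4⟩
    rw [h3]
    constructor
    · rintro ⟨i, hi, e, hX, hY⟩
      obtain ⟨e1, e2, e3, e4, e5⟩ := hI i hi
      rw [e1, e3, (hpaths i hi).1.2] at hX
      rw [e2, e4, (hpaths i hi).2.2] at hY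
      obtain ⟨-, -, h5, h6⟩ := hL.isMEM (List.getElem_mem hi) hX hY
      rw [← e5, ← e] at h5 h6
      exact ⟨h5, h6⟩
    · rintro ⟨hM, hτ⟩
      obtain ⟨q, hq, e, hX, hY⟩ := exists_tuple hL hM hτ
      obtain ⟨i, hi, rfl⟩ := List.getElem_of_mem hq
      obtain ⟨e1, e2, e3, e4, e5⟩ := hI i hi
      refine ⟨i, hi, by rw [e5, e], ?_, ?_⟩
      · rw [e1, e3, (hpaths i hi).1.2]; exact hX
      · rw [e2, e4, (hpaths i hi).2.2]; exact hY
  · obtain ⟨e1, e2, e3, e4, e5⟩ := hI i hi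
    obtain ⟨⟨n1, m1⟩, n2, m2⟩ := hpaths i hi
    obtain ⟨-, -, -, x, y, a, b, -, hX, hY⟩ := hmatch i hi
    rw [e1, e2, e3, e4]
    refine ⟨⟨n1, ?_⟩, n2, ?_⟩
    · rintro ⟨x', z⟩ hp
      exact (hL.isMEM (List.getElem_mem hi) ((m1 _ _).1 hp) hY).1
    · rintro ⟨x', z⟩ hp
      exact (hL.isMEM (List.getElem_mem hi) hX ((m2 _ _).1 hp)).2.1
  · rintro ⟨x, z⟩ hX hX' ⟨y, w⟩ hY hY' he
    obtain ⟨e1, e2, e3, e4, e5⟩ := hI i hi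
    obtain ⟨f1, f2, f3, f4, f5⟩ := hI i' hi'
    rw [e1, e3, (hpaths i hi).1.2] at hX
    rw [e2, e4, (hpaths i hi).2.2] at hY
    rw [f1, f3, (hpaths i' hi').1.2] at hX'
    rw [f2, f4, (hpaths i' hi').2.2] at hY'
    have hi₂ : i < L.length := hi
    have hi₂' : i' < L.length := hi'
    have := hL.unique (List.getElem_mem hi₂) (List.getElem_mem hi₂') hX hX' hY hY'
      (e5.symm.trans (he.trans f5))
    exact (List.Nodup.getElem_inj_iff hL.1).1 this

end FFGram

/-- Numbers that are polynomial in `g` fit into words of length `O(log g)`. -/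
theorem log_bounds {g N : ℕ} (hg : 3 ≤ g) (hN : N ≤ 10 * g ^ 5) :
    ((8 * N + 16 : ℕ) : ℤ) ≤ 2 ^ (9 * (Nat.log 2 g + 1)) := by
  have h1 : g < 2 ^ (Nat.log 2 g + 1) := Nat.lt_pow_succ_log_self (by norm_num) g
  have h2 : g ^ 9 ≤ (2 ^ (Nat.log 2 g + 1)) ^ 9 := Nat.pow_le_pow_left h1.le 9
  have h3 : 81 * g ^ 5 ≤ g ^ 9 := by
    have h4 : 3 ^ 4 ≤ g ^ 4 := Nat.pow_le_pow_left hg 4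
    calc 81 * g ^ 5 ≤ g ^ 4 * g ^ 5 := Nat.mul_le_mul_right _ (by simpa using h4)
      _ = g ^ 9 := by ring
  have h5 : 3 ^ 5 ≤ g ^ 5 := Nat.pow_le_pow_left hg 5
  rw [← pow_mul, mul_comm] at h2
  have : 8 * N + 16 ≤ 2 ^ (9 * (Nat.log 2 g + 1)) := by omega
  exact_mod_cast this

theorem add_le_mul_add_one {a b : ℕ} (ha : 1 ≤ a) (hb : 1 ≤ b) : a + b ≤ a * b + 1 := by
  obtain ⟨a, rfl⟩ := Nat.exists_eq_add_of_le' ha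
  obtain ⟨b, rfl⟩ := Nat.exists_eq_add_of_le' hb
  rw [show (a + 1) * (b + 1) = a * b + a + b + 1 by ring]
  omega

/-- Text positions that are polynomial in the size of the grammar take `O(k log s)` bits. -/
theorem log_add_le {s n k : ℕ} (hs : 3 ≤ s) (hn : n ≤ s ^ k) :
    Nat.log 2 (s + n) ≤ 4 * (k + 1) * Nat.log 2 s := by
  have h0 : 1 ≤ Nat.log 2 s := Nat.log_pos (by norm_num) (by omega)
  have h1 : s < 2 ^ (Nat.log 2 s + 1) := Nat.lt_pow_succ_log_self (by norm_num) s
  have h2 : s + n < 2 ^ ((Nat.log 2 s + 1) * (k + 2)) := by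
    have h3 : s + n ≤ s ^ (k + 2) := by
      have h4 : 1 ≤ s ^ k := Nat.one_le_pow _ _ (by omega)
      calc s + n ≤ s * s ^ k + s * s ^ k :=
            Nat.add_le_add (Nat.le_mul_of_pos_right _ h4)
              (hn.trans (Nat.le_mul_of_pos_left _ (by omega)))
        _ = 2 * (s * s ^ k) := by ring
        _ ≤ s * (s * s ^ k) := Nat.mul_le_mul_right _ (by omega)
        _ = s ^ (k + 2) := by ring
    rw [pow_mul]
    exact h3.trans_lt (Nat.pow_lt_pow_left h1 (by omega))
  have h3 : Nat.log 2 (s + n) < (Nat.log 2 s + 1) * (k + 2) :=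
    Nat.log_lt_of_lt_pow (by omega) h2
  nlinarith [Nat.mul_le_mul_right (k + 2) h0, Nat.zero_le (k * Nat.log 2 s)]

open FFGram in
theorem theorem2 :
    ∃ (P : RAM.Program) (c : ℕ),
      ∀ (𝒢 : FFGram) (τ : ℕ) (letters : List ℕ) (rules : List (List GSym)) (L : List PrTuple),
        𝒢.EnumeratesLetters letters → 𝒢.EnumeratesRules rules → 𝒢.IsPrMEMList τ L →
        ∃ (MEMs : List Match) (W S t : ℕ),
          MEMs.Nodup ∧
          (∀ M : Match, M ∈ MEMs ↔ IsMEM 𝒢.T M ∧ τ < M.len) ∧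
          P.Run W S (𝒢.codeInput letters rules L) t (MEMs.flatMap Match.code) ∧
          t ≤ c * (𝒢.size + MEMs.length) ∧
          P.bits W S ≤ c * (Nat.log 2 (𝒢.size + 𝒢.textLength) * (𝒢.size + MEMs.length)) ∧
          (∀ k : ℕ, 𝒢.textLength ≤ 𝒢.size ^ k →
            P.bits W S ≤ c * (k + 1) * (Nat.log 2 𝒢.size * (𝒢.size + MEMs.length))) := by
  refine ⟨RAM.prog, 10000, fun 𝒢 τ letters rules L hl hr hL => ?_⟩
  -- The climbs do not depend on the bound `N` in `valid`. A first, minimal `N` gives the number of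
  -- matches; this determines the size of the arrays, and hence the `N` with which the program is run.
  obtain ⟨P, hP⟩ := (valid hl hr hL le_rfl).exists_paths
  have hV₀ := valid hl hr hL le_rfl
  set I := 𝒢.toInst letters rules L with hIdef
  have hnL : I.nL = L.length := rfl
  obtain ⟨occ, hocc⟩ : ∃ occ, occ = ∑ i ∈ Finset.range I.nL,
      (P (I.X i) (I.oX i)).length * (P (I.Y i) (I.oY i)).length := ⟨_, rfl⟩
  have hout := fun out => outs_matches hl hr hL hV₀ hP (out := out)
  rw [← hIdef, ← hocc] at hout
  obtain ⟨g, hg⟩ : ∃ g, g = 𝒢.size + 𝒢.textLength := ⟨_, rfl⟩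
  have h3 := 𝒢.three_le_size
  obtain ⟨hst, hrl⟩ := st_le (L := L) (letters := letters) hr
  rw [← hIdef] at hst
  have hsig := length_letters_le hl
  have hoccg : occ ≤ g ^ 5 := by
    obtain ⟨out, ho⟩ := RAM.exists_outs I P I.nL
    obtain ⟨Ms, -, h1, h2, h4⟩ := hout out ho
    rw [← h4, hg]
    exact length_matches_le h1 fun M hM => ((h2 M).1 hM).1
  have hpos : ∀ i < I.nL, 1 ≤ (P (I.X i) (I.oX i)).length ∧ 1 ≤ (P (I.Y i) (I.oY i)).length :=
    fun i hi => ⟨hP.pos hV₀ (hV₀.X_good i hi) _, hP.pos hV₀ (hV₀.Y_good i hi) _⟩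
  have hle : ∀ i < I.nL,
      (P (I.X i) (I.oX i)).length * (P (I.Y i) (I.oY i)).length ≤ occ := fun i hi => by
    rw [hocc]
    exact Finset.single_le_sum
      (f := fun i => (P (I.X i) (I.oX i)).length * (P (I.Y i) (I.oY i)).length)
      (fun _ _ => Nat.zero_le _) (Finset.mem_range.2 hi)
  have hnLocc : L.length ≤ occ := by
    have := Finset.card_nsmul_le_sum (Finset.range I.nL)
      (fun i => (P (I.X i) (I.oX i)).length * (P (I.Y i) (I.oY i)).length) 1 fun i hi =>
        Nat.mul_pos (hpos i (Finset.mem_range.1 hi)).1 (hpos i (Finset.mem_range.1 hi)).2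
    rw [← hocc, Finset.card_range, smul_eq_mul, mul_one] at this
    exact this
  have hg3 : 3 ≤ g := by omega
  -- An array holds the input, or the ends of the climbs of one tuple. For two nonempty lists, the
  -- pairs of which are matches, the total length is at most `occ + 1`.
  obtain ⟨S, hS⟩ : ∃ S, S = I.st I.nb + 7 * L.length + occ + 1 := ⟨_, rfl⟩
  obtain ⟨N, hN⟩ : ∃ N, N = S + (2 + letters.length + rules.length) + 𝒢.textLength := ⟨_, rfl⟩
  have hNg : N ≤ 10 * g ^ 5 := by
    have h5 : 81 * g ≤ g ^ 5 := by
      have h4 : 3 ^ 4 ≤ g ^ 4 := Nat.pow_le_pow_left hg3 4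
      calc 81 * g ≤ g ^ 4 * g := Nat.mul_le_mul_right _ (by simpa using h4)
        _ = g ^ 5 := by ring
    omega
  -- Numbers are bounded by `10 * g ^ 5`, because there are at most `g ^ 5` matches.
  have hK := log_bounds hg3 hNg
  obtain ⟨W, hW⟩ : ∃ W, W = 9 * (Nat.log 2 g + 1) := ⟨_, rfl⟩
  rw [← hW] at hK
  have hV := valid hl hr hL (N := N) (by rw [← hIdef]; omega)
  rw [← hIdef] at hV
  obtain ⟨t, s', hrun, ho, ht⟩ := hV.run (S := S) hK (by rw [hnL]; omega) (by omega) hP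
    (fun i hi => by
      have h1 := hle i hi
      obtain ⟨h2, h3⟩ := hpos i hi
      have h4 : (P (I.X i) (I.oX i)).length + (P (I.Y i) (I.oY i)).length ≤
        (P (I.X i) (I.oX i)).length * (P (I.Y i) (I.oY i)).length + 1 := add_le_mul_add_one h2 h3
      omega)
    (input := 𝒢.codeInput letters rules L) (fun _ => rfl)
  rw [← hocc] at ht
  obtain ⟨Ms, e, m1, m2, m3⟩ := hout _ ho
  have hlog : 1 ≤ Nat.log 2 g := Nat.log_pos (by norm_num) (by omega)
  have hbits : RAM.prog.bits W S ≤
      2500 * (Nat.log 2 g * (𝒢.size + occ)) := by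
    have h1 : RAM.prog.bits W S = (W + 1) * (32 + 12 * S) := rfl
    have h2 : W + 1 ≤ 19 * Nat.log 2 g := by omega
    have h4 : 32 + 12 * S ≤ 100 * (𝒢.size + occ) := by omega
    rw [h1]
    calc (W + 1) * (32 + 12 * S) ≤ (19 * Nat.log 2 g) * (100 * (𝒢.size + occ)) :=
          Nat.mul_le_mul h2 h4
      _ = 1900 * (Nat.log 2 g * (𝒢.size + occ)) := by ring
      _ ≤ _ := Nat.mul_le_mul_right _ (by norm_num)
  have hT : 𝒢.T.length + rules.length ≤ I.st I.nb := by
    have h1 := I.le_st I.nb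
    have h2 : I.nb = rules.length + 𝒢.T.length := rfl
    omega
  refine ⟨Ms, W, S, t, m1, m2, ⟨?_, ?_, s', hrun, e⟩, ?_, ?_, fun k hk => ?_⟩
  · rw [length_codeInput, ← hIdef]; omega
  · refine codeInput_fits hl hr hV (by omega) (lt_of_lt_of_le ?_ hK)
    push_cast; omega
  · rw [m3]; omega
  · rw [m3, ← hg]
    exact hbits.trans (Nat.mul_le_mul_right _ (by norm_num))
  · rw [m3]
    have h1 := log_add_le h3 hk
    rw [← hg] at h1
    calc RAM.prog.bits W S ≤ 2500 * (Nat.log 2 g * (𝒢.size + occ)) := hbits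
      _ ≤ 2500 * (4 * (k + 1) * Nat.log 2 𝒢.size * (𝒢.size + occ)) := by gcongr
      _ = 10000 * (k + 1) * (Nat.log 2 𝒢.size * (𝒢.size + occ)) := by ring
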